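/- Let $Q_n$ be the directed graph with vertex set $\{0,1\}^n$ and an edge $x\to y$ whenever $y$ is obtained from $x$ by changing one bit from $0$ to $1$. In the problem Hypercube Path one is given $n$ and query access to a subgraph $G$ of $Q_n$ (a query asks, for vertices $x,y$, whether $x\to y$ is an edge of $G$, and queries can be made in superposition), and has to decide whether $G$ contains a directed path from $0^n$ to $1^n$. The model of computation is a quantum random access machine (QRAM). It has words of $O(n)$ bits on inputs of dimension $n$, a classical word RAM as control, finitely many one-word quantum registers, and a quantum memory that can be accessed at an address held in a quantum register, hence in a superposition of addresses. Each of the following takes one unit of time: a classical word operation or branching test, a reversible word operation on quantum registers, a Hadamard or $\pi/8$ gate (the gate $\mathrm{diag}(1,e^{i\pi/4})$) on one bit, and an access to the quantum memory. A single program serves all $n$, and its output is obtained by a measurement at the end. **Theorem.** There is a quantum algorithm in the QRAM model such that, whenever one edge query in dimension $n$ takes time $\tau(n)\le\mathrm{poly}(n)$, it has the following property for a function $T(n)=O^*(1.817^n)$, that is, $T(n)=O(n^c\cdot 1.817^n)$ for some constant $c$: for every $n$ and every subgraph $G$ of $Q_n$, it halts within time $T(n)$ and correctly decides Hypercube Path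 on $G$ with probability at least $2/3$. -/

import Mathlib

open Filter Asymptotics

noncomputable section

/-! # Hypercube Path -/

/-- The directed hypercube graph on `{0,1}^n`: there is an edge `x → y` iff `y` is obtained from `x`
by changing one bit from `0` to `1`. -/
def directedHypercube (n : ℕ) : Digraph (Fin n → Bool) where
  Adj x y := ∃ i : Fin n, x i = false ∧ y = Function.update x i true

/-- The instance `G` is a yes-instance: `G` has a directed path from `0^n` to `1^n`. -/
def HasHypercubePath {n : ℕ} (G : Digraph (Fin n → Bool)) : Prop :=
  Relation.ReflTransGen G.Adj (fun _ => false) (fun _ => true)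

/-! # Growth rates -/

/-- `f(n) = O(poly(n))`. -/
def IsPolyBounded (f : ℕ → ℝ) : Prop :=
  ∃ c : ℕ, f =O[atTop] fun n : ℕ => (n : ℝ) ^ c

/-- `f(n) = O^*(b^n)`, that is, `f(n) = O(poly(n) b^n)`. -/
def IsOStar (f : ℕ → ℝ) (b : ℝ) : Prop :=
  ∃ c : ℕ, f =O[atTop] fun n : ℕ => (n : ℝ) ^ c * b ^ n

/-! # Quantum random access machines

A machine with words of `w` bits has a classical part (an ordinary word RAM: registers, and a memory
with one word for each address) which controls a quantum part: finitely many quantum registers of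
one word each, and a quantum memory of `2 ^ w` words that is accessed at an address held in a quantum
register, so possibly in a superposition of addresses. There are no intermediate measurements; the
output is read off by a measurement at the end. -/

/-- The instruction set of a word RAM, for unsigned words. -/
inductive WordOp where
  | add | sub | mul | div | mod | and | or | xor | shl | shr | lt | eq

/-- The value of an operation; arithmetic is modulo `2 ^ w`, and the two comparisons return
`1` (true) or `0` (false). -/
def WordOp.eval {w : ℕ} : WordOp → BitVec w → BitVec w → BitVec w
  | .add, a, b => a + b
  | .sub, a, b => a - b
  | .mul, a, b => a * b
  | .div, a, b => a / b
  | .mod, a, b => a % b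
  | .and, a, b => a &&& b
  | .or, a, b => a ||| b
  | .xor, a, b => a ^^^ b
  | .shl, a, b => a <<< b
  | .shr, a, b => a >>> b
  | .lt, a, b => if a.toNat < b.toNat then BitVec.ofNat w 1 else BitVec.ofNat w 0
  | .eq, a, b => if a = b then BitVec.ofNat w 1 else BitVec.ofNat w 0

/-- A classical operand: a literal, or the content of a classical register. -/
inductive COperand where
  | lit (c : ℕ)
  | creg (j : ℕ)

/-- An operand of a quantum instruction: a classical one, or a quantum register. There are `k + 1`
quantum registers. -/
inductive QOperand (k : ℕ) where
  | classical (a : COperand)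
  | qreg (j : Fin (k + 1))

/-- Programs with `k + 1` quantum registers. -/
inductive QProg (k : ℕ) where
  /-- classical register `i` := `op a b` -/
  | cset (i : ℕ) (op : WordOp) (a b : COperand)
  /-- classical register `i` := classical memory at address `a` -/
  | cload (i : ℕ) (a : COperand)
  /-- classical memory at address `a` := `b` -/
  | cstore (a b : COperand)
  /-- quantum register `i` := (quantum register `i`) XOR `op a b` -/
  | qxor (i : Fin (k + 1)) (op : WordOp) (a b : QOperand k)
  /-- Hadamard gate on bit number `b` of quantum register `i` -/
  | hadamard (i : Fin (k + 1)) (b : COperand)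
  /-- the gate `diag (1, exp (i π / 4))` on bit number `b` of quantum register `i` -/
  | tgate (i : Fin (k + 1)) (b : COperand)
  /-- random access: swap quantum register `i` with the word of quantum memory whose address is the
  content of quantum register `j` -/
  | access (i j : Fin (k + 1))
  /-- edge query: XOR into quantum register `i` the answer (`1` or `0`) to the question whether the
  input graph has an edge from the vertex in quantum register `j` to the one in quantum register
  `l` -/
  | query (i j l : Fin (k + 1))
  /-- sequential composition -/
  | seq (p q : QProg k)
  /-- if `a ≠ 0` then `p` else `q` -/
  | cond (a : COperand) (p q : QProg k)
  /-- while `a ≠ 0` do `p` -/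
  | loop (a : COperand) (p : QProg k)

/-- The classical part of a machine state. -/
structure CStore (w : ℕ) where
  reg : ℕ → BitVec w
  mem : BitVec w → BitVec w

/-- Computational basis states of the quantum part: the contents of the registers and of the
memory. -/
abbrev QBasis (k w : ℕ) : Type := (Fin (k + 1) → BitVec w) × (BitVec w → BitVec w)

instance (w : ℕ) : Fintype (BitVec w) :=
  Fintype.ofEquiv (Fin (2 ^ w))
    ⟨BitVec.ofFin, BitVec.toFin, fun _ => rfl, fun _ => rfl⟩

/-- Quantum states, as vectors of amplitudes in the computational basis. -/
abbrev QState (k w : ℕ) : Type := QBasis k w → ℂ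

/-- The value of a classical operand. -/
def COperand.eval {w : ℕ} (σ : CStore w) : COperand → BitVec w
  | .lit c => BitVec.ofNat w c
  | .creg j => σ.reg j

/-- The value of an operand at a basis state. -/
def QOperand.eval {k w : ℕ} (σ : CStore w) (x : QBasis k w) : QOperand k → BitVec w
  | .classical a => a.eval σ
  | .qreg j => x.1 j

/-- The action on basis states of XORing the word `f x` into quantum register `i`. It is only
performed if `f` does not depend on that register: otherwise the instruction does nothing. -/
def xorInto {k w : ℕ} (i : Fin (k + 1)) (f : QBasis k w → BitVec w) (x : QBasis k w) :
    QBasis k w :=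
  open Classical in
  if ∀ (y : QBasis k w) (v : BitVec w), f (Function.update y.1 i v, y.2) = f y then
    (Function.update x.1 i (x.1 i ^^^ f x), x.2)
  else x

/-- The action on basis states of swapping quantum register `i` with the word of quantum memory at
the address in quantum register `j` (which must be another register: otherwise the instruction does
nothing). -/
def accessMap {k w : ℕ} (i j : Fin (k + 1)) (x : QBasis k w) : QBasis k w :=
  if i = j then x
  else (Function.update x.1 i (x.2 (x.1 j)), Function.update x.2 (x.1 j) (x.1 i))

theorem xorInto_involutive {k w : ℕ} (i : Fin (k + 1)) (f : QBasis k w → BitVec w) :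
    Function.Involutive (xorInto i f) := by
  intro x
  unfold xorInto
  split_ifs with h
  · simp [h]
  · rfl

theorem accessMap_involutive {k w : ℕ} (i j : Fin (k + 1)) :
    Function.Involutive (accessMap (w := w) i j) := by
  intro x
  by_cases h : i = j
  · simp [accessMap, h]
  · simp [accessMap, h, Function.update_of_ne (Ne.symm h)]

/-- The unitary operator that permutes the computational basis by `e`. -/
def permGate {k w : ℕ} (e : Equiv.Perm (QBasis k w)) (ψ : QState k w) : QState k w :=
  fun x => ψ (e.symm x)

/-- The basis state `x` with bit number `b` of quantum register `i` flipped. -/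
def flipBit {k w : ℕ} (i : Fin (k + 1)) (b : ℕ) (x : QBasis k w) : QBasis k w :=
  (Function.update x.1 i (x.1 i ^^^ BitVec.twoPow w b), x.2)

/-- The Hadamard gate on bit number `b` of quantum register `i` (the identity if there is no such
bit). -/
def hadamardGate {k w : ℕ} (i : Fin (k + 1)) (b : ℕ) (ψ : QState k w) : QState k w := fun x =>
  if b < w then
    if (x.1 i).getLsbD b then (ψ (flipBit i b x) - ψ x) / (Real.sqrt 2 : ℂ)
    else (ψ x + ψ (flipBit i b x)) / (Real.sqrt 2 : ℂ)
  else ψ x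

/-- The gate `diag (1, exp (i π / 4))` on bit number `b` of quantum register `i` (the identity if
there is no such bit). -/
def tGate {k w : ℕ} (i : Fin (k + 1)) (b : ℕ) (ψ : QState k w) : QState k w := fun x =>
  if (x.1 i).getLsbD b then Complex.exp (Complex.I * Real.pi / 4) * ψ x else ψ x

/-- The vertex of the hypercube that is encoded by the `n` lowest bits of a word. -/
def wordVertex {w : ℕ} (n : ℕ) (v : BitVec w) : Fin n → Bool := fun i => v.getLsbD i

/-- The answer, as a word, to the edge query for the vertices encoded by `u` and `v`. -/
def edgeAnswer {n w : ℕ} (G : Digraph (Fin n → Bool)) (u v : BitVec w) : BitVec w :=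
  open Classical in
  if G.Adj (wordVertex n u) (wordVertex n v) then BitVec.ofNat w 1 else BitVec.ofNat w 0

/-- `QExec G τ p s t s'`: on the input graph `G`, the program `p` started in the machine state `s`
halts after time `t` in the machine state `s'`. Each instruction and each evaluation of a branching
condition takes time `1`, and each edge query takes time `τ`. -/
inductive QExec {k w n : ℕ} (G : Digraph (Fin n → Bool)) (τ : ℕ) :
    QProg k → CStore w × QState k w → ℕ → CStore w × QState k w → Prop
  | cset (i : ℕ) (op : WordOp) (a b : COperand) (σ : CStore w) (ψ : QState k w) :
      QExec G τ (.cset i op a b) (σ, ψ) 1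
        (⟨Function.update σ.reg i (op.eval (a.eval σ) (b.eval σ)), σ.mem⟩, ψ)
  | cload (i : ℕ) (a : COperand) (σ : CStore w) (ψ : QState k w) :
      QExec G τ (.cload i a) (σ, ψ) 1 (⟨Function.update σ.reg i (σ.mem (a.eval σ)), σ.mem⟩, ψ)
  | cstore (a b : COperand) (σ : CStore w) (ψ : QState k w) :
      QExec G τ (.cstore a b) (σ, ψ) 1 (⟨σ.reg, Function.update σ.mem (a.eval σ) (b.eval σ)⟩, ψ)
  | qxor (i : Fin (k + 1)) (op : WordOp) (a b : QOperand k) (σ : CStore w) (ψ : QState k w) :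
      QExec G τ (.qxor i op a b) (σ, ψ) 1
        (σ, permGate (xorInto_involutive i fun x => op.eval (a.eval σ x) (b.eval σ x)).toPerm ψ)
  | hadamard (i : Fin (k + 1)) (b : COperand) (σ : CStore w) (ψ : QState k w) :
      QExec G τ (.hadamard i b) (σ, ψ) 1 (σ, hadamardGate i (b.eval σ).toNat ψ)
  | tgate (i : Fin (k + 1)) (b : COperand) (σ : CStore w) (ψ : QState k w) :
      QExec G τ (.tgate i b) (σ, ψ) 1 (σ, tGate i (b.eval σ).toNat ψ)
  | access (i j : Fin (k + 1)) (σ : CStore w) (ψ : QState k w) :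
      QExec G τ (.access i j) (σ, ψ) 1 (σ, permGate (accessMap_involutive i j).toPerm ψ)
  | query (i j l : Fin (k + 1)) (σ : CStore w) (ψ : QState k w) :
      QExec G τ (.query i j l) (σ, ψ) τ
        (σ, permGate (xorInto_involutive i fun x => edgeAnswer G (x.1 j) (x.1 l)).toPerm ψ)
  | seq {p q : QProg k} {s s' s'' : CStore w × QState k w} {t t' : ℕ}
      (hp : QExec G τ p s t s') (hq : QExec G τ q s' t' s'') :
      QExec G τ (.seq p q) s (t + t') s''
  | cond_true {a : COperand} {p q : QProg k} {s s' : CStore w × QState k w} {t : ℕ}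
      (ha : a.eval s.1 ≠ 0) (hp : QExec G τ p s t s') : QExec G τ (.cond a p q) s (t + 1) s'
  | cond_false {a : COperand} {p q : QProg k} {s s' : CStore w × QState k w} {t : ℕ}
      (ha : a.eval s.1 = 0) (hq : QExec G τ q s t s') : QExec G τ (.cond a p q) s (t + 1) s'
  | loop_true {a : COperand} {p : QProg k} {s s' s'' : CStore w × QState k w} {t t' : ℕ}
      (ha : a.eval s.1 ≠ 0) (hp : QExec G τ p s t s') (hl : QExec G τ (.loop a p) s' t' s'') :
      QExec G τ (.loop a p) s (t + 1 + t') s''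
  | loop_false {a : COperand} {p : QProg k} {s : CStore w × QState k w}
      (ha : a.eval s.1 = 0) : QExec G τ (.loop a p) s 1 s

/-- The initial machine state on inputs of dimension `n`: classical register `0` contains `n`,
everything else is `0`. -/
def startState (k w n : ℕ) : CStore w × QState k w :=
  (⟨Function.update (fun _ => 0) 0 (BitVec.ofNat w n), fun _ => 0⟩,
    Pi.single ((fun _ => 0, fun _ => 0) : QBasis k w) 1)

/-- The probability that a measurement of the lowest bit of quantum register `0` returns `b`. -/
def outputProb {k w : ℕ} (ψ : QState k w) (b : Bool) : ℝ :=
  ∑ x : QBasis k w, if (x.1 0).getLsbD 0 = b then ‖ψ x‖ ^ 2 else 0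

/-- A quantum algorithm: one program for all dimensions `n`. It has `numReg + 1` quantum
registers, and on inputs of dimension `n` words have `wordFactor * (n + 1)` bits. -/
structure QAlgorithm where
  numReg : ℕ
  wordFactor : ℕ
  prog : QProg numReg

/-- If edge queries in dimension `n` take time `τ n`, then `A` solves Hypercube Path with bounded
error in time `T`: in every dimension `n` and on every subgraph `G` of the directed hypercube, it
halts within time `T n` and outputs the correct answer with probability at least `2/3`. -/
def QAlgorithm.SolvesHypercubePath (A : QAlgorithm) (τ T : ℕ → ℕ) : Prop :=
  open Classical in
  ∀ (n : ℕ) (G : Digraph (Fin n → Bool)), G ≤ directedHypercube n →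
    ∃ (t : ℕ) (s : CStore (A.wordFactor * (n + 1)) × QState A.numReg (A.wordFactor * (n + 1))),
      QExec G (τ n) A.prog (startState A.numReg (A.wordFactor * (n + 1)) n) t s ∧
      t ≤ T n ∧ 2 / 3 ≤ outputProb s.2 (decide (HasHypercubePath G))

end

open BitVec (ofNat twoPow toNat_ofNat ofNat_eq_ofNat ofNat_add
  getLsbD_twoPow getLsbD_xor toNat_xor eq_of_getLsbD_eq ofNat_mul shiftLeft_eq'
  toNat_inj getElem_one lt_of_getLsbD getLsbD_ofNat)
open BitVec renaming zero_xor → bzero_xor, xor_zero → bxor_zero, xor_self → bxor_self,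
  xor_comm → bxor_comm
open Function (update update_of_ne update_self iterate_succ_apply')
open Finset (range mem_range mem_filter card_range mem_univ sum_le_sum)
open Nat (mod_eq_of_lt xor_lt_two_pow one_le_two_pow
  le_mul_of_pos_right)
open List (mem_cons not_mem_nil nodup_cons nodup_nil)

noncomputable section

notation:max i:max "##" n:max => ofNat n i
notation "d!" => (by decide)
notation "o!" => (by omega)

/-- The quantum registers. -/
abbrev Reg := Fin (255 + 1)

/-- The computational basis. -/
abbrev QB (w : ℕ) := QBasis 255 w

/-- Quantum states. -/
abbrev QS (w : ℕ) := QState 255 w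

/-- Invertible operators on quantum states. -/
abbrev QOp (w : ℕ) := QS w ≃ₗ[ℂ] QS w

/-- Input graphs. -/
abbrev DGraph (n : ℕ) := Digraph (Fin n → Bool)

lemma two_pow_le {a b : ℕ} (h : a ≤ b) : 2 ^ a ≤ 2 ^ b := Nat.pow_le_pow_right (by norm_num) h

lemma two_pow_lt {a b : ℕ} (h : a < b) : 2 ^ a < 2 ^ b := Nat.pow_lt_pow_right (by norm_num) h

variable {w n d H K a₀ j b a na nh : ℕ} {G : DGraph n} {σ : CStore w} {x : QB w} {ψ : QS w}
  {dir : Bool} {S : Set (QB w)} {i o Y X out : Reg} {v D : BitVec w} {ε : ℝ} {P T : COperand}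
  {M : BitVec w → BitVec w}

/-! # Reversible programs -/

/-- Elementary reversible instructions. -/
inductive Gate
  | qx (i : Reg) (op : WordOp) (a b : QOperand 255)
  | had (i : Reg) (b : COperand)
  /-- the phase flip controlled by the lowest bit of register `i` -/
  | zg (i : Reg)
  | acc (i j : Reg)
  | qry (i j l : Reg)

/-- Reversible programs. A program compiled at depth `d` uses the classical registers from `d` on
for its local variables; they are `0` before and after. `loop rev N p` runs `p` with local variable
`d` ranging over the numbers below `N`, downwards if `rev`. -/
inductive RProg
  | gate (g : Gate)
  | seq (p q : RProg)
  | loop (rev : Bool) (N : COperand) (p : RProg)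
  | letop (op : WordOp) (a b : COperand) (p : RProg)
  | letld (a : COperand) (p : RProg)

/-- Only classical registers below `d` occur. -/
def COperand.Lt : COperand → ℕ → Prop
  | .lit _, _ => True
  | .creg j, d => j < d

def CStore.set (σ : CStore w) (d : ℕ) (v : BitVec w) : CStore w :=
  ⟨update σ.reg d v, σ.mem⟩

namespace QProg

def czero (c : ℕ) : QProg 255 := .cset c .mul (.lit 0) (.lit 0)

/-- Run `p` with register `c` counting up from its value to `N`; register `c + 1` is a test
register. -/
def upLoop (c : ℕ) (N : COperand) (p : QProg 255) : QProg 255 :=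
  .seq (.cset (c + 1) .sub N (.creg c))
    (.loop (.creg (c + 1)) (.seq (.seq (czero (c + 1)) p)
      (.seq (.cset c .add (.creg c) (.lit 1)) (.cset (c + 1) .sub N (.creg c)))))

end QProg

def Gate.compile : Gate → QProg 255
  | .qx i op a b => .qxor i op a b
  | .had i b => .hadamard i b
  | .zg i => .seq (.seq (.tgate i (.lit 0)) (.tgate i (.lit 0)))
      (.seq (.tgate i (.lit 0)) (.tgate i (.lit 0)))
  | .acc i j => .access i j
  | .qry i j l => .query i j l

namespace RProg

def compile : RProg → ℕ → QProg 255
  | gate g, _ => g.compile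
  | seq p q, d => .seq (p.compile d) (q.compile d)
  | loop false N p, d => .seq (QProg.upLoop d N (p.compile (d + 2))) (QProg.czero d)
  | loop true N p, d => .seq (.cset d .add N (.lit 0)) (.loop (.creg d)
      (.seq (.cset d .sub (.creg d) (.lit 1)) (p.compile (d + 2))))
  | letop op a b p, d => .seq (.cset d op a b) (.seq (p.compile (d + 1)) (QProg.czero d))
  | letld a p, d => .seq (.cload d a) (.seq (p.compile (d + 1)) (QProg.czero d))

/-- The program that undoes `p`. -/
def inv : RProg → RProg
  | gate g => gate g
  | seq p q => seq q.inv p.inv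
  | loop r N p => loop (!r) N p.inv
  | letop op a b p => letop op a b p.inv
  | letld a p => letld a p.inv

def WF : RProg → ℕ → Prop
  | gate _, _ => True
  | seq p q, d => p.WF d ∧ q.WF d
  | loop _ N p, d => N.Lt d ∧ p.WF (d + 2)
  | letop _ _ _ p, d => p.WF (d + 1)
  | letld _ p, d => p.WF (d + 1)

end RProg

/-- `f (N - 1) * ⋯ * f 0` -/
def ordProd {Γ : Type*} [Monoid Γ] (f : ℕ → Γ) : ℕ → Γ
  | 0 => 1
  | N + 1 => f N * ordProd f N

/-- `f 0 * ⋯ * f (N - 1)` -/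
def revProd {Γ : Type*} [Monoid Γ] (f : ℕ → Γ) : ℕ → Γ
  | 0 => 1
  | N + 1 => revProd f N * f N

lemma ordProd_inv {Γ : Type*} [Group Γ] (f : ℕ → Γ) (N : ℕ) :
    (ordProd f N)⁻¹ = revProd (fun j => (f j)⁻¹) N := by
  induction N with
  | zero => simp [ordProd, revProd]
  | succ N ih => simp [ordProd, revProd, ih]

lemma revProd_inv {Γ : Type*} [Group Γ] (f : ℕ → Γ) (N : ℕ) :
    (revProd f N)⁻¹ = ordProd (fun j => (f j)⁻¹) N := by
  induction N with
  | zero => simp [ordProd, revProd]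
  | succ N ih => simp [ordProd, revProd, ih]

lemma map_ordProd {Γ Δ : Type*} [Monoid Γ] [Monoid Δ] (φ : Γ →* Δ) (f : ℕ → Γ) (N : ℕ) :
    φ (ordProd f N) = ordProd (fun j => φ (f j)) N := by
  induction N with
  | zero => simp [ordProd]
  | succ N ih => simp [ordProd, ih]

lemma map_revProd {Γ Δ : Type*} [Monoid Γ] [Monoid Δ] (φ : Γ →* Δ) (f : ℕ → Γ) (N : ℕ) :
    φ (revProd f N) = revProd (fun j => φ (f j)) N := by
  induction N with
  | zero => simp [revProd]
  | succ N ih => simp [revProd, ih]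

namespace RProg

/-- Interpretation of a program in a monoid, given the interpretation of the instructions. -/
def interp {Γ : Type*} [Monoid Γ] (γ : Gate → CStore w → Γ) : RProg → ℕ → CStore w → Γ
  | gate g, _, σ => γ g σ
  | seq p q, d, σ => interp γ q d σ * interp γ p d σ
  | loop false N p, d, σ =>
      ordProd (fun j => interp γ p (d + 2) (σ.set d j##w)) (N.eval σ).toNat
  | loop true N p, d, σ =>
      revProd (fun j => interp γ p (d + 2) (σ.set d j##w)) (N.eval σ).toNat
  | letop op a b p, d, σ => interp γ p (d + 1) (σ.set d (op.eval (a.eval σ) (b.eval σ)))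
  | letld a p, d, σ => interp γ p (d + 1) (σ.set d (σ.mem (a.eval σ)))

lemma interp_inv {Γ : Type*} [Group Γ] (γ : Gate → CStore w → Γ)
    (hγ : ∀ g σ, (γ g σ)⁻¹ = γ g σ) (p : RProg) :
    ∀ d σ, interp γ p.inv d σ = (interp γ p d σ)⁻¹ := by
  induction p with
  | gate g => intro d σ; simp [inv, interp, hγ]
  | seq p q ihp ihq => intro d σ; simp [inv, interp, ihp, ihq]
  | loop r N p ih =>
    intro d σ; cases r
    · simp [inv, interp, ih, ordProd_inv]
    · simp [inv, interp, ih, revProd_inv]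
  | letop op a b p ih => intro d σ; simp [inv, interp, ih]
  | letld a p ih => intro d σ; simp [inv, interp, ih]

end RProg

/-! ## Operators on quantum states -/

section Operators

/-- A permutation of the computational basis as an operator. -/
def permL : Equiv.Perm (QB w) →* (QOp w) where
  toFun e := LinearEquiv.funCongrLeft ℂ ℂ e.symm
  map_one' := rfl
  map_mul' _ _ := rfl

@[simp] lemma permL_apply (e : Equiv.Perm (QB w)) (ψ : QS w) (x : QB w) :
    permL e ψ x = ψ (e.symm x) := rfl

/-- The operator that flips the sign of the amplitudes where `φ` holds. -/
def phaseFun (φ : QB w → Prop) (ψ : QS w) : QS w := fun x =>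
  open Classical in if φ x then -ψ x else ψ x

lemma phaseFun_involutive (φ : QB w → Prop) (ψ : QS w) :
    phaseFun φ (phaseFun φ ψ) = ψ := by
  funext x; by_cases h : φ x <;> simp [phaseFun, h]

def phaseL (φ : QB w → Prop) : QOp w where
  toFun := phaseFun φ
  invFun := phaseFun φ
  left_inv := phaseFun_involutive φ
  right_inv := phaseFun_involutive φ
  map_add' ψ χ := by
    funext x; by_cases h : φ x
    · simp [phaseFun, h]; ring
    · simp [phaseFun, h]
  map_smul' c ψ := by funext x; by_cases h : φ x <;> simp [phaseFun, h]

open Classical in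
@[simp] lemma phaseL_apply (φ : QB w → Prop) (ψ : QS w) (x : QB w) :
    phaseL φ ψ x = if φ x then -ψ x else ψ x := rfl

lemma phaseL_inv (φ : QB w → Prop) : (phaseL φ)⁻¹ = phaseL φ := by
  rw [inv_eq_iff_mul_eq_one]; ext1 ψ; exact phaseFun_involutive φ ψ

lemma flipBit_involutive (i : Reg) (b : ℕ) :
    Function.Involutive (flipBit (w := w) i b) := by
  intro x; simp [flipBit]

lemma sqrt_two_mul_self : ((Real.sqrt 2 : ℂ)) * (Real.sqrt 2 : ℂ) = 2 := by
  rw [← Complex.ofReal_mul, Real.mul_self_sqrt (by norm_num)]; norm_num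

lemma flipBit_bit (i : Reg) (hb : b < w) (x : QB w) :
    ((flipBit i b x).1 i).getLsbD b = !(x.1 i).getLsbD b := by
  simp [flipBit, hb]

lemma hadamardGate_involutive (i : Reg) (b : ℕ) (ψ : QS w) :
    hadamardGate i b (hadamardGate i b ψ) = ψ := by
  funext x; by_cases hb : b < w
  · have h0 : (Real.sqrt 2 : ℂ) ≠ 0 := by simp
    have h2 := sqrt_two_mul_self; cases hx : (x.1 i).getLsbD b
    · simp only [hadamardGate, hb, if_true, flipBit_bit i hb, hx, flipBit_involutive i b x]; simp
      field_simp; rw [show (Real.sqrt 2 : ℂ) ^ 2 = 2 by rw [sq, h2]]; ring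
    · simp only [hadamardGate, hb, if_true, flipBit_bit i hb, hx, flipBit_involutive i b x]; simp
      field_simp; rw [show (Real.sqrt 2 : ℂ) ^ 2 = 2 by rw [sq, h2]]; ring
  · simp [hadamardGate, hb]

def hadL (i : Reg) (b : ℕ) : QOp w where
  toFun := hadamardGate i b
  invFun := hadamardGate i b
  left_inv := hadamardGate_involutive i b
  right_inv := hadamardGate_involutive i b
  map_add' ψ χ := by
    funext x; simp only [hadamardGate, Pi.add_apply]; split_ifs <;> ring
  map_smul' c ψ := by
    funext x; simp only [hadamardGate, Pi.smul_apply, smul_eq_mul, RingHom.id_apply]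
    split_ifs <;> ring

@[simp] lemma hadL_apply (i : Reg) (b : ℕ) (ψ : QS w) : hadL i b ψ = hadamardGate i b ψ := rfl

lemma hadL_inv (i : Reg) (b : ℕ) : (hadL (w := w) i b)⁻¹ = hadL i b := by
  rw [inv_eq_iff_mul_eq_one]; ext1 ψ; exact hadamardGate_involutive i b ψ

/-- The action of an instruction on basis states (trivial for those that are not permutations). -/
def Gate.perm (G : DGraph n) : Gate → CStore w → Equiv.Perm (QB w)
  | .qx i op a b, σ => (xorInto_involutive i fun x => op.eval (a.eval σ x) (b.eval σ x)).toPerm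
  | .had _ _, _ => 1
  | .zg _, _ => 1
  | .acc i j, _ => (accessMap_involutive i j).toPerm
  | .qry i j l, _ => (xorInto_involutive i fun x => edgeAnswer G (x.1 j) (x.1 l)).toPerm

def Gate.den (G : DGraph n) : Gate → CStore w → (QOp w)
  | .had i b, σ => hadL i (b.eval σ).toNat
  | .zg i, _ => phaseL fun x => (x.1 i).getLsbD 0
  | g, σ => permL (g.perm G σ)

def Gate.cost (τ : ℕ) : Gate → ℕ
  | .qx _ _ _ _ => 1
  | .had _ _ => 1
  | .zg _ => 4
  | .acc _ _ => 1
  | .qry _ _ _ => τ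

lemma toPerm_inv {α : Type*} {f : α → α} (h : Function.Involutive f) :
    (h.toPerm : Equiv.Perm α)⁻¹ = h.toPerm := by
  rw [inv_eq_iff_mul_eq_one]; ext1 x; exact h x

lemma Gate.perm_inv (G : DGraph n) (g : Gate) (σ : CStore w) :
    (g.perm G σ)⁻¹ = g.perm G σ := by
  cases g <;> simp only [Gate.perm, toPerm_inv, inv_one]

lemma Gate.den_inv (G : DGraph n) (g : Gate) (σ : CStore w) :
    (g.den G σ)⁻¹ = g.den G σ := by
  cases g <;> simp only [Gate.den, hadL_inv, phaseL_inv, ← map_inv, Gate.perm_inv]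

end Operators

namespace RProg

variable (G : DGraph n)

/-- The operator performed by a program. -/
def den : RProg → ℕ → CStore w → (QOp w) := interp (Gate.den G)

/-- The permutation of basis states performed by a program without Hadamard and phase gates. -/
def perm : RProg → ℕ → CStore w → Equiv.Perm (QB w) := interp (Gate.perm G)

/-- The running time of a program. -/
def cost (τ : ℕ) : RProg → ℕ → CStore w → ℕ
  | gate g, _, _ => g.cost τ
  | seq p q, d, σ => cost τ p d σ + cost τ q d σ
  | loop false N p, d, σ => 1 + ((∑ j ∈ range (N.eval σ).toNat,
      ((1 + cost τ p (d + 2) (σ.set d j##w)) + (1 + 1) + 1)) + 1) + 1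
  | loop true N p, d, σ => 1 + ((∑ j ∈ range (N.eval σ).toNat,
      ((1 + cost τ p (d + 2) (σ.set d j##w)) + 1)) + 1)
  | letop op a b p, d, σ => 1 + (cost τ p (d + 1) (σ.set d (op.eval (a.eval σ) (b.eval σ))) + 1)
  | letld a p, d, σ => 1 + (cost τ p (d + 1) (σ.set d (σ.mem (a.eval σ))) + 1)

lemma den_inv (p : RProg) (d : ℕ) (σ : CStore w) : p.inv.den G d σ = (p.den G d σ)⁻¹ :=
  interp_inv _ (Gate.den_inv G) p d σ

lemma perm_inv (p : RProg) (d : ℕ) (σ : CStore w) : p.inv.perm G d σ = (p.perm G d σ)⁻¹ :=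
  interp_inv _ (Gate.perm_inv G) p d σ

end RProg

section Soundness

variable {τ : ℕ}

lemma CStore.set_self (h : σ.reg d = v) :
    σ.set d v = σ := by
  subst h; simp [CStore.set]

lemma CStore.set_set (σ : CStore w) (d : ℕ) (u v : BitVec w) :
    (σ.set d u).set d v = σ.set d v := by
  simp [CStore.set]

lemma CStore.set_comm (σ : CStore w) {e : ℕ} (h : d ≠ e) (u v : BitVec w) :
    (σ.set d u).set e v = (σ.set e v).set d u := by
  simp [CStore.set, Function.update_comm h]

@[simp] lemma CStore.set_reg_self (σ : CStore w) (d : ℕ) (v : BitVec w) :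
    (σ.set d v).reg d = v := by simp [CStore.set]

lemma CStore.set_reg_ne (σ : CStore w) (v : BitVec w) (h : j ≠ d) :
    (σ.set d v).reg j = σ.reg j := by simp [CStore.set, h]

@[simp] lemma CStore.set_mem (σ : CStore w) (d : ℕ) (v : BitVec w) : (σ.set d v).mem = σ.mem := rfl

lemma COperand.eval_set {a : COperand} {e : ℕ} (h : a.Lt d) (hde : d ≤ e) (σ : CStore w)
    (v : BitVec w) : a.eval (σ.set e v) = a.eval σ := by
  cases a with
  | lit c => rfl
  | creg j => exact CStore.set_reg_ne σ v (by have : j < d := h; omega)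

lemma QExec.cset' (i : ℕ) (op : WordOp) (a b : COperand) (σ σ' : CStore w) (ψ : QS w)
    (h : σ' = σ.set i (op.eval (a.eval σ) (b.eval σ))) :
    QExec G τ (.cset i op a b) (σ, ψ) 1 (σ', ψ) := by
  subst h; exact .cset i op a b σ ψ

lemma QExec.czero (c : ℕ) (σ : CStore w) (ψ : QS w) :
    QExec G τ (QProg.czero c) (σ, ψ) 1 (σ.set c 0, ψ) :=
  .cset' _ _ _ _ _ _ _ (by simp [WordOp.eval, COperand.eval])

lemma ofNat_succ (j : ℕ) : j##w + 1#w = (j + 1)##w := by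
  simp [ofNat_add]

lemma toNat_ofNat_le {N : BitVec w} (h : j ≤ N.toNat) :
    (j##w).toNat = j := by
  simp only [toNat_ofNat]; exact mod_eq_of_lt (lt_of_le_of_lt h N.isLt)

lemma sub_ofNat_eq_zero {N : BitVec w} (h : j ≤ N.toNat) :
    N - j##w = 0 ↔ j = N.toNat := by
  constructor
  · intro h1; have h2 : N = j##w := by
      have := congrArg (· + j##w) h1; simpa using this
    rw [h2, toNat_ofNat_le h]
  · rintro rfl; simp

/-- The states `s j` are those at the beginning of the iterations, with registers `c` and `c + 1`
disregarded. -/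
lemma QExec.upLoop {c : ℕ} {N : COperand} {p : QProg 255} {V : BitVec w}
    (s : ℕ → CStore w × QS w) (t : ℕ → ℕ) (h0 : (s 0).1.reg c = 0)
    (hN : ∀ j ≤ V.toNat, ∀ u v, N.eval (((s j).1.set c u).set (c + 1) v) = V)
    (hp : ∀ j < V.toNat, QExec G τ p (((s j).1.set c j##w).set (c + 1) 0, (s j).2)
      (t j) (((s (j + 1)).1.set c j##w).set (c + 1) 0, (s (j + 1)).2)) :
    QExec G τ (QProg.upLoop c N p) (s 0)
      (1 + (∑ j ∈ range V.toNat, ((1 + t j) + (1 + 1) + 1) + 1))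
      (((s V.toNat).1.set c V).set (c + 1) 0, (s V.toNat).2) := by
  have key : ∀ m j, j + m = V.toNat →
      QExec G τ (.loop (.creg (c + 1)) (.seq (.seq (QProg.czero (c + 1)) p)
      (.seq (.cset c .add (.creg c) (.lit 1)) (.cset (c + 1) .sub N (.creg c)))))
      (((s j).1.set c j##w).set (c + 1) (V - j##w), (s j).2)
      (∑ i ∈ range m, ((1 + t (j + i)) + (1 + 1) + 1) + 1)
      (((s V.toNat).1.set c V).set (c + 1) 0, (s V.toNat).2) := by
    intro m; induction m with
    | zero =>
      intro j hj; obtain rfl : j = V.toNat := by omega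
      have : V - ofNat w V.toNat = 0 := (sub_ofNat_eq_zero le_rfl).2 rfl; rw [this]
      simp only [BitVec.ofNat_toNat, BitVec.setWidth_eq, Finset.range_zero, Finset.sum_empty,
        zero_add]
      exact .loop_false (by simp [COperand.eval])
    | succ m ih =>
      intro j hj; have hlt : j < V.toNat := by omega
      have hne : V - j##w ≠ 0 := by
        rw [Ne, sub_ofNat_eq_zero hlt.le]; omega
      have h2 := ih (j + 1) o!; have e : (∑ i ∈ range (m + 1), ((1 + t (j + i)) + (1 + 1) + 1) + 1)
          = ((1 + t j) + (1 + 1)) + 1 +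
            (∑ i ∈ range m, ((1 + t (j + 1 + i)) + (1 + 1) + 1) + 1) := by
        rw [Finset.sum_range_succ']
        rw [Finset.sum_congr rfl (fun i _ => by rw [Nat.add_right_comm j 1 i, Nat.add_assoc j i 1]
          : ∀ i ∈ range m, ((1 + t (j + 1 + i)) + (1 + 1) + 1) =
            ((1 + t (j + (i + 1))) + (1 + 1) + 1)), add_zero]
        ring
      rw [e]; refine .loop_true (by simpa [COperand.eval] using hne) (.seq
        (s' := (((s (j + 1)).1.set c j##w).set (c + 1) 0, (s (j + 1)).2))
        (.seq (.czero _ _ _) ?_)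
        (.seq (s' := (((s (j + 1)).1.set c (j + 1)##w).set (c + 1) 0, (s (j + 1)).2))
          (.cset' _ _ _ _ _ _ _ ?_) (.cset' _ _ _ _ _ _ _ ?_))) h2
      · rw [CStore.set_set]; exact hp j hlt
      · have hc : c ≠ c + 1 := by omega
        simp only [COperand.eval, WordOp.eval, CStore.set_reg_ne _ _ hc, CStore.set_reg_self,
          ofNat_succ]
        rw [CStore.set_comm _ hc.symm, CStore.set_set]
      · have hc : c ≠ c + 1 := by omega
        rw [hN (j + 1) o!, CStore.set_set]
        simp only [COperand.eval, WordOp.eval, CStore.set_reg_ne _ _ hc, CStore.set_reg_self]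
  have h1 := key V.toNat 0 o!; simp only [zero_add] at h1; refine .seq (.cset' _ _ _ _ _ _ _ rfl) ?_
  have e : (s 0).1 = (s 0).1.set c 0#w := (CStore.set_self (by simpa using h0)).symm
  have e2 := hN 0 o! 0 ((s 0).1.reg (c + 1)); rw [CStore.set_self h0, CStore.set_self rfl] at e2
  have e3 : WordOp.sub.eval (N.eval (s 0).1) ((COperand.creg c).eval (s 0).1) =
      V - 0#w := by
    rw [e2]; simp [COperand.eval, WordOp.eval, h0]
  rw [e3]; rw [← e] at h1; exact h1

lemma tGate_four (i : Reg) (ψ : QS w) :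
    tGate i 0 (tGate i 0 (tGate i 0 (tGate i 0 ψ))) = phaseL (fun x => (x.1 i).getLsbD 0) ψ := by
  funext x; simp only [tGate, phaseL_apply]; split_ifs
  · rw [← mul_assoc, ← mul_assoc, ← mul_assoc, ← Complex.exp_add, ← Complex.exp_add,
      ← Complex.exp_add]
    have : (Complex.I * Real.pi / 4 + Complex.I * Real.pi / 4 + Complex.I * Real.pi / 4 +
      Complex.I * Real.pi / 4) = Real.pi * Complex.I := by ring
    rw [this, Complex.exp_pi_mul_I]; ring
  · rfl

lemma Gate.compile_sound (g : Gate) (σ : CStore w) (ψ : QS w) :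
    QExec G τ g.compile (σ, ψ) (g.cost τ) (σ, g.den G σ ψ) := by
  cases g with
  | qx i op a b => exact .qxor i op a b σ ψ
  | had i b => exact .hadamard i b σ ψ
  | acc i j => exact .access i j σ ψ
  | qry i j l => exact .query i j l σ ψ
  | zg i =>
    have h := fun ψ => QExec.tgate (G := G) (τ := τ) i (.lit 0) σ ψ
    have := QExec.seq (.seq (h ψ) (h _)) (.seq (h _) (h _))
    simp only [COperand.eval, toNat_ofNat, Nat.zero_mod, tGate_four] at this; exact this

lemma RProg.compile_sound (p : RProg) : ∀ (d : ℕ) (σ : CStore w),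
    (∀ i, d ≤ i → σ.reg i = 0) → p.WF d → ∀ ψ,
    QExec G τ (p.compile d) (σ, ψ) (p.cost τ d σ) (σ, p.den G d σ ψ) := by
  induction p with
  | gate g => intro d σ _ _ ψ; exact g.compile_sound σ ψ
  | seq p q ihp ihq => intro d σ h hw ψ; exact .seq (ihp d σ h hw.1 ψ) (ihq d σ h hw.2 _)
  | letop op a b p ih =>
    intro d σ h hw ψ; refine .seq (.cset' _ _ _ _ _ _ _ rfl) (.seq (ih (d + 1) _ ?_ hw ψ) ?_)
    · intro i hi; rw [CStore.set_reg_ne _ _ o!]; exact h i o!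
    · have := QExec.czero (G := G) (τ := τ) d (σ.set d (op.eval (a.eval σ) (b.eval σ)))
        (p.den G (d + 1) (σ.set d (op.eval (a.eval σ) (b.eval σ))) ψ)
      rw [CStore.set_set, CStore.set_self (h d le_rfl)] at this; exact this
  | letld a p ih =>
    intro d σ h hw ψ
    refine .seq (.cload _ _ _ _) (.seq (ih (d + 1) (σ.set d (σ.mem (a.eval σ))) ?_ hw ψ) ?_)
    · intro i hi; rw [CStore.set_reg_ne _ _ o!]; exact h i o!
    · have := QExec.czero (G := G) (τ := τ) d (σ.set d (σ.mem (a.eval σ)))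
        (p.den G (d + 1) (σ.set d (σ.mem (a.eval σ))) ψ)
      rw [CStore.set_set, CStore.set_self (h d le_rfl)] at this; exact this
  | loop r N p ih =>
    intro d σ h hw ψ; have hd : σ.reg d = 0 := h d le_rfl
    have hbody : ∀ j : ℕ, ∀ ψ, QExec G τ (p.compile (d + 2)) (σ.set d j##w, ψ)
        (p.cost τ (d + 2) (σ.set d j##w))
        (σ.set d j##w, p.den G (d + 2) (σ.set d j##w) ψ) := by
      intro j ψ; refine ih (d + 2) _ ?_ hw.2 ψ
      intro i hi; rw [CStore.set_reg_ne _ _ o!]; exact h i o!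
    set f := fun j => p.den G (d + 2) (σ.set d j##w) with hf
    cases r
    · have e1 : ∀ v, (σ.set d v).set (d + 1) 0 = σ.set d v := fun v =>
        CStore.set_self (by rw [CStore.set_reg_ne _ _ o!]; exact h _ o!)
      have := QExec.upLoop (G := G) (τ := τ) (c := d) (N := N) (p := p.compile (d + 2))
        (V := N.eval σ) (fun j => (σ, ordProd f j ψ))
        (fun j => p.cost τ (d + 2) (σ.set d j##w)) hd
        (fun j _ u v => by
          rw [COperand.eval_set hw.1 o!, COperand.eval_set hw.1 le_rfl])
        (fun j _ => by
          simp only [e1]; exact hbody j _)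
      have h2 := this.seq (QExec.czero (G := G) (τ := τ) d _ _)
      simp only [e1, CStore.set_set, CStore.set_self hd] at h2; exact h2
    · have key : ∀ m ≤ (N.eval σ).toNat, ∀ ψ, QExec G τ (.loop (.creg d)
          (.seq (.cset d .sub (.creg d) (.lit 1)) (p.compile (d + 2))))
          (σ.set d m##w, ψ) ((∑ j ∈ range m,
          ((1 + p.cost τ (d + 2) (σ.set d j##w)) + 1)) + 1)
          (σ, revProd f m ψ) := by
        intro m; induction m with
        | zero =>
          intro _ ψ; have := QExec.loop_false (G := G) (τ := τ) (a := .creg d)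
            (p := .seq (.cset d .sub (.creg d) (.lit 1)) (p.compile (d + 2))) (s := (σ, ψ))
            (by simpa [COperand.eval] using hd)
          have e0 : σ.set d 0#w = σ := CStore.set_self (by simpa using hd)
          simpa [e0, revProd] using this
        | succ m ihm =>
          intro hm ψ; rw [Finset.sum_range_succ]
          have e : (∑ j ∈ range m, ((1 + p.cost τ (d + 2) (σ.set d j##w)) + 1)) +
              ((1 + p.cost τ (d + 2) (σ.set d m##w)) + 1) + 1 =
              (1 + p.cost τ (d + 2) (σ.set d m##w)) + 1 + ((∑ j ∈ range m,
              ((1 + p.cost τ (d + 2) (σ.set d j##w)) + 1)) + 1) := by ring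
          rw [e]; refine .loop_true ?_ (.seq (s' := (σ.set d m##w, ψ))
            (.cset' _ _ _ _ _ _ _ ?_) (hbody m ψ)) (ihm o! _)
          · simp only [COperand.eval, CStore.set_reg_self]; intro h0
            have := congrArg BitVec.toNat h0; rw [toNat_ofNat_le hm] at this; simp at this
          · simp only [COperand.eval, WordOp.eval, CStore.set_reg_self, CStore.set_set]
            rw [← ofNat_succ m]; simp
      have h1 := key _ le_rfl ψ; refine .seq (.cset' _ _ _ _ _ _ _ ?_) h1
      simp [COperand.eval, WordOp.eval]

end Soundness

open CStore (set_reg_ne set_reg_self set_self set_set set_comm)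
open COperand (eval_set)

/-! # Basis states -/

def setR (x : QB w) (i : Reg) (v : BitVec w) : QB w :=
  (update x.1 i v, x.2)

def setM (x : QB w) (a : BitVec w) (v : BitVec w) : QB w :=
  (x.1, update x.2 a v)

def xorR (x : QB w) (i : Reg) (v : BitVec w) : QB w := setR x i (x.1 i ^^^ v)

@[simp] lemma setR_self (x : QB w) (i : Reg) (v : BitVec w) :
    (setR x i v).1 i = v := by simp [setR]

@[simp] lemma setR_ne {j : Reg} (h : j ≠ i) :
    (setR x i v).1 j = x.1 j := by simp [setR, h]

@[simp] lemma setR_mem (x : QB w) (i : Reg) (v : BitVec w) : (setR x i v).2 = x.2 := rfl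

@[simp] lemma setM_reg (x : QB w) (a v : BitVec w) : (setM x a v).1 = x.1 := rfl

@[simp] lemma setM_self (x : QB w) (a v : BitVec w) : (setM x a v).2 a = v := by
  simp [setM]

@[simp] lemma setM_ne (x : QB w) {a b : BitVec w} (v : BitVec w) (h : b ≠ a) :
    (setM x a v).2 b = x.2 b := by simp [setM, h]

@[simp] lemma setR_setR (x : QB w) (i : Reg) (u v : BitVec w) :
    setR (setR x i u) i v = setR x i v := by simp [setR]

lemma setR_comm (x : QB w) {j : Reg} (h : i ≠ j) (u v : BitVec w) :
    setR (setR x i u) j v = setR (setR x j v) i u := by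
  simp [setR, Function.update_comm h]

lemma setR_eq_self (h : x.1 i = v) :
    setR x i v = x := by subst h; simp [setR]

lemma setM_eq_self {a : BitVec w} (h : x.2 a = v) : setM x a v = x := by
  subst h; simp [setM]

lemma setM_setR (x : QB w) (i : Reg) (a u v : BitVec w) :
    setM (setR x i u) a v = setR (setM x a v) i u := rfl

@[simp] lemma xorR_self (x : QB w) (i : Reg) (v : BitVec w) :
    (xorR x i v).1 i = x.1 i ^^^ v := by simp [xorR]

@[simp] lemma xorR_ne (x : QB w) {j : Reg} (v : BitVec w) (h : j ≠ i) :
    (xorR x i v).1 j = x.1 j := by simp [xorR, h]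

@[simp] lemma xorR_mem (x : QB w) (i : Reg) (v : BitVec w) : (xorR x i v).2 = x.2 := rfl

lemma xorR_xorR (x : QB w) (i : Reg) (u v : BitVec w) :
    xorR (xorR x i u) i v = xorR x i (u ^^^ v) := by simp [xorR, xor_assoc]

@[simp] lemma xorR_zero (x : QB w) (i : Reg) : xorR x i 0 = x := by
  simp only [xorR]; exact setR_eq_self (by simp)

lemma xorR_of_zero (h : x.1 i = 0) (v : BitVec w) :
    xorR x i v = setR x i v := by simp [xorR, h]

/-- The value `1` or `0` of a proposition. -/
def bw (w : ℕ) (P : Prop) : BitVec w :=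
  open Classical in if P then 1#w else 0#w

lemma bw_true {P : Prop} (h : P) : bw w P = 1#w := by simp [bw, h]

lemma bw_false {P : Prop} (h : ¬P) : bw w P = 0#w := by simp [bw, h]

lemma WordOp.eval_lt_zero (v : BitVec w) : WordOp.lt.eval 0#w v = bw w (v ≠ 0) := by
  have : 0 < v.toNat ↔ v ≠ 0#w := by
    rw [Ne, ← toNat_inj]; simp [Nat.pos_iff_ne_zero]
  by_cases h : v = 0#w
  · subst h; simp [WordOp.eval, bw]
  · simp [WordOp.eval, bw, this, h]

lemma WordOp.eval_lt_eq (u v : BitVec w) : WordOp.lt.eval u v = bw w (u.toNat < v.toNat) := by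
  simp only [WordOp.eval, bw]; split_ifs <;> rfl

lemma WordOp.eval_eq_eq (u v : BitVec w) : WordOp.eq.eval u v = bw w (u = v) := by
  simp only [WordOp.eval, bw]; split_ifs <;> rfl

lemma bw_and (P Q : Prop) : bw w P &&& bw w Q = bw w (P ∧ Q) := by
  by_cases hP : P <;> by_cases hQ : Q <;> simp [bw, hP, hQ]

lemma bw_bit (hw : 0 < w) (P : Prop) : (bw w P).getLsbD 0 ↔ P := by
  by_cases hP : P <;> simp [bw, hP, hw]

/-- `f` does not depend on register `i`. -/
def Indep {α : Type*} (f : QB w → α) (i : Reg) : Prop :=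
  ∀ y v, f (setR y i v) = f y

/-- XORing `f` into register `i`. -/
def xorP (i : Reg) (f : QB w → BitVec w) : Equiv.Perm (QB w) :=
  (xorInto_involutive i f).toPerm

lemma xorP_apply {f : QB w → BitVec w} (h : Indep f i)
    (x : QB w) : xorP i f x = xorR x i (f x) := by
  show xorInto i f x = _; have h' : ∀ y v, f (update y.1 i v, y.2) = f y := fun y v => h y v
  rw [xorInto, if_pos h']; rfl

lemma xorInto_setR (hi : i ≠ o) {f : QB w → BitVec w}
    (h : Indep f o) (x : QB w) (v : BitVec w) :
    xorInto i f (setR x o v) = setR (xorInto i f x) o v := by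
  unfold xorInto; split_ifs with hc
  · rw [h]; show setR (setR x o v) i ((setR x o v).1 i ^^^ _) = setR (setR x i _) o v
    rw [setR_ne hi, setR_comm _ hi.symm]
  · rfl

def QOperand.Avoids : QOperand 255 → Reg → Prop
  | .classical _, _ => True
  | .qreg j, i => j ≠ i

lemma QOperand.eval_setR {a : QOperand 255} (h : a.Avoids i) (σ : CStore w)
    (x : QB w) (v : BitVec w) : a.eval σ (setR x i v) = a.eval σ x := by
  cases a with
  | classical a => rfl
  | qreg j => exact setR_ne h

/-! # Programs that permute the computational basis -/

namespace Gate

def Pure : Gate → Prop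
  | had _ _ => False
  | zg _ => False
  | _ => True

/-- The register `o` does not occur. -/
def Avoids : Gate → Reg → Prop
  | qx i _ a b, o => i ≠ o ∧ a.Avoids o ∧ b.Avoids o
  | had i _, o => i ≠ o
  | zg i, o => i ≠ o
  | acc i j, o => i ≠ o ∧ j ≠ o
  | qry i j l, o => i ≠ o ∧ j ≠ o ∧ l ≠ o

end Gate

namespace RProg

/-- All instructions satisfy `Φ`. -/
def All (Φ : Gate → Prop) : RProg → Prop
  | gate g => Φ g
  | seq p q => p.All Φ ∧ q.All Φ
  | loop _ _ p => p.All Φ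
  | letop _ _ _ p => p.All Φ
  | letld _ p => p.All Φ

lemma All.inv {Φ : Gate → Prop} {p : RProg} (h : p.All Φ) : p.inv.All Φ := by
  induction p with
  | gate g => exact h
  | seq p q ihp ihq => exact ⟨ihq h.2, ihp h.1⟩
  | loop r N p ih => exact ih h
  | letop op a b p ih => exact ih h
  | letld a p ih => exact ih h

variable (G : DGraph n)

lemma den_eq_permL {p : RProg} (h : p.All Gate.Pure) : ∀ (d : ℕ) (σ : CStore w),
    p.den G d σ = permL (p.perm G d σ) := by
  induction p with
  | gate g => intro d σ; cases g <;> first | exact h.elim | rfl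
  | seq p q ihp ihq =>
    intro d σ; simp only [den, perm, interp] at *; rw [ihp h.1, ihq h.2, map_mul]
  | loop r N p ih =>
    intro d σ; simp only [den, perm] at *
    cases r <;> simp only [interp, ih h, map_ordProd, map_revProd]
  | letop op a b p ih => intro d σ; exact ih h _ _
  | letld a p ih => intro d σ; exact ih h _ _

/-- A relation between basis states that is kept by all instructions is kept by the program. -/
lemma perm_rel (Φ : Gate → Prop) (r : QB w → QB w → Prop)
    (hΦ : ∀ g : Gate, Φ g → ∀ σ x y, r x y → r (g.perm G σ x) (g.perm G σ y)) {p : RProg}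
    (h : p.All Φ) : ∀ (d : ℕ) (σ : CStore w) (x y), r x y →
      r (p.perm G d σ x) (p.perm G d σ y) := by
  induction p with
  | gate g => intro d σ; exact hΦ g h σ
  | seq p q ihp ihq => intro d σ x y hr; exact ihq h.2 d σ _ _ (ihp h.1 d σ x y hr)
  | loop b N p ih =>
    intro d σ; cases b
    · simp only [perm, interp]
      generalize (N.eval σ).toNat = m
      induction m with
      | zero => intro x y hr; exact hr
      | succ m ihm => intro x y hr; exact ih h _ _ _ _ (ihm x y hr)
    · simp only [perm, interp]
      generalize (N.eval σ).toNat = m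
      induction m with
      | zero => intro x y hr; exact hr
      | succ m ihm => intro x y hr; exact ihm _ _ (ih h _ _ _ _ hr)
  | letop op a b p ih => intro d σ; exact ih h _ _
  | letld a p ih => intro d σ; exact ih h _ _

lemma perm_qx {op : WordOp} {a b : QOperand 255} (ha : a.Avoids i)
    (hb : b.Avoids i) (d : ℕ) (σ : CStore w) (x : QB w) :
    (gate (.qx i op a b)).perm G d σ x = xorR x i (op.eval (a.eval σ x) (b.eval σ x)) :=
  xorP_apply (f := fun x => op.eval (a.eval σ x) (b.eval σ x))
    (fun y v => by simp only [QOperand.eval_setR ha, QOperand.eval_setR hb]) x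

lemma perm_acc {j : Reg} (h : i ≠ j) (d : ℕ) (σ : CStore w) (x : QB w) :
    (gate (.acc i j)).perm G d σ x = setM (setR x i (x.2 (x.1 j))) (x.1 j) (x.1 i) := by
  show accessMap i j x = _; simp [accessMap, h, setM, setR]

lemma perm_qry {j l : Reg} (hj : j ≠ i) (hl : l ≠ i) (d : ℕ) (σ : CStore w)
    (x : QB w) : (gate (.qry i j l)).perm G d σ x =
      xorR x i (bw w (G.Adj (wordVertex n (x.1 j)) (wordVertex n (x.1 l)))) := by
  refine xorP_apply (f := fun x => edgeAnswer G (x.1 j) (x.1 l)) (fun y v => ?_) x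
  simp only [setR_ne hj, setR_ne hl]

lemma perm_seq (p q : RProg) (d : ℕ) (σ : CStore w) (x : QB w) :
    (seq p q).perm G d σ x = q.perm G d σ (p.perm G d σ x) := rfl

/-- A program commutes with changes of a register that it does not use. -/
lemma perm_setR {p : RProg} (h : p.All (·.Avoids o)) (v : BitVec w)
    (d : ℕ) (σ : CStore w) (x : QB w) :
    p.perm G d σ (setR x o v) = setR (p.perm G d σ x) o v := by
  refine perm_rel G (·.Avoids o) (fun x y => x = setR y o v) ?_ h d σ _ _ rfl; rintro g hg σ x y rfl
  cases g with
  | qx i op a b =>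
    exact xorInto_setR hg.1 (f := fun x => op.eval (a.eval σ x) (b.eval σ x)) (fun y v => by
      simp only [QOperand.eval_setR hg.2.1, QOperand.eval_setR hg.2.2]) _ _
  | had i b => rfl
  | zg i => rfl
  | acc i j =>
    have h1 := perm_acc (w := w) G (i := i) (j := j); by_cases hij : i = j
    · subst hij; show accessMap _ _ _ = setR (accessMap _ _ _) _ _; simp [accessMap]
    · specialize h1 hij 0 σ
      show (gate (.acc i j)).perm G 0 σ _ = setR ((gate (.acc i j)).perm G 0 σ _) _ _
      rw [h1, h1, setR_ne hg.2, setR_ne hg.1, setM_setR, setM_setR, setR_comm _ hg.1.symm]; rfl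
  | qry i j l =>
    exact xorInto_setR hg.1 (f := fun x => edgeAnswer G (x.1 j) (x.1 l)) (fun y v => by
      simp only [setR_ne hg.2.1, setR_ne hg.2.2]) _ _

/-- Run `A`, then `B`, then undo `A`. -/
def bracket (A B : RProg) : RProg := seq A (seq B A.inv)

lemma perm_bracket (A B : RProg) (d : ℕ) (σ : CStore w) (x : QB w) :
    (bracket A B).perm G d σ x = (A.perm G d σ)⁻¹ (B.perm G d σ (A.perm G d σ x)) := by
  simp only [bracket, perm_seq, perm_inv]

lemma den_bracket (A B : RProg) (d : ℕ) (σ : CStore w) :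
    (bracket A B).den G d σ = (A.den G d σ)⁻¹ * B.den G d σ * A.den G d σ := by
  rw [← den_inv]; simp only [bracket, den, interp]

lemma perm_bracket_xor {A B : RProg} (hA : A.All (·.Avoids o))
    (hB : B.perm G d σ (A.perm G d σ x) = xorR (A.perm G d σ x) o v) :
    (bracket A B).perm G d σ x = xorR x o v := by
  have ho : (A.perm G d σ x).1 o = x.1 o := by
    have := perm_setR G hA (x.1 o) d σ x; rw [setR_eq_self rfl] at this; rw [this, setR_self]
  rw [perm_bracket, hB, xorR, ho, ← perm_setR G hA]; exact Equiv.symm_apply_apply _ _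

lemma All.bracket {Φ : Gate → Prop} {A B : RProg} (hA : A.All Φ) (hB : B.All Φ) :
    (bracket A B).All Φ := ⟨hA, hB, hA.inv⟩

end RProg

/-! # Norms and approximation -/

def nrm (ψ : QS w) : ℝ := ‖(WithLp.toLp 2 ψ : EuclideanSpace ℂ (QB w))‖

lemma nrm_nonneg (ψ : QS w) : 0 ≤ nrm ψ := norm_nonneg _

lemma nrm_sq (ψ : QS w) : nrm ψ ^ 2 = ∑ x, ‖ψ x‖ ^ 2 := by
  rw [nrm, EuclideanSpace.norm_sq_eq]

lemma nrm_eq_of_sum {χ : QS w} (h : ∑ x, ‖ψ x‖ ^ 2 = ∑ x, ‖χ x‖ ^ 2) :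
    nrm ψ = nrm χ := by
  have := (sq_eq_sq₀ (nrm_nonneg ψ) (nrm_nonneg χ)).1 (by rw [nrm_sq, nrm_sq, h]); exact this

lemma nrm_add_le (ψ χ : QS w) : nrm (ψ + χ) ≤ nrm ψ + nrm χ :=
  norm_add_le (WithLp.toLp 2 ψ : EuclideanSpace ℂ (QB w)) _

lemma nrm_sub_le (ψ χ : QS w) : nrm (ψ - χ) ≤ nrm ψ + nrm χ :=
  norm_sub_le (WithLp.toLp 2 ψ : EuclideanSpace ℂ (QB w)) _

lemma nrm_neg (ψ : QS w) : nrm (-ψ) = nrm ψ :=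
  norm_neg (WithLp.toLp 2 ψ : EuclideanSpace ℂ (QB w))

lemma nrm_smul (c : ℂ) (ψ : QS w) : nrm (c • ψ) = ‖c‖ * nrm ψ :=
  norm_smul c (WithLp.toLp 2 ψ : EuclideanSpace ℂ (QB w))

lemma nrm_zero : nrm (0 : QS w) = 0 :=
  norm_zero (E := EuclideanSpace ℂ (QB w))

lemma nrm_sub_comm (ψ χ : QS w) : nrm (ψ - χ) = nrm (χ - ψ) := by
  rw [← nrm_neg, neg_sub]

lemma nrm_sub_triangle (ψ χ φ : QS w) : nrm (ψ - φ) ≤ nrm (ψ - χ) + nrm (χ - φ) := by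
  have := nrm_add_le (ψ - χ) (χ - φ)
  rwa [sub_add_sub_cancel] at this

def Iso (U : QOp w) : Prop := ∀ ψ, nrm (U ψ) = nrm ψ

lemma Iso.one : Iso (1 : QOp w) := fun _ => rfl

lemma Iso.mul {U V : QOp w} (hU : Iso U) (hV : Iso V) : Iso (U * V) :=
  fun ψ => (hU _).trans (hV ψ)

lemma Iso.ordProd {f : ℕ → (QOp w)} (hf : ∀ j, Iso (f j)) (N : ℕ) :
    Iso (ordProd f N) := by
  induction N with
  | zero => exact Iso.one
  | succ N ih => exact (hf N).mul ih

lemma Iso.revProd {f : ℕ → (QOp w)} (hf : ∀ j, Iso (f j)) (N : ℕ) :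
    Iso (revProd f N) := by
  induction N with
  | zero => exact Iso.one
  | succ N ih => exact ih.mul (hf N)

lemma iso_permL (e : Equiv.Perm (QB w)) : Iso (permL e) := fun ψ =>
  nrm_eq_of_sum (Equiv.sum_comp e.symm fun x => ‖ψ x‖ ^ 2)

lemma iso_phaseL (φ : QB w → Prop) : Iso (phaseL φ) := fun ψ =>
  nrm_eq_of_sum (Finset.sum_congr rfl fun x _ => by rw [phaseL_apply]; split_ifs <;> simp)

lemma norm_sq_had (a b : ℂ) : ‖(a + b) / (Real.sqrt 2 : ℂ)‖ ^ 2 +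
    ‖(a - b) / (Real.sqrt 2 : ℂ)‖ ^ 2 = ‖a‖ ^ 2 + ‖b‖ ^ 2 := by
  have h := parallelogram_law_with_norm ℝ a b
  rw [norm_div, norm_div, Complex.norm_real, Real.norm_of_nonneg (Real.sqrt_nonneg 2), div_pow,
    div_pow, Real.sq_sqrt (by norm_num)]
  nlinarith [h]

lemma iso_hadL (i : Reg) (b : ℕ) : Iso (hadL (w := w) i b) := fun ψ => by
  apply nrm_eq_of_sum; by_cases hb : b < w
  · have hs : ∀ F : QB w → ℝ, ∑ x, F x = (∑ x, (F x + F (flipBit i b x))) / 2 := by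
      intro F; have := Equiv.sum_comp (flipBit_involutive (w := w) i b).toPerm F
      simp only [Function.Involutive.coe_toPerm] at this; rw [Finset.sum_add_distrib, this]; ring
    rw [hs, hs fun x => ‖ψ x‖ ^ 2]; congr 1; refine Finset.sum_congr rfl fun x _ => ?_
    simp only [hadL_apply, hadamardGate, hb, if_true, flipBit_bit i hb, flipBit_involutive i b x]
    cases (x.1 i).getLsbD b
    · simp only [Bool.not_false, if_true, Bool.false_eq_true, if_false]; exact norm_sq_had _ _
    · simp only [Bool.not_true, Bool.false_eq_true, if_false, if_true]
      have := norm_sq_had (ψ (flipBit i b x)) (ψ x); linarith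
  · simp [hadamardGate, hb]

lemma RProg.den_iso (G : DGraph n) (p : RProg) :
    ∀ (d : ℕ) (σ : CStore w), Iso (p.den G d σ) := by
  induction p with
  | gate g =>
    intro d σ; cases g with
    | had i b => exact iso_hadL _ _
    | zg i => exact iso_phaseL _
    | qx i op a b => exact iso_permL _
    | acc i j => exact iso_permL _
    | qry i j l => exact iso_permL _
  | seq p q ihp ihq => intro d σ; exact (ihq d σ).mul (ihp d σ)
  | loop r N p ih =>
    intro d σ; cases r
    · exact Iso.ordProd (fun j => ih _ _) _
    · exact Iso.revProd (fun j => ih _ _) _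
  | letop op a b p ih => intro d σ; exact ih _ _
  | letld a p ih => intro d σ; exact ih _ _

/-- `ψ` is a superposition of basis states in `S`. -/
def Supp (ψ : QS w) (S : Set (QB w)) : Prop := ∀ x, x ∉ S → ψ x = 0

lemma Supp.mono {S' : Set (QB w)} (h : Supp ψ S) (hS : S ⊆ S') :
    Supp ψ S' := fun x hx => h x fun h' => hx (hS h')

/-- `V` maps superpositions of basis states in `S` to superpositions of basis states in `S'`. -/
def Maps (V : QOp w) (S S' : Set (QB w)) : Prop :=
  ∀ ψ, Supp ψ S → Supp (V ψ) S'

lemma Maps.one (S : Set (QB w)) : Maps 1 S S := fun _ h => h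

lemma Maps.mul {U V : QOp w} {S' S'' : Set (QB w)}
    (hU : Maps U S' S'') (hV : Maps V S S') : Maps (U * V) S S'' := fun ψ h => hU _ (hV ψ h)

lemma maps_permL {e : Equiv.Perm (QB w)} {S' : Set (QB w)}
    (h : ∀ x ∈ S, e x ∈ S') : Maps (permL e) S S' := fun ψ hψ x hx => by
  rw [permL_apply]; refine hψ _ fun h' => hx ?_
  have := h _ h'
  rwa [Equiv.apply_symm_apply] at this

lemma maps_phaseL (φ : QB w → Prop) (S : Set (QB w)) : Maps (phaseL φ) S S :=
  fun ψ hψ x hx => by rw [phaseL_apply, hψ x hx]; simp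

lemma maps_hadL
    (h : ∀ x ∈ S, flipBit i b x ∈ S) : Maps (hadL i b) S S := fun ψ hψ x hx => by
  have hx' : flipBit i b x ∉ S := fun h' => hx (by
    have := h _ h'
    rwa [flipBit_involutive i b x] at this)
  simp only [hadL_apply, hadamardGate, hψ x hx, hψ _ hx']; simp

lemma Maps.ordProd {f : ℕ → (QOp w)} {N : ℕ}
    (hf : ∀ j < N, Maps (f j) S S) : Maps (ordProd f N) S S := by
  induction N with
  | zero => exact Maps.one S
  | succ N ih => exact (hf N o!).mul (ih fun j hj => hf j o!)

/-- On superpositions of basis states in `S`, the operators `U` and `V` agree up to `ε`. -/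
def Approx (U V : QOp w) (S : Set (QB w)) (ε : ℝ) : Prop :=
  ∀ ψ, Supp ψ S → nrm (U ψ - V ψ) ≤ ε * nrm ψ

lemma Approx.refl (U : QOp w) (S : Set (QB w)) :
    Approx U U S 0 := fun ψ _ => by simp [nrm_zero]

lemma Approx.mono {U V : QOp w} {S' : Set (QB w)} {ε' : ℝ}
    (h : Approx U V S ε) (hS : S' ⊆ S) (hε : ε ≤ ε') : Approx U V S' ε' := fun ψ hψ =>
  (h ψ (hψ.mono hS)).trans (mul_le_mul_of_nonneg_right hε (nrm_nonneg ψ))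

lemma approx_of_eq {U V : QOp w}
    (h : ∀ ψ, Supp ψ S → U ψ = V ψ) : Approx U V S 0 := fun ψ hψ => by
  rw [h ψ hψ]; simp [nrm_zero]

lemma Approx.mul {U U' V V' : QOp w} {S' : Set (QB w)}
    {ε' : ℝ} (h' : Approx U' V' S' ε') (h : Approx U V S ε) (hU' : Iso U') (hV : Iso V)
    (hm : Maps V S S') : Approx (U' * U) (V' * V) S (ε' + ε) := fun ψ hψ => by
  have h1 := nrm_sub_triangle (U' (U ψ)) (U' (V ψ)) (V' (V ψ))
  have h2 : nrm (U' (U ψ) - U' (V ψ)) ≤ ε * nrm ψ := by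
    rw [← map_sub, hU']; exact h ψ hψ
  have h3 := h' _ (hm ψ hψ); rw [hV] at h3; rw [add_mul]; show nrm (U' (U ψ) - V' (V ψ)) ≤ _
  linarith

lemma Approx.ordProd {f g : ℕ → (QOp w)} {N : ℕ} (h : ∀ j < N, Approx (f j) (g j) S ε) (hf : ∀ j, Iso (f j))
    (hg : ∀ j, Iso (g j)) (hm : ∀ j < N, Maps (g j) S S) :
    Approx (ordProd f N) (ordProd g N) S (N * ε) := by
  induction N with
  | zero =>
    rw [Nat.cast_zero, zero_mul]; exact Approx.refl 1 S
  | succ N ih =>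
    refine (Approx.mul (h N o!) (ih (fun j hj => h j o!)
      (fun j hj => hm j o!)) (hf N) (Iso.ordProd hg N)
      (Maps.ordProd fun j hj => hm j o!)).mono subset_rfl ?_
    push_cast; linarith

lemma Approx.bracket {W V X X' Y : QOp w} {S' : Set (QB w)}
    {ε' δ : ℝ} (hW : Approx W V S ε) (hX : Approx X X' S' ε') (iW : Iso W) (iV : Iso V)
    (iX : Iso X) (iY : Iso Y) (hV : Maps V S S') (hY : Maps Y S S)
    (hδ : ∀ ψ, Supp ψ S → nrm (X' (V ψ) - V (Y ψ)) ≤ δ * nrm ψ) :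
    Approx (W⁻¹ * X * W) Y S (2 * ε + ε' + δ) := fun ψ hψ => by
  have h0 : nrm ((W⁻¹ * X * W) ψ - Y ψ) = nrm (X (W ψ) - W (Y ψ)) := by
    rw [← iW ((W⁻¹ * X * W) ψ - Y ψ), map_sub]; congr 2; exact W.apply_symm_apply _
  have h1 : nrm (X (W ψ) - X (V ψ)) ≤ ε * nrm ψ := by rw [← map_sub, iX]; exact hW ψ hψ
  have h2 := hX _ (hV ψ hψ); rw [iV] at h2; have h3 := hδ ψ hψ; have h4 := hW _ (hY ψ hψ)
  rw [iY, nrm_sub_comm] at h4; have t1 := nrm_sub_triangle (X (W ψ)) (X (V ψ)) (W (Y ψ))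
  have t2 := nrm_sub_triangle (X (V ψ)) (X' (V ψ)) (W (Y ψ))
  have t3 := nrm_sub_triangle (X' (V ψ)) (V (Y ψ)) (W (Y ψ)); rw [h0]; linarith

lemma permL_congr {e e' : Equiv.Perm (QB w)}
    (h : ∀ x ∈ S, e x = e' x) (hψ : Supp ψ S) : permL e ψ = permL e' ψ := by
  funext x; rw [permL_apply, permL_apply]; by_cases h1 : e.symm x ∈ S
  · have := h _ h1; rw [Equiv.apply_symm_apply] at this; rw [this, Equiv.symm_apply_apply, ← this]
  · by_cases h2 : e'.symm x ∈ S
    · have := h _ h2; rw [Equiv.apply_symm_apply] at this; rw [← this, Equiv.symm_apply_apply, this]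
    · rw [hψ _ h1, hψ _ h2]

lemma approx_permL {e e' : Equiv.Perm (QB w)}
    (h : ∀ x ∈ S, e x = e' x) : Approx (permL e) (permL e') S 0 :=
  approx_of_eq fun _ hψ => permL_congr h hψ

lemma phaseL_congr {φ φ' : QB w → Prop}
    (h : ∀ x ∈ S, φ x ↔ φ' x) (hψ : Supp ψ S) : phaseL φ ψ = phaseL φ' ψ := by
  funext x; by_cases hx : x ∈ S
  · have := h x hx; simp only [phaseL_apply]; split_ifs <;> first | rfl | (exfalso; tauto)
  · simp [phaseL_apply, hψ x hx]

lemma permL_phaseL (e : Equiv.Perm (QB w)) (φ : QB w → Prop) :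
    phaseL φ * permL e = permL e * phaseL fun x => φ (e x) := by
  ext ψ x; show phaseL φ (permL e ψ) x = permL e (phaseL (fun x => φ (e x)) ψ) x
  simp only [phaseL_apply, permL_apply]; split_ifs <;> first | rfl | (exfalso; simp_all)

/-- Conjugating an approximate `X` by a permutation. -/
lemma Approx.bracket_perm {A : Equiv.Perm (QB w)} {X : QOp w}
    {e e' : Equiv.Perm (QB w)} {S' : Set (QB w)}
    (hX : Approx X (permL e) S' ε) (iX : Iso X) (hA : ∀ x ∈ S, A x ∈ S')
    (he : ∀ x ∈ S, e' x ∈ S) (h : ∀ x ∈ S, e (A x) = A (e' x)) :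
    Approx ((permL A)⁻¹ * X * permL A) (permL e') S ε := by
  refine (Approx.bracket (δ := 0) (Approx.refl (permL A) S) hX (iso_permL _) (iso_permL _) iX
    (iso_permL _) (maps_permL hA) (maps_permL he) ?_).mono subset_rfl (by simp)
  intro ψ hψ; have : permL e (permL A ψ) = permL A (permL e' ψ) := by
    have := permL_congr (e := e * A) (e' := A * e') h hψ
    rwa [map_mul, map_mul] at this
  simp [this, nrm_zero]

/-! # Amplitude amplification -/

lemma ordProd_congr {Γ : Type*} [Monoid Γ] {f g : ℕ → Γ} {N : ℕ} (h : ∀ j < N, f j = g j) :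
    ordProd f N = ordProd g N := by
  induction N with
  | zero => rfl
  | succ N ih => simp only [ordProd]; rw [h N o!, ih fun j hj => h j o!]

lemma commute_ordProd {Γ : Type*} [Monoid Γ] {f : ℕ → Γ} {a : Γ} {N : ℕ}
    (h : ∀ j < N, Commute (f j) a) : Commute (ordProd f N) a := by
  induction N with
  | zero => exact Commute.one_left a
  | succ N ih => exact (h N o!).mul_left (ih fun j hj => h j o!)

lemma revProd_eq_ordProd {Γ : Type*} [Monoid Γ] {f : ℕ → Γ} (h : ∀ i j, Commute (f i) (f j))
    (N : ℕ) : revProd f N = ordProd f N := by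
  induction N with
  | zero => rfl
  | succ N ih =>
    rw [revProd, ih]; exact (commute_ordProd fun j _ => h j N).eq

lemma toNat_xor_twoPow (hb : b < w) (h : v.getLsbD b = false) :
    (v ^^^ twoPow w b).toNat = v.toNat + 2 ^ b := by
  have h1 : v ^^^ twoPow w b = v ||| twoPow w b := by
    ext i hi; simp only [BitVec.getElem_xor, BitVec.getElem_or, BitVec.getElem_twoPow]
    by_cases hi' : i = b
    · subst hi'; rw [BitVec.getLsbD_eq_getElem hi] at h; simp [h]
    · simp [hi']
  have h2 : v &&& twoPow w b = 0#w := by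
    ext i hi; simp only [BitVec.getElem_and, BitVec.getElem_twoPow, BitVec.getElem_zero]
    by_cases hi' : i = b
    · subst hi'; rw [BitVec.getLsbD_eq_getElem hi] at h; simp [h]
    · simp [hi']
  have h3 := BitVec.toNat_add_of_and_eq_zero h2
  rw [BitVec.add_eq_or_of_and_eq_zero _ _ h2, BitVec.toNat_twoPow,
    mod_eq_of_lt (two_pow_lt hb)] at h3
  rw [h1, h3]

lemma toNat_xor_twoPow' (hb : b < w) (h : v.getLsbD b = true) :
    (v ^^^ twoPow w b).toNat + 2 ^ b = v.toNat := by
  have := toNat_xor_twoPow hb (v := v ^^^ twoPow w b) (by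
    simp [h, hb])
  rw [← this, xor_assoc, bxor_self, bxor_zero]

lemma getLsbD_of_lt (h : v.toNat < 2 ^ b) : v.getLsbD b = false := by
  rw [BitVec.getLsbD]; exact Nat.testBit_lt_two_pow h

lemma flipBit_eq (i : Reg) (b : ℕ) (x : QB w) :
    flipBit i b x = setR x i (x.1 i ^^^ twoPow w b) := rfl

lemma flipBit_comm (i : Reg) (a b : ℕ) (x : QB w) :
    flipBit i a (flipBit i b x) = flipBit i b (flipBit i a x) := by
  simp only [flipBit_eq, setR_self, setR_setR, xor_assoc]; rw [bxor_comm (twoPow w b)]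

lemma flipBit_bit_ne (i : Reg) (h : a ≠ b) (x : QB w) :
    ((flipBit i a x).1 i).getLsbD b = (x.1 i).getLsbD b := by
  simp [flipBit, getLsbD_twoPow, h]

lemma hadL_commute (i : Reg) (a b : ℕ) :
    Commute (hadL (w := w) i a) (hadL i b) := by
  by_cases hab : a = b
  · subst hab; exact Commute.refl _
  show hadL i a * hadL i b = hadL i b * hadL i a; ext ψ x
  show hadamardGate i a (hadamardGate i b ψ) x = hadamardGate i b (hadamardGate i a ψ) x
  by_cases ha : a < w <;> by_cases hb : b < w <;>
    simp only [hadamardGate, ha, hb, if_true, if_false]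
  simp only [flipBit_bit_ne i hab, flipBit_bit_ne i (Ne.symm hab), flipBit_comm i a b]
  split_ifs <;> ring

/-- Hadamard gates on the `b` lowest bits of register `i`. -/
def hadN (i : Reg) (b : ℕ) : QOp w := ordProd (hadL i) b

lemma hadN_inv (i : Reg) (b : ℕ) : (hadN (w := w) i b)⁻¹ = hadN i b := by
  rw [hadN, ordProd_inv]; simp only [hadL_inv]
  exact revProd_eq_ordProd (fun a b => hadL_commute i a b) _

lemma hadN_hadN (i : Reg) (b : ℕ) (ψ : QS w) : hadN i b (hadN i b ψ) = ψ := by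
  have : hadN (w := w) i b * hadN i b = 1 := by
    nth_rewrite 1 [← hadN_inv]; exact inv_mul_cancel _
  exact congrArg (fun U => U ψ) this

lemma iso_hadN (i : Reg) (b : ℕ) : Iso (hadN (w := w) i b) :=
  Iso.ordProd (fun j => iso_hadL i j) b

lemma hadN_succ (i : Reg) (b : ℕ) (ψ : QS w) :
    hadN i (b + 1) ψ = hadamardGate i b (hadN i b ψ) := rfl

lemma hadN_of_zero (hb : b ≤ w)
    (hψ : ∀ x : QB w, x.1 i ≠ 0 → ψ x = 0) (x : QB w) :
    hadN i b ψ x =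
      if (x.1 i).toNat < 2 ^ b then ((Real.sqrt 2 : ℂ)⁻¹) ^ b * ψ (setR x i 0) else 0 := by
  induction b generalizing x with
  | zero =>
    simp only [hadN, ordProd, pow_zero, Nat.lt_one_iff, one_mul]; show ψ x = _; split_ifs with h
    · have : x.1 i = 0 := BitVec.eq_of_toNat_eq (by simpa using h); rw [setR_eq_self this]
    · exact hψ x fun h' => h (by simp [h'])
  | succ b ih =>
    have hbw : b < w := by omega
    rw [hadN_succ]
    simp only [hadamardGate, hbw, if_true, ih o!, flipBit_eq, setR_self, setR_setR, pow_succ]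
    cases hx : (x.1 i).getLsbD b
    · have h1 := toNat_xor_twoPow hbw hx
      have h2 : ¬ (x.1 i ^^^ twoPow w b).toNat < 2 ^ b := by omega
      have h3 : (x.1 i).toNat < 2 ^ b * 2 ↔ (x.1 i).toNat < 2 ^ b := by
        refine ⟨fun h => ?_, fun h => by omega⟩; by_contra h4
        have : (x.1 i).toNat.testBit b = true := by
          rw [Nat.testBit_eq_decide_div_mod_eq]; have : (x.1 i).toNat / 2 ^ b = 1 := by
            apply Nat.div_eq_of_lt_le <;> omega
          rw [this]; rfl
        rw [BitVec.getLsbD] at hx; rw [hx] at this; exact absurd this (by simp)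
      simp only [h2, if_false, h3, Bool.false_eq_true]; split_ifs
      · rw [add_zero, div_eq_mul_inv]; ring
      · simp
    · have h1 := toNat_xor_twoPow' hbw hx; have h2 : ¬ (x.1 i).toNat < 2 ^ b := by omega
      have h3 : (x.1 i ^^^ twoPow w b).toNat < 2 ^ b ↔ (x.1 i).toNat < 2 ^ b * 2 := by omega
      simp only [h2, if_false, h3, if_true]; split_ifs
      · rw [sub_zero, div_eq_mul_inv]; ring
      · simp

lemma hadN_at_zero (hb : b ≤ w) (ψ : QS w) (x : QB w)
    (hx : (x.1 i).toNat % 2 ^ b = 0) :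
    hadN i b ψ x = ((Real.sqrt 2 : ℂ)⁻¹) ^ b *
      ∑ m ∈ range (2 ^ b), ψ (setR x i (x.1 i + m##w)) := by
  induction b generalizing x with
  | zero =>
    show ψ x = _; simp [setR_eq_self]
  | succ b ih =>
    have hbw : b < w := by omega
    have hm : (x.1 i).toNat % 2 ^ b = 0 := by
      rw [pow_succ] at hx; exact Nat.mod_eq_zero_of_dvd
        ((Dvd.intro _ rfl).trans (Nat.dvd_of_mod_eq_zero hx))
    have hbit : (x.1 i).getLsbD b = false := by
      rw [BitVec.getLsbD]; obtain ⟨c, hc⟩ := Nat.dvd_of_mod_eq_zero hx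
      rw [hc, Nat.testBit_two_pow_mul]; simp
    have h1 := toNat_xor_twoPow hbw hbit; have h2 : x.1 i ^^^ twoPow w b = x.1 i + (2 ^ b)##w := by
      apply BitVec.eq_of_toNat_eq; have := (x.1 i ^^^ twoPow w b).isLt; rw [h1] at this ⊢
      rw [BitVec.toNat_add, toNat_ofNat, mod_eq_of_lt (a := 2 ^ b) o!, mod_eq_of_lt this]
    rw [hadN_succ]; simp only [hadamardGate, hbw, if_true, hbit, Bool.false_eq_true, if_false]
    rw [ih o! x hm, ih o! (flipBit i b x) (by
      rw [flipBit_eq, setR_self, h1]; simp [hm]), pow_succ 2 b, mul_two, Finset.sum_range_add]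
    simp only [flipBit_eq, setR_self, setR_setR, h2, ofNat_add, ← BitVec.add_assoc]
    rw [pow_succ, div_eq_mul_inv]; ring

lemma inv_sqrt_two_pow (b : ℕ) :
    ((Real.sqrt 2 : ℂ)⁻¹) ^ b * ((Real.sqrt 2 : ℂ)⁻¹) ^ b = ((2 : ℂ) ^ b)⁻¹ := by
  rw [← mul_pow, ← mul_inv, sqrt_two_mul_self, inv_pow]

/-- The average over the `b` lowest bits of register `i`, for states in which the higher bits
are `0`. -/
def avg (i : Reg) (b : ℕ) (ψ : QS w) : QS w := fun x =>
  if (x.1 i).toNat < 2 ^ b then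
    ((2 : ℂ) ^ b)⁻¹ * ∑ m ∈ range (2 ^ b), ψ (setR x i m##w) else 0

/-- The part of `ψ` where `κ` holds. -/
def part (κ : QB w → Prop) (ψ : QS w) : QS w := fun x =>
  open Classical in if κ x then ψ x else 0

lemma part_add_part (κ : QB w → Prop) (ψ : QS w) :
    part κ ψ + part (fun x => ¬κ x) ψ = ψ := by
  funext x; simp only [part, Pi.add_apply]; by_cases h : κ x <;> simp [h]

lemma nrm_part_le (κ : QB w → Prop) (ψ : QS w) : nrm (part κ ψ) ≤ nrm ψ := by
  rw [← sq_le_sq₀ (nrm_nonneg _) (nrm_nonneg _), nrm_sq, nrm_sq]; refine sum_le_sum fun x _ => ?_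
  unfold part; split_ifs
  · exact le_rfl
  · simp

lemma hadN_part_zero (hb : b ≤ w) (ψ : QS w) :
    hadN i b (part (fun x => x.1 i = 0) (hadN i b ψ)) = avg i b ψ := by
  funext x; rw [hadN_of_zero hb (fun x hx => by simp only [part, hx, if_false]), avg]
  refine if_congr Iff.rfl ?_ rfl; simp only [part, setR_self, if_true]
  rw [hadN_at_zero hb _ _ (by simp), ← mul_assoc, inv_sqrt_two_pow]; simp

lemma hadN_part {κ : QB w → Prop} (hκ : Indep κ i)
    (ψ : QS w) : hadN i b (part κ ψ) = part κ (hadN i b ψ) := by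
  induction b with
  | zero => rfl
  | succ b ih =>
    rw [hadN_succ, hadN_succ, ih]; funext x
    have : κ (flipBit i b x) = κ x := by rw [flipBit_eq]; exact hκ x _
    by_cases h : κ x
    · simp only [hadamardGate, part, this.mpr h, h, if_true]
    · have h' : ¬κ (flipBit i b x) := this ▸ h; simp only [hadamardGate, part, h', h, if_false]
      simp

/-- The controlled reflection about the average. -/
lemma diffusion (hb : b ≤ w) {κ : QB w → Prop}
    (hκ : Indep κ i) (ψ : QS w) (x : QB w) [Decidable (κ x)] :
    hadN i b (phaseL (fun x => κ x ∧ x.1 i ≠ 0) (hadN i b ψ)) x =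
      if κ x then 2 * avg i b ψ x - ψ x else ψ x := by
  have h1 : phaseL (fun x => κ x ∧ x.1 i ≠ 0) (hadN i b ψ) = hadN i b ψ +
      part κ ((2 : ℂ) • (part (fun x => x.1 i = 0) (hadN i b ψ)) - (2 : ℂ) • hadN i b ψ) := by
    funext y; simp only [phaseL_apply, part, Pi.add_apply, Pi.sub_apply, Pi.smul_apply, smul_eq_mul]
    by_cases h : κ y <;> by_cases h' : y.1 i = 0#w <;> simp [h, h']
    all_goals ring
  rw [h1, map_add, hadN_part hκ, map_sub, map_smul, map_smul, hadN_part_zero hb, hadN_hadN]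
  simp only [part, Pi.add_apply, Pi.sub_apply, Pi.smul_apply, smul_eq_mul]
  by_cases h : κ x <;> simp [h]
  ring

/-! ## The Grover iteration -/

lemma two_value_identity (g h : ℝ) (hN : g + h ≠ 0) (α β μ : ℂ)
    (hμ : μ * ((g + h : ℝ) : ℂ) = -(g : ℂ) * α + (h : ℂ) * β) :
    (g * ‖(2 * μ + α) - α‖ ^ 2 + h * ‖(2 * μ - β) - β‖ ^ 2) * (g + h) =
      4 * g * (g * ‖α‖ ^ 2 + h * ‖β‖ ^ 2) := by
  obtain rfl : μ = (-(g : ℂ) * α + (h : ℂ) * β) / ((g + h : ℝ) : ℂ) := by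
    rw [eq_div_iff (by exact_mod_cast hN), hμ]
  have e1 : (2 * ((-(g : ℂ) * α + (h : ℂ) * β) / ((g + h : ℝ) : ℂ)) + α) - α =
      ((2 / (g + h) : ℝ) : ℂ) * (-(g : ℂ) * α + (h : ℂ) * β) := by
    push_cast; ring
  have hN' : (g : ℂ) + h ≠ 0 := by exact_mod_cast hN
  have e2 : (2 * ((-(g : ℂ) * α + (h : ℂ) * β) / ((g + h : ℝ) : ℂ)) - β) - β =
      ((2 / (g + h) : ℝ) : ℂ) * (-(g : ℂ) * α - (g : ℂ) * β) := by
    push_cast; field_simp; ring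
  rw [e1, e2]
  simp only [← Complex.normSq_eq_norm_sq, Complex.normSq_apply, Complex.mul_re, Complex.mul_im,
    Complex.add_re, Complex.add_im, Complex.sub_re, Complex.sub_im, Complex.neg_re,
    Complex.neg_im, Complex.ofReal_re, Complex.ofReal_im]
  field_simp; ring

lemma sum_two_value {N : ℕ} (p : ℕ → Prop) [DecidablePred p] {E : Type*} [AddCommMonoid E]
    (a b : E) : ∑ m ∈ range N, (if p m then a else b) = ((range N).filter p).card • a +
        ((range N).filter fun m => ¬p m).card • b := by
  rw [Finset.sum_ite, Finset.sum_const, Finset.sum_const]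

lemma fiber_identity {N : ℕ} (hN : 0 < N) (p : ℕ → Prop) [DecidablePred p] (α β : ℂ)
    (v : ℕ → ℂ) (hv : ∀ m < N, v m = if p m then α else β) (μ : ℂ)
    (hμ : μ = (N : ℂ)⁻¹ * ∑ m ∈ range N, if p m then -v m else v m) :
    (∑ m ∈ range N, ‖(2 * μ - if p m then -v m else v m) - v m‖ ^ 2) * N =
      4 * ((range N).filter p).card * ∑ m ∈ range N, ‖v m‖ ^ 2 := by
  have h1 : ∑ m ∈ range N, ‖(2 * μ - if p m then -v m else v m) - v m‖ ^ 2 =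
      ∑ m ∈ range N, if p m then ‖(2 * μ + α) - α‖ ^ 2 else ‖(2 * μ - β) - β‖ ^ 2 := by
    refine Finset.sum_congr rfl fun m hm => ?_
    rw [hv m (mem_range.1 hm)]; split_ifs <;> simp
  have h2 : ∑ m ∈ range N, ‖v m‖ ^ 2 =
      ∑ m ∈ range N, if p m then ‖α‖ ^ 2 else ‖β‖ ^ 2 := by
    refine Finset.sum_congr rfl fun m hm => ?_
    rw [hv m (mem_range.1 hm)]; split_ifs <;> simp
  have h3 : ∑ m ∈ range N, (if p m then -v m else v m) =
      ∑ m ∈ range N, if p m then -α else β := by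
    refine Finset.sum_congr rfl fun m hm => ?_
    rw [hv m (mem_range.1 hm)]; split_ifs <;> simp
  rw [h3, sum_two_value] at hμ; rw [h1, h2, sum_two_value, sum_two_value]
  have hc := Finset.card_filter_add_card_filter_not (s := range N) p; rw [card_range] at hc
  have hc' : (N : ℝ) = (((range N).filter p).card : ℝ) +
      (((range N).filter fun m => ¬p m).card : ℝ) := by exact_mod_cast hc.symm
  have hN0 : (N : ℝ) ≠ 0 := by exact_mod_cast hN.ne'
  rw [hc'] at hN0
  have := two_value_identity _ _ hN0 α β μ (by
    rw [← hc', hμ, mul_comm, ← mul_assoc, Complex.ofReal_natCast,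
      mul_inv_cancel₀ (by exact_mod_cast hN.ne'), one_mul]
    simp [nsmul_eq_mul])
  rw [← hc'] at this; simpa [nsmul_eq_mul] using this

/-- Grover's iteration on the `b` lowest bits of register `i`. -/
def grover (i : Reg) (b : ℕ) (f : QB w → Prop) : QOp w :=
  hadN i b * phaseL (fun x => x.1 i ≠ 0) * hadN i b * phaseL f

lemma iso_grover (i : Reg) (b : ℕ) (f : QB w → Prop) : Iso (grover i b f) :=
  (((iso_hadN i b).mul (iso_phaseL _)).mul (iso_hadN i b)).mul (iso_phaseL _)

lemma grover_apply (hb : b ≤ w) (f : QB w → Prop)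
    (ψ : QS w) (x : QB w) :
    grover i b f ψ x = 2 * avg i b (phaseL f ψ) x - phaseL f ψ x := by
  have := diffusion hb (κ := fun _ => True) (i := i) (fun _ _ => rfl) (phaseL f ψ) x
  simp only [true_and, if_true] at this; exact this

/-- States that are constant on the solutions and on the non-solutions in each fibre of register
`i`, and that live on the fibres with a solution. -/
def balanced (i : Reg) (b : ℕ) (f : QB w → Prop) : Submodule ℂ (QS w) where
  carrier := {ψ | (∀ x y : QB w, (x.1 i).toNat < 2 ^ b → (y.1 i).toNat < 2 ^ b →
      setR x i 0 = setR y i 0 → (f x ↔ f y) → ψ x = ψ y) ∧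
    (∀ x : QB w, ¬((x.1 i).toNat < 2 ^ b ∧ ∃ m < 2 ^ b, f (setR x i m##w)) → ψ x = 0)}
  add_mem' := by
    rintro ψ χ ⟨h1, h2⟩ ⟨h3, h4⟩
    exact ⟨fun x y hx hy h hf => by simp [h1 x y hx hy h hf, h3 x y hx hy h hf],
      fun x hx => by simp [h2 x hx, h4 x hx]⟩
  zero_mem' := ⟨fun _ _ _ _ _ _ => rfl, fun _ _ => rfl⟩
  smul_mem' := by
    rintro c ψ ⟨h1, h2⟩
    exact ⟨fun x y hx hy h hf => by simp [h1 x y hx hy h hf], fun x hx => by simp [h2 x hx]⟩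

lemma setR_of_fiber {y : QB w} (h : setR x i 0 = setR y i 0)
    (v : BitVec w) : setR x i v = setR y i v := by
  rw [← setR_setR x i 0, h, setR_setR]

lemma avg_fiber {y : QB w} (hx : (x.1 i).toNat < 2 ^ b)
    (hy : (y.1 i).toNat < 2 ^ b) (h : setR x i 0 = setR y i 0) (ψ : QS w) :
    avg i b ψ x = avg i b ψ y := by
  simp only [avg, hx, hy, if_true, setR_of_fiber h]

lemma grover_balanced (hb : b ≤ w) {f : QB w → Prop} (h : ψ ∈ balanced i b f) : grover i b f ψ ∈ balanced i b f := by
  obtain ⟨h1, h2⟩ := h; refine ⟨fun x y hx hy hxy hf => ?_, fun x hx => ?_⟩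
  · rw [grover_apply hb, grover_apply hb, avg_fiber hx hy hxy]
    simp only [phaseL_apply, h1 x y hx hy hxy hf]; by_cases h : f x
    · simp [h, hf.1 h]
    · have h' : ¬f y := fun h' => h (hf.2 h')
      simp [h, h']
  · rw [grover_apply hb]; have e : avg i b (phaseL f ψ) x = 0 := by
      unfold avg; split_ifs with hlt
      · rw [Finset.sum_eq_zero, mul_zero]; intro m hm; rw [phaseL_apply, h2, neg_zero, ite_self]
        rintro ⟨-, m', hm', hf⟩; rw [setR_setR] at hf; exact hx ⟨hlt, m', hm', hf⟩
      · rfl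
    rw [e, phaseL_apply, h2 x hx]; simp

lemma sum_fibers (i : Reg) (hb : b ≤ w) (F : QB w → ℝ)
    (hF : ∀ x : QB w, ¬(x.1 i).toNat < 2 ^ b → F x = 0) :
    ∑ x, F x = ∑ c ∈ Finset.univ.filter (fun c : QB w => c.1 i = 0),
      ∑ m ∈ range (2 ^ b), F (setR c i m##w) := by
  classical
  have h2w : 2 ^ b ≤ 2 ^ w := two_pow_le hb; rw [← Finset.sum_product']
  symm
  rw [← Finset.sum_filter_of_ne (s := Finset.univ) (p := fun x : QB w =>
    (x.1 i).toNat < 2 ^ b) (fun x _ hx => by by_contra h; exact hx (hF x h))]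
  refine Finset.sum_bij (fun p _ => setR p.1 i (ofNat w p.2)) ?_ ?_ ?_ ?_
  · rintro ⟨c, m⟩ h
    simp only [Finset.mem_product, mem_filter, mem_univ, true_and, mem_range] at h ⊢
    rw [setR_self, toNat_ofNat, mod_eq_of_lt o!]; exact h.2
  · rintro ⟨c, m⟩ h ⟨c', m'⟩ h' e
    simp only [Finset.mem_product, mem_filter, mem_univ, true_and, mem_range] at h h' e
    have e1 := congrArg (fun x : QB w => (x.1 i).toNat) e
    simp only [setR_self, toNat_ofNat, mod_eq_of_lt (show m < 2 ^ w by omega),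
      mod_eq_of_lt (show m' < 2 ^ w by omega)] at e1
    have e2 := congrArg (fun x : QB w => setR x i 0) e
    simp only [setR_setR, setR_eq_self h.1, setR_eq_self h'.1] at e2; rw [e1, e2]
  · intro x hx; simp only [mem_filter, mem_univ, true_and] at hx
    refine ⟨(setR x i 0, (x.1 i).toNat), ?_, ?_⟩
    · simp [hx]
    · simp [setR_eq_self]
  · intros; rfl

lemma grover_gap (hb : b ≤ w) {f : QB w → Prop} (h : ψ ∈ balanced i b f) :
    4 * nrm ψ ^ 2 ≤ 2 ^ b * nrm (grover i b f ψ - ψ) ^ 2 := by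
  classical
  have hg := grover_balanced hb h; have hgs := (balanced i b f).sub_mem hg h; obtain ⟨h1, h2⟩ := h
  rw [nrm_sq, nrm_sq, sum_fibers i hb _ (fun x hx => by rw [h2 x fun h => hx h.1]; simp),
    sum_fibers i hb _ (fun x hx => by rw [hgs.2 x fun h => hx h.1]; simp), Finset.mul_sum,
    Finset.mul_sum]
  refine sum_le_sum fun c hc => ?_
  have h2w : 2 ^ b ≤ 2 ^ w := two_pow_le hb
  have hlt : ∀ m < 2 ^ b, ((setR c i m##w).1 i).toNat < 2 ^ b := fun m hm => by
    rw [setR_self, toNat_ofNat, mod_eq_of_lt o!]; exact hm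
  by_cases hm : ∃ m < 2 ^ b, f (setR c i m##w)
  swap
  · rw [Finset.sum_eq_zero fun m _ => by
      rw [h2 _ (fun h => hm (by simpa using h.2))]; simp]
    rw [mul_zero]; positivity
  obtain ⟨m1, hm1, hf1⟩ := hm; set p : ℕ → Prop := fun m => f (setR c i m##w) with hp
  set v : ℕ → ℂ := fun m => ψ (setR c i m##w) with hv
  obtain ⟨β, hβ⟩ : ∃ β, ∀ m < 2 ^ b, ¬p m → v m = β := by
    by_cases h3 : ∃ m < 2 ^ b, ¬p m
    · obtain ⟨m2, hm2, hf2⟩ := h3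
      exact ⟨v m2, fun m hm hf => h1 _ _ (hlt m hm) (hlt m2 hm2) (by simp) (iff_of_false hf hf2)⟩
    · push Not at h3
      exact ⟨0, fun m hm hf => absurd (h3 m hm) hf⟩
  have hv' : ∀ m < 2 ^ b, v m = if p m then v m1 else β := by
    intro m hm; split_ifs with hf
    · exact h1 _ _ (hlt m hm) (hlt m1 hm1) (by simp) (iff_of_true hf hf1)
    · exact hβ m hm hf
  have key := fiber_identity (N := 2 ^ b) (by positivity) p (v m1) β v hv'
    (avg i b (phaseL f ψ) (setR c i m1##w)) (by
      rw [avg, if_pos (hlt m1 hm1)]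
      simp only [setR_setR, Nat.cast_pow, Nat.cast_ofNat, phaseL_apply, hp, hv])
  have e : ∀ m ∈ range (2 ^ b), ‖(grover i b f ψ - ψ) (setR c i m##w)‖ ^ 2 =
      ‖(2 * avg i b (phaseL f ψ) (setR c i m1##w) -
        if p m then -v m else v m) - v m‖ ^ 2 := by
    intro m hm; rw [mem_range] at hm
    rw [Pi.sub_apply, grover_apply hb, avg_fiber (hlt m hm) (hlt m1 hm1) (by simp), phaseL_apply]
  rw [Finset.sum_congr rfl e]
  have hcard : 1 ≤ ((range (2 ^ b)).filter p).card := Finset.card_pos.2 ⟨m1, by simp [hm1, hp, hf1]⟩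
  have hcard' : (1 : ℝ) ≤ (((range (2 ^ b)).filter p).card : ℝ) := by exact_mod_cast hcard
  have hnn : 0 ≤ ∑ m ∈ range (2 ^ b), ‖v m‖ ^ 2 :=
    Finset.sum_nonneg fun _ _ => by positivity
  push_cast at key; rw [mul_comm] at key; rw [key]; nlinarith

/-- The average of the first `M` powers of Grover's iteration. -/
def groverAvg (i : Reg) (b : ℕ) (f : QB w → Prop) (M : ℕ) (ψ : QS w) :
    QS w := (M : ℂ)⁻¹ • ∑ j ∈ range M, (grover i b f ^ j) ψ

lemma grover_pow_balanced (hb : b ≤ w) {f : QB w → Prop} (h : ψ ∈ balanced i b f) (j : ℕ) :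
    (grover i b f ^ j) ψ ∈ balanced i b f := by
  induction j with
  | zero => exact h
  | succ j ih => rw [pow_succ']; exact grover_balanced hb ih

lemma groverAvg_balanced (hb : b ≤ w) {f : QB w → Prop} (h : ψ ∈ balanced i b f) (M : ℕ) :
    groverAvg i b f M ψ ∈ balanced i b f :=
  Submodule.smul_mem _ _ (Submodule.sum_mem _ fun j _ => grover_pow_balanced hb h j)

lemma nrm_groverAvg_le (hb : b ≤ w) {f : QB w → Prop} (h : ψ ∈ balanced i b f) {M : ℕ} (hM : 4 * 2 ^ b ≤ M ^ 2) :
    nrm (groverAvg i b f M ψ) ≤ 1 / 2 * nrm ψ := by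
  set U := grover i b f; set χ : QS w := ∑ j ∈ range M, (U ^ j) ψ with hχ
  have hχb : χ ∈ balanced i b f := Submodule.sum_mem _ fun j _ => grover_pow_balanced hb h j
  have hM0 : 0 < M := by
    rcases Nat.eq_zero_or_pos M with rfl | h
    · simp at hM
    · exact h
  have e1 : U χ - χ = (U ^ M) ψ - ψ := by
    rw [hχ, map_sum]; have : ∀ j, U ((U ^ j) ψ) = (U ^ (j + 1)) ψ := fun j => by rw [pow_succ']; rfl
    simp only [this]; rw [← Finset.sum_sub_distrib, Finset.sum_range_sub (fun j => (U ^ j) ψ)]; rfl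
  have iM : ∀ j, nrm ((U ^ j) ψ) = nrm ψ := fun j => by
    induction j with
    | zero => rfl
    | succ j ih => rw [pow_succ', ← ih]; exact iso_grover i b f _
  have e2 : nrm (U χ - χ) ≤ 2 * nrm ψ := by
    rw [e1]; refine (nrm_sub_le _ _).trans ?_; rw [iM]; linarith
  have e3 := grover_gap hb hχb
  have e4 : nrm (U χ - χ) ^ 2 ≤ (2 * nrm ψ) ^ 2 := pow_le_pow_left₀ (nrm_nonneg _) e2 2
  have hM' : (4 : ℝ) * 2 ^ b ≤ (M : ℝ) ^ 2 := by exact_mod_cast hM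
  have e5 : nrm χ ^ 2 ≤ ((M : ℝ) * (1 / 2 * nrm ψ)) ^ 2 := by
    have : (2 : ℝ) ^ b * nrm (U χ - χ) ^ 2 ≤ 2 ^ b * (2 * nrm ψ) ^ 2 :=
      mul_le_mul_of_nonneg_left e4 (by positivity)
    have h6 : (4 : ℝ) * 2 ^ b * nrm ψ ^ 2 ≤ (M : ℝ) ^ 2 * nrm ψ ^ 2 :=
      mul_le_mul_of_nonneg_right hM' (by positivity)
    nlinarith
  have e6 : nrm χ ≤ (M : ℝ) * (1 / 2 * nrm ψ) :=
    (sq_le_sq₀ (nrm_nonneg _) (by have := nrm_nonneg ψ; positivity)).1 e5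
  rw [groverAvg, nrm_smul, norm_inv, Complex.norm_natCast]
  rw [inv_mul_le_iff₀ (by exact_mod_cast hM0)]; exact e6

lemma grover_fixed (hb : b ≤ w) {f : QB w → Prop} (h1 : ∀ x : QB w, f x → ψ x = 0)
    (h2 : ∀ x : QB w, (x.1 i).toNat < 2 ^ b → ∀ m < 2 ^ b, ψ (setR x i m##w) = ψ x)
    (h3 : ∀ x : QB w, ¬(x.1 i).toNat < 2 ^ b → ψ x = 0) : grover i b f ψ = ψ := by
  have e : phaseL f ψ = ψ := by
    funext x; rw [phaseL_apply]; split_ifs with h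
    · rw [h1 x h, neg_zero]
    · rfl
  funext x; rw [grover_apply hb, e]; by_cases hx : (x.1 i).toNat < 2 ^ b
  · rw [avg, if_pos hx, Finset.sum_congr rfl fun m hm => h2 x hx m (mem_range.1 hm)]; simp; ring
  · rw [avg, if_neg hx, h3 x hx]; simp

/-! # Search -/

lemma xor_twoPow_lt {i : ℕ} (hv : v.toNat < 2 ^ b) (hi : i < b) :
    (v ^^^ twoPow w i).toNat < 2 ^ b := by
  rw [toNat_xor]; refine xor_lt_two_pow hv ?_; rw [BitVec.toNat_twoPow]
  exact lt_of_le_of_lt (Nat.mod_le _ _) (two_pow_lt hi)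

lemma maps_hadN
    (h : ∀ x ∈ S, ∀ j < b, setR x i (x.1 i ^^^ twoPow w j) ∈ S) : Maps (hadN i b) S S :=
  Maps.ordProd fun j hj => maps_hadL fun x hx => h x hx j hj

lemma hadL_commute_permL (b : ℕ) {e : Equiv.Perm (QB w)}
    (he : ∀ x v, e (setR x i v) = setR (e x) i v) : Commute (hadL i b) (permL e) := by
  have hei : ∀ x, (e x).1 i = x.1 i := fun x => by
    have := he x (x.1 i); rw [setR_eq_self rfl] at this; rw [this, setR_self]
  have hs : ∀ x, flipBit i b (e.symm x) = e.symm (flipBit i b x) := fun x => by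
    rw [Equiv.eq_symm_apply, flipBit_eq, he, Equiv.apply_symm_apply, flipBit_eq,
      ← hei, Equiv.apply_symm_apply]
  show hadL i b * permL e = permL e * hadL i b; ext ψ x
  show hadamardGate i b (permL e ψ) x = hadamardGate i b ψ (e.symm x)
  have h2 : (e.symm x).1 i = x.1 i := by rw [← hei, Equiv.apply_symm_apply]
  simp only [hadamardGate, permL_apply, hs, h2]

lemma phaseL_commute_permL {φ : QB w → Prop} {e : Equiv.Perm (QB w)}
    (h : ∀ x, φ (e x) ↔ φ x) : Commute (phaseL φ) (permL e) := by
  have := permL_phaseL e φ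
  rw [show (fun x => φ (e x)) = φ from funext fun x => propext (h x)] at this; exact this

/-- The assumptions on the registers `Z` (candidates), `C` (iteration counts), `F` (success flags),
`o` (answer of the oracle), `out` (result), the addresses `stk` for used counts, the condition `f`
that is searched for, and the set `S` of admissible basis states. -/
structure SearchSpec (Z C F o out : Reg) (nb nm nT : ℕ) (stk : ℕ → BitVec w)
    (f : QB w → Prop) (S : Set (QB w)) : Prop where
  nodup : [Z, C, F, o, out].Nodup
  hb : nb ≤ w
  hm : nm ≤ w
  hbm : 4 * 2 ^ nb ≤ (2 ^ nm) ^ 2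
  fC : Indep f C
  fo : Indep f o
  fout : Indep f out
  sZ : ∀ x ∈ S, ∀ v : BitVec w, v.toNat < 2 ^ nb → setR x Z v ∈ S
  sC : ∀ x ∈ S, ∀ v, setR x C v ∈ S
  sF : ∀ x ∈ S, ∀ v, setR x F v ∈ S
  so : ∀ x ∈ S, ∀ v, setR x o v ∈ S
  sout : ∀ x ∈ S, ∀ v, setR x out v ∈ S
  sM : ∀ x ∈ S, ∀ r < nT, ∀ v, setM x (stk r) v ∈ S

namespace SearchSpec

variable {Z C F : Reg} {nb nm nT : ℕ} {stk : ℕ → BitVec w} {f : QB w → Prop}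

/-- The basis states that occur during the search. -/
def E0 (Z o : Reg) (nb : ℕ) (S : Set (QB w)) : Set (QB w) :=
  {x | x ∈ S ∧ (x.1 Z).toNat < 2 ^ nb ∧ x.1 o = 0}

/-- The basis states without success. -/
def E1 (Z C F o : Reg) (nb nT : ℕ) (stk : ℕ → BitVec w) (S : Set (QB w)) : Set (QB w) :=
  {x | x ∈ E0 Z o nb S ∧ x.1 C = 0 ∧ x.1 F = 0 ∧ ∀ r < nT, x.2 (stk r) = 0}

/-- The initial basis states. -/
def clean (Z C F o : Reg) (nT : ℕ) (stk : ℕ → BitVec w) (S : Set (QB w)) : Set (QB w) :=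
  {x | x ∈ S ∧ x.1 Z = 0 ∧ x.1 o = 0 ∧ x.1 C = 0 ∧ x.1 F = 0 ∧ ∀ r < nT, x.2 (stk r) = 0}

/-- The basis states with an earlier success. -/
def junk (Z F o : Reg) (nb : ℕ) (S : Set (QB w)) (r : ℕ) : Set (QB w) :=
  {x | x ∈ E0 Z o nb S ∧ ∃ r' < r, (x.1 F).getLsbD r' = true}

/-- The assumptions on the step that records whether `C` is nonzero. -/
structure Record (Z C F o out : Reg) (nb nT : ℕ) (stk : ℕ → BitVec w)
    (S : Set (QB w)) (fs : ℕ → Equiv.Perm (QB w)) : Prop where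
  maps : ∀ r < nT, ∀ x ∈ E0 Z o nb S, fs r x ∈ E0 Z o nb S
  fix : ∀ r < nT, ∀ x ∈ E0 Z o nb S, x.1 C = 0 → x.2 (stk r) = 0 → fs r x = x
  success : ∀ r < nT, ∀ x ∈ E0 Z o nb S, x.1 C ≠ 0 → x.1 F = 0 → ((fs r x).1 F).getLsbD r = true
  keep : ∀ r < nT, ∀ x ∈ E0 Z o nb S, ∀ r' < r, ((fs r x).1 F).getLsbD r' = (x.1 F).getLsbD r'
  commute : ∀ r x v, fs r (setR x out v) = setR (fs r x) out v

/-- Iteration number `j`, controlled by `j < C`. -/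
def iter (Z C : Reg) (nb : ℕ) (f : QB w → Prop) (j : ℕ) : QOp w :=
  hadN Z nb * phaseL (fun x => j < (x.1 C).toNat ∧ x.1 Z ≠ 0) * hadN Z nb *
    phaseL (fun x => f x ∧ j < (x.1 C).toNat)

/-- One run of the search. -/
def round (Z C : Reg) (nb nm : ℕ) (f : QB w → Prop)
    (fs : ℕ → Equiv.Perm (QB w)) (r : ℕ) : QOp w :=
  permL (fs r) * (hadN C nm * (ordProd (iter Z C nb f) (2 ^ nm) * hadN C nm))

lemma iso_iter (j : ℕ) : Iso (iter Z C nb f j) :=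
  (((iso_hadN _ _).mul (iso_phaseL _)).mul (iso_hadN _ _)).mul (iso_phaseL _)

lemma iso_round (fs : ℕ → Equiv.Perm (QB w)) (r : ℕ) : Iso (round Z C nb nm f fs r) :=
  (iso_permL _).mul ((iso_hadN _ _).mul ((Iso.ordProd (fun _ => iso_iter _) _).mul
    (iso_hadN _ _)))

variable (h : SearchSpec Z C F o out nb nm nT stk f S)
include h

lemma ne : Z ≠ C ∧ Z ≠ F ∧ Z ≠ o ∧ Z ≠ out ∧ C ≠ F ∧ C ≠ o ∧ C ≠ out ∧ F ≠ o ∧ F ≠ out ∧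
    o ≠ out := by
  have := h.nodup; simp only [nodup_cons, mem_cons, not_or, not_mem_nil] at this
  tauto

lemma e0_Z {x} (hx : x ∈ E0 Z o nb S) (hv : v.toNat < 2 ^ nb) : setR x Z v ∈ E0 Z o nb S :=
  ⟨h.sZ x hx.1 v hv, by simpa using hv, by rw [setR_ne h.ne.2.2.1.symm]; exact hx.2.2⟩

lemma e0_C {x} (hx : x ∈ E0 Z o nb S) (v : BitVec w) : setR x C v ∈ E0 Z o nb S :=
  ⟨h.sC x hx.1 v, by rw [setR_ne h.ne.1]; exact hx.2.1, by
    rw [setR_ne h.ne.2.2.2.2.2.1.symm]; exact hx.2.2⟩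

lemma e1_Z {x} (hx : x ∈ E1 Z C F o nb nT stk S) (hv : v.toNat < 2 ^ nb) :
    setR x Z v ∈ E1 Z C F o nb nT stk S :=
  ⟨h.e0_Z hx.1 hv, by rw [setR_ne h.ne.1.symm]; exact hx.2.1, by
    rw [setR_ne h.ne.2.1.symm]; exact hx.2.2.1, hx.2.2.2⟩

lemma maps_iter {E : Set (QB w)}
    (hE : ∀ x ∈ E, (x.1 Z).toNat < 2 ^ nb ∧ ∀ v : BitVec w, v.toNat < 2 ^ nb → setR x Z v ∈ E)
    (j : ℕ) : Maps (iter Z C nb f j) E E := by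
  have h1 : Maps (hadN Z nb) E E := maps_hadN fun x hx j hj =>
    (hE x hx).2 _ (xor_twoPow_lt (hE x hx).1 hj)
  exact ((h1.mul (maps_phaseL _ _)).mul h1).mul (maps_phaseL _ _)

lemma maps_round {fs : ℕ → Equiv.Perm (QB w)} {E E' : Set (QB w)}
    (hE : ∀ x ∈ E, (x.1 Z).toNat < 2 ^ nb ∧ ∀ v : BitVec w, v.toNat < 2 ^ nb → setR x Z v ∈ E)
    (hC : ∀ x ∈ E, ∀ v, setR x C v ∈ E) {r : ℕ} (hfs : ∀ x ∈ E, fs r x ∈ E') :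
    Maps (round Z C nb nm f fs r) E E' := by
  have h1 : Maps (hadN C nm) E E := maps_hadN fun x hx j _ => hC x hx _
  exact (maps_permL hfs).mul (h1.mul ((Maps.ordProd fun j _ => h.maps_iter hE j).mul h1))

lemma iter_spread (j : ℕ) :
    iter Z C nb f j (fun x => if (x.1 C).toNat < 2 ^ nm then
      ((Real.sqrt 2 : ℂ)⁻¹) ^ nm * (grover Z nb f ^ (min (x.1 C).toNat j)) ψ (setR x C 0) else 0) =
    fun x => if (x.1 C).toNat < 2 ^ nm then
      ((Real.sqrt 2 : ℂ)⁻¹) ^ nm * (grover Z nb f ^ (min (x.1 C).toNat (j + 1))) ψ (setR x C 0)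
      else 0 := by
  classical
  set Φ : QS w := fun x => if (x.1 C).toNat < 2 ^ nm then
      ((Real.sqrt 2 : ℂ)⁻¹) ^ nm * (grover Z nb f ^ (min (x.1 C).toNat j)) ψ (setR x C 0) else 0
    with hΦ
  have hZC := h.ne.1; funext x
  have hd := diffusion h.hb (i := Z) (κ := fun x : QB w => j < (x.1 C).toNat)
    (fun y v => by simp only [setR_ne hZC.symm]) (phaseL (fun x => f x ∧ j < (x.1 C).toNat) Φ) x
  refine hd.trans ?_; by_cases hj : j < (x.1 C).toNat
  · rw [if_pos hj, show min (x.1 C).toNat (j + 1) = j + 1 by omega, pow_succ']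
    show _ = if _ then _ * grover Z nb f ((grover Z nb f ^ j) ψ) (setR x C 0) else 0
    rw [grover_apply h.hb]; set χ := (grover Z nb f ^ j) ψ
    have key : ∀ y : QB w, y.1 C = x.1 C →
        phaseL (fun x => f x ∧ j < (x.1 C).toNat) Φ y = if (x.1 C).toNat < 2 ^ nm then
          ((Real.sqrt 2 : ℂ)⁻¹) ^ nm * phaseL f χ (setR y C 0) else 0 := by
      intro y hy; have e : f (setR y C 0) ↔ f y := by rw [h.fC y 0]
      simp only [phaseL_apply, hΦ, hy, hj, and_true, min_eq_right hj.le, e]; split_ifs <;> simp [χ]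
    rw [key x rfl]; have e2 : avg Z nb (phaseL (fun x => f x ∧ j < (x.1 C).toNat) Φ) x =
        if (x.1 C).toNat < 2 ^ nm then
          ((Real.sqrt 2 : ℂ)⁻¹) ^ nm * avg Z nb (phaseL f χ) (setR x C 0) else 0 := by
      simp only [avg, setR_ne hZC]; simp only [key _ (setR_ne hZC.symm), setR_comm _ hZC]; split_ifs
      · rw [← Finset.mul_sum]; ring
      · simp
      · simp
      · simp
    rw [e2]; split_ifs
    · ring
    · ring
  · rw [if_neg hj, show min (x.1 C).toNat (j + 1) = min (x.1 C).toNat j by omega]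
    simp only [phaseL_apply, hj, and_false, if_false]; rfl

lemma iters_spread (hψ : ∀ x : QB w, x.1 C ≠ 0 → ψ x = 0) :
    ordProd (iter Z C nb f) (2 ^ nm) (hadN C nm ψ) = fun x => if (x.1 C).toNat < 2 ^ nm then
      ((Real.sqrt 2 : ℂ)⁻¹) ^ nm * (grover Z nb f ^ (x.1 C).toNat) ψ (setR x C 0) else 0 := by
  have key : ∀ j, ordProd (iter Z C nb f) j (hadN C nm ψ) =
      fun x => if (x.1 C).toNat < 2 ^ nm then ((Real.sqrt 2 : ℂ)⁻¹) ^ nm *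
        (grover Z nb f ^ (min (x.1 C).toNat j)) ψ (setR x C 0) else 0 := by
    intro j; induction j with
    | zero =>
      funext x; show hadN C nm ψ x = _; rw [hadN_of_zero h.hm hψ]; simp
    | succ j ih =>
      rw [← h.iter_spread, ← ih]; rfl
  rw [key]; funext x; split_ifs with hx
  · rw [min_eq_left hx.le]
  · rfl

lemma maps_grover : Maps (grover Z nb f) (E1 Z C F o nb nT stk S) (E1 Z C F o nb nT stk S) := by
  have h1 : Maps (hadN Z nb) (E1 Z C F o nb nT stk S) (E1 Z C F o nb nT stk S) :=
    maps_hadN fun x hx j hj => h.e1_Z hx (xor_twoPow_lt hx.1.2.1 hj)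
  exact ((h1.mul (maps_phaseL _ _)).mul h1).mul (maps_phaseL _ _)

lemma supp_groverAvg (hψ : Supp ψ (E1 Z C F o nb nT stk S)) (M : ℕ) :
    Supp (groverAvg Z nb f M ψ) (E1 Z C F o nb nT stk S) := by
  intro x hx
  have : ∀ j, (grover Z nb f ^ j) ψ x = 0 := by
    intro j; have : Supp ((grover Z nb f ^ j) ψ) (E1 Z C F o nb nT stk S) := by
      induction j with
      | zero => exact hψ
      | succ j ih => rw [pow_succ']; exact h.maps_grover _ ih
    exact this x hx
  simp [groverAvg, Finset.sum_apply, this]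

variable {fs : ℕ → Equiv.Perm (QB w)} (hfs : Record Z C F o out nb nT stk S fs)
include hfs

lemma round_apply (hψ : Supp ψ (E1 Z C F o nb nT stk S)) {r : ℕ}
    (hr : r < nT) : ∃ χ, Supp χ (junk Z F o nb S (r + 1)) ∧
      round Z C nb nm f fs r ψ = groverAvg Z nb f (2 ^ nm) ψ + χ := by
  have hψC : ∀ x : QB w, x.1 C ≠ 0 → ψ x = 0 := fun x hx => hψ x fun h' => hx h'.2.1
  set Φ := hadN C nm (ordProd (iter Z C nb f) (2 ^ nm) (hadN C nm ψ)) with hΦ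
  have hsupp : Supp Φ {x | x ∈ E0 Z o nb S ∧ x.1 F = 0} := by
    have hE : ∀ x ∈ {x : QB w | x ∈ E0 Z o nb S ∧ x.1 F = 0}, (x.1 Z).toNat < 2 ^ nb ∧
        ∀ v : BitVec w, v.toNat < 2 ^ nb → setR x Z v ∈ {x | x ∈ E0 Z o nb S ∧ x.1 F = 0} :=
      fun x hx => ⟨hx.1.2.1, fun v hv => ⟨h.e0_Z hx.1 hv, by
        rw [setR_ne h.ne.2.1.symm]; exact hx.2⟩⟩
    have hC : Maps (hadN C nm) {x | x ∈ E0 Z o nb S ∧ x.1 F = 0}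
        {x | x ∈ E0 Z o nb S ∧ x.1 F = 0} := maps_hadN fun x hx j _ =>
      ⟨h.e0_C hx.1 _, by rw [setR_ne h.ne.2.2.2.2.1.symm]; exact hx.2⟩
    exact hC _ (Maps.ordProd (fun j _ => h.maps_iter hE j) _ (hC _ (hψ.mono fun x hx =>
      ⟨hx.1, hx.2.2.1⟩)))
  have h0 : part (fun x => x.1 C = 0) Φ = groverAvg Z nb f (2 ^ nm) ψ := by
    funext x; unfold part; split_ifs with hx
    · rw [hΦ, h.iters_spread hψC, hadN_at_zero h.hm _ _ (by simp [hx])]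
      have e : ∀ c ∈ range (2 ^ nm), (if ((setR x C (x.1 C + c##w)).1 C).toNat <
          2 ^ nm then ((Real.sqrt 2 : ℂ)⁻¹) ^ nm * (grover Z nb f ^
            ((setR x C (x.1 C + c##w)).1 C).toNat) ψ
            (setR (setR x C (x.1 C + c##w)) C 0) else 0) =
          ((Real.sqrt 2 : ℂ)⁻¹) ^ nm * (grover Z nb f ^ c) ψ x := by
        intro c hc; rw [mem_range] at hc; have h2w : 2 ^ nm ≤ 2 ^ w := two_pow_le h.hm
        have e1 : ((setR x C (x.1 C + c##w)).1 C).toNat = c := by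
          rw [setR_self, hx]; simp [mod_eq_of_lt (lt_of_lt_of_le hc h2w)]
        rw [e1, if_pos hc, setR_setR, setR_eq_self hx]
      rw [Finset.sum_congr rfl e, ← Finset.mul_sum, ← mul_assoc, inv_sqrt_two_pow]
      simp [groverAvg, Finset.sum_apply]
    · exact (h.supp_groverAvg hψ _ x fun h' => hx h'.2.1).symm
  refine ⟨permL (fs r) (part (fun x => ¬x.1 C = 0) Φ), ?_, ?_⟩
  · refine maps_permL (S := {x | x ∈ E0 Z o nb S ∧ x.1 F = 0 ∧ x.1 C ≠ 0}) ?_ _ ?_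
    · rintro x ⟨hx, hF, hC⟩; exact ⟨hfs.maps r hr x hx, r, by omega, hfs.success r hr x hx hC hF⟩
    · intro x hx; unfold part; split_ifs with hC
      · exact hsupp x fun h' => hx ⟨h'.1, h'.2, hC⟩
      · rfl
  · have e : permL (fs r) (groverAvg Z nb f (2 ^ nm) ψ) = groverAvg Z nb f (2 ^ nm) ψ :=
      permL_congr (e' := 1) (S := E1 Z C F o nb nT stk S)
        (fun x hx => hfs.fix r hr x hx.1 hx.2.1 (hx.2.2.2 r hr)) (h.supp_groverAvg hψ _)
    show permL (fs r) Φ = _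
    conv_lhs => rw [← part_add_part (fun x => x.1 C = 0) Φ, map_add, h0, e]

lemma round_fixed (hψ : Supp ψ (E1 Z C F o nb nT stk S))
    (hg : grover Z nb f ψ = ψ) {r : ℕ} (hr : r < nT) : round Z C nb nm f fs r ψ = ψ := by
  have hψC : ∀ x : QB w, x.1 C ≠ 0 → ψ x = 0 := fun x hx => hψ x fun h' => hx h'.2.1
  have hp : ∀ j, (grover Z nb f ^ j) ψ = ψ := by
    intro j; induction j with
    | zero => rfl
    | succ j ih =>
      rw [pow_succ']; show grover Z nb f ((grover Z nb f ^ j) ψ) = ψ; rw [ih, hg]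
  have e : ordProd (iter Z C nb f) (2 ^ nm) (hadN C nm ψ) = hadN C nm ψ := by
    rw [h.iters_spread hψC]; funext x; rw [hadN_of_zero h.hm hψC]; simp only [hp]
  show permL (fs r) (hadN C nm (ordProd (iter Z C nb f) (2 ^ nm) (hadN C nm ψ))) = ψ
  rw [e, hadN_hadN]; exact permL_congr (e' := 1) (S := E1 Z C F o nb nT stk S)
        (fun x hx => hfs.fix r hr x hx.1 hx.2.1 (hx.2.2.2 r hr)) hψ

lemma maps_junk {r : ℕ} (hr : r < nT) :
    Maps (round Z C nb nm f fs r) (junk Z F o nb S r) (junk Z F o nb S (r + 1)) := by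
  refine h.maps_round ?_ ?_ ?_
  · rintro x ⟨hx, r', hr', hb⟩
    exact ⟨hx.2.1, fun v hv => ⟨h.e0_Z hx hv, r', hr', by rwa [setR_ne h.ne.2.1.symm]⟩⟩
  · rintro x ⟨hx, r', hr', hb⟩ v; exact ⟨h.e0_C hx v, r', hr', by rwa [setR_ne h.ne.2.2.2.2.1.symm]⟩
  · rintro x ⟨hx, r', hr', hb⟩
    exact ⟨hfs.maps r hr x hx, r', by omega, by rwa [hfs.keep r hr x hx r' hr']⟩

lemma rounds_apply (hψ : Supp ψ (E1 Z C F o nb nT stk S))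
    (hbal : ψ ∈ balanced Z nb f) {r : ℕ} (hr : r ≤ nT) :
    ∃ ξ χ, Supp ξ (E1 Z C F o nb nT stk S) ∧ ξ ∈ balanced Z nb f ∧
      nrm ξ ≤ (1 / 2) ^ r * nrm ψ ∧ Supp χ (junk Z F o nb S r) ∧
      ordProd (round Z C nb nm f fs) r ψ = ξ + χ := by
  induction r with
  | zero => exact ⟨ψ, 0, hψ, hbal, by simp, fun _ _ => rfl, by simp [ordProd]⟩
  | succ r ih =>
    obtain ⟨ξ, χ, h1, h2, h3, h4, h5⟩ := ih o!
    obtain ⟨χ', h6, h7⟩ := h.round_apply hfs h1 (r := r) o!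
    refine ⟨_, χ' + round Z C nb nm f fs r χ, h.supp_groverAvg h1 _,
      groverAvg_balanced h.hb h2 _, (nrm_groverAvg_le h.hb h2 h.hbm).trans ?_, ?_, ?_⟩
    · rw [pow_succ]; linarith
    · intro x hx; rw [Pi.add_apply, h6 x hx, h.maps_junk hfs o! _ h4 x hx, add_zero]
    · show round Z C nb nm f fs r (ordProd (round Z C nb nm f fs) r ψ) = _
      rw [h5, map_add, h7, add_assoc]

lemma commute_out : Commute (ordProd (round Z C nb nm f fs) nT * hadN Z nb)
    (permL (xorP out fun _ => 1#w)) := by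
  obtain ⟨-, -, -, hZ, -, -, hC, -, -, -⟩ := h.ne
  have hap : ∀ x : QB w, xorP out (fun _ => 1#w) x = xorR x out 1#w :=
    fun x => xorP_apply (fun _ _ => rfl) x
  have hset : ∀ i, i ≠ out → ∀ (x : QB w) v, xorP out (fun _ => 1#w) (setR x i v) =
      setR (xorP out (fun _ => 1#w) x) i v := by
    intro i hi x v; rw [hap, hap, xorR, xorR, setR_ne hi.symm, setR_comm _ hi]
  have cZ : ∀ b, Commute (hadN Z b) (permL (xorP out fun _ => 1#w)) := fun b =>
    commute_ordProd fun j _ => hadL_commute_permL j (hset Z hZ)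
  have cC : ∀ b, Commute (hadN C b) (permL (xorP out fun _ => 1#w)) := fun b =>
    commute_ordProd fun j _ => hadL_commute_permL j (hset C hC)
  refine Commute.mul_left (commute_ordProd fun r _ => ?_) (cZ nb)
  refine Commute.mul_left ?_ ((cC _).mul_left (Commute.mul_left (commute_ordProd fun j _ => ?_)
    (cC _)))
  · show permL _ * permL _ = permL _ * permL _; rw [← map_mul, ← map_mul]; congr 1
    ext1 x
    show fs r (xorP out (fun _ => 1#w) x) = xorP out (fun _ => 1#w) (fs r x)
    rw [hap, hap, xorR, hfs.commute]; have : (fs r x).1 out = x.1 out := by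
      have := hfs.commute r x (x.1 out); rw [setR_eq_self rfl] at this; rw [this, setR_self]
    rw [xorR, this]
  · refine Commute.mul_left (Commute.mul_left (Commute.mul_left (cZ _)
      (phaseL_commute_permL fun x => ?_)) (cZ _)) (phaseL_commute_permL fun x => ?_)
    · rw [hap, xorR, setR_ne hC, setR_ne hZ]
    · rw [hap, xorR, setR_ne hC, h.fout]

lemma search_error (hψ : Supp ψ (clean Z C F o nT stk S)) :
    nrm (permL (xorP out fun x => bw w (x.1 F ≠ 0))
        ((ordProd (round Z C nb nm f fs) nT * hadN Z nb : QOp w) ψ) -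
      (ordProd (round Z C nb nm f fs) nT * hadN Z nb : QOp w)
        (permL (xorP out fun x => bw w (∃ m < 2 ^ nb, f (setR x Z m##w))) ψ)) ≤
      2 * (1 / 2) ^ nT * nrm ψ := by
  obtain ⟨hZC, hZF, hZo, hZout, hCF, hCo, hCout, hFo, hFout, hoout⟩ := h.ne
  set V := ordProd (round Z C nb nm f fs) nT * hadN Z nb with hV
  set fex : QB w → Prop := fun x => ∃ m < 2 ^ nb, f (setR x Z m##w) with hfex
  set X := permL (xorP out fun x : QB w => bw w (x.1 F ≠ 0)) with hX
  set Y := permL (xorP out fun x => bw w (fex x)) with hY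
  set X1 := permL (xorP out fun _ : QB w => 1#w) with hX1
  have hXa : ∀ x : QB w, xorP out (fun x => bw w (x.1 F ≠ 0)) x =
      xorR x out (bw w (x.1 F ≠ 0)) := fun x => xorP_apply (fun y v => by
        simp only [setR_ne hFout]) x
  have hfexout : Indep fex out := fun y v => by
    simp only [hfex, setR_comm _ hZout.symm, h.fout _ _]
  have hYa : ∀ x : QB w, xorP out (fun x => bw w (fex x)) x =
      xorR x out (bw w (fex x)) := fun x => xorP_apply (fun y v => by
        rw [hfexout]) x
  have hX1a : ∀ x : QB w, xorP out (fun _ => 1#w) x = xorR x out 1#w :=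
    fun x => xorP_apply (fun _ _ => rfl) x
  set ψ1 := part fex ψ with hψ1
  set ψ0 := part (fun x => ¬fex x) ψ with hψ0
  have hsum : ψ1 + ψ0 = ψ := part_add_part fex ψ
  have s1 : Supp ψ1 {x | x ∈ clean Z C F o nT stk S ∧ fex x} := fun x hx => by
    rw [hψ1, part]; split_ifs with hf
    · exact hψ x fun h' => hx ⟨h', hf⟩
    · rfl
  have s0 : Supp ψ0 {x | x ∈ clean Z C F o nT stk S ∧ ¬fex x} := fun x hx => by
    rw [hψ0, part]; split_ifs with hf
    · rfl
    · exact hψ x fun h' => hx ⟨h', hf⟩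
  have hZ0 : ∀ φ : QS w, Supp φ (clean Z C F o nT stk S) →
      ∀ x : QB w, x.1 Z ≠ 0 → φ x = 0 := fun φ hφ x hx => hφ x fun h' => hx h'.2.1
  have hclean : clean Z C F o nT stk S ⊆ E1 Z C F o nb nT stk S := fun x hx =>
    ⟨⟨hx.1, by rw [hx.2.1]; simp, hx.2.2.1⟩, hx.2.2.2.1, hx.2.2.2.2.1, hx.2.2.2.2.2⟩
  have hE1 : Maps (hadN Z nb) (E1 Z C F o nb nT stk S) (E1 Z C F o nb nT stk S) :=
    maps_hadN fun x hx j hj => h.e1_Z hx (xor_twoPow_lt hx.1.2.1 hj)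
  have s1' : Supp ψ1 (clean Z C F o nT stk S) := s1.mono fun x hx => hx.1
  have s0' : Supp ψ0 (clean Z C F o nT stk S) := s0.mono fun x hx => hx.1
  have hfib : ∀ x : QB w, fex (setR x Z 0) ↔ fex x := fun x => by
    simp only [hfex, setR_setR]
  have hXfix : ∀ φ, Supp φ (E1 Z C F o nb nT stk S) → X φ = φ := fun φ hφ =>
    permL_congr (e' := 1) (S := E1 Z C F o nb nT stk S) (fun x hx => by
      rw [hXa, hx.2.2.1, bw_false (by simp)]; exact xorR_zero _ _) hφ
  have hV0 : V ψ0 = hadN Z nb ψ0 := by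
    have hg : grover Z nb f (hadN Z nb ψ0) = hadN Z nb ψ0 := by
      refine grover_fixed h.hb (fun x hx => ?_) (fun x hx m hm => ?_) (fun x hx => ?_)
      · rw [hadN_of_zero h.hb (hZ0 _ s0')]; split_ifs with hlt
        · rw [s0 _ fun h' => h'.2 ((hfib x).2 ⟨(x.1 Z).toNat, hlt, by
            rwa [BitVec.ofNat_toNat, BitVec.setWidth_eq, setR_eq_self rfl]⟩), mul_zero]
        · rfl
      · have h2w : 2 ^ nb ≤ 2 ^ w := two_pow_le h.hb
        rw [hadN_of_zero h.hb (hZ0 _ s0'), hadN_of_zero h.hb (hZ0 _ s0'), setR_setR, if_pos hx,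
          if_pos]
        rw [setR_self, toNat_ofNat, mod_eq_of_lt o!]; exact hm
      · rw [hadN_of_zero h.hb (hZ0 _ s0'), if_neg hx]
    show ordProd (round Z C nb nm f fs) nT (hadN Z nb ψ0) = _
    have : ∀ r ≤ nT, ordProd (round Z C nb nm f fs) r (hadN Z nb ψ0) = hadN Z nb ψ0 := by
      intro r; induction r with
      | zero => intro _; rfl
      | succ r ih =>
        intro hr; show round Z C nb nm f fs r (ordProd (round Z C nb nm f fs) r (hadN Z nb ψ0)) = _
        rw [ih o!]; exact h.round_fixed hfs (hE1 _ (s0'.mono hclean)) hg o!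
    exact this nT le_rfl
  have e0 : X (V ψ0) - V (Y ψ0) = 0 := by
    have : Y ψ0 = ψ0 := permL_congr (e' := 1) (fun x hx => by
      rw [hYa, bw_false hx.2]; exact xorR_zero _ _) s0
    rw [this, hV0, hXfix _ (hE1 _ (s0'.mono hclean)), sub_self]
  have hbal : hadN Z nb ψ1 ∈ balanced Z nb f := by
    refine ⟨fun x y hx hy hxy _ => ?_, fun x hx => ?_⟩
    · rw [hadN_of_zero h.hb (hZ0 _ s1'), hadN_of_zero h.hb (hZ0 _ s1'), if_pos hx, if_pos hy, hxy]
    · rw [hadN_of_zero h.hb (hZ0 _ s1')]; split_ifs with hlt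
      · rw [s1 _ fun h' => hx ⟨hlt, (hfib x).1 h'.2⟩, mul_zero]
      · rfl
  obtain ⟨ξ, χ, h1, -, h3, h4, h5⟩ := h.rounds_apply hfs (hE1 _ (s1'.mono hclean)) hbal le_rfl
  have hV1 : V ψ1 = ξ + χ := h5; have e1 : X (V ψ1) - V (Y ψ1) = ξ - X1 ξ := by
    have a1 : Y ψ1 = X1 ψ1 := permL_congr (fun x hx => by
      rw [hYa, bw_true hx.2, hX1a]) s1
    have a2 : V (X1 ψ1) = X1 (V ψ1) := congrArg (fun U => U ψ1) (h.commute_out hfs).eq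
    have a3 : X χ = X1 χ := permL_congr (fun x hx => by
      obtain ⟨-, r', -, hb⟩ := hx
      rw [hXa, bw_true (fun h0 => by rw [h0] at hb; simp at hb), hX1a]) h4
    rw [a1, a2, hV1, map_add, map_add, a3, hXfix _ h1]
    abel
  have e2 : X (V ψ) - V (Y ψ) = ξ - X1 ξ := by
    rw [← e1, ← hsum]; simp only [map_add]; rw [add_sub_add_comm, e0, add_zero]
  rw [e2]; have hn : nrm (hadN Z nb ψ1) = nrm ψ1 := iso_hadN _ _ _; rw [hn] at h3
  have hle : nrm ψ1 ≤ nrm ψ := nrm_part_le _ _; have hX1n : nrm (X1 ξ) = nrm ξ := iso_permL _ _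
  have := nrm_sub_le ξ (X1 ξ); have hp : (0 : ℝ) < (1 / 2) ^ nT := by positivity
  nlinarith

end SearchSpec

/-! # The search program -/

/-- The registers `1, …, 15` are scratch registers, the others are not. -/
def Hi (r : Reg) : Prop := r.val = 0 ∨ 16 ≤ r.val

lemma Hi.ne {r : Reg} (h : Hi r) {s : Reg} (hs : 0 < s.val ∧ s.val < 16) :
    r ≠ s := by
  rintro rfl; unfold Hi at h; omega

/-- `a` is available at depth `d` and has the value `v`. -/
def Val (σ : CStore w) (d : ℕ) (a : COperand) (v : ℕ) : Prop :=
  a.Lt d ∧ a.eval σ = v##w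

lemma COperand.Lt.mono {a : COperand} {d' : ℕ} (h : a.Lt d) (hd : d ≤ d') : a.Lt d' := by
  cases a with
  | lit c => trivial
  | creg j => exact lt_of_lt_of_le h hd

lemma Val.mono {d' : ℕ} {a : COperand} {v : ℕ} (h : Val σ d a v)
    (hd : d ≤ d') : Val σ d' a v := ⟨h.1.mono hd, h.2⟩

lemma Val.set {e : ℕ} {a : COperand} {v : ℕ} (h : Val σ d a v)
    (he : d ≤ e) (u : BitVec w) : Val (σ.set e u) d a v :=
  ⟨h.1, (eval_set h.1 he σ u).trans h.2⟩

lemma Val.creg (σ : CStore w) (d v : ℕ) : Val (σ.set d v##w) (d + 1) (.creg d) v :=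
  ⟨Nat.lt_succ_self d, set_reg_self _ _ _⟩

lemma Val.toNat {a : COperand} {v : ℕ} (h : Val σ d a v)
    (hv : v < 2 ^ w) : (a.eval σ).toNat = v := by
  rw [h.2, toNat_ofNat, mod_eq_of_lt hv]

namespace RProg

/-- `i ^= op a b` -/
abbrev qx (i : Reg) (op : WordOp) (a b : QOperand 255) : RProg :=
  gate (.qx i op a b)

end RProg

/-- A classical operand as a quantum one. -/
abbrev QOperand.c (a : COperand) : QOperand 255 := .classical a

abbrev QOperand.q (j : Reg) : QOperand 255 := .qreg j

open RProg QOperand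

/-- Hadamard gates on the `b` lowest bits of register `i`. -/
def hadAll (i : Reg) (b : COperand) (d : ℕ) : RProg :=
  .loop false b (.gate (.had i (.creg d)))

/-- The phase flip controlled by the oracle and by `j < C`. -/
def oraclePhase (C o : Reg) (B : RProg) (j : COperand) : RProg :=
  bracket B (bracket (.seq (qx 1 .lt (c j) (q C)) (qx 3 .and (q o) (q 1))) (.gate (.zg 3)))

/-- Reflection about the uniform superposition, controlled by `j < C`. -/
def diffPhase (Z C : Reg) (b : COperand) (d : ℕ) (j : COperand) : RProg :=
  bracket (hadAll Z b d) (bracket (.seq (.seq (qx 1 .lt (c j) (q C)) (qx 2 .lt (c (.lit 0)) (q Z)))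
    (qx 3 .and (q 1) (q 2))) (.gate (.zg 3)))

/-- Set bit number `j` of `F` if `C` is nonzero, and move `C` to the memory. -/
def recordStep (C F : Reg) (st j : COperand) : RProg :=
  .seq (bracket (qx 1 .lt (c (.lit 0)) (q C)) (qx F .shl (q 1) (c j)))
    (bracket (qx 4 .add (c st) (c j)) (.gate (.acc C 4)))

def searchCore (Z C F o : Reg) (b m M T st : COperand) (B : ℕ → RProg) (d : ℕ) : RProg :=
  .seq (hadAll Z b d) (.loop false T (.seq (.seq (hadAll C m (d + 2))
    (.seq (.loop false M (.seq (oraclePhase C o (B (d + 4)) (.creg (d + 2)))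
      (diffPhase Z C b (d + 4) (.creg (d + 2))))) (hadAll C m (d + 2))))
      (recordStep C F st (.creg d))))

/-- Search for a value of `Z` below `2 ^ b` for which `B` sets `o`; the answer goes to `out`. -/
def search (Z C F o out : Reg) (b m M T st : COperand) (B : ℕ → RProg) (d : ℕ) : RProg :=
  bracket (searchCore Z C F o b m M T st B d) (qx out .lt (c (.lit 0)) (q F))

lemma perm_cc (i : Reg) (op : WordOp) (a b : COperand) (d : ℕ) (σ : CStore w)
    (x : QB w) : (qx i op (c a) (c b)).perm G d σ x = xorR x i (op.eval (a.eval σ) (b.eval σ)) :=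
  perm_qx G (a := c a) (b := c b) trivial trivial d σ x

lemma perm_cr {j : Reg} (hj : j ≠ i) (op : WordOp) (a : COperand) (d : ℕ)
    (σ : CStore w) (x : QB w) : (qx i op (c a) (q j)).perm G d σ x =
      xorR x i (op.eval (a.eval σ) (x.1 j)) :=
  perm_qx G (a := c a) (b := q j) trivial hj d σ x

lemma perm_rc {j : Reg} (hj : j ≠ i) (op : WordOp) (a : COperand) (d : ℕ)
    (σ : CStore w) (x : QB w) : (qx i op (q j) (c a)).perm G d σ x =
      xorR x i (op.eval (x.1 j) (a.eval σ)) :=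
  perm_qx G (a := q j) (b := c a) hj trivial d σ x

lemma perm_rr {j l : Reg} (hj : j ≠ i) (hl : l ≠ i) (op : WordOp) (d : ℕ)
    (σ : CStore w) (x : QB w) : (qx i op (q j) (q l)).perm G d σ x =
      xorR x i (op.eval (x.1 j) (x.1 l)) :=
  perm_qx G (a := q j) (b := q l) hj hl d σ x

lemma den_hadAll (i : Reg) {b : COperand} {nb : ℕ}
    (hb : Val σ d b nb) (hnb : nb < 2 ^ w) : (hadAll i b d).den G d σ = hadN i nb := by
  show ordProd _ (b.eval σ).toNat = _; rw [hb.toNat hnb]; refine ordProd_congr fun j hj => ?_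
  show hadL i ((COperand.creg d).eval (σ.set d j##w)).toNat = _
  rw [COperand.eval, set_reg_self, toNat_ofNat, mod_eq_of_lt (hj.trans hnb)]

lemma den_bracket_zg {A : RProg} (hA : A.All Gate.Pure) (i : Reg) (d : ℕ)
    (σ : CStore w) : (bracket A (.gate (.zg i))).den G d σ =
      phaseL fun x => ((A.perm G d σ x).1 i).getLsbD 0 := by
  rw [den_bracket, den_eq_permL G hA]; show (permL _)⁻¹ * phaseL _ * permL _ = _
  rw [mul_assoc, permL_phaseL, ← mul_assoc, inv_mul_cancel, one_mul]

lemma toNat_zero_lt (v : BitVec w) : (0#w).toNat < v.toNat ↔ v ≠ 0#w := by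
  rw [Ne, ← toNat_inj]; simp [Nat.pos_iff_ne_zero]

lemma lt_two_pow_of_le {v : ℕ} (hv : v ≤ w) : v < 2 ^ w :=
  lt_of_le_of_lt hv Nat.lt_two_pow_self

/-- The assumptions on a search program. -/
structure SearchAssm (G : DGraph n) (Z C F o out : Reg)
    (b m M T st : COperand) (nb nm nT nst : ℕ) (B : ℕ → RProg) (d : ℕ) (σ : CStore w)
    (f : QB w → Prop) (S : Set (QB w)) (ε : ℝ) : Prop where
  spec : SearchSpec Z C F o out nb nm nT (fun r => (nst + r)##w) f S
  hw : 0 < w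
  hT : nT ≤ w
  vb : Val σ d b nb
  vm : Val σ d m nm
  vM : Val σ d M (2 ^ nm)
  vT : Val σ d T nT
  vst : Val σ d st nst
  hM : 2 ^ nm < 2 ^ w
  hi : ∀ r ∈ [Z, C, F, o, out], Hi r
  scr : ∀ x ∈ S, x.1 1 = 0 ∧ x.1 2 = 0 ∧ x.1 3 = 0 ∧ x.1 4 = 0
  body : ∀ r j, Approx ((B (d + 4)).den G (d + 4)
    ((σ.set d r##w).set (d + 2) j##w))
    (permL (xorP o fun x => bw w (f x))) S ε

namespace SearchAssm

open SearchSpec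

variable {Z C F : Reg} {b m M st : COperand} {nb nm nT nst : ℕ} {B : ℕ → RProg} {f : QB w → Prop} (h : SearchAssm G Z C F o out b m M T st nb nm nT nst B d σ f S ε)
include h

lemma hZ : Hi Z := h.hi Z (by simp)
lemma hC : Hi C := h.hi C (by simp)
lemma hF : Hi F := h.hi F (by simp)
lemma ho : Hi o := h.hi o (by simp)
lemma hout : Hi out := h.hi out (by simp)


lemma xor_o_apply (x : QB w) : xorP o (fun x => bw w (f x)) x = xorR x o (bw w (f x)) :=
  xorP_apply (fun y v => by simp only [h.spec.fo y v]) x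

lemma oraclePhase_approx (r j : ℕ) (hj : j < 2 ^ nm) :
    Approx ((oraclePhase C o (B (d + 4)) (.creg (d + 2))).den G (d + 4)
      ((σ.set d r##w).set (d + 2) j##w))
      (phaseL fun x => f x ∧ j < (x.1 C).toNat) (E0 Z o nb S) (2 * ε) := by
  set σ' := (σ.set d r##w).set (d + 2) j##w with hσ'
  obtain ⟨hZC, hZF, hZo, hZout, hCF, hCo, hCout, hFo, hFout, hoout⟩ := h.spec.ne
  rw [oraclePhase, den_bracket, den_bracket_zg (A := .seq (qx _ _ _ _) (qx _ _ _ _)) ⟨trivial, trivial⟩]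
  have hE : E0 Z o nb S ⊆ S := fun x hx => hx.1
  have hB := (h.body r j).mono hE le_rfl
  have hmaps : Maps (permL (xorP o fun x => bw w (f x))) (E0 Z o nb S) S :=
    maps_permL fun x hx => by rw [h.xor_o_apply]; exact h.spec.so x hx.1 _
  set φ : QB w → Prop := fun x => (((RProg.seq (qx 1 .lt (c (.creg (d + 2))) (q C))
    (qx 3 .and (q o) (q 1))).perm G (d + 4) σ' x).1 3).getLsbD 0 with hφ
  have key : ∀ x ∈ S, φ x ↔ (x.1 o).getLsbD 0 ∧ j < (x.1 C).toNat := by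
    intro x hx; obtain ⟨h1, h2, h3, h4⟩ := h.scr x hx
    have hj' : ((COperand.creg (d + 2)).eval σ').toNat = j := by
      rw [hσ', COperand.eval, set_reg_self, toNat_ofNat, mod_eq_of_lt (hj.trans h.hM)]
    simp only [hφ]; have hC := h.hC; have ho := h.ho
    simp (disch := first | decide | assumption |
      exact Hi.ne (by assumption) d! | exact (Hi.ne (by assumption) d!).symm) only [perm_seq, perm_cr, perm_rr,
      xorR_self, xorR_ne, h1, h3, WordOp.eval_lt_eq, hj']
    simp only [WordOp.eval, ofNat_eq_ofNat, bzero_xor, BitVec.getLsbD_and, Bool.and_eq_true, bw_bit h.hw]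
  refine (Approx.bracket (δ := 0) hB (Approx.refl (phaseL φ) S) (RProg.den_iso G _ _ _)
    (iso_permL _) (iso_phaseL _) (iso_phaseL _) hmaps (maps_phaseL _ _) ?_).mono subset_rfl
    (by linarith)
  intro ψ hψ; have e1 : phaseL φ (permL (xorP o fun x => bw w (f x)) ψ) =
      permL (xorP o fun x => bw w (f x)) (phaseL (fun x => φ (xorP o (fun x => bw w (f x)) x)) ψ) :=
    congrArg (fun U => U ψ) (permL_phaseL (xorP o fun x => bw w (f x)) φ)
  rw [e1, phaseL_congr (φ' := fun x => f x ∧ j < (x.1 C).toNat) ?_ hψ, sub_self, nrm_zero, zero_mul]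
  intro x hx; rw [h.xor_o_apply]; refine (key (xorR x o _) (h.spec.so x hx.1 _)).trans ?_
  rw [xorR_self, hx.2.2, xorR_ne _ _ hCo, ofNat_eq_ofNat, bzero_xor, bw_bit h.hw]

lemma maps_hadN_Z : Maps (hadN Z nb) (E0 Z o nb S) (E0 Z o nb S) :=
  maps_hadN fun _ hx _ hj => h.spec.e0_Z hx (xor_twoPow_lt hx.2.1 hj)

lemma maps_hadN_C : Maps (hadN C nm) (E0 Z o nb S) (E0 Z o nb S) :=
  maps_hadN fun _ hx _ _ => h.spec.e0_C hx _

lemma e0_iter (x) (hx : x ∈ E0 Z o nb S) : (x.1 Z).toNat < 2 ^ nb ∧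
    ∀ v : BitVec w, v.toNat < 2 ^ nb → setR x Z v ∈ E0 Z o nb S :=
  ⟨hx.2.1, fun _ hv => h.spec.e0_Z hx hv⟩

lemma diffPhase_approx (r j : ℕ) (hj : j < 2 ^ nm) :
    Approx ((diffPhase Z C b (d + 4) (.creg (d + 2))).den G (d + 4)
      ((σ.set d r##w).set (d + 2) j##w))
      (hadN Z nb * phaseL (fun x => j < (x.1 C).toNat ∧ x.1 Z ≠ 0) * hadN Z nb)
      (E0 Z o nb S) 0 := by
  set σ' := (σ.set d r##w).set (d + 2) j##w with hσ'
  obtain ⟨hZC, hZF, hZo, hZout, hCF, hCo, hCout, hFo, hFout, hoout⟩ := h.spec.ne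
  have vb : Val σ' (d + 4) b nb := ((h.vb.set le_rfl _).set o! _).mono o!
  rw [diffPhase, den_bracket, den_bracket_zg (A := .seq (.seq (qx _ _ _ _) (qx _ _ _ _)) (qx _ _ _ _))
    ⟨⟨trivial, trivial⟩, trivial⟩,
    den_hadAll Z vb (lt_two_pow_of_le h.spec.hb), hadN_inv]
  refine approx_of_eq fun ψ hψ => ?_
  show hadN Z nb (phaseL _ (hadN Z nb ψ)) = hadN Z nb (phaseL _ (hadN Z nb ψ)); congr 1
  refine phaseL_congr ?_ (h.maps_hadN_Z ψ hψ); intro x hx; obtain ⟨h1, h2, h3, h4⟩ := h.scr x hx.1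
  have hj' : ((COperand.creg (d + 2)).eval σ').toNat = j := by
    rw [hσ', COperand.eval, set_reg_self, toNat_ofNat, mod_eq_of_lt (hj.trans h.hM)]
  have hC := h.hC; have hZ := h.hZ
  simp (disch := first | decide | assumption |
      exact Hi.ne (by assumption) d! | exact (Hi.ne (by assumption) d!).symm) only [perm_seq, perm_cr, perm_rr,
    xorR_self, xorR_ne, h1, h2, h3, WordOp.eval_lt_eq, COperand.eval]
  simp only [COperand.eval] at hj'
  simp only [hj', WordOp.eval, ofNat_eq_ofNat, bzero_xor, bw_and, bw_bit h.hw, toNat_zero_lt]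

lemma iter_approx (r j : ℕ) (hj : j < 2 ^ nm) :
    Approx ((RProg.seq (oraclePhase C o (B (d + 4)) (.creg (d + 2)))
      (diffPhase Z C b (d + 4) (.creg (d + 2)))).den G (d + 4)
      ((σ.set d r##w).set (d + 2) j##w))
      (iter Z C nb f j) (E0 Z o nb S) (2 * ε) :=
  ((h.diffPhase_approx r j hj).mul (h.oraclePhase_approx r j hj) (RProg.den_iso G _ _ _)
    (iso_phaseL _) (maps_phaseL _ _)).mono subset_rfl (by linarith)

lemma recordStep_apply (hx : x ∈ S) {r : ℕ} (hr : r < nT) :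
    (recordStep C F st (.creg d)).perm G (d + 2) (σ.set d r##w) x =
      let y := xorR x F (bw w (x.1 C ≠ 0) <<< r)
      setM (setR y C (y.2 (nst + r)##w)) (nst + r)##w (x.1 C) := by
  obtain ⟨hZC, hZF, hZo, hZout, hCF, hCo, hCout, hFo, hFout, hoout⟩ := h.spec.ne
  set σ' := σ.set d r##w with hσ'
  have hrw : r < 2 ^ w := lt_two_pow_of_le (by have := h.hT; omega)
  have hr' : (COperand.creg d).eval σ' = r##w := set_reg_self _ _ _
  have hst : st.eval σ' = nst##w := (h.vst.set le_rfl _).2; obtain ⟨h1, h2, h3, h4⟩ := h.scr x hx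
  have e1 : (bracket (qx 1 .lt (c (.lit 0)) (q C)) (qx F .shl (q 1)
      (c (.creg d)))).perm G (d + 2) σ' x = xorR x F (bw w (x.1 C ≠ 0) <<< r) := by
    refine perm_bracket_xor G (A := qx 1 .lt (c (.lit 0)) (q C))
      ⟨(h.hF.ne d!).symm, trivial, hCF⟩ ?_
    have hC := h.hC; have hF := h.hF
    simp (disch := first | decide | assumption |
      exact Hi.ne (by assumption) d! | exact (Hi.ne (by assumption) d!).symm) only [perm_cr, perm_rc, hr', xorR_self, h1, ofNat_eq_ofNat, bzero_xor]
    congr 1; simp only [COperand.eval, WordOp.eval_lt_zero]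
    simp only [WordOp.eval, shiftLeft_eq', toNat_ofNat, mod_eq_of_lt hrw]; rfl
  rw [recordStep, perm_seq, e1]; set y := xorR x F (bw w (x.1 C ≠ 0) <<< r) with hy
  have y4 : y.1 4 = 0 := by rw [hy, xorR_ne _ _ (h.hF.ne d!).symm, h4]
  have yC : y.1 C = x.1 C := xorR_ne _ _ hCF; have hC4 : C ≠ 4 := h.hC.ne d!
  have hA : ∀ z : QB w, (qx 4 .add (c st) (c (.creg d))).perm G (d + 2) σ' z =
      xorR z 4 (nst + r)##w := fun z => by
    simp (disch := first | decide | assumption |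
      exact Hi.ne (by assumption) d! | exact (Hi.ne (by assumption) d!).symm) only [perm_cc, hr', hst, WordOp.eval, ofNat_add]
  rw [perm_bracket, hA, perm_acc G hC4]
  rw [show ((qx 4 .add (c st) (c (.creg d))).perm G (d + 2) σ')⁻¹ =
    (qx 4 .add (c st) (c (.creg d))).perm G (d + 2) σ' from
      Gate.perm_inv G (.qx 4 .add (c st) (c (.creg d))) σ', hA]
  simp only [xorR_self, y4, ofNat_eq_ofNat, bzero_xor, xorR_mem, xorR_ne _ _ hC4, yC]
  have e2 : ∀ (z : QB w) a u v, xorR (setM (setR (xorR z 4 a) C u) a v) 4 a =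
      setM (setR z C u) a v := by
    intro z a u v; have e3 : setR (setR (setM (setR z 4 (z.1 4 ^^^ a)) a v) C u) 4 (z.1 4) =
        setR (setM z a v) C u := by
      rw [setR_comm _ hC4, setM_setR, setR_setR]; congr 1; exact setR_eq_self rfl
    rw [xorR, setM_reg, setR_ne hC4.symm, xorR_self, xor_assoc, bxor_self, bxor_zero]; exact e3
  exact e2 y _ _ _

lemma record : Record Z C F o out nb nT (fun r => (nst + r)##w) S fun r =>
    (recordStep C F st (.creg d)).perm G (d + 2) (σ.set d r##w) := by
  obtain ⟨hZC, hZF, hZo, hZout, hCF, hCo, hCout, hFo, hFout, hoout⟩ := h.spec.ne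
  refine ⟨fun r hr x hx => ?_, fun r hr x hx hC hm => ?_, fun r hr x hx hC hF => ?_,
    fun r hr x hx r' hr' => ?_, fun r x v => ?_⟩
  · rw [h.recordStep_apply hx.1 hr]
    refine ⟨h.spec.sM _ (h.spec.sC _ (h.spec.sF _ hx.1 _) _) r hr _, ?_, ?_⟩
    · rw [setM_reg, setR_ne hZC, xorR_ne _ _ hZF]; exact hx.2.1
    · rw [setM_reg, setR_ne hCo.symm, xorR_ne _ _ hFo.symm]; exact hx.2.2
  · rw [h.recordStep_apply hx.1 hr]; have hm' : x.2 (nst + r)##w = 0 := hm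
    simp only [bw_false (not_not.2 hC), BitVec.zero_shiftLeft]
    rw [show xorR x F 0#w = x from xorR_zero _ _, hm', setR_eq_self hC, hC]; exact setM_eq_self hm'
  · rw [h.recordStep_apply hx.1 hr]; simp only [setM_reg]
    have hrw : r < w := by have := h.hT; omega
    rw [setR_ne hCF.symm, xorR_self, hF, bw_true hC]; simp [hrw]
  · rw [h.recordStep_apply hx.1 hr]; simp only [setM_reg]; rw [setR_ne hCF.symm, xorR_self]
    simp [hr']
  · refine perm_setR G ?_ v _ _ x; have h1 : (1 : Fin 256) ≠ out := (h.hout.ne d!).symm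
    have h4 : (4 : Fin 256) ≠ out := (h.hout.ne d!).symm
    exact ⟨All.bracket ⟨h1, trivial, hCout⟩ ⟨hFout, h1, trivial⟩,
      All.bracket ⟨h4, trivial, trivial⟩ ⟨hCout, h4⟩⟩

omit h in
lemma recordStep_pure : (recordStep C F st (.creg d)).All Gate.Pure :=
  ⟨All.bracket trivial trivial, All.bracket trivial trivial⟩

lemma searchCore_approx : Approx ((searchCore Z C F o b m M T st B d).den G d σ)
    (ordProd (round Z C nb nm f fun r =>
      (recordStep C F st (.creg d)).perm G (d + 2) (σ.set d r##w)) nT * hadN Z nb)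
    (E0 Z o nb S) (nT * (2 ^ nm * (2 * ε))) := by
  have hcore : (searchCore Z C F o b m M T st B d).den G d σ =
      (RProg.loop false T (.seq (.seq (hadAll C m (d + 2))
    (.seq (.loop false M (.seq (oraclePhase C o (B (d + 4)) (.creg (d + 2)))
      (diffPhase Z C b (d + 4) (.creg (d + 2))))) (hadAll C m (d + 2))))
      (recordStep C F st (.creg d)))).den G d σ * (hadAll Z b d).den G d σ := rfl
  rw [hcore, den_hadAll Z h.vb (lt_two_pow_of_le h.spec.hb)]; have hm1 := h.maps_hadN_Z
  refine (Approx.mul (ε' := nT * (2 ^ nm * (2 * ε))) ?_ (Approx.refl (hadN Z nb) _)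
    (RProg.den_iso G _ _ _) (iso_hadN _ _) hm1).mono subset_rfl (by linarith)
  have hiter : ∀ r, Approx ((RProg.loop false M (.seq (oraclePhase C o (B (d + 4)) (.creg (d + 2)))
      (diffPhase Z C b (d + 4) (.creg (d + 2))))).den G (d + 2) (σ.set d r##w))
      (ordProd (iter Z C nb f) (2 ^ nm)) (E0 Z o nb S) (2 ^ nm * (2 * ε)) := by
    intro r; show Approx (ordProd _ (M.eval _).toNat) _ _ _; rw [(h.vM.set le_rfl r##w).toNat h.hM]
    have := Approx.ordProd (N := 2 ^ nm) (fun j hj => h.iter_approx r j hj)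
      (fun j => RProg.den_iso G _ _ _) (fun j => iso_iter j)
      (fun j _ => h.spec.maps_iter h.e0_iter j)
    push_cast at this; exact this
  show Approx (ordProd _ (T.eval σ).toNat) _ _ _; rw [h.vT.toNat (lt_two_pow_of_le h.hT)]
  have hvm : ∀ r, Val (σ.set d r##w) (d + 2) m nm := fun r =>
    (h.vm.set le_rfl _).mono o!
  have hH : ∀ r, (hadAll C m (d + 2)).den G (d + 2) (σ.set d r##w) = hadN C nm :=
    fun r => den_hadAll C (hvm r) (lt_two_pow_of_le h.spec.hm)
  refine Approx.ordProd (fun r hr => ?_) (fun r => RProg.den_iso G _ _ _)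
    (fun r => iso_round _ r) (fun r hr => h.spec.maps_round h.e0_iter
      (fun x hx v => h.spec.e0_C hx v) fun x hx => h.record.maps r hr x hx)
  have e : (RProg.seq (.seq (hadAll C m (d + 2))
    (.seq (.loop false M (.seq (oraclePhase C o (B (d + 4)) (.creg (d + 2)))
      (diffPhase Z C b (d + 4) (.creg (d + 2))))) (hadAll C m (d + 2))))
      (recordStep C F st (.creg d))).den G (d + 2) (σ.set d r##w) =
    (recordStep C F st (.creg d)).den G (d + 2) (σ.set d r##w) *
      ((hadAll C m (d + 2)).den G (d + 2) (σ.set d r##w) *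
      (RProg.loop false M (.seq (oraclePhase C o (B (d + 4)) (.creg (d + 2)))
      (diffPhase Z C b (d + 4) (.creg (d + 2))))).den G (d + 2) (σ.set d r##w) *
      (hadAll C m (d + 2)).den G (d + 2) (σ.set d r##w)) := rfl
  show Approx ((RProg.seq _ _).den G (d + 2) (σ.set d r##w)) _ _ _
  rw [e, den_eq_permL G recordStep_pure, hH, mul_assoc]
  have a1 := Approx.mul (hiter r) (Approx.refl (hadN C nm) _) (RProg.den_iso G _ _ _)
    (iso_hadN _ _) h.maps_hadN_C
  have m1 : Maps (ordProd (iter Z C nb f) (2 ^ nm) * hadN C nm) (E0 Z o nb S) (E0 Z o nb S) :=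
    (Maps.ordProd fun j _ => h.spec.maps_iter h.e0_iter j).mul h.maps_hadN_C
  have i1 : Iso (ordProd (iter Z C nb f) (2 ^ nm) * hadN C nm) :=
    (Iso.ordProd (fun j => iso_iter j) _).mul (iso_hadN _ _)
  have a2 := Approx.mul (Approx.refl (hadN C nm) _) a1 (iso_hadN _ _) i1 m1
  have a3 := Approx.mul (Approx.refl (permL ((recordStep C F st (.creg d)).perm G (d + 2)
    (σ.set d r##w))) _) a2 (iso_permL _) ((iso_hadN _ _).mul i1)
    (h.maps_hadN_C.mul m1)
  exact a3.mono subset_rfl (by linarith)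

omit h in
lemma clean_subset : clean Z C F o nT (fun r => (nst + r)##w) S ⊆ E0 Z o nb S :=
  fun x hx => ⟨hx.1, by rw [hx.2.1]; simp, hx.2.2.1⟩

lemma search_approx : Approx ((search Z C F o out b m M T st B d).den G d σ)
    (permL (xorP out fun x => bw w (∃ m < 2 ^ nb, f (setR x Z m##w))))
    (clean Z C F o nT (fun r => (nst + r)##w) S)
    (4 * nT * 2 ^ nm * ε + 2 * (1 / 2) ^ nT) := by
  obtain ⟨hZC, hZF, hZo, hZout, hCF, hCo, hCout, hFo, hFout, hoout⟩ := h.spec.ne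
  rw [search, den_bracket, den_eq_permL G (p := qx out .lt (c (.lit 0)) (q F)) trivial]
  have hX : (qx out .lt (c (.lit 0)) (q F)).perm G d σ =
      xorP out fun x => bw w (x.1 F ≠ 0) := by
    ext1 x
    rw [perm_cr hFout, xorP_apply (fun y v => by rw [setR_ne hFout])]
    simp only [COperand.eval, WordOp.eval_lt_zero]
  rw [hX]
  set V := (ordProd (round Z C nb nm f fun r =>
      (recordStep C F st (.creg d)).perm G (d + 2) (σ.set d r##w)) nT * hadN Z nb :
      QS w ≃ₗ[ℂ] QS w) with hV
  set Y := xorP out fun x : QB w =>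
    bw w (∃ m < 2 ^ nb, f (setR x Z m##w)) with hY
  have hYa : ∀ x, Y x = xorR x out (bw w (∃ m < 2 ^ nb, f (setR x Z m##w))) :=
    fun x => xorP_apply (fun y v => by simp only [setR_comm _ hZout.symm, h.spec.fout _ _]) x
  have hmV : Maps V (E0 Z o nb S) Set.univ := fun ψ _ x hx => (hx trivial).elim
  refine (Approx.bracket (S' := Set.univ) (δ := 2 * (1 / 2) ^ nT) (h.searchCore_approx.mono
    clean_subset le_rfl) (Approx.refl _ _) (RProg.den_iso G _ _ _)
    ((Iso.ordProd (fun r => iso_round _ r) _).mul (iso_hadN _ _)) (iso_permL _) (iso_permL _)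
    (fun ψ _ x hx => (hx trivial).elim) (maps_permL fun x hx => ?_)
    (fun ψ hψ => h.spec.search_error h.record hψ)).mono subset_rfl (by
      apply le_of_eq; ring)
  rw [hYa, xorR]; refine ⟨h.spec.sout x hx.1 _, ?_, ?_, ?_, ?_, hx.2.2.2.2.2⟩
  · rw [setR_ne hZout]; exact hx.2.1
  · rw [setR_ne hoout]; exact hx.2.2.1
  · rw [setR_ne hCout]; exact hx.2.2.2.1
  · rw [setR_ne hFout]; exact hx.2.2.2.2.1

end SearchAssm

/-! # Frames -/

/-- The lowest one-bit. -/
def lowBit (D : BitVec w) : BitVec w := D &&& (0 - D)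

/-- Remove the lowest one-bit. -/
def strip (D : BitVec w) : BitVec w := D ^^^ lowBit D

/-- The one-bit number `j`. -/
def frameBit (D : BitVec w) (j : ℕ) : BitVec w := lowBit (strip^[j] D)

/-- The sum of the `P j` for those `j < a` that are in the mask `m`. -/
def lin (P : ℕ → BitVec w) : ℕ → BitVec w → BitVec w
  | 0, _ => 0
  | a + 1, m => lin P a m ^^^ if m.getLsbD a then P a else 0

/-- Reachability from `s` by steps that add elements of the frame `P`, in terms of masks. -/
inductive FReach (E : BitVec w → BitVec w → Prop) (s : BitVec w) (P : ℕ → BitVec w) (a : ℕ) :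
    BitVec w → Prop
  | zero : FReach E s P a 0
  | step {m m' : BitVec w} {j : ℕ} (hm : FReach E s P a m) (hj : j < a)
      (hb : m'.getLsbD j = true) (h : m = m' ^^^ twoPow w j)
      (he : E (s ^^^ lin P a m) (s ^^^ lin P a m')) : FReach E s P a m'

lemma lin_congr {P P' : ℕ → BitVec w} (h : ∀ j < a, P j = P' j) (m : BitVec w) :
    lin P a m = lin P' a m := by
  induction a with
  | zero => rfl
  | succ a ih => rw [lin, lin, ih fun j hj => h j o!, h a o!]

lemma lin_xor (P : ℕ → BitVec w) (a : ℕ) (m m' : BitVec w) :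
    lin P a (m ^^^ m') = lin P a m ^^^ lin P a m' := by
  induction a with
  | zero => simp [lin]
  | succ a ih =>
    rw [lin, lin, lin, ih, getLsbD_xor]
    cases m.getLsbD a <;> cases m'.getLsbD a <;> simp [xor_assoc]
    exact bxor_comm _ _

lemma lin_twoPow (P : ℕ → BitVec w) (hj : j < a) (hw : j < w) :
    lin P a (twoPow w j) = P j := by
  have key : ∀ b, b ≤ j → lin P b (twoPow w j) = 0 := by
    intro b; induction b with
    | zero => intro _; rfl
    | succ b ih =>
      intro hb; rw [lin, ih o!, getLsbD_twoPow]; simp [show j ≠ b by omega]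
  have key2 : ∀ c, lin P (j + 1 + c) (twoPow w j) = P j := by
    intro c; induction c with
    | zero => rw [Nat.add_zero, lin, key j le_rfl, getLsbD_twoPow]; simp [hw]
    | succ c ih =>
      rw [← Nat.add_assoc, lin, ih, getLsbD_twoPow]; simp [show j ≠ j + 1 + c by omega]
  obtain ⟨c, rfl⟩ := Nat.exists_eq_add_of_le (show j + 1 ≤ a by omega); exact key2 c

lemma FReach.congr {E : BitVec w → BitVec w → Prop} {s : BitVec w} {P P' : ℕ → BitVec w} (h : ∀ j < a, P j = P' j) {m : BitVec w} (hm : FReach E s P a m) :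
    FReach E s P' a m := by
  induction hm with
  | zero => exact .zero
  | step hm hj hb h' he ih => exact .step ih hj hb h' (by rwa [← lin_congr h, ← lin_congr h])

lemma FReach.iff_of_ne {E : BitVec w → BitVec w → Prop} {s : BitVec w} {P : ℕ → BitVec w} {m : BitVec w} (hm : m ≠ 0) : FReach E s P a m ↔ ∃ j < a, m.getLsbD j = true ∧
      FReach E s P a (m ^^^ twoPow w j) ∧
      E (s ^^^ lin P a (m ^^^ twoPow w j)) (s ^^^ lin P a m) := by
  constructor
  · intro h; cases h with
    | zero => exact (hm rfl).elim
    | step h' hj hb e he => subst e; exact ⟨_, hj, hb, h', he⟩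
  · rintro ⟨j, hj, hb, h', he⟩; exact .step h' hj hb rfl he

/-- The word whose bits below `a` are given by `f`. -/
def bitWord (w : ℕ) (f : ℕ → Prop) : ℕ → BitVec w
  | 0 => 0
  | a + 1 => bitWord w f a ^^^ (bw w (f a) <<< a)

lemma getLsbD_bitWord (ha : a ≤ w) (f : ℕ → Prop) (i : ℕ) :
    (bitWord w f a).getLsbD i = true ↔ i < a ∧ f i := by
  induction a with
  | zero => simp [bitWord]
  | succ a ih =>
    rw [bitWord, getLsbD_xor, BitVec.getLsbD_shiftLeft]
    have hb : ∀ j, (bw w (f a)).getLsbD j = true ↔ j = 0 ∧ f a := by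
      intro j; by_cases hf : f a
      · rw [bw_true hf, BitVec.getLsbD_one]; simp [hf]; omega
      · rw [bw_false hf]; simp [hf]
    have := ih o!; by_cases h1 : i < a
    · simp only [h1, true_and] at this; simp [h1, this, show i < a + 1 by omega]
    · have h2 : (bitWord w f a).getLsbD i = false := by
        rw [Bool.eq_false_iff, Ne, this]; tauto
      rw [h2]; simp only [Bool.false_xor, h1, Bool.not_false, decide_false, Bool.and_true,
        Bool.and_eq_true, decide_eq_true_eq, hb]
      constructor
      · rintro ⟨h3, h4, h5⟩; obtain rfl : i = a := by omega
        exact ⟨o!, h5⟩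
      · rintro ⟨h3, h4⟩; obtain rfl : i = a := by omega
        exact ⟨o!, o!, h4⟩

lemma bitWord_ne_zero (ha : a ≤ w) (f : ℕ → Prop) :
    bitWord w f a ≠ 0 ↔ ∃ j < a, f j := by
  constructor
  · intro h; by_contra hc
    push Not at hc
    refine h (eq_of_getLsbD_eq fun i _ => ?_)
    rw [Bool.eq_false_iff.2 (fun hi => hc i ((getLsbD_bitWord ha f i).1 hi).1
      ((getLsbD_bitWord ha f i).1 hi).2)]
    simp
  · rintro ⟨j, hj, hf⟩ h; have := (getLsbD_bitWord ha f j).2 ⟨hj, hf⟩; rw [h] at this; simp at this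

/-! # Elementary programs -/

/-- Swap register `X` with the memory at address `a + i`. -/
def swapAt (X : Reg) (a : COperand) (i : QOperand 255) : RProg :=
  bracket (qx 4 .add (c a) i) (.gate (.acc X 4))

lemma perm_swapAt (hX : X ≠ 4) (a : COperand) {i : QOperand 255}
    (hi4 : i.Avoids 4) (hiX : i.Avoids X) (d : ℕ) (σ : CStore w)
    (h4 : x.1 4 = 0) :
    (swapAt X a i).perm G d σ x =
      setM (setR x X (x.2 (a.eval σ + i.eval σ x))) (a.eval σ + i.eval σ x) (x.1 X) := by
  have hA : ∀ z : QB w, (qx 4 .add (c a) i).perm G d σ z =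
      xorR z 4 (a.eval σ + i.eval σ z) := fun z => perm_qx G (a := c a) trivial hi4 d σ z
  have hi : ∀ z v, (z : QB w).1 4 = v → i.eval σ z = i.eval σ (setR z 4 0) := fun z v _ => by
    rw [QOperand.eval_setR hi4]
  rw [swapAt, perm_bracket, hA, perm_acc G hX,
    show ((qx 4 .add (c a) i).perm G d σ)⁻¹ = (qx 4 .add (c a) i).perm G d σ from
      Gate.perm_inv G (.qx 4 .add (c a) i) σ, hA]
  set v := a.eval σ + i.eval σ x with hv
  have e1 : a.eval σ + i.eval σ (setM (setR (xorR x 4 v) X ((xorR x 4 v).2 ((xorR x 4 v).1 4)))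
      ((xorR x 4 v).1 4) ((xorR x 4 v).1 X)) = v := by
    rw [hv]; congr 1
    have : ∀ (z : QB w) a u, i.eval σ (setM z a u) = i.eval σ z := by
      intro z a u; cases i <;> rfl
    rw [this, QOperand.eval_setR hiX, xorR, QOperand.eval_setR hi4]
  rw [e1]; simp only [xorR_self, h4, ofNat_eq_ofNat, bzero_xor, xorR_mem, xorR_ne _ _ hX]
  rw [xorR, setM_reg, setR_ne hX.symm, xorR_self, h4, ofNat_eq_ofNat, bzero_xor, bxor_self]
  show setR (setR (setM (setR x 4 _) v _) X _) 4 _ = setR (setM x v _) X _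
  rw [setR_comm _ hX, setM_setR, setR_setR]; congr 1; exact setR_eq_self h4

/-- XOR the memory at address `a + i` into register `Y`. -/
def readAt (Y : Reg) (a : COperand) (i : QOperand 255) : RProg :=
  bracket (swapAt 5 a i) (qx Y .or (q 5) (q 5))

lemma or_self_eval (v : BitVec w) : WordOp.or.eval v v = v := by simp [WordOp.eval]

lemma perm_readAt (hY : Y ≠ 4 ∧ Y ≠ 5) (a : COperand) {i : QOperand 255}
    (hi : i.Avoids 4 ∧ i.Avoids 5 ∧ i.Avoids Y) (d : ℕ) (σ : CStore w)
    (h4 : x.1 4 = 0) :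
    (readAt Y a i).perm G d σ x = xorR x Y (x.2 (a.eval σ + i.eval σ x)) := by
  refine perm_bracket_xor G (All.bracket ⟨hY.1.symm, trivial, hi.2.2⟩ ⟨hY.2.symm, hY.1.symm⟩) ?_
  rw [perm_swapAt d! a hi.1 hi.2.1 d σ h4, perm_rr hY.2.symm hY.2.symm]
  simp only [setM_reg, setR_self, or_self_eval]

lemma perm_readAt_c (hY : Y ≠ 4 ∧ Y ≠ 5) (a i : COperand) (d : ℕ)
    (σ : CStore w) (h4 : x.1 4 = 0) :
    (readAt Y a (c i)).perm G d σ x = xorR x Y (x.2 (a.eval σ + i.eval σ)) :=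
  perm_readAt (i := c i) hY a ⟨trivial, trivial, trivial⟩ d σ h4

lemma perm_readAt_q {j : Reg} (hY : Y ≠ 4 ∧ Y ≠ 5) (a : COperand)
    (hj : j ≠ 4 ∧ j ≠ 5 ∧ j ≠ Y) (d : ℕ) (σ : CStore w) (h4 : x.1 4 = 0) :
    (readAt Y a (q j)).perm G d σ x = xorR x Y (x.2 (a.eval σ + x.1 j)) :=
  perm_readAt (i := q j) hY a hj d σ h4

/-- XOR the linear combination of the frame at address `P` with mask in register `14` into
register `8`. -/
def linProg (P a : COperand) (d : ℕ) : RProg :=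
  .loop false a (bracket (.seq (readAt 6 P (c (.creg d))) (.seq (qx 1 .shr (q 14) (c (.creg d)))
    (.seq (qx 2 .and (q 1) (c (.lit 1))) (qx 3 .sub (c (.lit 0)) (q 2))))) (qx 8 .and (q 6) (q 3)))

lemma and_neg_bit (P m : BitVec w) (j : ℕ) :
    P &&& (0#w - ((m >>> j) &&& 1#w)) = if m.getLsbD j then P else 0 := by
  have : (m >>> j) &&& 1#w = if m.getLsbD j then 1#w else 0#w := by
    ext i hi; simp only [BitVec.getElem_and, BitVec.getElem_ushiftRight, getElem_one]
    by_cases h : i = 0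
    · subst h; cases m.getLsbD j <;> simp
    · cases m.getLsbD j <;> simp [h, getElem_one]
  rw [this]; cases m.getLsbD j
  · simp
  · simp only [if_true, BitVec.zero_sub, BitVec.neg_one_eq_allOnes, BitVec.and_allOnes]

/-- The scratch registers of the linear combinations are clean. -/
def LinScr (x : QB w) : Prop :=
  x.1 1 = 0 ∧ x.1 2 = 0 ∧ x.1 3 = 0 ∧ x.1 4 = 0 ∧ x.1 5 = 0 ∧ x.1 6 = 0

lemma COperand.eval_lit (σ : CStore w) (v : ℕ) : (COperand.lit v).eval σ = v##w := rfl

lemma val_creg_eval (σ : CStore w) (d : ℕ) (v : BitVec w) :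
    (COperand.creg d).eval (σ.set d v) = v := set_reg_self _ _ _

lemma perm_linProg {a : COperand} (va : Val σ d a na)
    (hP : P.Lt d) (hna : na ≤ w) (hx : LinScr x) :
    (linProg P a d).perm G d σ x =
      xorR x 8 (lin (fun j => x.2 (P.eval σ + j##w)) na (x.1 14)) := by
  show (ordProd _ (a.eval σ).toNat : Equiv.Perm (QB w)) x = _; rw [va.toNat (lt_two_pow_of_le hna)]
  suffices h : ∀ b ≤ na, (ordProd (fun j => interp (Gate.perm G) (bracket (.seq (readAt 6 P
      (c (.creg d))) (.seq (qx 1 .shr (q 14) (c (.creg d)))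
    (.seq (qx 2 .and (q 1) (c (.lit 1))) (qx 3 .sub (c (.lit 0)) (q 2))))) (qx 8 .and (q 6) (q 3)))
      (d + 2) (σ.set d j##w)) b : Equiv.Perm (QB w)) x =
      xorR x 8 (lin (fun j => x.2 (P.eval σ + j##w)) b (x.1 14)) from h na le_rfl
  intro b; induction b with
  | zero => intro _; exact (xorR_zero x 8).symm
  | succ b ih =>
    intro hb; obtain ⟨h1, h2, h3, h4, h5, h6⟩ := hx
    rw [ordProd, Equiv.Perm.mul_apply, ih o!, lin, ← xorR_xorR]
    set y := xorR x 8 (lin (fun j => x.2 (P.eval σ + j##w)) b (x.1 14)) with hy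
    have y1 : ∀ r : Reg, r ≠ 8 → y.1 r = x.1 r := fun r hr => by rw [hy, xorR_ne _ _ hr]
    set σ' := σ.set d b##w with hσ'
    have hv : (COperand.creg d).eval σ' = b##w := val_creg_eval _ _ _
    have hbw : b < 2 ^ w := lt_two_pow_of_le o!
    have hP' : P.eval σ' = P.eval σ := eval_set hP le_rfl σ _
    show (bracket _ _).perm G (d + 2) σ' y = _; refine perm_bracket_xor G ?_ ?_
    · simp +decide [RProg.All, bracket, inv, Gate.Avoids, QOperand.Avoids, readAt, swapAt]
    · rw [perm_seq, perm_readAt_c d! _ _ _ _ (by rw [y1 _ d!, h4])]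
      simp (disch := decide) only [perm_seq, perm_rc, perm_cr, perm_rr, xorR_self, xorR_ne, y1,
        h1, h2, h3, h6, hv, hP']
      congr 1
      simp only [WordOp.eval, ofNat_eq_ofNat, bzero_xor, COperand.eval_lit, BitVec.ushiftRight_eq',
        toNat_ofNat, mod_eq_of_lt hbw, and_neg_bit]
      rw [hy, xorR_mem]

/-- Store the lowest one-bits of register `7` as a frame at address `P`, and remove them from
register `7`. -/
def frameProg (P a : COperand) (d : ℕ) : RProg :=
  .loop false a (.seq (bracket (qx 1 .sub (c (.lit 0)) (q 7)) (qx 5 .and (q 7) (q 1)))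
    (.seq (qx 7 .or (q 5) (q 5)) (swapAt 5 P (c (.creg d)))))

/-- The memory with the values `f 0, …, f (a - 1)` written at the addresses from `A` on. -/
def writeMem (M : BitVec w → BitVec w) (A : BitVec w) (f : ℕ → BitVec w) : ℕ → BitVec w → BitVec w
  | 0 => M
  | a + 1 => update (writeMem M A f a) (A + a##w) (f a)

lemma add_ofNat_inj {A : BitVec w} {i : ℕ} (hi : i < 2 ^ w) (hj : j < 2 ^ w) :
    A + i##w = A + j##w ↔ i = j := by
  rw [add_right_inj]; constructor
  · intro h; have := congrArg BitVec.toNat h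
    rwa [toNat_ofNat, toNat_ofNat, mod_eq_of_lt hi, mod_eq_of_lt hj] at this
  · rintro rfl; rfl

lemma writeMem_of_ne {A : BitVec w} {f : ℕ → BitVec w}
    {u : BitVec w} (h : ∀ j < a, u ≠ A + j##w) : writeMem M A f a u = M u := by
  induction a with
  | zero => rfl
  | succ a ih => rw [writeMem, update_of_ne (h a o!), ih fun j hj => h j o!]

lemma writeMem_apply {A : BitVec w} {f : ℕ → BitVec w}
    (ha : a ≤ 2 ^ w) (hj : j < a) : writeMem M A f a (A + j##w) = f j := by
  induction a with
  | zero => omega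
  | succ a ih =>
    rw [writeMem]; by_cases h : j = a
    · subst h; rw [update_self]
    · rw [update_of_ne, ih o! o!]; rw [Ne, add_ofNat_inj o! o!]; exact h

lemma perm_frameProg {a : COperand} (va : Val σ d a na)
    (hP : P.Lt d) (hna : na ≤ w) (h1 : x.1 1 = 0) (h4 : x.1 4 = 0)
    (h5 : x.1 5 = 0) (hm : ∀ j < na, x.2 (P.eval σ + j##w) = 0) :
    (frameProg P a d).perm G d σ x = ((setR x 7 (strip^[na] (x.1 7))).1,
      writeMem x.2 (P.eval σ) (frameBit (x.1 7)) na) := by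
  show (ordProd _ (a.eval σ).toNat : Equiv.Perm (QB w)) x = _; rw [va.toNat (lt_two_pow_of_le hna)]
  suffices h : ∀ b ≤ na, (ordProd (fun j => (RProg.seq (bracket (qx 1 .sub (c (.lit 0)) (q 7))
      (qx 5 .and (q 7) (q 1))) (.seq (qx 7 .or (q 5) (q 5)) (swapAt 5 P (c (.creg d))))).perm G
      (d + 2) (σ.set d j##w)) b : Equiv.Perm (QB w)) x =
      ((setR x 7 (strip^[b] (x.1 7))).1, writeMem x.2 (P.eval σ) (frameBit (x.1 7)) b) from
    h na le_rfl
  intro b; induction b with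
  | zero => intro _; exact (congrArg (fun y : QB w => (y.1, x.2)) (setR_eq_self rfl)).symm
  | succ b ih =>
    intro hb; rw [ordProd, Equiv.Perm.mul_apply, ih o!]; have hb2 : b < 2 ^ w := lt_two_pow_of_le o!
    set y : QB w := ((setR x 7 (strip^[b] (x.1 7))).1,
      writeMem x.2 (P.eval σ) (frameBit (x.1 7)) b) with hy
    have yr : ∀ r : Reg, r ≠ 7 → y.1 r = x.1 r := fun r hr => setR_ne hr
    have y7 : y.1 7 = strip^[b] (x.1 7) := setR_self x 7 _
    have ym : y.2 (P.eval σ + b##w) = 0 := by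
      rw [hy]; refine (writeMem_of_ne fun j hj => ?_).trans (hm b o!)
      rw [Ne, add_ofNat_inj hb2 (lt_two_pow_of_le o!)]; omega
    set σ' := σ.set d b##w with hσ'
    have hv : (COperand.creg d).eval σ' = b##w := val_creg_eval _ _ _
    have hP' : P.eval σ' = P.eval σ := eval_set hP le_rfl σ _
    have e1 : (bracket (qx 1 .sub (c (.lit 0)) (q 7)) (qx 5 .and (q 7) (q 1))).perm G (d + 2) σ' y
        = setR y 5 (lowBit (y.1 7)) := by
      rw [← xorR_of_zero (by rw [yr _ d!, h5])]; refine perm_bracket_xor G ?_ ?_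
      · simp +decide [RProg.All, Gate.Avoids, QOperand.Avoids]
      · simp (disch := decide) only [perm_cr, perm_rr, xorR_self, xorR_ne, yr, h1]
        simp only [WordOp.eval, ofNat_eq_ofNat, bzero_xor, COperand.eval_lit, lowBit]
    rw [perm_seq, e1, perm_seq, perm_rr d! d!, or_self_eval,
      perm_swapAt d! P (i := c (.creg d)) trivial trivial _ _
        (by simp (disch := decide) only [xorR_ne, setR_ne, yr, h4])]
    simp (disch := decide) only [setR_self, QOperand.eval, hv, hP', xorR_mem, setR_mem, ym, xorR_ne]
    have e2 : setR (xorR (setR y 5 (lowBit (y.1 7))) 7 (lowBit (y.1 7))) 5 0 =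
        setR y 7 (strip (y.1 7)) := by
      rw [xorR, setR_ne (show (7 : Reg) ≠ 5 by decide),
        setR_comm _ (show (7 : Reg) ≠ 5 by decide), setR_setR,
        setR_eq_self (x := y) (by rw [yr _ d!, h5]), strip]
    rw [e2, y7]; refine Prod.ext ?_ ?_
    · show update (update x.1 7 _) 7 _ = update x.1 7 _
      rw [Function.update_idem, iterate_succ_apply']
    · rfl

/-! # Dynamic programming over masks -/

/-- The edges of `G`, or the reversed edges, in terms of words. -/
def WordEdge (G : DGraph n) (dir : Bool) (u v : BitVec w) : Prop :=
  if dir then G.Adj (wordVertex n u) (wordVertex n v) else G.Adj (wordVertex n v) (wordVertex n u)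

lemma perm_letop (op : WordOp) (a b : COperand) (p : RProg) (d : ℕ) (σ : CStore w) :
    (RProg.letop op a b p).perm G d σ =
      p.perm G (d + 1) (σ.set d (op.eval (a.eval σ) (b.eval σ))) := rfl

def copyC (Y : Reg) (a : COperand) : RProg := qx Y .or (c a) (c a)

def copyQ (Y X : Reg) : RProg := qx Y .or (q X) (q X)

lemma perm_copyC (Y : Reg) (a : COperand) (d : ℕ) (σ : CStore w)
    (x : QB w) : (copyC Y a).perm G d σ x = xorR x Y (a.eval σ) := by
  rw [copyC, perm_cc, or_self_eval]

lemma perm_copyQ (h : X ≠ Y) (d : ℕ) (σ : CStore w)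
    (x : QB w) : (copyQ Y X).perm G d σ x = xorR x Y (x.1 X) := by
  rw [copyQ, perm_rr h h, or_self_eval]

/-- Extend paths by step number `j`, with the vertex reached in register `8`. -/
def dpExtend (dir : Bool) (P T j m b : COperand) : RProg :=
  bracket (.seq (.seq (.seq (copyQ 9 8) (readAt 9 P (c j))) (readAt 10 T (c m)))
    (.seq (qx 12 .lt (c (.lit 0)) (q 10)) (.seq (.gate (if dir then .qry 15 9 8 else .qry 15 8 9))
    (.seq (qx 1 .and (q 12) (q 15)) (qx 2 .and (q 1) (c b)))))) (qx 11 .shl (q 2) (c j))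

/-- Compute the table entry for the mask `m`. -/
def dpStep (dir : Bool) (P a T m : COperand) (d : ℕ) : RProg :=
  .seq (.seq (copyC 14 m) (.seq (linProg P a d) (copyQ 8 13)))
    (.seq (.seq (qx 11 .eq (c m) (c (.lit 0))) (.seq (.loop false a
      (.letop .shl (.lit 1) (.creg d) (.letop .xor m (.creg (d + 2))
        (.letop .shr m (.creg d) (.letop .and (.creg (d + 4)) (.lit 1)
          (dpExtend dir P T (.creg d) (.creg (d + 3)) (.creg (d + 5))))))))
      (swapAt 11 T (c m))))
      (.seq (copyQ 8 13) (.seq (linProg P a d) (copyC 14 m))))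

/-- Compute the table at address `T` for the masks in the classical list at address `L`. -/
def dpProg (dir : Bool) (P a T L N : COperand) (d : ℕ) : RProg :=
  .loop false N (.letop .add L (.creg d) (.letld (.creg (d + 2))
    (dpStep dir P a T (.creg (d + 3)) (d + 4))))

/-- The scratch registers other than `7` and `13` are clean. -/
def DpScr (x : QB w) : Prop :=
  ∀ r : Reg, (0 < r.val ∧ r.val < 16 ∧ r ≠ 7 ∧ r ≠ 13) → x.1 r = 0

lemma bit_word (m : BitVec w) (j : ℕ) : (m >>> j) &&& 1#w = bw w (m.getLsbD j = true) := by
  have : (m >>> j) &&& 1#w = if m.getLsbD j then 1#w else 0#w := by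
    ext i hi; simp only [BitVec.getElem_and, BitVec.getElem_ushiftRight, getElem_one]
    by_cases h : i = 0
    · subst h; cases m.getLsbD j <;> simp
    · cases m.getLsbD j <;> simp [h, getElem_one]
  rw [this]; by_cases h : m.getLsbD j = true
  · rw [bw_true h, if_pos h]
  · rw [bw_false h, if_neg h]

lemma perm_dpExtend {j m b : COperand} {bP : Prop} (hx : ∀ r : Reg, (0 < r.val ∧ r.val < 16 ∧ r ≠ 7 ∧ r ≠ 13 ∧
      r ≠ 8 ∧ r ≠ 11 ∧ r ≠ 14) → x.1 r = 0) (hb : b.eval σ = bw w bP) :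
    (dpExtend dir P T j m b).perm G d σ x = xorR x 11 (bw w ((x.2 (T.eval σ + m.eval σ) ≠ 0 ∧
      WordEdge G dir (x.1 8 ^^^ x.2 (P.eval σ + j.eval σ)) (x.1 8)) ∧ bP) <<<
        (j.eval σ).toNat) := by
  refine perm_bracket_xor G ?_ ?_
  · cases dir <;> simp +decide [RProg.All, bracket, inv, Gate.Avoids, QOperand.Avoids, readAt,
      swapAt, copyQ]
  · have h4 : x.1 4 = 0 := hx _ d!; have h9 : x.1 9 = 0 := hx _ d!
    set u := x.1 8 ^^^ x.2 (P.eval σ + j.eval σ) with hu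
    set v := x.2 (T.eval σ + m.eval σ) with hv
    have e1 : (RProg.seq (.seq (copyQ 9 8) (readAt 9 P (c j))) (readAt 10 T (c m))).perm G d σ x =
        xorR (xorR x 9 u) 10 v := by
      have q1 : ∀ v, (xorR x 9 v).1 4 = 0 := fun v => by rw [xorR_ne _ _ d!, h4]
      rw [perm_seq, perm_seq, perm_copyQ d!, perm_readAt_c d! _ _ _ _ (q1 _),
        xorR_xorR, perm_readAt_c d! _ _ _ _ (q1 _)]
      rfl
    set y := xorR (xorR x 9 u) 10 v with hy
    have yr : ∀ r : Reg, (r ≠ 9 ∧ r ≠ 10) → y.1 r = x.1 r := fun r hr => by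
      rw [hy, xorR_ne _ _ hr.2, xorR_ne _ _ hr.1]
    have y9 : y.1 9 = u := by
      rw [hy, xorR_ne _ _ d!, xorR_self, h9]; simp only [ofNat_eq_ofNat, bzero_xor]
    have y10 : y.1 10 = v := by
      rw [hy, xorR_self, xorR_ne _ _ d!, hx _ d!]; simp only [ofNat_eq_ofNat, bzero_xor]
    have e2 : ∀ z : QB w, (RProg.gate (if dir then Gate.qry 15 9 8 else
        Gate.qry 15 8 9)).perm G d σ z = xorR z 15 (bw w (WordEdge G dir (z.1 9) (z.1 8))) := by
      intro z; cases dir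
      · exact perm_qry G d! d! d σ z
      · exact perm_qry G d! d! d σ z
    rw [perm_seq, e1]
    simp (disch := decide) only [perm_seq, perm_rc, perm_cr, perm_rr, e2, xorR_self, xorR_ne,
      yr, y9, y10, hx, hb, ofNat_eq_ofNat, bzero_xor, COperand.eval_lit]
    congr 1; rw [WordOp.eval_lt_zero]; simp only [WordOp.eval, bw_and, shiftLeft_eq']; rfl

/-- The table entry for the mask `m`. -/
def dpValue (G : DGraph n) (dir : Bool) (M : BitVec w → BitVec w) (P T : BitVec w)
    (a : ℕ) (s m : BitVec w) : BitVec w :=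
  bw w (m = 0) ^^^ bitWord w (fun j => (M (T + (m ^^^ twoPow w j)) ≠ 0 ∧
    WordEdge G dir ((s ^^^ lin (fun j => M (P + j##w)) a m) ^^^ M (P + j##w))
      (s ^^^ lin (fun j => M (P + j##w)) a m)) ∧ m.getLsbD j = true) a

lemma perm_dpStep {a m : COperand}
    (va : Val σ d a na) (hP : P.Lt d) (hT : T.Lt d) (hm : m.Lt d) (hna : na ≤ w) (hx : DpScr x) (h0 : x.2 (T.eval σ + m.eval σ) = 0)
    (hsep : ∀ j < na, P.eval σ + j##w ≠ T.eval σ + m.eval σ) :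
    (dpStep dir P a T m d).perm G d σ x = setM x (T.eval σ + m.eval σ)
      (dpValue G dir x.2 (P.eval σ) (T.eval σ) na (x.1 13) (m.eval σ)) := by
  set mv := m.eval σ with hmv
  set l := lin (fun j => x.2 (P.eval σ + j##w)) na mv with hl
  have e1 : (RProg.seq (copyC 14 m) (.seq (linProg P a d) (copyQ 8 13))).perm G d σ x =
      setR (setR x 14 mv) 8 (x.1 13 ^^^ l) := by
    have e : xorR x 14 mv = setR x 14 mv := xorR_of_zero (hx _ d!) _
    rw [perm_seq, perm_seq, perm_copyC, ← hmv, e, perm_linProg va hP hna,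
      perm_copyQ d!, xorR_xorR, xorR_of_zero]
    · simp (disch := decide) only [setR_self, setR_mem, xorR_ne, setR_ne]; rw [bxor_comm l]
    · rw [setR_ne d!]; exact hx _ d!
    · refine ⟨?_, ?_, ?_, ?_, ?_, ?_⟩ <;> rw [setR_ne d!] <;> exact hx _ d!
  set f : ℕ → Prop := fun j => (x.2 (T.eval σ + (mv ^^^ twoPow w j)) ≠ 0 ∧
    WordEdge G dir ((x.1 13 ^^^ l) ^^^ x.2 (P.eval σ + j##w)) (x.1 13 ^^^ l)) ∧
      mv.getLsbD j = true with hf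
  set y := setR (setR x 14 mv) 8 (x.1 13 ^^^ l) with hy
  have yr : ∀ r : Reg, (r ≠ 14 ∧ r ≠ 8) → y.1 r = x.1 r := fun r hr => by
    rw [hy, setR_ne hr.2, setR_ne hr.1]
  have ym : y.2 = x.2 := rfl
  have e2 : ∀ z, z = xorR y 11 (bw w (mv = 0)) → (RProg.loop false a
      (.letop .shl (.lit 1) (.creg d) (.letop .xor m (.creg (d + 2))
        (.letop .shr m (.creg d) (.letop .and (.creg (d + 4)) (.lit 1)
          (dpExtend dir P T (.creg d) (.creg (d + 3)) (.creg (d + 5)))))))).perm G d σ z =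
      xorR z 11 (bitWord w f na) := by
    rintro z rfl; show (ordProd _ (a.eval σ).toNat : Equiv.Perm (QB w)) _ = _
    rw [va.toNat (lt_two_pow_of_le hna)]
    have key : ∀ b ≤ na, (ordProd (fun j => (RProg.letop .shl (.lit 1) (.creg d)
        (.letop .xor m (.creg (d + 2)) (.letop .shr m (.creg d) (.letop .and (.creg (d + 4)) (.lit 1)
          (dpExtend dir P T (.creg d) (.creg (d + 3)) (.creg (d + 5))))))).perm G (d + 2)
            (σ.set d j##w)) b : Equiv.Perm (QB w))
            (xorR y 11 (bw w (mv = 0))) =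
          xorR (xorR y 11 (bw w (mv = 0))) 11 (bitWord w f b) := by
      intro b; induction b with
      | zero => intro _; exact (xorR_zero _ _).symm
      | succ b ih =>
        intro hb
        rw [ordProd, Equiv.Perm.mul_apply, ih o!, bitWord, ← xorR_xorR _ _ (bitWord w f b)]
        have hbw : b < 2 ^ w := lt_two_pow_of_le o!; set σ1 := σ.set d b##w with hσ1
        set v2 := WordOp.shl.eval ((COperand.lit 1).eval σ1) ((COperand.creg d).eval σ1) with hv2
        set σ2 := σ1.set (d + 2) v2 with hσ2
        set v3 := WordOp.xor.eval (m.eval σ2) ((COperand.creg (d + 2)).eval σ2) with hv3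
        set σ3 := σ2.set (d + 3) v3 with hσ3
        set v4 := WordOp.shr.eval (m.eval σ3) ((COperand.creg d).eval σ3) with hv4
        set σ4 := σ3.set (d + 4) v4 with hσ4
        set v5 := WordOp.and.eval ((COperand.creg (d + 4)).eval σ4) ((COperand.lit 1).eval σ4)
          with hv5
        set σ5 := σ4.set (d + 5) v5 with hσ5
        have low : ∀ o : COperand, o.Lt d → o.eval σ2 = o.eval σ ∧ o.eval σ3 = o.eval σ ∧
            o.eval σ5 = o.eval σ := by
          intro o ho; have q1 : o.eval σ1 = o.eval σ := eval_set ho le_rfl _ _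
          have q2 : o.eval σ2 = o.eval σ := (eval_set ho o! _ _).trans q1
          have q3 : o.eval σ3 = o.eval σ := (eval_set ho o! _ _).trans q2
          have q4 : o.eval σ4 = o.eval σ := (eval_set ho o! _ _).trans q3
          exact ⟨q2, q3, (eval_set ho o! _ _).trans q4⟩
        have c1 : (COperand.creg d).eval σ1 = b##w := val_creg_eval _ _ _
        have c3 : (COperand.creg d).eval σ3 = b##w := by
          rw [← c1]; exact (set_reg_ne _ _ o!).trans (set_reg_ne _ _ o!)
        have c5 : (COperand.creg d).eval σ5 = b##w := by
          rw [← c3]; exact (set_reg_ne _ _ o!).trans (set_reg_ne _ _ o!)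
        have d5 : (COperand.creg (d + 3)).eval σ5 = mv ^^^ twoPow w b := by
          have : (COperand.creg (d + 3)).eval σ5 = v3 :=
            (set_reg_ne _ _ o!).trans ((set_reg_ne _ _ o!).trans
              (set_reg_self _ _ _))
          rw [this, hv3, (low m hm).1, show (COperand.creg (d + 2)).eval σ2 = v2 from
            val_creg_eval _ _ _, hv2, c1]
          simp only [WordOp.eval, COperand.eval_lit, shiftLeft_eq', toNat_ofNat, mod_eq_of_lt hbw]
          rfl
        have f5 : (COperand.creg (d + 5)).eval σ5 = bw w (mv.getLsbD b = true) := by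
          rw [show (COperand.creg (d + 5)).eval σ5 = v5 from val_creg_eval _ _ _, hv5,
            show (COperand.creg (d + 4)).eval σ4 = v4 from val_creg_eval _ _ _, hv4,
            (low m hm).2.1, c3]
          simp only [WordOp.eval, COperand.eval_lit, BitVec.ushiftRight_eq', toNat_ofNat,
            mod_eq_of_lt hbw, bit_word]
          rfl
        rw [perm_letop, perm_letop, perm_letop, perm_letop,
          perm_dpExtend (σ := σ5) (bP := mv.getLsbD b = true) ?_ f5]
        · rw [c5, d5, (low P hP).2.2, (low T hT).2.2, toNat_ofNat, mod_eq_of_lt hbw]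
          simp (disch := decide) only [xorR_mem, xorR_ne]; rw [hy, setR_self]; rfl
        · intro r hr; obtain ⟨r1, r2, r3, r4, r5, r6, r7⟩ := hr
          rw [xorR_ne _ _ r6, xorR_ne _ _ r6, yr _ ⟨r7, r5⟩]; exact hx r ⟨r1, r2, r3, r4⟩
    exact key na le_rfl
  set LP : RProg := .loop false a
      (.letop .shl (.lit 1) (.creg d) (.letop .xor m (.creg (d + 2))
        (.letop .shr m (.creg d) (.letop .and (.creg (d + 4)) (.lit 1)
          (dpExtend dir P T (.creg d) (.creg (d + 3)) (.creg (d + 5))))))) with hLP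
  have e0 : (dpStep dir P a T m d).perm G d σ x =
      (RProg.seq (copyQ 8 13) (.seq (linProg P a d) (copyC 14 m))).perm G d σ
        ((swapAt 11 T (c m)).perm G d σ (LP.perm G d σ ((qx 11 .eq (c m) (c (.lit 0))).perm G d σ
          ((RProg.seq (copyC 14 m) (.seq (linProg P a d) (copyQ 8 13))).perm G d σ x)))) := rfl
  rw [e0, e1, perm_cc, WordOp.eval_eq_eq,
    show (COperand.lit 0).eval σ = (0 : BitVec w) from rfl, ← hmv, e2 _ rfl, xorR_xorR]
  set V := bw w (mv = 0) ^^^ bitWord w f na with hV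
  have e3 : xorR y 11 V = setR y 11 V := xorR_of_zero (by
    rw [yr _ d!]; exact hx _ d!) _
  have h4 : (setR y 11 V).1 4 = 0 := by
    rw [setR_ne d!, yr _ d!]; exact hx _ d!
  rw [e3, perm_swapAt d! T (i := c m) trivial trivial _ _ h4]
  simp only [QOperand.eval, ← hmv, setR_mem, setR_setR, setR_self]
  rw [show y.2 (T.eval σ + mv) = 0 from h0, setR_eq_self (x := y) (by
    rw [yr _ d!]; exact hx _ d!)]
  set z := setM y (T.eval σ + mv) V with hz
  have z8 : z.1 8 = x.1 13 ^^^ l := by rw [hz, setM_reg, hy, setR_self]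
  have zr : ∀ r : Reg, (r ≠ 14 ∧ r ≠ 8) → z.1 r = x.1 r := yr
  have z14 : z.1 14 = mv := by
    show y.1 14 = mv; rw [hy, setR_ne d!, setR_self]
  have z13 : z.1 13 = x.1 13 := zr _ d!; have zl : lin (fun j => z.2 (P.eval σ + j##w)) na mv = l :=
    lin_congr (fun j hj => by rw [hz, setM_ne _ _ (hsep j hj)]; rfl) mv
  rw [perm_seq, perm_seq, perm_copyQ d!, z13, perm_linProg va hP hna, perm_copyC]
  · simp (disch := decide) only [xorR_ne, xorR_mem, z14, zl, xorR_xorR, ← hmv]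
    have : x.1 13 ^^^ l = z.1 8 := z8.symm
    rw [this, show xorR z 8 (z.1 8) = setR z 8 0 by rw [xorR, bxor_self]; rfl, xorR,
      setR_ne d!, z14, bxor_self]
    show setR (setR (setM (setR (setR x 14 mv) 8 (x.1 13 ^^^ l)) _ V) 8 0) 14 0 = _
    rw [setM_setR, setM_setR, setR_setR, setR_comm _ d!, setR_setR,
      setR_eq_self (x := setM x (T.eval σ + mv) V) (hx 14 d!),
      setR_eq_self (x := setM x (T.eval σ + mv) V) (hx 8 d!)]
    rfl
  · refine ⟨?_, ?_, ?_, ?_, ?_, ?_⟩ <;> rw [xorR_ne _ _ d!, zr _ d!] <;>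
      exact hx _ d!

/-- Lists of masks that contain the submasks of each member before it. -/
structure MaskList (L : ℕ → BitVec w) (N : ℕ) : Prop where
  inj : ∀ i < N, ∀ i' < N, L i = L i' → i = i'
  sub : ∀ i < N, ∀ j, (L i).getLsbD j = true → ∃ i' < i, L i' = L i ^^^ twoPow w j

lemma perm_dpProg {a L N : COperand} {nN : ℕ}
    {Lw : ℕ → BitVec w} (va : Val σ d a na) (vN : Val σ d N nN) (hP : P.Lt d) (hT : T.Lt d)
    (hL : L.Lt d) (hna : na ≤ w) (hN : nN < 2 ^ w)
    (hmem : ∀ i < nN, σ.mem (L.eval σ + i##w) = Lw i) (hLw : MaskList Lw nN) (hx : DpScr x) (h0 : ∀ i < nN, x.2 (T.eval σ + Lw i) = 0)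
    (hsep : ∀ i < nN, ∀ j < na, P.eval σ + j##w ≠ T.eval σ + Lw i) :
    ((dpProg dir P a T L N d).perm G d σ x).1 = x.1 ∧
    (∀ u, (∀ i < nN, u ≠ T.eval σ + Lw i) → ((dpProg dir P a T L N d).perm G d σ x).2 u = x.2 u) ∧
    ∀ i < nN, ((dpProg dir P a T L N d).perm G d σ x).2 (T.eval σ + Lw i) ≠ 0 ↔
      FReach (WordEdge G dir) (x.1 13) (fun j => x.2 (P.eval σ + j##w)) na (Lw i) := by
  have hbase : (dpProg dir P a T L N d).perm G d σ = (ordProd (fun j => (RProg.letop .add L (.creg d)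
      (.letld (.creg (d + 2)) (dpStep dir P a T (.creg (d + 3)) (d + 4)))).perm G (d + 2)
        (σ.set d j##w)) nN : Equiv.Perm (QB w)) := by
    rw [← vN.toNat hN]; rfl
  rw [hbase]
  set F : ℕ → Equiv.Perm (QB w) := fun j => (RProg.letop .add L (.creg d)
      (.letld (.creg (d + 2)) (dpStep dir P a T (.creg (d + 3)) (d + 4)))).perm G (d + 2)
        (σ.set d j##w) with hF
  suffices key : ∀ b ≤ nN, (ordProd F b x).1 = x.1 ∧
      (∀ u, (∀ i < b, u ≠ T.eval σ + Lw i) → (ordProd F b x).2 u = x.2 u) ∧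
      ∀ i < b, (ordProd F b x).2 (T.eval σ + Lw i) ≠ 0 ↔
        FReach (WordEdge G dir) (x.1 13) (fun j => x.2 (P.eval σ + j##w)) na (Lw i) from
    key nN le_rfl
  intro b; induction b with
  | zero => intro _; exact ⟨rfl, fun u _ => rfl, fun i hi => by omega⟩
  | succ b ih =>
    intro hb; obtain ⟨i1, i2, i3⟩ := ih o!; set y := ordProd F b x with hy
    have hprod : ordProd F (b + 1) x = F b y := rfl; set σ1 := σ.set d b##w with hσ1
    set v2 := WordOp.add.eval (L.eval σ1) ((COperand.creg d).eval σ1) with hv2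
    set σ2 := σ1.set (d + 2) v2 with hσ2
    set σ3 := σ2.set (d + 3) (σ2.mem ((COperand.creg (d + 2)).eval σ2)) with hσ3
    have low : ∀ o : COperand, o.Lt d → o.eval σ3 = o.eval σ := fun o ho =>
      (eval_set ho o! _ _).trans ((eval_set ho o! _ _).trans
        (eval_set ho le_rfl _ _))
    have e2 : v2 = L.eval σ + b##w := by
      rw [hv2, hσ1, val_creg_eval, eval_set hL le_rfl]; rfl
    have e3 : (COperand.creg (d + 3)).eval σ3 = Lw b := by
      rw [hσ3, val_creg_eval, hσ2, val_creg_eval, e2]; exact hmem b o!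
    have va3 : Val σ3 (d + 4) a na := ⟨va.1.mono o!, (low a va.1).trans va.2⟩
    have yP : ∀ j < na, y.2 (P.eval σ + j##w) = x.2 (P.eval σ + j##w) :=
      fun j hj => i2 _ fun i hi => hsep i o! j hj
    have hstep : F b y = setM y (T.eval σ + Lw b)
        (dpValue G dir y.2 (P.eval σ) (T.eval σ) na (y.1 13) (Lw b)) := by
      show (dpStep dir P a T (.creg (d + 3)) (d + 4)).perm G (d + 4) σ3 y = _
      rw [perm_dpStep va3 (hP.mono o!) (hT.mono o!)
        (show (COperand.creg (d + 3)).Lt (d + 4) from Nat.lt_succ_self _) hna, low T hT, low P hP, e3]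
      · intro r hr; rw [i1]; exact hx r hr
      · rw [low T hT, e3, i2, h0 b o!]; intro i hi h; have := hLw.inj b o! i o! (by simpa using h)
        omega
      · intro j hj; rw [low T hT, low P hP, e3]; exact hsep b o! j hj
    rw [hprod, hstep]; refine ⟨i1, fun u hu => ?_, fun i hi => ?_⟩
    · rw [setM_ne _ _ (hu b o!)]; exact i2 u fun i hi => hu i o!
    · by_cases hib : i = b
      · subst hib; rw [setM_self, dpValue, i1]
        have hl : lin (fun j => y.2 (P.eval σ + j##w)) na (Lw i) =
            lin (fun j => x.2 (P.eval σ + j##w)) na (Lw i) := lin_congr yP _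
        rw [hl]; by_cases hz : Lw i = 0
        · have e0 : bitWord w (fun j => (y.2 (T.eval σ + (Lw i ^^^ twoPow w j)) ≠ 0 ∧
              WordEdge G dir ((x.1 13 ^^^ lin (fun j => x.2 (P.eval σ + j##w)) na (Lw i))
                ^^^ y.2 (P.eval σ + j##w))
              (x.1 13 ^^^ lin (fun j => x.2 (P.eval σ + j##w)) na (Lw i))) ∧
                (Lw i).getLsbD j = true) na = 0 := by
            by_contra hne; obtain ⟨j, hj, -, hj2⟩ := (bitWord_ne_zero hna _).1 hne
            rw [hz] at hj2; simp at hj2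
          rw [e0, bw_true hz, hz]; refine iff_of_true ?_ .zero; by_cases hw : w = 0
          · exfalso; subst hw; simp at hN; omega
          · have h1 : 1 < 2 ^ w := Nat.one_lt_two_pow hw; intro hc; have := congrArg BitVec.toNat hc
            simp [mod_eq_of_lt h1] at this
        · rw [bw_false hz, show (0#w : BitVec w) = 0 from rfl, ofNat_eq_ofNat,
            bzero_xor, ← ofNat_eq_ofNat, bitWord_ne_zero hna, FReach.iff_of_ne hz]
          refine exists_congr fun j => and_congr_right fun hj => ?_
          have hP2 : (x.1 13 ^^^ lin (fun j => x.2 (P.eval σ + j##w)) na (Lw i)) ^^^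
              y.2 (P.eval σ + j##w) = x.1 13 ^^^
                lin (fun j => x.2 (P.eval σ + j##w)) na (Lw i ^^^ twoPow w j) := by
            rw [lin_xor, lin_twoPow _ hj o!, yP j hj, xor_assoc]
          rw [hP2]; constructor
          · rintro ⟨⟨t1, t2⟩, t3⟩; obtain ⟨i', hi', e⟩ := hLw.sub i o! j t3; rw [← e] at t1
            exact ⟨t3, e ▸ (i3 i' hi').1 t1, t2⟩
          · rintro ⟨t3, t1, t2⟩; obtain ⟨i', hi', e⟩ := hLw.sub i o! j t3; rw [← e] at t1 ⊢
            exact ⟨⟨(i3 i' hi').2 t1, e ▸ t2⟩, t3⟩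
      · rw [setM_ne]
        · exact i3 i o!
        · intro h; exact hib (hLw.inj i o! b o! (by simpa using h))

/-! # Lists of masks of small weight -/

/-- The number of sets of fewer than `h` elements below `a`. -/
def listLen : ℕ → ℕ → ℕ
  | _, 0 => 0
  | 0, _ + 1 => 1
  | a + 1, h + 1 => listLen a (h + 1) + listLen a h

/-- Entry number `i` in the list of the masks below `2 ^ a` with fewer than `h` elements. -/
def listEntry (w : ℕ) : ℕ → ℕ → ℕ → BitVec w
  | 0, _, _ => 0
  | a + 1, h, i => if i < listLen a h then listEntry w a h i
      else listEntry w a (h - 1) (i - listLen a h) ^^^ twoPow w a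

/-- The number of elements of a mask. -/
def weight (v : BitVec w) : ℕ := ((range w).filter fun i => v.getLsbD i = true).card

lemma listLen_zero (a : ℕ) : listLen a 0 = 0 := by cases a <;> rfl

lemma listLen_succ (a h : ℕ) : listLen (a + 1) h = listLen a h + listLen a (h - 1) := by
  cases h with
  | zero => simp [listLen_zero]
  | succ h => rfl

lemma listLen_mono_succ (a h : ℕ) : listLen a h ≤ listLen (a + 1) h := by
  rw [listLen_succ]; omega

lemma listLen_mono {a' : ℕ} (h : a ≤ a') (t : ℕ) : listLen a t ≤ listLen a' t := by
  induction h with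
  | refl => exact le_rfl
  | step _ ih => exact ih.trans (listLen_mono_succ _ _)

lemma listLen_mono_right (a h : ℕ) : listLen a h ≤ listLen a (h + 1) := by
  induction a generalizing h with
  | zero => cases h <;> simp [listLen]
  | succ a ih =>
    cases h with
    | zero => simp [listLen_zero]
    | succ h =>
      have h1 := ih (h + 1); have h2 := ih h; simp only [listLen]; omega

lemma listEntry_prefix {a' : ℕ} (h : a ≤ a') {t i : ℕ} (hi : i < listLen a t) :
    listEntry w a' t i = listEntry w a t i := by
  induction h with
  | refl => rfl
  | step h ih =>
    rw [listEntry, if_pos (lt_of_lt_of_le hi (listLen_mono h t)), ih]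

lemma listEntry_lt (a h i : ℕ) : (listEntry w a h i).toNat < 2 ^ a := by
  induction a generalizing h i with
  | zero => simp [listEntry]
  | succ a ih =>
    have h2 : 2 ^ a ≤ 2 ^ (a + 1) := two_pow_le o!; rw [listEntry]; split_ifs
    · exact lt_of_lt_of_le (ih _ _) h2
    · exact xor_twoPow_lt (lt_of_lt_of_le (ih _ _) h2) o!

lemma getLsbD_listEntry {h i : ℕ} (hj : a ≤ j) : (listEntry w a h i).getLsbD j = false :=
  getLsbD_of_lt (lt_of_lt_of_le (listEntry_lt a h i) (two_pow_le hj))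

lemma listEntry_incl {h i : ℕ} (hi : i < listLen a h) :
    ∃ i' < listLen a (h + 1), listEntry w a (h + 1) i' = listEntry w a h i := by
  induction a generalizing h i with
  | zero => exact ⟨0, by simp [listLen], rfl⟩
  | succ a ih =>
    rw [listLen_succ] at hi ⊢; by_cases h1 : i < listLen a h
    · obtain ⟨i', hi', e⟩ := ih h1; refine ⟨i', by omega, ?_⟩
      rw [listEntry, if_pos hi', e, listEntry, if_pos h1]
    · have h0 : h ≠ 0 := by rintro rfl; simp [listLen_zero] at hi
      obtain ⟨i', hi', e⟩ := ih (h := h - 1) (i := i - listLen a h) o!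
      rw [show h - 1 + 1 = h by omega] at hi' e
      refine ⟨listLen a (h + 1) + i', by simpa using hi', ?_⟩
      rw [listEntry, if_neg o!, show h + 1 - 1 = h by omega, Nat.add_sub_cancel_left, e,
        listEntry, if_neg h1]

lemma maskList_listEntry (ha : a ≤ w) (h : ℕ) :
    MaskList (listEntry w a h) (listLen a h) := by
  induction a generalizing h with
  | zero =>
    have h1 : listLen 0 h ≤ 1 := by cases h <;> simp [listLen]
    exact ⟨fun i hi i' hi' _ => by omega, fun i _ j hj => by simp [listEntry] at hj⟩
  | succ a ih =>
    have hbit : ∀ h i, (listEntry w a h i ^^^ twoPow w a).getLsbD a = true := by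
      intro h i; rw [getLsbD_xor, getLsbD_listEntry le_rfl, getLsbD_twoPow]
      simp; omega
    rw [listLen_succ]; refine ⟨fun i hi i' hi' e => ?_, fun i hi j hj => ?_⟩
    · simp only [listEntry] at e; split_ifs at e with h1 h2 h2
      · exact (ih o! h).inj i h1 i' h2 e
      · have := hbit (h - 1) (i' - listLen a h)
        rw [← e, getLsbD_listEntry le_rfl] at this; simp at this
      · have := hbit (h - 1) (i - listLen a h)
        rw [e, getLsbD_listEntry le_rfl] at this; simp at this
      · have := (ih o! (h - 1)).inj (i - listLen a h) o! (i' - listLen a h)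
          o! (by simpa using e)
        omega
    · simp only [listEntry] at hj ⊢; split_ifs at hj with h1
      · obtain ⟨i', hi', e⟩ := (ih o! h).sub i h1 j hj
        exact ⟨i', hi', by rw [if_pos o!, if_pos h1, e]⟩
      · rw [if_neg h1]; by_cases hja : j = a
        · subst hja; have h0 : h ≠ 0 := by rintro rfl; simp [listLen_zero] at hi
          obtain ⟨i', hi', e⟩ := listEntry_incl (w := w) (a := j) (h := h - 1)
            (i := i - listLen j h) o!
          rw [show h - 1 + 1 = h by omega] at hi' e; refine ⟨i', by omega, ?_⟩
          rw [if_pos hi', e, xor_assoc, bxor_self, bxor_zero]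
        · rw [getLsbD_xor, getLsbD_twoPow] at hj
          have hj' : (listEntry w a (h - 1) (i - listLen a h)).getLsbD j = true := by
            simpa [show a ≠ j by omega] using hj
          obtain ⟨i', hi', e⟩ := (ih o! (h - 1)).sub _ o! j hj'
          refine ⟨listLen a h + i', by omega, ?_⟩
          rw [if_neg o!, Nat.add_sub_cancel_left, e, xor_assoc, xor_assoc, bxor_comm (twoPow w j)]

lemma weight_xor_twoPow (hj : j < w) (hv : v.getLsbD j = false) :
    weight (v ^^^ twoPow w j) = weight v + 1 := by
  rw [weight, weight, ← Finset.card_insert_of_notMem (a := j) (by simp [hv])]; congr 1; ext i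
  simp only [mem_filter, mem_range, Finset.mem_insert, getLsbD_xor, getLsbD_twoPow]
  by_cases hi : i = j
  · subst hi; rw [hv]; simp [hj]
  · simp [hi, Ne.symm hi]

lemma exists_listEntry (ha : a ≤ w) {h : ℕ} (hv : v.toNat < 2 ^ a)
    (hw : weight v < h) : ∃ i < listLen a h, listEntry w a h i = v := by
  induction a generalizing h v with
  | zero =>
    have h0 : v = 0 := by
      rw [← toNat_inj]; simpa using hv
    cases h with
    | zero => omega
    | succ h => exact ⟨0, by simp [listLen], by rw [h0]; rfl⟩
  | succ a ih =>
    rw [listLen_succ]; cases hb : v.getLsbD a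
    · have : v.toNat < 2 ^ a := by
        by_contra hc; have h2 : v.toNat / 2 ^ a = 1 := by
          have h3 : v.toNat / 2 ^ a < 2 := Nat.div_lt_of_lt_mul (by rw [← pow_succ]; exact hv)
          have h4 : 0 < v.toNat / 2 ^ a := Nat.div_pos o! (by positivity); omega
        rw [BitVec.getLsbD, Nat.testBit_eq_decide_div_mod_eq, h2] at hb; simp at hb
      obtain ⟨i, hi, e⟩ := ih o! this hw; exact ⟨i, by omega, by rw [listEntry, if_pos hi, e]⟩
    · have h1 := toNat_xor_twoPow' (show a < w by omega) hb
      have h2 : (v ^^^ twoPow w a).getLsbD a = false := by simp [hb]; omega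
      have h3 := weight_xor_twoPow (show a < w by omega) h2
      rw [xor_assoc, bxor_self, bxor_zero] at h3
      obtain ⟨i, hi, e⟩ := ih (h := h - 1) (v := v ^^^ twoPow w a) o!
        (by rw [pow_succ] at hv; omega) o!
      refine ⟨listLen a h + i, by omega, ?_⟩
      rw [listEntry, if_neg o!, Nat.add_sub_cancel_left, e, xor_assoc, bxor_self, bxor_zero]

lemma listLen_le_two_pow (a h : ℕ) : listLen a h ≤ 2 ^ a := by
  induction a generalizing h with
  | zero => cases h <;> simp [listLen]
  | succ a ih => rw [listLen_succ, pow_succ]; have := ih h; have := ih (h - 1); omega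

/-! # The organization of the quantum memory -/

/-- Address `v` in region `r` of the memory. -/
def region (n : ℕ) (r : ℕ) (v : BitVec w) : BitVec w :=
  (r * 2 ^ (n + 40))##w + v

lemma toNat_region (hw : 128 * (n + 1) ≤ w) {r : ℕ} (hr : r < 2 ^ (n + 20))
    (hv : v.toNat < 2 ^ (n + 40)) : (region n r v).toNat = r * 2 ^ (n + 40) + v.toNat := by
  have h1 : (r + 1) * 2 ^ (n + 40) ≤ 2 ^ w :=
    calc (r + 1) * 2 ^ (n + 40) ≤ 2 ^ (n + 20) * 2 ^ (n + 40) := Nat.mul_le_mul_right _ hr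
      _ = 2 ^ (n + 20 + (n + 40)) := (pow_add _ _ _).symm
      _ ≤ 2 ^ w := two_pow_le o!
  have h2 : r * 2 ^ (n + 40) + v.toNat < 2 ^ w := by rw [add_mul] at h1; omega
  rw [region, BitVec.toNat_add, toNat_ofNat, mod_eq_of_lt (by omega : r * 2 ^ (n + 40) <
    2 ^ w), mod_eq_of_lt h2]

lemma region_inj (hw : 128 * (n + 1) ≤ w) {r r' : ℕ} (hr : r < 2 ^ (n + 20))
    (hr' : r' < 2 ^ (n + 20)) {v' : BitVec w} (hv : v.toNat < 2 ^ (n + 40))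
    (hv' : v'.toNat < 2 ^ (n + 40)) (h : region n r v = region n r' v') : r = r' ∧ v = v' := by
  have h1 := congrArg BitVec.toNat h; rw [toNat_region hw hr hv, toNat_region hw hr' hv'] at h1
  have h2 := congrArg (· / 2 ^ (n + 40)) h1; have h3 := congrArg (· % 2 ^ (n + 40)) h1
  have h0 : 0 < 2 ^ (n + 40) := by positivity
  simp only [mul_comm _ (2 ^ (n + 40)), Nat.mul_add_div h0, Nat.div_eq_of_lt hv,
    Nat.div_eq_of_lt hv', Nat.mul_add_mod, mod_eq_of_lt hv, mod_eq_of_lt hv'] at h2 h3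
  exact ⟨o!, BitVec.eq_of_toNat_eq h3⟩

lemma toNat_ofNat_of_lt {v : ℕ} (hb : b ≤ w) (hv : v < 2 ^ b) : (v##w).toNat = v := by
  rw [toNat_ofNat, mod_eq_of_lt (lt_of_lt_of_le hv (two_pow_le hb))]

/-! # Programs for tables in regions -/

/-- The constants and lists that the programs find in the classical registers and memory. -/
structure Ctx (n H : ℕ) (σ : CStore w) : Prop where
  hw : 128 * (n + 1) ≤ w
  hH : H ≤ n + 4
  reg1 : σ.reg 1 = (2 ^ (n + 40))##w
  reg2 : σ.reg 2 = (2 ^ n - 1)##w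
  reg3 : σ.reg 3 = (n + 8)##w
  reg4 : σ.reg 4 = w##w
  reg5 : ∀ r, 1 ≤ r → r ≤ 3 → σ.reg (4 + r) = (r * 2 ^ (n + 40))##w
  len : ∀ a ≤ n, ∀ h ≤ H + 1, σ.mem (a * (n + 8) + h)##w = (listLen a h)##w
  list : ∀ h ≤ H + 1, ∀ i < listLen n h, σ.mem (region n h i##w) = listEntry w n h i

lemma Ctx.set (h : Ctx n H σ) {e : ℕ} (he : 8 ≤ e) (v : BitVec w) : Ctx n H (σ.set e v) where
  hw := h.hw
  hH := h.hH
  reg1 := by rw [set_reg_ne _ _ o!]; exact h.reg1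
  reg2 := by rw [set_reg_ne _ _ o!]; exact h.reg2
  reg3 := by rw [set_reg_ne _ _ o!]; exact h.reg3
  reg4 := by rw [set_reg_ne _ _ o!]; exact h.reg4
  reg5 := fun r h1 h2 => by rw [set_reg_ne _ _ o!]; exact h.reg5 r h1 h2
  len := h.len
  list := h.list

/-- Run `p` with the address and the length of the classical list for `a` and `h + 1`. -/
def withList (a h : COperand) (p : COperand → COperand → ℕ → RProg) (d : ℕ) : RProg :=
  .letop .mul a (.creg 3) (.letop .add (.creg d) h (.letop .add (.creg (d + 1)) (.lit 1)
    (.letld (.creg (d + 2)) (.letop .add h (.lit 1) (.letop .mul (.creg (d + 4)) (.creg 1)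
      (p (.creg (d + 5)) (.creg (d + 3)) (d + 6)))))))

/-- The table for masks with at most `h` elements in the frame at `P`, of length `a`. -/
def dpList (dir : Bool) (P T a h : COperand) : ℕ → RProg := withList a h (dpProg dir P a T)

/-- `v` is a mask below `2 ^ a` with at most `h` elements. -/
def InList (a h : ℕ) (v : BitVec w) : Prop :=
  ∃ i < listLen a (h + 1), listEntry w a (h + 1) i = v

/-- The contents of a table. -/
def TabSem (G : DGraph n) (dir : Bool) (s : BitVec w) (P : ℕ → BitVec w) (a h : ℕ)
    (v : BitVec w) : Prop := InList a h v ∧ FReach (WordEdge G dir) s P a v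

lemma Val.add_region {p : ℕ}
    (h : Val σ d P (p * 2 ^ (n + 40))) (v : BitVec w) : P.eval σ + v = region n p v := by
  rw [h.2]; rfl

lemma listEntry_lt' (hw : 128 * (n + 1) ≤ w) (ha : a ≤ n) (h i : ℕ) :
    (listEntry w a h i).toNat < 2 ^ (n + 40) :=
  lt_of_lt_of_le (listEntry_lt a h i) (two_pow_le o!)

lemma small_lt_region (hw : 128 * (n + 1) ≤ w) (hj : j < n) :
    (j##w).toNat < 2 ^ (n + 40) := by
  have h1 : j < 2 ^ (n + 40) := lt_of_lt_of_le (lt_trans hj Nat.lt_two_pow_self)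
    (two_pow_le o!)
  rwa [toNat_ofNat_of_lt o! h1]

lemma withList_env (hσ : Ctx n H σ) {a h : COperand}
    (hd : 8 ≤ d) (va : Val σ d a na) (vh : Val σ d h nh) (hna : na ≤ n) (hnh : nh ≤ H) :
    ∃ σ' : CStore w, σ'.mem = σ.mem ∧ (∀ {o u}, Val σ d o u → Val σ' (d + 6) o u) ∧
      Val σ' (d + 6) (.creg (d + 3)) (listLen na (nh + 1)) ∧
      Val σ' (d + 6) (.creg (d + 5)) ((nh + 1) * 2 ^ (n + 40)) ∧
      (∀ p, (withList a h p d).perm G d σ = (p (.creg (d + 5)) (.creg (d + 3)) (d + 6)).perm G (d + 6) σ') ∧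
      ∀ Φ : RProg → ℕ → CStore w → ℕ → Prop,
        (∀ op a b p d σ c, Φ p (d + 1) (σ.set d (WordOp.eval op (a.eval σ) (b.eval σ))) c →
          Φ (.letop op a b p) d σ (c + 1)) →
        (∀ a p d σ c, Φ p (d + 1) (σ.set d (σ.mem (a.eval σ))) c → Φ (.letld a p) d σ (c + 1)) →
        ∀ p c, Φ (p (.creg (d + 5)) (.creg (d + 3)) (d + 6)) (d + 6) σ' c →
          Φ (withList a h p d) d σ (c + 6) := by
  have hH := hσ.hH
  set σ1 := σ.set d (WordOp.mul.eval (a.eval σ) ((COperand.creg 3).eval σ)) with hσ1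
  set σ2 := σ1.set (d + 1) (WordOp.add.eval ((COperand.creg d).eval σ1) (h.eval σ1)) with hσ2
  set σ3 := σ2.set (d + 2)
    (WordOp.add.eval ((COperand.creg (d + 1)).eval σ2) ((COperand.lit 1).eval σ2)) with hσ3
  set σ4 := σ3.set (d + 3) (σ3.mem ((COperand.creg (d + 2)).eval σ3)) with hσ4
  set σ5 := σ4.set (d + 4) (WordOp.add.eval (h.eval σ4) ((COperand.lit 1).eval σ4)) with hσ5
  set σ6 := σ5.set (d + 5)
    (WordOp.mul.eval ((COperand.creg (d + 4)).eval σ5) ((COperand.creg 1).eval σ5)) with hσ6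
  have low : ∀ o : COperand, o.Lt d → o.eval σ1 = o.eval σ ∧ o.eval σ4 = o.eval σ ∧
      o.eval σ5 = o.eval σ ∧ o.eval σ6 = o.eval σ := by
    intro o ho; have q1 : o.eval σ1 = o.eval σ := eval_set ho le_rfl _ _
    have q2 : o.eval σ2 = o.eval σ := (eval_set ho o! _ _).trans q1
    have q3 : o.eval σ3 = o.eval σ := (eval_set ho o! _ _).trans q2
    have q4 : o.eval σ4 = o.eval σ := (eval_set ho o! _ _).trans q3
    have q5 : o.eval σ5 = o.eval σ := (eval_set ho o! _ _).trans q4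
    exact ⟨q1, q4, q5, (eval_set ho o! _ _).trans q5⟩
  have c1 : (COperand.creg d).eval σ1 = (na * (n + 8))##w := by
    rw [hσ1, val_creg_eval, va.2, COperand.eval, hσ.reg3, ofNat_mul]; rfl
  have c2 : (COperand.creg (d + 1)).eval σ2 = (na * (n + 8) + nh)##w := by
    rw [hσ2, val_creg_eval, c1, (low h vh.1).1, vh.2, ofNat_add]; rfl
  have c3 : (COperand.creg (d + 2)).eval σ3 = (na * (n + 8) + (nh + 1))##w := by
    rw [hσ3, val_creg_eval, c2, COperand.eval_lit, ← add_assoc, ofNat_add (_ + _) 1]; rfl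
  have c4 : (COperand.creg (d + 3)).eval σ4 = (listLen na (nh + 1))##w := by
    rw [hσ4, val_creg_eval, c3]; exact hσ.len na hna (nh + 1) o!
  have c4' : (COperand.creg (d + 3)).eval σ6 = (listLen na (nh + 1))##w := by
    rw [← c4]; exact (set_reg_ne _ _ o!).trans (set_reg_ne _ _ o!)
  have c5 : (COperand.creg (d + 4)).eval σ5 = (nh + 1)##w := by
    rw [hσ5, val_creg_eval, (low h vh.1).2.1, vh.2, COperand.eval_lit, ofNat_add]; rfl
  have r1 : (COperand.creg 1).Lt d := show 1 < d by omega
  have c6 : (COperand.creg (d + 5)).eval σ6 = ((nh + 1) * 2 ^ (n + 40))##w := by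
    rw [hσ6, val_creg_eval, c5, (low _ r1).2.2.1, COperand.eval, hσ.reg1, ofNat_mul]; rfl
  refine ⟨σ6, rfl, fun ho => ⟨ho.1.mono o!, (low _ ho.1).2.2.2.trans ho.2⟩,
    ⟨show d + 3 < d + 6 by omega, c4'⟩, ⟨show d + 5 < d + 6 by omega, c6⟩, fun _ => rfl,
    fun Φ h1 h2 p c h => ?_⟩
  exact h1 _ _ _ _ d σ (c + 5) (h1 _ _ _ _ (d + 1) σ1 (c + 4) (h1 _ _ _ _ (d + 2) σ2 (c + 3)
    (h2 _ _ (d + 3) σ3 (c + 2) (h1 _ _ _ _ (d + 4) σ4 (c + 1) (h1 _ _ _ _ (d + 5) σ5 c h)))))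

lemma perm_dpList (hσ : Ctx n H σ) {a h : COperand}
    {p t : ℕ} (hd : 8 ≤ d) (va : Val σ d a na) (vh : Val σ d h nh)
    (vP : Val σ d P (p * 2 ^ (n + 40))) (vT : Val σ d T (t * 2 ^ (n + 40))) (hna : na ≤ n)
    (hnh : nh ≤ H) (hpt : p ≠ t) (hp : p < 2 ^ (n + 20)) (ht : t < 2 ^ (n + 20)) (hx : DpScr x)
    (h0 : ∀ v : BitVec w, v.toNat < 2 ^ (n + 40) → x.2 (region n t v) = 0) :
    ((dpList dir P T a h d).perm G d σ x).1 = x.1 ∧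
    (∀ u, (∀ v : BitVec w, v.toNat < 2 ^ (n + 40) → u ≠ region n t v) →
      ((dpList dir P T a h d).perm G d σ x).2 u = x.2 u) ∧
    ∀ v : BitVec w, v.toNat < 2 ^ (n + 40) →
      (((dpList dir P T a h d).perm G d σ x).2 (region n t v) ≠ 0 ↔
        TabSem G dir (x.1 13) (fun j => x.2 (region n p j##w)) na nh v) := by
  have hw := hσ.hw; have hH := hσ.hH
  obtain ⟨σ', hm, up, vN, vL, hp', -⟩ := withList_env (G := G) hσ hd va vh hna hnh
  have hlen : listLen na (nh + 1) < 2 ^ w := by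
    have := listLen_le_two_pow na (nh + 1); have h2 : 2 ^ na < 2 ^ w := two_pow_lt o!; omega
  have hlt : ∀ i, (listEntry w na (nh + 1) i).toNat < 2 ^ (n + 40) := listEntry_lt' hw hna (nh + 1)
  have := perm_dpProg (G := G) (dir := dir) (x := x) (Lw := listEntry w na (nh + 1)) (up va) vN
    (up vP).1 (up vT).1 vL.1 o! hlen (fun i hi => by
      rw [vL.add_region, ← listEntry_prefix hna hi, hm]
      exact hσ.list (nh + 1) o! i (lt_of_lt_of_le hi (listLen_mono hna _)))
    (maskList_listEntry o! _) hx
    (fun i hi => by rw [(up vT).add_region]; exact h0 _ (hlt i))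
    (fun i hi j hj hc => by
      rw [(up vT).add_region, (up vP).add_region] at hc
      exact hpt (region_inj hw hp ht (small_lt_region hw o!) (hlt i) hc).1)
  obtain ⟨h1, h2, h3⟩ := this; simp only [(up vT).add_region, (up vP).add_region] at h2 h3
  rw [dpList, hp']; refine ⟨h1, fun u hu => h2 u fun i hi => hu _ (hlt i), fun v hv => ?_⟩
  by_cases hin : InList na nh v
  · obtain ⟨i, hi, rfl⟩ := hin; rw [h3 i hi]; exact ⟨fun h => ⟨⟨i, hi, rfl⟩, h⟩, fun h => h.2⟩
  · rw [h2 _ fun i hi hc => hin ⟨i, hi, (region_inj hw ht ht hv (hlt i) hc).2.symm⟩, h0 v hv]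
    exact ⟨fun h => (h rfl).elim, fun h => (hin h.1).elim⟩

/-- The table for paths from the vertex in register `s`. -/
def dpFrom (dir : Bool) (P T a h : COperand) (s : Reg) (d : ℕ) : RProg :=
  .seq (copyQ 13 s) (.seq (dpList dir P T a h d) (copyQ 13 s))

/-- All scratch registers are clean. -/
def Scr (x : QB w) : Prop := ∀ r : Reg, (0 < r.val ∧ r.val < 16) → x.1 r = 0

lemma perm_dpFrom (hσ : Ctx n H σ) {a h : COperand}
    {s : Reg} (hs : Hi s)
    {p t : ℕ} (hd : 8 ≤ d) (va : Val σ d a na) (vh : Val σ d h nh)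
    (vP : Val σ d P (p * 2 ^ (n + 40))) (vT : Val σ d T (t * 2 ^ (n + 40))) (hna : na ≤ n)
    (hnh : nh ≤ H) (hpt : p ≠ t) (hp : p < 2 ^ (n + 20)) (ht : t < 2 ^ (n + 20)) (hx : Scr x)
    (h0 : ∀ v : BitVec w, v.toNat < 2 ^ (n + 40) → x.2 (region n t v) = 0) :
    ((dpFrom dir P T a h s d).perm G d σ x).1 = x.1 ∧
    (∀ u, (∀ v : BitVec w, v.toNat < 2 ^ (n + 40) → u ≠ region n t v) →
      ((dpFrom dir P T a h s d).perm G d σ x).2 u = x.2 u) ∧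
    ∀ v : BitVec w, v.toNat < 2 ^ (n + 40) →
      (((dpFrom dir P T a h s d).perm G d σ x).2 (region n t v) ≠ 0 ↔
        TabSem G dir (x.1 s) (fun j => x.2 (region n p j##w)) na nh v) := by
  have hs13 : s ≠ 13 := hs.ne d!; have h13 : x.1 13 = 0 := hx _ d!
  have hscr : DpScr (xorR x 13 (x.1 s)) := fun r hr => by
    rw [xorR_ne _ _ hr.2.2.2]; exact hx r ⟨hr.1, hr.2.1⟩
  obtain ⟨h1, h2, h3⟩ := perm_dpList (G := G) (dir := dir) (x := xorR x 13 (x.1 s)) hσ hd va vh vP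
    vT hna hnh hpt hp ht hscr h0
  rw [dpFrom, perm_seq, perm_seq, perm_copyQ hs13, perm_copyQ hs13]; refine ⟨?_, h2, ?_⟩
  · rw [h1, xorR_ne _ _ hs13, xorR]; show update _ 13 _ = _
    rw [h1, xorR_self, xor_assoc, bxor_self]; show update (update x.1 13 _) 13 _ = _; simp
  · intro v hv; rw [xorR_mem, h3 v hv, xorR_self, h13, ofNat_eq_ofNat, bzero_xor]; rfl

/-- XOR the linear combination of the frame at `P` with mask in register `m` into `Y`. -/
def linTo (Y : Reg) (P a : COperand) (m : Reg) (d : ℕ) : RProg :=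
  bracket (.seq (copyQ 14 m) (linProg P a d)) (copyQ Y 8)

lemma perm_linTo {m : Reg} (hY : Hi Y) (hm : Hi m) (hYm : m ≠ Y) {a : COperand}
    {p : ℕ} (va : Val σ d a na) (vP : Val σ d P (p * 2 ^ (n + 40)))
    (hna : na ≤ w) (hx : Scr x) :
    (linTo Y P a m d).perm G d σ x =
      xorR x Y (lin (fun j => x.2 (region n p j##w)) na (x.1 m)) := by
  have h1 : (1 : Reg) ≠ Y := (hY.ne d!).symm; have h2 : (2 : Reg) ≠ Y := (hY.ne d!).symm
  have h3 : (3 : Reg) ≠ Y := (hY.ne d!).symm; have h4 : (4 : Reg) ≠ Y := (hY.ne d!).symm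
  have h5 : (5 : Reg) ≠ Y := (hY.ne d!).symm; have h6 : (6 : Reg) ≠ Y := (hY.ne d!).symm
  have h8 : (8 : Reg) ≠ Y := (hY.ne d!).symm; have h14 : (14 : Reg) ≠ Y := (hY.ne d!).symm
  have hm8 : m ≠ 8 := hm.ne d!; have hm14 : m ≠ 14 := hm.ne d!; refine perm_bracket_xor G ?_ ?_
  · simp +decide [RProg.All, bracket, inv, Gate.Avoids, QOperand.Avoids, readAt, swapAt, copyQ,
      linProg, *]
  · have e14 : xorR x 14 (x.1 m) = setR x 14 (x.1 m) := xorR_of_zero (hx _ d!) _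
    rw [perm_seq, perm_copyQ hm14, e14, perm_linProg va vP.1 hna, perm_copyQ h8]
    · congr 1; rw [xorR_self, setR_self, setR_ne d!, hx 8 d!, ofNat_eq_ofNat, bzero_xor]
      simp only [vP.add_region, setR_mem]
    · refine ⟨?_, ?_, ?_, ?_, ?_, ?_⟩ <;> rw [setR_ne d!] <;> exact hx _ d!

/-- Store the one-bits of register `7` as a frame at `P`, and move the remaining bits to `Y`. -/
def frameFrom (Y : Reg) (P a : COperand) (d : ℕ) : RProg :=
  .seq (frameProg P a d) (.seq (copyQ Y 7) (copyQ 7 Y))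

lemma perm_frameFrom (hY : Hi Y) {a : COperand} {p : ℕ} (hw : 128 * (n + 1) ≤ w) (va : Val σ d a na) (vP : Val σ d P (p * 2 ^ (n + 40)))
    (hna : na ≤ n) (hp : p < 2 ^ (n + 20)) (hx : ∀ r : Reg, (0 < r.val ∧ r.val < 16 ∧ r ≠ 7) → x.1 r = 0)
    (hxY : x.1 Y = 0)
    (h0 : ∀ v : BitVec w, v.toNat < 2 ^ (n + 40) → x.2 (region n p v) = 0) :
    ((frameFrom Y P a d).perm G d σ x).1 = (setR (setR x 7 0) Y (strip^[na] (x.1 7))).1 ∧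
    (∀ u, (∀ v : BitVec w, v.toNat < 2 ^ (n + 40) → u ≠ region n p v) →
      ((frameFrom Y P a d).perm G d σ x).2 u = x.2 u) ∧
    ∀ j < na, ((frameFrom Y P a d).perm G d σ x).2 (region n p j##w) =
      frameBit (x.1 7) j := by
  have h7 : (7 : Reg) ≠ Y := (hY.ne d!).symm
  have e := perm_frameProg (G := G) (x := x) va vP.1 o! (hx _ d!)
    (hx _ d!) (hx _ d!) (fun j hj => by
      rw [vP.add_region]; exact h0 _ (small_lt_region hw o!))
  rw [frameFrom, perm_seq, perm_seq, e, perm_copyQ h7, perm_copyQ h7.symm]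
  set M := writeMem x.2 (P.eval σ) (frameBit (x.1 7)) na with hM
  refine ⟨?_, fun u hu => ?_, fun j hj => ?_⟩
  · have a1 : xorR ((setR x 7 (strip^[na] (x.1 7))).1, M) Y
        ((((setR x 7 (strip^[na] (x.1 7))).1, M) : QB w).1 7) =
          setR ((setR x 7 (strip^[na] (x.1 7))).1, M) Y (strip^[na] (x.1 7)) := by
      rw [xorR_of_zero]
      · congr 1
      · exact (setR_ne h7.symm).trans hxY
    rw [a1, setR_self, xorR, setR_ne h7]
    have a2 : (((setR x 7 (strip^[na] (x.1 7))).1, M) : QB w).1 7 = strip^[na] (x.1 7) :=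
      setR_self x 7 _
    rw [a2, bxor_self]; show update (update (update x.1 7 _) Y _) 7 _ = update (update x.1 7 _) Y _
    rw [Function.update_comm h7.symm, Function.update_idem]; rfl
  · show M u = _
    exact writeMem_of_ne fun j hj => by
      rw [vP.add_region]; exact hu _ (small_lt_region hw o!)
  · show M _ = _; rw [← vP.add_region]; exact writeMem_apply (lt_two_pow_of_le o!).le hj

/-- XOR the entry with number in `Z` of the list for weight `h` into `Y`. -/
def readList (Y : Reg) (h : COperand) (Z : Reg) (d : ℕ) : RProg :=
  .letop .add h (.lit 257) (.letop .mul (.creg d) (.creg 1) (readAt Y (.creg (d + 1)) (q Z)))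

lemma perm_readList (hσ : Ctx n H σ) {Z : Reg} (hY : Hi Y)
    (hZ : Hi Z) (hYZ : Z ≠ Y) {h : COperand} (hd : 8 ≤ d) (vh : Val σ d h nh) (hx : Scr x) :
    (readList Y h Z d).perm G d σ x = xorR x Y (x.2 (region n (nh + 257) (x.1 Z))) := by
  set σ1 := σ.set d (WordOp.add.eval (h.eval σ) ((COperand.lit 257).eval σ)) with hσ1
  set σ2 := σ1.set (d + 1)
    (WordOp.mul.eval ((COperand.creg d).eval σ1) ((COperand.creg 1).eval σ1)) with hσ2
  have e : (readList Y h Z d).perm G d σ = (readAt Y (.creg (d + 1)) (q Z)).perm G (d + 2) σ2 := rfl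
  have e1 : (COperand.creg d).eval σ1 = (nh + 257)##w := by
    rw [hσ1, val_creg_eval, vh.2, COperand.eval_lit, ofNat_add nh 257]
    generalize 257#w = c
    rfl
  have e2 : (COperand.creg 1).eval σ1 = (2 ^ (n + 40))##w := (set_reg_ne _ _ o!).trans hσ.reg1
  have e3 : (COperand.creg (d + 1)).eval σ2 = ((nh + 257) * 2 ^ (n + 40))##w := by
    rw [hσ2, val_creg_eval, e1, e2, ofNat_mul (nh + 257)]
    generalize (nh + 257)##w = c
    rfl
  rw [e, perm_readAt_q ⟨hY.ne d!, hY.ne d!⟩ _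
    ⟨hZ.ne d!, hZ.ne d!, hYZ⟩ _ _ (hx _ d!), e3]
  rfl

/-! # Frames of registers and regions -/

/-- Register number `s` of frame `f`. -/
def fr (f s : ℕ) : Reg := Fin.ofNat 256 (16 * (f + 1) + s)

/-- The frame of registers for the connection search on level `j`. -/
abbrev cf (j : ℕ) : ℕ → Reg := fr (2 * j + 1)

/-- The frame of registers for the search on level `j`. -/
abbrev uf (j : ℕ) : ℕ → Reg := fr (2 * j + 2)

lemma fr_val {f s : ℕ} (hf : f ≤ 13) (hs : s < 16) : (fr f s).val = 16 * (f + 1) + s := by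
  show (16 * (f + 1) + s) % 256 = _; exact mod_eq_of_lt o!

lemma fr_ne_fr {f s s' : ℕ} (hf : f ≤ 13) (hs : s < 16) (hs' : s' < 16) (h : s ≠ s') :
    fr f s ≠ fr f s' := fun e => by
  have := congrArg Fin.val e; rw [fr_val hf hs, fr_val hf hs'] at this; omega

lemma hi_fr {f s : ℕ} (hf : f ≤ 13) (hs : s < 16) : Hi (fr f s) :=
  Or.inr (by rw [fr_val hf hs]; omega)

lemma ne_fr {f s : ℕ} {r : Reg} (hf : f ≤ 13) (hs : s < 16) (h : r.val = 0 ∨ 16 * (f + 2) ≤ r.val) :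
    r ≠ fr f s := fun e => by
  rw [e, fr_val hf hs] at h; omega

def ZeroAt (n : ℕ) (M : BitVec w → BitVec w) (q : ℕ) : Prop :=
  ∀ v : BitVec w, v.toNat < 2 ^ (n + 40) → M (region n q v) = 0

def FrameAt (n : ℕ) (M : BitVec w → BitVec w) (q a : ℕ) (D : BitVec w) : Prop :=
  ∀ j < a, M (region n q j##w) = frameBit D j

def TabAt (G : DGraph n) (M : BitVec w → BitVec w) (q : ℕ) (dir : Bool) (s : BitVec w)
    (P : ℕ → BitVec w) (a h : ℕ) : Prop :=
  ∀ v : BitVec w, v.toNat < 2 ^ (n + 40) → (M (region n q v) ≠ 0 ↔ TabSem G dir s P a h v)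

/-- `M` and `M'` agree on region `q`. -/
def SameAt (n : ℕ) (M M' : BitVec w → BitVec w) (q : ℕ) : Prop :=
  ∀ v : BitVec w, v.toNat < 2 ^ (n + 40) → M (region n q v) = M' (region n q v)

lemma ZeroAt.same {M' : BitVec w → BitVec w} {q : ℕ} (h : ZeroAt n M q)
    (hs : SameAt n M' M q) : ZeroAt n M' q := fun v hv => (hs v hv).trans (h v hv)

lemma FrameAt.same {M' : BitVec w → BitVec w} {q : ℕ}
    (h : FrameAt n M q a D) (hs : SameAt n M' M q) (hw : 128 * (n + 1) ≤ w) (ha : a ≤ n) :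
    FrameAt n M' q a D := fun j hj => (hs _ (small_lt_region hw o!)).trans (h j hj)

lemma TabAt.same {M' : BitVec w → BitVec w} {q h : ℕ} {s : BitVec w}
    {P : ℕ → BitVec w} (ht : TabAt G M q dir s P a h) (hs : SameAt n M' M q) :
    TabAt G M' q dir s P a h := fun v hv => by rw [hs v hv]; exact ht v hv

lemma TabSem.congr {s : BitVec w} {P P' : ℕ → BitVec w} {h : ℕ}
    (hP : ∀ j < a, P j = P' j) : TabSem G dir s P a h v ↔ TabSem G dir s P' a h v :=
  ⟨fun h => ⟨h.1, h.2.congr hP⟩, fun h => ⟨h.1, h.2.congr fun j hj => (hP j hj).symm⟩⟩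

lemma sameAt_setM (hw : 128 * (n + 1) ≤ w) (x : QB w) {q q' : ℕ} (hq : q < 2 ^ (n + 20))
    (hq' : q' < 2 ^ (n + 20)) (h : q ≠ q') {r : ℕ} (hr : r < w) (hwU : w < 2 ^ (n + 40))
    (u : BitVec w) :
    SameAt n (setM x (q' * 2 ^ (n + 40) + r)##w u).2 x.2 q := fun v hv => by
  refine setM_ne _ _ fun e => h ?_
  rw [ofNat_add] at e; refine (region_inj hw hq hq' hv ?_ e).1
  rw [toNat_ofNat_of_lt (show n + 40 ≤ w by omega) o!]; omega

/-- The frame of the word in register `m` and the table for paths from the vertex in `s`. -/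
def frameTab (dir : Bool) (Y : Reg) (P T a h : COperand) (m s : Reg) (d : ℕ) : RProg :=
  .seq (copyQ 7 m) (.seq (frameFrom Y P a d) (dpFrom dir P T a h s d))

lemma perm_frameCopy {m : Reg} (hY : Hi Y) (hm : Hi m) (hmY : m ≠ Y) {a : COperand}
    {p : ℕ} (hw : 128 * (n + 1) ≤ w) (va : Val σ d a na)
    (vP : Val σ d P (p * 2 ^ (n + 40))) (hna : na ≤ n) (hp : p < 2 ^ (n + 20)) (hx : Scr x) (hxY : x.1 Y = 0) (h0P : ZeroAt n x.2 p) :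
    ((RProg.seq (copyQ 7 m) (frameFrom Y P a d)).perm G d σ x).1 =
      (setR x Y (strip^[na] (x.1 m))).1 ∧
    (∀ q, q < 2 ^ (n + 20) → q ≠ p →
      SameAt n ((RProg.seq (copyQ 7 m) (frameFrom Y P a d)).perm G d σ x).2 x.2 q) ∧
    FrameAt n ((RProg.seq (copyQ 7 m) (frameFrom Y P a d)).perm G d σ x).2 p na (x.1 m) := by
  have hm7 : m ≠ 7 := hm.ne d!; have h7Y : Y ≠ 7 := hY.ne d!
  have e7 : xorR x 7 (x.1 m) = setR x 7 (x.1 m) := xorR_of_zero (hx _ d!) _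
  obtain ⟨h1, h2, h3⟩ := perm_frameFrom (G := G) (x := setR x 7 (x.1 m)) hY hw va vP hna hp
    (fun r hr => by rw [setR_ne hr.2.2]; exact hx r ⟨hr.1, hr.2.1⟩)
    (by rw [setR_ne h7Y, hxY]) h0P
  rw [setR_self] at h1 h3; rw [perm_seq, perm_copyQ hm7, e7]
  refine ⟨?_, fun q hq hqp v hv => h2 _ fun v' hv' e => hqp (region_inj hw hq hp hv hv' e).1, h3⟩
  rw [h1, setR_setR, setR_eq_self (hx 7 d!)]

lemma perm_frameTab (hσ : Ctx n H σ) {a h : COperand}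
    {m s : Reg} (hY : Hi Y) (hm : Hi m) (hs : Hi s) (hmY : m ≠ Y) (hsY : s ≠ Y)
    {p t : ℕ} (hd : 8 ≤ d) (va : Val σ d a na) (vh : Val σ d h nh)
    (vP : Val σ d P (p * 2 ^ (n + 40))) (vT : Val σ d T (t * 2 ^ (n + 40))) (hna : na ≤ n)
    (hnh : nh ≤ H) (hpt : p ≠ t) (hp : p < 2 ^ (n + 20)) (ht : t < 2 ^ (n + 20)) (hx : Scr x) (hxY : x.1 Y = 0) (h0P : ZeroAt n x.2 p)
    (h0T : ZeroAt n x.2 t) :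
    ((frameTab dir Y P T a h m s d).perm G d σ x).1 = (setR x Y (strip^[na] (x.1 m))).1 ∧
    (∀ q, q < 2 ^ (n + 20) → q ≠ p → q ≠ t →
      SameAt n ((frameTab dir Y P T a h m s d).perm G d σ x).2 x.2 q) ∧
    FrameAt n ((frameTab dir Y P T a h m s d).perm G d σ x).2 p na (x.1 m) ∧
    TabAt G ((frameTab dir Y P T a h m s d).perm G d σ x).2 t dir (x.1 s) (frameBit (x.1 m)) na
      nh := by
  have hw := hσ.hw
  obtain ⟨h1, h2, h3⟩ := perm_frameCopy (G := G) hY hm hmY hw va vP hna hp hx hxY h0P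
  set y := (RProg.seq (copyQ 7 m) (frameFrom Y P a d)).perm G d σ x with hy
  have e : (frameTab dir Y P T a h m s d).perm G d σ x = (dpFrom dir P T a h s d).perm G d σ y := rfl
  have hyS : Scr y := fun r hr => by
    rw [h1, setR_ne (hY.ne hr).symm]; exact hx r hr
  obtain ⟨k1, k2, k3⟩ := perm_dpFrom (G := G) (dir := dir) hσ hs hd va vh vP vT hna hnh hpt hp ht
    hyS (h0T.same (h2 t ht hpt.symm))
  rw [e]; refine ⟨k1.trans h1, fun q hq hqp hqt v hv => ?_, ?_, fun v hv => ?_⟩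
  · rw [k2 _ fun v' hv' e => hqt (region_inj hw hq ht hv hv' e).1]; exact h2 q hq hqp v hv
  · exact h3.same (fun v hv => k2 _ fun v' hv' e => hpt (region_inj hw hp ht hv hv' e).1) hw hna
  · rw [k3 v hv, h1, setR_ne hsY]; exact TabSem.congr h3

lemma frameBit_lt (h : D.toNat < 2 ^ b) (j : ℕ) :
    (frameBit D j).toNat < 2 ^ b := by
  have hl : ∀ E : BitVec w, E.toNat < 2 ^ b → (lowBit E).toNat < 2 ^ b := fun E hE => by
    rw [lowBit, BitVec.toNat_and]; exact lt_of_le_of_lt Nat.and_le_left hE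
  have hs : ∀ j, (strip^[j] D).toNat < 2 ^ b := by
    intro j; induction j with
    | zero => exact h
    | succ j ih =>
      rw [iterate_succ_apply', strip, toNat_xor]; exact xor_lt_two_pow ih (hl _ ih)
  exact hl _ (hs j)

lemma lin_lt {P : ℕ → BitVec w} (h : ∀ j, (P j).toNat < 2 ^ b) (a : ℕ) (m : BitVec w) :
    (lin P a m).toNat < 2 ^ b := by
  induction a with
  | zero => simp [lin]
  | succ a ih =>
    rw [lin, toNat_xor]; refine xor_lt_two_pow ih ?_; split_ifs
    · exact h a
    · simp

/-! # Levels -/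

/-- The parameters of a level. -/
structure LevelP where
  (a t g β b nm b' nm' : ℕ)

/-- The values that the programs for level `j` find in classical registers. -/
def LevelP.val (L : LevelP) (n j : ℕ) : ℕ → ℕ
  | 0 => L.a
  | 1 => L.t
  | 2 => L.g
  | 3 => L.β
  | 4 => L.b
  | 5 => L.nm
  | 6 => 2 ^ L.nm
  | 7 => L.b'
  | 8 => L.nm'
  | 9 => 2 ^ L.nm'
  | 10 => 2 ^ L.g - 1
  | 11 => (16 * (2 * j + 2)) * 2 ^ (n + 40)
  | 12 => (16 * (2 * j + 2) + 1) * 2 ^ (n + 40)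
  | 13 => (16 * (2 * j + 2) + 2) * 2 ^ (n + 40)
  | s => (16 * (2 * j + 1) + (s - 14)) * 2 ^ (n + 40)

def lreg (j s : ℕ) : COperand := .creg (8 + 32 * j + s)

structure LevelP.OK (L : LevelP) (n H : ℕ) : Prop where
  ha : L.a ≤ n
  ht : L.t ≤ H
  htn : L.t ≤ n
  hg : L.g ≤ H
  hgn : L.g ≤ n
  hβ : L.β ≤ H
  hb : L.b ≤ n + 39
  hb' : L.b' ≤ n + 39
  hnm : L.nm ≤ n + 39
  hnm' : L.nm' ≤ n + 39
  hbm : 4 * 2 ^ L.b ≤ (2 ^ L.nm) ^ 2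
  hbm' : 4 * 2 ^ L.b' ≤ (2 ^ L.nm') ^ 2

/-- The classical data for the programs of `K` levels. -/
structure LCtx (n H K : ℕ) (lv : ℕ → LevelP) (σ : CStore w) : Prop extends Ctx n H σ where
  hwU : w < 2 ^ (n + 40)
  lev : ∀ j < K, ∀ s < 18, Val σ 300 (lreg j s) ((lv j).val n j s)
  ok : ∀ j < K, (lv j).OK n H

lemma LCtx.set {lv : ℕ → LevelP} (h : LCtx n H K lv σ) {e : ℕ}
    (he : 300 ≤ e) (v : BitVec w) : LCtx n H K lv (σ.set e v) where
  toCtx := h.toCtx.set o! v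
  hwU := h.hwU
  lev := fun j hj s hs => (h.lev j hj s hs).set he v
  ok := h.ok

/-- Entry `z` of the list for `h`. -/
def LL (w n h z : ℕ) : BitVec w := if z < listLen n (h + 1) then listEntry w n (h + 1) z else 0

/-- The source for the direction `dir`. -/
def src (w n : ℕ) (dir : Bool) : BitVec w := if dir then 0 else (2 ^ n - 1)##w

/-- The permanent contents of the memory: the lists, and two tables. -/
structure Std (G : DGraph n) (H a₀ : ℕ) (M : BitVec w → BitVec w) : Prop where
  list : ∀ h ≤ H, ∀ v : BitVec w, v.toNat < 2 ^ (n + 40) → M (region n (h + 257) v) = LL w n h v.toNat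
  tab : ∀ dir, TabAt G M (if dir then 1 else 2) dir (src w n dir) (twoPow w) n a₀

lemma Std.same {M' : BitVec w → BitVec w} (h : Std G H a₀ M)
    (hs : ∀ q, q < 16 ∨ 257 ≤ q → q < 2 ^ (n + 20) → SameAt n M' M q) (hH : H ≤ n + 4) :
    Std G H a₀ M' where
  list := fun h' hh v hv => by
    rw [hs (h' + 257) o! ?_ v hv, h.list h' hh v hv]
    have : 2 ^ (n + 20) = 2 ^ n * 2 ^ 20 := pow_add _ _ _
    have h2 : n < 2 ^ n := Nat.lt_two_pow_self; omega
  tab := fun dir => (h.tab dir).same <| hs _ (by split_ifs <;> omega) (by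
    have : 4 ≤ 2 ^ (n + 20) := le_trans (by norm_num) (two_pow_le (by omega : 2 ≤ n + 20))
    split_ifs <;> omega)

/-- The scratch registers and the frames up to `f` are clean. -/
structure Clean (G : DGraph n) (H a₀ f : ℕ) (x : QB w) : Prop where
  reg : ∀ r : Reg, 0 < r.val → r.val < 16 * (f + 2) → x.1 r = 0
  mem : ∀ q, 16 ≤ q → q < 16 * (f + 1) → ZeroAt n x.2 q
  std : Std G H a₀ x.2

lemma Clean.mono {f f' : ℕ} (h : Clean G H a₀ f x) (hf : f' ≤ f) : Clean G H a₀ f' x :=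
  ⟨fun r h0 hr => h.reg r h0 o!, fun q h1 h2 => h.mem q h1 o!, h.std⟩

lemma Clean.scr {f : ℕ} (h : Clean G H a₀ f x) : Scr x :=
  fun r hr => h.reg r hr.1 o!

lemma Clean.setR {f : ℕ} (h : Clean G H a₀ f x)
    (ho : o.val = 0 ∨ 16 * (f + 2) ≤ o.val) (u : BitVec w) : Clean G H a₀ f (setR x o u) :=
  ⟨fun r h0 hr => by
    rw [setR_ne (fun e => by subst e; omega)]; exact h.reg r h0 hr, h.mem, h.std⟩

lemma Scr.setR (h : Scr x) (ho : Hi o) (u : BitVec w) :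
    Scr (setR x o u) := fun r hr => by rw [setR_ne (ho.ne hr).symm]; exact h r hr

/-- A pure program around a program that decides `f`. -/
lemma approx_bracket_xorP {A B : RProg}
    {f g : QB w → Prop} {S' : Set (QB w)} (hA : A.All Gate.Pure)
    (hA' : A.All (·.Avoids out)) (hB : Approx (B.den G d σ) (permL (xorP out fun x => bw w (f x))) S' ε)
    (hf : Indep f out) (hg : Indep g out) (hS : ∀ x ∈ S, A.perm G d σ x ∈ S')
    (hSo : ∀ x ∈ S, ∀ u, setR x out u ∈ S) (hfg : ∀ x ∈ S, f (A.perm G d σ x) ↔ g x) :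
    Approx ((RProg.bracket A B).den G d σ) (permL (xorP out fun x => bw w (g x))) S ε := by
  have ef : ∀ x, xorP out (fun x => bw w (f x)) x = xorR x out (bw w (f x)) :=
    fun x => xorP_apply (fun y v => by simp only [hf y v]) x
  have eg : ∀ x, xorP out (fun x => bw w (g x)) x = xorR x out (bw w (g x)) :=
    fun x => xorP_apply (fun y v => by simp only [hg y v]) x
  rw [den_bracket, den_eq_permL G hA]; refine Approx.bracket_perm hB (RProg.den_iso G _ _ _) hS
    (fun x hx => by rw [eg]; exact hSo x hx _) fun x hx => ?_
  rw [ef, eg, propext (hfg x hx), xorR, xorR, perm_setR G hA']; congr 2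
  have := perm_setR G hA' (x.1 out) d σ x; rw [setR_eq_self (x := x) rfl] at this
  rw [this, setR_self]

/-- Decide a conjunction. -/
lemma approx_bracket_and {U C : RProg} {r₁ r₂ : Reg}
    {f₁ f₂ : QB w → Prop} {ε₁ ε₂ : ℝ}
    (hU : Approx (U.den G d σ) (permL (xorP r₁ fun x => bw w (f₁ x))) S ε₁)
    (hC : Approx (C.den G d σ) (permL (xorP r₂ fun x => bw w (f₂ x))) S ε₂)
    (hn : [r₁, r₂, o].Nodup) (h11 : Indep f₁ r₁) (h12 : Indep f₁ r₂) (h1o : Indep f₁ o)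
    (h21 : Indep f₂ r₁) (h22 : Indep f₂ r₂) (h2o : Indep f₂ o)
    (s₁ : ∀ x ∈ S, ∀ u, setR x r₁ u ∈ S) (s₂ : ∀ x ∈ S, ∀ u, setR x r₂ u ∈ S)
    (so : ∀ x ∈ S, ∀ u, setR x o u ∈ S) :
    Approx ((RProg.bracket (.seq U C) (qx o .and (q r₁) (q r₂))).den G d σ)
      (permL (xorP o fun x => bw w (f₁ x ∧ f₂ x))) {x | x ∈ S ∧ x.1 r₁ = 0 ∧ x.1 r₂ = 0}
      (2 * (ε₁ + ε₂)) := by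
  obtain ⟨n12, n1o, n2o⟩ : r₁ ≠ r₂ ∧ r₁ ≠ o ∧ r₂ ≠ o := by
    simp only [nodup_cons, mem_cons, not_mem_nil] at hn; tauto
  have e1 : ∀ x, xorP r₁ (fun x => bw w (f₁ x)) x = xorR x r₁ (bw w (f₁ x)) :=
    fun x => xorP_apply (fun y v => by simp only [h11 y v]) x
  have e2 : ∀ x, xorP r₂ (fun x => bw w (f₂ x)) x = xorR x r₂ (bw w (f₂ x)) :=
    fun x => xorP_apply (fun y v => by simp only [h22 y v]) x
  have eo : ∀ x, xorP o (fun x => bw w (f₁ x ∧ f₂ x)) x = xorR x o (bw w (f₁ x ∧ f₂ x)) :=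
    fun x => xorP_apply (fun y v => by simp only [h1o y v, h2o y v]) x
  set S₀ : Set (QB w) := {x | x ∈ S ∧ x.1 r₁ = 0 ∧ x.1 r₂ = 0} with hS₀
  have m1 : Maps (permL (xorP r₁ fun x => bw w (f₁ x))) S S :=
    maps_permL fun x hx => by rw [e1]; exact s₁ x hx _
  have m2 : Maps (permL (xorP r₂ fun x => bw w (f₂ x))) S S :=
    maps_permL fun x hx => by rw [e2]; exact s₂ x hx _
  have hV := (hC.mul hU (RProg.den_iso G _ _ _) (iso_permL _) m1).mono (fun x hx => hx.1 : S₀ ⊆ S)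
    le_rfl
  rw [den_bracket, show (RProg.seq U C).den G d σ = C.den G d σ * U.den G d σ from rfl,
    den_eq_permL G (p := qx o .and (q r₁) (q r₂)) trivial]
  refine (Approx.bracket (ε' := 0) (δ := 0) hV (Approx.refl _ Set.univ)
    ((RProg.den_iso G _ _ _).mul (RProg.den_iso G _ _ _)) ((iso_permL _).mul (iso_permL _))
    (iso_permL _) (iso_permL _) (fun ψ _ x hx => (hx trivial).elim) (maps_permL fun x hx => ?_)
    ?_).mono subset_rfl (by linarith)
  · rw [eo]
    exact ⟨so x hx.1 _, by rw [xorR_ne _ _ n1o]; exact hx.2.1, by rw [xorR_ne _ _ n2o]; exact hx.2.2⟩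
  · intro ψ hψ
    have h : ∀ x ∈ S₀, ((qx o .and (q r₁) (q r₂)).perm G d σ * (xorP r₂ (fun x => bw w (f₂ x)) *
        xorP r₁ fun x => bw w (f₁ x))) x = ((xorP r₂ (fun x => bw w (f₂ x)) *
        xorP r₁ fun x => bw w (f₁ x)) * xorP o fun x => bw w (f₁ x ∧ f₂ x)) x := by
      rintro x ⟨-, hx1, hx2⟩
      have i1 : ∀ y u, f₂ (xorR y r₁ u) ↔ f₂ y := fun y u => by rw [xorR, h21]
      have i2 : ∀ y u, f₁ (xorR y o u) ↔ f₁ y := fun y u => by rw [xorR, h1o]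
      have i3 : ∀ y u, f₂ (xorR y o u) ↔ f₂ y := fun y u => by rw [xorR, h2o]
      simp only [Equiv.Perm.mul_apply, e1, e2, eo, i1, i2, i3, perm_rr n1o n2o]
      have v1 : (xorR (xorR x r₁ (bw w (f₁ x))) r₂ (bw w (f₂ x))).1 r₁ = bw w (f₁ x) := by
        rw [xorR_ne _ _ n12, xorR_self, hx1, ofNat_eq_ofNat, bzero_xor]
      have v2 : (xorR (xorR x r₁ (bw w (f₁ x))) r₂ (bw w (f₂ x))).1 r₂ = bw w (f₂ x) := by
        rw [xorR_self, xorR_ne _ _ n12.symm, hx2, ofNat_eq_ofNat, bzero_xor]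
      rw [v1, v2]; simp only [WordOp.eval, bw_and]
      simp only [xorR, setR_ne n12.symm, setR_ne n1o, setR_ne n2o, setR_ne n1o.symm,
        setR_ne n2o.symm]
      rw [setR_comm _ n2o, setR_comm _ n1o]
    have := permL_congr h hψ; rw [map_mul, map_mul, map_mul, map_mul] at this
    rw [show permL ((qx o .and (q r₁) (q r₂)).perm G d σ) ((permL (xorP r₂ fun x => bw w (f₂ x)) *
      permL (xorP r₁ fun x => bw w (f₁ x))) ψ) = _ from this]
    simp [nrm_zero]

/-! # The connection search -/

section Connection

/-- The mask number `z` completes `R` to a path from `X` to `v`. -/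
def ConnSem (G : DGraph n) (L : LevelP) (dir : Bool) (v R X : BitVec w) (z : ℕ) : Prop :=
  let D := v ^^^ src w n dir
  let Q := lin (frameBit R) L.t (LL w n L.g z)
  let S := lin (frameBit D) L.a Q
  (TabSem G (!dir) v (frameBit D) L.a L.β (R ^^^ Q) ∧ strip^[L.g] S = 0) ∧
    TabSem G dir X (frameBit S) L.g L.g (2 ^ L.g - 1)##w

/-- The masks for the candidate in register `0` of frame `B`. -/
def connMasks (j : ℕ) (R : Reg) (d : ℕ) : RProg :=
  let B := 2 * j + 1
  .seq (readList (fr B 4) (lreg j 2) (fr B 0) d) (.seq (linTo (fr B 5) (lreg j 15) (lreg j 1) (fr B 4) d)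
    (.seq (copyQ (fr B 6) R) (.seq (copyQ (fr B 6) (fr B 5))
      (.seq (readAt (fr B 10) (lreg j 13) (q (fr B 6)))
        (linTo (fr B 7) (lreg j 12) (lreg j 0) (fr B 5) d)))))

/-- The three conditions. -/
def connTests (j : ℕ) : RProg :=
  let B := 2 * j + 1
  .seq (readAt (fr B 11) (lreg j 17) (c (lreg j 10))) (.seq (qx (fr B 12) .lt (c (.lit 0)) (q (fr B 10)))
    (.seq (qx (fr B 13) .eq (q (fr B 8)) (c (.lit 0))) (.seq (qx (fr B 14) .lt (c (.lit 0)) (q (fr B 11)))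
      (qx (fr B 15) .and (q (fr B 12)) (q (fr B 13))))))

def connPrep (j : ℕ) (dir : Bool) (R X : Reg) (d : ℕ) : RProg :=
  .seq (connMasks j R d) (.seq (frameTab dir (cf j 8) (lreg j 16) (lreg j 17) (lreg j 2)
    (lreg j 2) (cf j 7) X d) (connTests j))

def connBody (j : ℕ) (dir : Bool) (R X : Reg) (d : ℕ) : RProg :=
  bracket (connPrep j dir R X d)
    (qx (cf j 3) .and (q (cf j 15)) (q (cf j 14)))

def connFrame (j : ℕ) (R : Reg) (d : ℕ) : RProg :=
  .seq (copyQ 7 R) (frameFrom (cf j 9) (lreg j 15) (lreg j 1) d)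

/-- Search for a completion of the mask in `R` to a path from the vertex in `X`. -/
def conn (j : ℕ) (dir : Bool) (R X out : Reg) (d : ℕ) : RProg :=
  bracket (connFrame j R d) (search (cf j 0) (cf j 1) (cf j 2)
    (cf j 3) out (lreg j 7) (lreg j 8) (lreg j 9) (.creg 4) (lreg j 14)
    (connBody j dir R X) d)

/-- The table for the vertex in `v` is in place. -/
structure Prepared (G : DGraph n) (L : LevelP) (j : ℕ) (dir : Bool)
    (v : BitVec w) (M : BitVec w → BitVec w) : Prop where
  frame : FrameAt n M (16 * (2 * j + 2) + 1) L.a (v ^^^ src w n dir)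
  tab : TabAt G M (16 * (2 * j + 2) + 2) (!dir) v (frameBit (v ^^^ src w n dir)) L.a L.β

lemma Prepared.same {L : LevelP} {M' : BitVec w → BitVec w}
    (h : Prepared G L j dir v M) (hw : 128 * (n + 1) ≤ w) (ha : L.a ≤ n)
    (hs : ∀ q, q = 16 * (2 * j + 2) + 1 ∨ q = 16 * (2 * j + 2) + 2 → SameAt n M' M q) :
    Prepared G L j dir v M' :=
  ⟨h.frame.same (hs _ (Or.inl rfl)) hw ha, h.tab.same (hs _ (Or.inr rfl))⟩

/-- The basis states during the search for a completion. -/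
structure ConnState (G : DGraph n) (H a₀ : ℕ) (L : LevelP) (j : ℕ) (dir : Bool)
    (v R X : Reg) (x : QB w) : Prop where
  reg : ∀ r : Reg, 0 < r.val → r.val < 16 * (2 * j + 3) →
    (∀ s ∈ [0, 1, 2, 3, 9], r ≠ cf j s) → x.1 r = 0
  cand : (x.1 (cf j 0)).toNat < 2 ^ L.b'
  mem : ∀ q, 16 ≤ q → q < 16 * (2 * j + 2) → q ≠ 16 * (2 * j + 1) → q ≠ 16 * (2 * j + 1) + 1 →
    ZeroAt n x.2 q
  frame : FrameAt n x.2 (16 * (2 * j + 1) + 1) L.t (x.1 R)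
  hR : (x.1 R).toNat < 2 ^ n
  std : Std G H a₀ x.2
  prep : Prepared G L j dir (x.1 v) x.2

/-- The basis states on which `conn` works. -/
structure ConnInput (G : DGraph n) (H a₀ : ℕ) (L : LevelP) (j : ℕ) (dir : Bool)
    (v R : Reg) (x : QB w) : Prop where
  clean : Clean G H a₀ (2 * j + 1) x
  hR : (x.1 R).toNat < 2 ^ n
  prep : Prepared G L j dir (x.1 v) x.2

variable {lv : ℕ → LevelP} {v R : Reg}

lemma lt_region_num {q : ℕ} (hq : q ≤ 2 ^ 19) : q < 2 ^ (n + 20) :=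
  lt_of_le_of_lt hq (two_pow_lt o!)

lemma ConnState.scr {L : LevelP} (h : ConnState G H a₀ L j dir v R X x)
    (hj : 2 * j + 1 ≤ 13) : Scr x := fun r hr => h.reg r hr.1 o! fun s hs e => by
  have h16 : s < 16 := by simp at hs; omega
  have := (congrArg Fin.val e).trans (fr_val hj h16); omega

lemma LCtx.levAt (hσ : LCtx n H K lv σ) (hj : j < K) (hd : 300 ≤ d) :
    ∀ s < 18, Val σ d (lreg j s) ((lv j).val n j s) := fun s hs => (hσ.lev j hj s hs).mono hd

lemma cf_ne (h : 2 * j + 1 ≤ 13) (s s' : ℕ) (hs : s < 16 ∧ s' < 16 ∧ s ≠ s') : cf j s ≠ cf j s' :=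
  fr_ne_fr h hs.1 hs.2.1 hs.2.2

lemma uf_ne (h : 2 * j + 2 ≤ 13) (s s' : ℕ) (hs : s < 16 ∧ s' < 16 ∧ s ≠ s') : uf j s ≠ uf j s' :=
  fr_ne_fr h hs.1 hs.2.1 hs.2.2

lemma ne_cf (h : 2 * j + 1 ≤ 13) (hR : R.val = 0 ∨ 16 * (2 * j + 3) ≤ R.val) (s : ℕ)
    (hs : s < 16) : R ≠ cf j s := ne_fr h hs o!

lemma ne_uf (h : 2 * j + 2 ≤ 13) (hR : R.val = 0 ∨ 16 * (2 * j + 4) ≤ R.val) (s : ℕ)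
    (hs : s < 16) : R ≠ uf j s := ne_fr h hs o!

lemma perm_connMasks (hσ : LCtx n H K lv σ) (hK : K ≤ 6) (hj : j < K) (hd : 300 ≤ d)
    (hR : 16 * (2 * j + 3) ≤ R.val)
    (hx : ConnState G H a₀ (lv j) j dir v R X x) :
    (connMasks j R d).perm G d σ x = 
      let B := 2 * j + 1
      let m := LL w n (lv j).g (x.1 (fr B 0)).toNat
      let Q := lin (frameBit (x.1 R)) (lv j).t m
      setR (setR (setR (setR (setR x (fr B 4) m) (fr B 5) Q) (fr B 6) (x.1 R ^^^ Q)) (fr B 10)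
        (x.2 (region n (16 * (2 * j + 2) + 2) (x.1 R ^^^ Q)))) (fr B 7)
        (lin (frameBit (x.1 v ^^^ src w n dir)) (lv j).a Q) := by
  have hw := hσ.hw; have ok := hσ.ok j hj; have hB : 2 * j + 1 ≤ 13 := by omega
  have lev := hσ.levAt hj hd; have hscr := hx.scr hB; have ne := cf_ne (j := j) hB
  have hi := fun s => hi_fr (s := s) hB
  have nR := ne_cf (R := R) hB o!
  have z : ∀ s, s < 16 ∧ s ∉ [0, 1, 2, 3, 9] → x.1 (cf j s) = 0 := fun s h =>
    hx.reg _ (by rw [fr_val hB h.1]; omega) (by rw [fr_val hB h.1]; omega) fun s' hs' =>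
      ne _ _ ⟨h.1, by simp at hs'; omega, fun e => h.2 (e ▸ hs')⟩
  have e1 : (readList (cf j 4) (lreg j 2) (cf j 0) d).perm G d σ x =
      setR x (cf j 4) (LL w n (lv j).g (x.1 (cf j 0)).toNat) := by
    rw [perm_readList hσ.toCtx (hi 4 d!) (hi 0 d!) (ne _ _ d!) o!
      (lev 2 d!) hscr, xorR_of_zero (z 4 d!)]
    congr 1; exact hx.std.list _ ok.hg _ (lt_of_lt_of_le hx.cand (two_pow_le
      (by have := ok.hb'; omega)))
  set m := LL w n (lv j).g (x.1 (cf j 0)).toNat with hm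
  set x1 := setR x (cf j 4) m with hx1
  have s1 : Scr x1 := hscr.setR (hi 4 d!) _
  have e2 : (linTo (cf j 5) (lreg j 15) (lreg j 1) (cf j 4) d).perm G d σ x1 =
      setR x1 (cf j 5) (lin (frameBit (x.1 R)) (lv j).t m) := by
    rw [perm_linTo (hi 5 d!) (hi 4 d!) (ne _ _ d!) (lev 1 d!)
      (lev 15 d!) (by have := ok.htn; show (lv j).t ≤ w; omega) s1, xorR_of_zero]
    · rw [hx1, setR_self, setR_mem]; congr 1; exact lin_congr hx.frame _
    · rw [hx1, setR_ne (ne _ _ d!), z 5 d!]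
  set Q := lin (frameBit (x.1 R)) (lv j).t m with hQ
  set x2 := setR x1 (cf j 5) Q with hx2
  have s2 : Scr x2 := s1.setR (hi 5 d!) _
  have e3 : (copyQ (cf j 6) R).perm G d σ x2 = setR x2 (cf j 6) (x.1 R) := by
    rw [perm_copyQ (nR 6 d!), xorR_of_zero]
    · rw [hx2, setR_ne (nR 5 d!), hx1, setR_ne (nR 4 d!)]
    · rw [hx2, setR_ne (ne _ _ d!), hx1, setR_ne (ne _ _ d!), z 6 d!]
  have e4 : (copyQ (cf j 6) (cf j 5)).perm G d σ
      (setR x2 (cf j 6) (x.1 R)) = setR x2 (cf j 6) (x.1 R ^^^ Q) := by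
    rw [perm_copyQ (ne _ _ d!), xorR, setR_setR, setR_self, setR_ne (ne _ _ d!), hx2, setR_self]
  set x3 := setR x2 (cf j 6) (x.1 R ^^^ Q) with hx3
  have s3 : Scr x3 := s2.setR (hi 6 d!) _
  have e5 : (readAt (cf j 10) (lreg j 13) (q (cf j 6))).perm G d σ x3 =
      setR x3 (cf j 10) (x.2 (region n (16 * (2 * j + 2) + 2) (x.1 R ^^^ Q))) := by
    rw [perm_readAt_q ⟨(hi 10 d!).ne d!, (hi 10 d!).ne d!⟩ _
      ⟨(hi 6 d!).ne d!, (hi 6 d!).ne d!, ne _ _ d!⟩ _ _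
      (s3 _ d!), (lev 13 d!).add_region, xorR_of_zero]
    · rw [hx3, setR_self]; rfl
    · rw [hx3, setR_ne (ne _ _ d!), hx2, setR_ne (ne _ _ d!), hx1, setR_ne (ne _ _ d!), z 10 d!]
  set x4 := setR x3 (cf j 10) (x.2 (region n (16 * (2 * j + 2) + 2) (x.1 R ^^^ Q)))
    with hx4
  have s4 : Scr x4 := s3.setR (hi 10 d!) _
  have e6 : (linTo (cf j 7) (lreg j 12) (lreg j 0) (cf j 5) d).perm G d σ x4 =
      setR x4 (cf j 7) (lin (frameBit (x.1 v ^^^ src w n dir)) (lv j).a Q) := by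
    rw [perm_linTo (hi 7 d!) (hi 5 d!) (ne _ _ d!) (lev 0 d!)
      (lev 12 d!) (by have := ok.ha; show (lv j).a ≤ w; omega) s4, xorR_of_zero]
    · rw [hx4, setR_ne (ne _ _ d!), hx3, setR_ne (ne _ _ d!), hx2, setR_self]; congr 1
      exact lin_congr hx.prep.frame _
    · rw [hx4, setR_ne (ne _ _ d!), hx3, setR_ne (ne _ _ d!), hx2,
        setR_ne (ne _ _ d!), hx1, setR_ne (ne _ _ d!), z 7 d!]
  show (linTo (cf j 7) (lreg j 12) (lreg j 0) (cf j 5) d).perm G d σ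
    ((readAt (cf j 10) (lreg j 13) (q (cf j 6))).perm G d σ
    ((copyQ (cf j 6) (cf j 5)).perm G d σ
    ((copyQ (cf j 6) R).perm G d σ
    ((linTo (cf j 5) (lreg j 15) (lreg j 1) (cf j 4) d).perm G d σ
    ((readList (cf j 4) (lreg j 2) (cf j 0) d).perm G d σ x))))) = _
  rw [e1, e2, e3, e4, e5, e6]

lemma perm_connBody (hσ : LCtx n H K lv σ) (hK : K ≤ 6) (hj : j < K) (hd : 300 ≤ d)
    (hR : 16 * (2 * j + 3) ≤ R.val) (hX : 16 * (2 * j + 3) ≤ X.val) (hx : ConnState G H a₀ (lv j) j dir v R X x)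
    (hav : (connPrep j dir R X d).All (·.Avoids (cf j 3))) :
    (connBody j dir R X d).perm G d σ x = xorR x (cf j 3)
      (bw w (ConnSem G (lv j) dir (x.1 v) (x.1 R) (x.1 X) (x.1 (cf j 0)).toNat)) := by
  have hw := hσ.hw; have ok := hσ.ok j hj; have hB : 2 * j + 1 ≤ 13 := by omega
  have lev := hσ.levAt hj hd; have hscr := hx.scr hB; have ne := cf_ne (j := j) hB
  have hi := fun s => hi_fr (s := s) hB
  have nX := ne_cf (R := X) hB o!
  have z : ∀ s, s < 16 ∧ s ∉ [0, 1, 2, 3, 9] → x.1 (cf j s) = 0 := fun s h =>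
    hx.reg _ (by rw [fr_val hB h.1]; omega) (by rw [fr_val hB h.1]; omega) fun s' hs' =>
      ne _ _ ⟨h.1, by simp at hs'; omega, fun e => h.2 (e ▸ hs')⟩
  refine perm_bracket_xor G hav ?_; rw [perm_rr (ne _ _ d!) (ne _ _ d!)]; congr 1
  have e := perm_connMasks (G := G) hσ hK hj hd hR hx; simp only at e
  set m := LL w n (lv j).g (x.1 (cf j 0)).toNat with hm
  set Q := lin (frameBit (x.1 R)) (lv j).t m with hQ
  set S := lin (frameBit (x.1 v ^^^ src w n dir)) (lv j).a Q with hS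
  set T := x.2 (region n (16 * (2 * j + 2) + 2) (x.1 R ^^^ Q)) with hT
  set y := setR (setR (setR (setR (setR x (cf j 4) m) (cf j 5) Q)
    (cf j 6) (x.1 R ^^^ Q)) (cf j 10) T) (cf j 7) S with hy
  have yne : ∀ r, (∀ s ∈ [4, 5, 6, 7, 10], r ≠ cf j s) → y.1 r = x.1 r := fun r hr => by
    rw [hy, setR_ne (hr 7 (by simp)), setR_ne (hr 10 (by simp)), setR_ne (hr 6 (by simp)),
      setR_ne (hr 5 (by simp)), setR_ne (hr 4 (by simp))]
  have yz : ∀ s, s < 16 ∧ s ∉ [0, 1, 2, 3, 9, 4, 5, 6, 7, 10] → y.1 (cf j s) = 0 :=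
    fun s h => by
      rw [yne _ fun s' hs' => ne _ _ ⟨h.1, by simp at hs'; omega, fun e => h.2 (by subst e; simp at hs' ⊢; omega)⟩]
      exact z s ⟨h.1, fun hs => h.2 (by simp at hs ⊢; omega)⟩
  have ys : Scr y := ((((hscr.setR (hi _ d!) _).setR (hi _ d!) _).setR
    (hi _ d!) _).setR (hi _ d!) _).setR (hi _ d!) _
  obtain ⟨k1, -, -, k4⟩ := perm_frameTab (G := G) (dir := dir) (Y := cf j 8)
    (m := cf j 7) (s := X) (x := y) hσ.toCtx (hi 8 d!) (hi 7 d!)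
    (Or.inr o!) (ne _ _ d!) (nX 8 d!) o! (lev 2 d!)
    (lev 2 d!) (lev 16 d!) (lev 17 d!) ok.hgn ok.hg o!
    (lt_region_num o!) (lt_region_num o!) ys (yz 8 d!)
    (hx.mem _ o! o! o! o!)
    (hx.mem _ o! o! o! o!)
  set u := (frameTab dir (cf j 8) (lreg j 16) (lreg j 17) (lreg j 2)
    (lreg j 2) (cf j 7) X d).perm G d σ y with hu
  have y7 : y.1 (cf j 7) = S := setR_self _ _ _
  have yX : y.1 X = x.1 X := yne _ fun s hs => nX s (by simp at hs; omega)
  rw [y7] at k1 k4; rw [yX] at k4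
  have u8 : u.1 (cf j 8) = strip^[(lv j).g] S := by rw [k1, setR_self]; rfl
  have u10 : u.1 (cf j 10) = T := by
    rw [k1, setR_ne (ne _ _ d!), hy, setR_ne (ne _ _ d!), setR_self]
  have uz : ∀ s, s < 16 ∧ s ∉ [0, 1, 2, 3, 9, 4, 5, 6, 7, 10, 8] → u.1 (cf j s) = 0 :=
    fun s h => by
      rw [k1, setR_ne (ne _ _ ⟨h.1, by decide, fun e => h.2 (by subst e; simp)⟩)]
      exact yz s ⟨h.1, fun hs => h.2 (by simp at hs ⊢; omega)⟩
  have u4 : u.1 4 = 0 := by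
    rw [k1, setR_ne ((hi 8 d!).ne d!).symm]; exact ys 4 d!
  have e11 : (readAt (cf j 11) (lreg j 17) (c (lreg j 10))).perm G d σ u =
      xorR u (cf j 11) (u.2 (region n (16 * (2 * j + 1) + 3)
        (2 ^ (lv j).g - 1)##w)) := by
    rw [perm_readAt_c ⟨(hi 11 d!).ne d!, (hi 11 d!).ne d!⟩ _ _ _ _
      u4, (lev 17 d!).add_region, (lev 10 d!).2]
    rfl
  have t1 : T ≠ 0 ↔ TabSem G (!dir) (x.1 v) (frameBit (x.1 v ^^^ src w n dir)) (lv j).a (lv j).β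
      (x.1 R ^^^ Q) := by
    refine hx.prep.tab _ ?_; rw [toNat_xor]; have h2 : (2 : ℕ) ^ n ≤ 2 ^ (n + 40) := two_pow_le o!
    exact xor_lt_two_pow (hx.hR.trans_le h2) ((lin_lt (frameBit_lt hx.hR) _ _).trans_le h2)
  have t3 := k4 (2 ^ (lv j).g - 1)##w (by
    have h0 : (2 : ℕ) ^ (lv j).g ≤ 2 ^ (n + 40) := two_pow_le
      (by have := ok.hgn; omega)
    have h1 : 0 < 2 ^ (lv j).g := by positivity
    rw [toNat_ofNat_of_lt (b := n + 40) o! o!]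
    omega)
  set V := u.2 (region n (16 * (2 * j + 1) + 3) (2 ^ (lv j).g - 1)##w) with hV
  have hfin : (connPrep j dir R X d).perm G d σ x = (connTests j).perm G d σ u := by
    rw [connPrep, perm_seq, perm_seq, e]
  rw [hfin]; show (((connTests j).perm G d σ u).1 (cf j 15)) &&&
    (((connTests j).perm G d σ u).1 (cf j 14)) = _
  rw [connTests]; have q1 := ne 10 12 d!; have q2 := ne 8 13 d!; have q3 := ne 11 14 d!
  have q4 := ne 12 15 d!; have q5 := ne 13 15 d!
  simp (disch := first | exact ne _ _ d! | decide) only [perm_seq, e11, perm_cr q1, perm_rc q2,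
    perm_cr q3, perm_rr q4 q5, xorR_self, xorR_ne, u8, u10, uz, ofNat_eq_ofNat,
    bzero_xor, COperand.eval_lit, WordOp.eval_lt_zero, WordOp.eval_eq_eq]
  simp only [WordOp.eval, bw_and]; unfold ConnSem; simp only [← ofNat_eq_ofNat, t1, t3]; rfl

end Connection

/-! # Registers that the programs do not use -/

section Avoidance

variable {r m s : Reg}

lemma hi_ne (hr : Hi r) : (1 ≠ r ∧ 2 ≠ r ∧ 3 ≠ r ∧ 4 ≠ r ∧ 5 ≠ r ∧ 6 ≠ r ∧ 7 ≠ r) ∧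
    8 ≠ r ∧ 9 ≠ r ∧ 10 ≠ r ∧ 11 ≠ r ∧ 12 ≠ r ∧ 13 ≠ r ∧ 14 ≠ r ∧ 15 ≠ r :=
  ⟨⟨(hr.ne d!).symm, (hr.ne d!).symm, (hr.ne d!).symm,
    (hr.ne d!).symm, (hr.ne d!).symm, (hr.ne d!).symm,
    (hr.ne d!).symm⟩, (hr.ne d!).symm, (hr.ne d!).symm,
    (hr.ne d!).symm, (hr.ne d!).symm, (hr.ne d!).symm,
    (hr.ne d!).symm, (hr.ne d!).symm, (hr.ne d!).symm⟩

lemma avoids_copyQ (hY : Y ≠ r) (hm : m ≠ r) : (copyQ Y m).All (·.Avoids r) := ⟨hY, hm, hm⟩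

lemma avoids_readAt (hr : Hi r) (hY : Y ≠ r) (a : COperand) {i : QOperand 255}
    (hi : i.Avoids r) : (readAt Y a i).All (·.Avoids r) := by
  have h4 : 4 ≠ r := (hr.ne d!).symm; have h5 : 5 ≠ r := (hr.ne d!).symm
  exact All.bracket (All.bracket ⟨h4, trivial, hi⟩ ⟨h5, h4⟩) ⟨hY, h5, h5⟩

lemma avoids_linProg (hr : Hi r) (P a : COperand) (d : ℕ) :
    (linProg P a d).All (·.Avoids r) := by
  have := hi_ne hr
  simp [RProg.All, bracket, inv, Gate.Avoids, QOperand.Avoids, readAt, swapAt, linProg, *]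

lemma avoids_linTo (hr : Hi r) (hY : Y ≠ r) (hm : m ≠ r) (P a : COperand) (d : ℕ) :
    (linTo Y P a m d).All (·.Avoids r) := by
  have := hi_ne hr; have h := avoids_linProg hr P a d
  exact All.bracket ⟨avoids_copyQ this.2.2.2.2.2.2.2.1 hm, h⟩ (avoids_copyQ hY this.2.1)

lemma avoids_readList (hr : Hi r) (hY : Y ≠ r) (hm : m ≠ r) (h : COperand) (d : ℕ) :
    (readList Y h m d).All (·.Avoids r) := avoids_readAt hr hY _ hm

lemma avoids_frameFrom (hr : Hi r) (hY : Y ≠ r) (P a : COperand) (d : ℕ) :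
    (frameFrom Y P a d).All (·.Avoids r) := by
  have := hi_ne hr
  simp [RProg.All, bracket, inv, Gate.Avoids, QOperand.Avoids, swapAt, frameFrom, frameProg, copyQ, *]

lemma avoids_dpProg (hr : Hi r) (dir : Bool) (P a T L N : COperand) (d : ℕ) :
    (dpProg dir P a T L N d).All (·.Avoids r) := by
  have := hi_ne hr
  cases dir <;> simp [RProg.All, bracket, inv, Gate.Avoids, QOperand.Avoids, swapAt, readAt, dpProg,
    dpStep, dpExtend, copyQ, copyC, linProg, *]

lemma avoids_dpList (hr : Hi r) (dir : Bool) (P T a h : COperand) (d : ℕ) :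
    (dpList dir P T a h d).All (·.Avoids r) :=
  avoids_dpProg hr dir P a T (.creg (d + 5)) (.creg (d + 3)) (d + 6)

lemma avoids_dpFrom (hr : Hi r) (hs : s ≠ r) (dir : Bool) (P T a h : COperand) (d : ℕ) :
    (dpFrom dir P T a h s d).All (·.Avoids r) :=
  have h13 := (hi_ne hr).2.2.2.2.2.2.1
  ⟨avoids_copyQ h13 hs, avoids_dpList hr _ _ _ _ _ _, avoids_copyQ h13 hs⟩

lemma avoids_frameTab (hr : Hi r) (hY : Y ≠ r) (hm : m ≠ r) (hs : s ≠ r) (dir : Bool)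
    (P T a h : COperand) (d : ℕ) : (frameTab dir Y P T a h m s d).All (·.Avoids r) :=
  ⟨avoids_copyQ (hi_ne hr).1.2.2.2.2.2.2 hm, avoids_frameFrom hr hY _ _ _,
    avoids_dpFrom hr hs _ _ _ _ _ _⟩

lemma pure_linTo (P a : COperand) (d : ℕ) : (linTo Y P a m d).All Gate.Pure := by
  simp [RProg.All, bracket, inv, Gate.Pure, linTo, linProg, readAt, swapAt, copyQ]

lemma pure_readAt (a : COperand) (i : QOperand 255) : (readAt Y a i).All Gate.Pure := by
  simp [RProg.All, bracket, inv, Gate.Pure, readAt, swapAt]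

lemma pure_readList (h : COperand) (d : ℕ) : (readList Y h m d).All Gate.Pure := pure_readAt _ _

lemma pure_frameFrom (P a : COperand) (d : ℕ) : (frameFrom Y P a d).All Gate.Pure := by
  simp [RProg.All, bracket, inv, Gate.Pure, frameFrom, frameProg, swapAt, copyQ]

lemma pure_dpList (dir : Bool) (P T a h : COperand) (d : ℕ) :
    (dpList dir P T a h d).All Gate.Pure := by
  cases dir <;> simp [RProg.All, bracket, inv, Gate.Pure, swapAt, readAt, dpList, withList, dpProg,
    dpStep, dpExtend, copyQ, copyC, linProg]

lemma pure_frameTab (dir : Bool) (P T a h : COperand) (d : ℕ) :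
    (frameTab dir Y P T a h m s d).All Gate.Pure :=
  ⟨trivial, pure_frameFrom _ _ _, trivial, pure_dpList _ _ _ _ _ _, trivial⟩

lemma pure_connPrep (j : ℕ) (dir : Bool) (R X : Reg) (d : ℕ) :
    (connPrep j dir R X d).All Gate.Pure :=
  ⟨⟨pure_readList _ _, pure_linTo _ _ _, trivial, trivial, pure_readAt _ _, pure_linTo _ _ _⟩,
    pure_frameTab _ _ _ _ _ _, pure_readAt _ _, trivial, trivial, trivial, trivial⟩

lemma avoids_connPrep {R : Reg} (hr : Hi r) (hR : R ≠ r) (hX : X ≠ r)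
    (h : ∀ s < 16, s = 0 ∨ 4 ≤ s → cf j s ≠ r) (dir : Bool) (d : ℕ) :
    (connPrep j dir R X d).All (·.Avoids r) :=
  have n := fun s hs => h s hs
  ⟨⟨avoids_readList hr (n _ d! d!) (n _ d! d!) _ _, avoids_linTo hr (n _ d! d!) (n _ d! d!) _ _ _,
    avoids_copyQ (n _ d! d!) hR,
    avoids_copyQ (n _ d! d!) (n _ d! d!),
    avoids_readAt hr (n _ d! d!) _ (n 6 d! d!),
    avoids_linTo hr (n _ d! d!) (n _ d! d!) _ _ _⟩,
    avoids_frameTab hr (n _ d! d!) (n _ d! d!) hX _ _ _ _ _ _,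
    avoids_readAt hr (n _ d! d!) _ trivial,
    ⟨n 12 d! d!, trivial, n 10 d! d!⟩,
    ⟨n 13 d! d!, n 8 d! d!, trivial⟩,
    ⟨n 14 d! d!, trivial, n 11 d! d!⟩,
    n 15 d! d!, n 12 d! d!, n 13 d! d!⟩

lemma avoids_connFrame {R : Reg} (hr : Hi r) (hR : R ≠ r)
    (h : cf j 9 ≠ r) (d : ℕ) : (connFrame j R d).All (·.Avoids r) :=
  ⟨avoids_copyQ (hi_ne hr).1.2.2.2.2.2.2 hR, avoids_frameFrom hr h _ _ _⟩

end Avoidance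

section ConnectionSearch

variable {lv : ℕ → LevelP} {v R : Reg}

lemma ConnState.setR {L : LevelP} (h : ConnState G H a₀ L j dir v R X x)
    (hj : 2 * j + 1 ≤ 13) (hR : 16 * (2 * j + 3) ≤ R.val) (hv : 16 * (2 * j + 3) ≤ v.val) {u : BitVec w} (ho : (o.val = 0 ∨ 16 * (2 * j + 3) ≤ o.val) ∧ o ≠ v ∧ o ≠ R ∨
      (∃ s ∈ [1, 2, 3], o = cf j s) ∨ o = cf j 0 ∧ u.toNat < 2 ^ L.b') :
    ConnState G H a₀ L j dir v R X (setR x o u) := by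
  have oR : R ≠ o ∧ v ≠ o := by
    rcases ho with ho | ⟨s, hs, rfl⟩ | ⟨rfl, -⟩
    · exact ⟨ho.2.2.symm, ho.2.1.symm⟩
    · have : s < 16 := by simp at hs; omega
      exact ⟨ne_fr hj this (Or.inr o!), ne_fr hj this (Or.inr o!)⟩
    · exact ⟨ne_fr hj d! (Or.inr o!), ne_fr hj d! (Or.inr o!)⟩
  refine ⟨fun r h0 hr hs => ?_, ?_, h.mem, ?_, ?_, h.std, ?_⟩
  · rw [setR_ne]
    · exact h.reg r h0 hr hs
    · rintro rfl; rcases ho with ho | ⟨s, hs', e⟩ | ⟨e, -⟩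
      · omega
      · exact hs s (by simp at hs' ⊢; omega) e
      · exact hs 0 (by simp) e
  · by_cases e : cf j 0 = o
    · rcases ho with ho | ⟨s, hs', rfl⟩ | ⟨rfl, hu⟩
      · have := (congrArg Fin.val e).symm.trans (fr_val hj (show 0 < 16 by decide)); omega
      · exact (fr_ne_fr hj d! (by simp at hs'; omega) (by simp at hs'; omega) e).elim
      · rw [setR_self]; exact hu
    · rw [setR_ne e]; exact h.cand
  · rw [setR_ne oR.1]; exact h.frame
  · rw [setR_ne oR.1]; exact h.hR
  · rw [setR_ne oR.2]; exact h.prep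

lemma ConnInput.setR {L : LevelP} (h : ConnInput G H a₀ L j dir v R x) (ho : (o.val = 0 ∨ 16 * (2 * j + 3) ≤ o.val) ∧ o ≠ v ∧ o ≠ R) (u : BitVec w) :
    ConnInput G H a₀ L j dir v R (setR x o u) := by
  refine ⟨h.clean.setR ho.1 u, ?_, ?_⟩
  · rw [setR_ne ho.2.2.symm]; exact h.hR
  · rw [setR_ne ho.2.1.symm]; exact h.prep

lemma connSearch_assm (hσ : LCtx n H K lv σ) (hK : K ≤ 6) (hj : j < K) (hd : 300 ≤ d)
    (hR : 16 * (2 * j + 3) ≤ R.val) (hX : 16 * (2 * j + 3) ≤ X.val) (hv : 16 * (2 * j + 3) ≤ v.val)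
    (ho : (out.val = 0 ∨ 16 * (2 * j + 3) ≤ out.val) ∧ out ≠ v ∧ out ≠ R) (hoX : out ≠ X) :
    SearchAssm G (cf j 0) (cf j 1) (cf j 2) (cf j 3) out
      (lreg j 7) (lreg j 8) (lreg j 9) (.creg 4) (lreg j 14) (lv j).b' (lv j).nm' w
      ((16 * (2 * j + 1)) * 2 ^ (n + 40)) (connBody j dir R X) d σ
      (fun x => ConnSem G (lv j) dir (x.1 v) (x.1 R) (x.1 X) (x.1 (cf j 0)).toNat)
      {x | ConnState G H a₀ (lv j) j dir v R X x} 0 := by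
  have hw := hσ.hw; have ok := hσ.ok j hj; have hB : 2 * j + 1 ≤ 13 := by omega
  have lev := hσ.levAt hj hd; have ne := cf_ne (j := j) hB; have hi := fun s => hi_fr (s := s) hB
  have nR := ne_cf (R := R) hB o!; have nX := ne_cf (R := X) hB o!; have nv := ne_cf (R := v) hB o!
  have nout := ne_cf (R := out) hB o!
  have hout : Hi out := by rcases ho.1 with h | h <;> [exact Or.inl h; exact Or.inr o!]
  have n0 : ∀ s s', s < 16 ∧ s' < 16 ∧ s ≠ s' → cf j s' ≠ cf j s :=
    fun s s' h => (ne s s' h).symm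
  have ind : ∀ s, s < 16 ∧ 0 < s → Indep (fun x : QB w => ConnSem G (lv j) dir (x.1 v) (x.1 R) (x.1 X)
      (x.1 (cf j 0)).toNat) (cf j s) := fun s hs y u => by
    simp only [setR_ne (nv s hs.1), setR_ne (nR s hs.1), setR_ne (nX s hs.1),
      setR_ne (ne 0 s ⟨d!, hs.1, by omega⟩)]
  refine
    { spec := ?_
      hw := by omega
      hT := le_rfl
      vb := lev 7 d!
      vm := lev 8 d!
      vM := lev 9 d!
      vT := ⟨show 4 < d by omega, hσ.reg4⟩
      vst := lev 14 d!
      hM := two_pow_lt (by have := ok.hnm'; omega)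
      hi := ?_
      scr := ?_
      body := ?_ }
  · refine
      { nodup := ?_
        hb := by have := ok.hb'; omega
        hm := by have := ok.hnm'; omega
        hbm := ok.hbm'
        fC := ind 1 d!
        fo := ind 3 d!
        fout := fun y u => ?_
        sZ := fun x hx u hu => hx.setR hB hR hv (Or.inr (Or.inr ⟨rfl, hu⟩))
        sC := fun x hx u => hx.setR hB hR hv (Or.inr (Or.inl ⟨1, by simp, rfl⟩))
        sF := fun x hx u => hx.setR hB hR hv (Or.inr (Or.inl ⟨2, by simp, rfl⟩))
        so := fun x hx u => hx.setR hB hR hv (Or.inr (Or.inl ⟨3, by simp, rfl⟩))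
        sout := fun x hx u => hx.setR hB hR hv (Or.inl ho)
        sM := fun x hx r hr u => ?_ }
    · simp only [nodup_cons, mem_cons, not_mem_nil, not_or, or_false, nodup_nil]
      exact ⟨⟨ne _ _ d!, ne _ _ d!, ne _ _ d!, (nout 0 d!).symm⟩,
        ⟨ne _ _ d!, ne _ _ d!, (nout 1 d!).symm⟩,
        ⟨ne _ _ d!, (nout 2 d!).symm⟩, (nout 3 d!).symm, not_false, trivial⟩
    · simp only [setR_ne ho.2.1.symm, setR_ne ho.2.2.symm, setR_ne hoX.symm,
        setR_ne (nout 0 d!).symm]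
    · have same : ∀ q, q < 2 ^ (n + 20) → q ≠ 16 * (2 * j + 1) →
          SameAt n (setM x ((16 * (2 * j + 1)) * 2 ^ (n + 40) + r)##w u).2 x.2 q :=
        fun q hq hne => sameAt_setM hw x hq (lt_region_num o!) hne hr hσ.hwU u
      exact ⟨hx.reg, hx.cand, fun q h1 h2 h3 h4 => (hx.mem q h1 h2 h3 h4).same
        (same q (lt_region_num o!) h3), hx.frame.same (same _ (lt_region_num o!)
        o!) hw ok.htn, hx.hR, hx.std.same (fun q h1 h2 => same q h2 o!) hσ.hH,
        hx.prep.same hw ok.ha fun q hq => same q (lt_region_num o!) o!⟩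
  · intro r hr; simp only [mem_cons, not_mem_nil, or_false] at hr
    rcases hr with rfl | rfl | rfl | rfl | rfl
    exacts [hi 0 d!, hi 1 d!, hi 2 d!, hi 3 d!, hout]
  · intro x hx; have := hx.scr hB; exact ⟨this 1 d!, this 2 d!, this 3 d!, this 4 d!⟩
  · intro r i
    have hpure : (connBody j dir R X (d + 4)).All Gate.Pure := All.bracket (pure_connPrep _ _ _ _ _) trivial
    rw [den_eq_permL G hpure]; refine approx_permL fun x hx => ?_
    rw [perm_connBody ((hσ.set hd _).set o! _) hK hj o! hR hX hx
      (avoids_connPrep (hi 3 d!) (nR 3 d!) (nX 3 d!)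
        (fun s hs h => ne s 3 ⟨hs, by decide, by omega⟩) _ _),
      xorP_apply (fun y u => by simp only [ind 3 d! y u])]

lemma conn_approx (hσ : LCtx n H K lv σ) (hK : K ≤ 6) (hj : j < K) (hd : 300 ≤ d)
    (hR : 16 * (2 * j + 3) ≤ R.val) (hX : 16 * (2 * j + 3) ≤ X.val) (hv : 16 * (2 * j + 3) ≤ v.val)
    (ho : (out.val = 0 ∨ 16 * (2 * j + 3) ≤ out.val) ∧ out ≠ v ∧ out ≠ R) (hoX : out ≠ X) :
    Approx ((conn j dir R X out d).den G d σ) (permL (xorP out fun x => bw w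
      (∃ z < 2 ^ (lv j).b', ConnSem G (lv j) dir (x.1 v) (x.1 R) (x.1 X) z)))
      {x | ConnInput G H a₀ (lv j) j dir v R x} (2 * (1 / 2) ^ w) := by
  have hw := hσ.hw; have ok := hσ.ok j hj; have hB : 2 * j + 1 ≤ 13 := by omega
  have lev := hσ.levAt hj hd; have hi := fun s => hi_fr (s := s) hB
  have nR := ne_cf (R := R) hB o!; have nX := ne_cf (R := X) hB o!; have nv := ne_cf (R := v) hB o!
  have nout := ne_cf (R := out) hB o!
  have hout : Hi out := by rcases ho.1 with h | h <;> [exact Or.inl h; exact Or.inr o!]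
  have hHi : Hi R := Or.inr o!
  have key := (connSearch_assm (G := G) (a₀ := a₀) (dir := dir) hσ hK hj hd hR hX hv ho hoX).search_approx
  have key' := approx_bracket_xorP (A := connFrame j R d) (g := fun x => ∃ z < 2 ^ (lv j).b',
    ConnSem G (lv j) dir (x.1 v) (x.1 R) (x.1 X) z) (S := {x | ConnInput G H a₀ (lv j) j dir v R x})
    ⟨trivial, pure_frameFrom _ _ _⟩ (avoids_connFrame hout ho.2.2.symm (nout 9 d!).symm d) key ?_ ?_ ?_
    (fun x hx u => ConnInput.setR hx ho u) ?_
  · refine Approx.mono key' subset_rfl (by simp)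
  · intro y u; simp only [setR_comm _ (nout 0 d!), setR_self,
      setR_ne ho.2.1.symm, setR_ne ho.2.2.symm, setR_ne hoX.symm]
    simp only [setR_ne (nv 0 d!), setR_ne (nR 0 d!), setR_ne (nX 0 d!),
      setR_ne ho.2.1.symm, setR_ne ho.2.2.symm, setR_ne hoX.symm,
      setR_ne (nout 0 d!).symm, setR_self]
  · intro y u; simp only [setR_ne ho.2.1.symm, setR_ne ho.2.2.symm, setR_ne hoX.symm]
  · intro x hx
    have zr : ∀ s, s < 16 → x.1 (cf j s) = 0 := fun s hs =>
      hx.clean.reg _ (by rw [fr_val hB hs]; omega) (by rw [fr_val hB hs]; omega)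
    obtain ⟨h1, h2, h3⟩ := perm_frameCopy (G := G) (hi 9 d!) hHi (nR 9 d!) hw
      (lev 1 d!) (lev 15 d!) ok.htn (lt_region_num o!) hx.clean.scr
      (zr 9 d!) (hx.clean.mem _ o! o!)
    change ((connFrame j R d).perm G d σ x).1 = _ at h1
    change ∀ q, q < 2 ^ (n + 20) → q ≠ 16 * (2 * j + 1) + 1 → SameAt n ((connFrame j R d).perm G d σ x).2 x.2 q at h2
    change FrameAt n ((connFrame j R d).perm G d σ x).2 (16 * (2 * j + 1) + 1) _ _ at h3
    set y := (connFrame j R d).perm G d σ x with hy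
    have yR : ∀ r, r ≠ cf j 9 → y.1 r = x.1 r := fun r hr => by rw [h1, setR_ne hr]
    have yz : ∀ s, s < 16 ∧ s ≠ 9 → y.1 (cf j s) = 0 := fun s hs => by
      rw [yR _ (fr_ne_fr hB hs.1 d! hs.2), zr s hs.1]
    refine ⟨⟨fun r h0 hr hs => ?_, ?_, ?_, ?_, ?_, ?_, ?_⟩, yz 0 d!, yz 3 d!,
      yz 1 d!, yz 2 d!, fun r hr => ?_⟩
    · rw [yR r (hs 9 (by simp))]; exact hx.clean.reg r h0 o!
    · rw [yz 0 d!]; simp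
    · exact fun q q1 q2 q3 q4 => (hx.clean.mem q q1 o!).same
        (h2 q (lt_region_num o!) q4)
    · rw [yR _ (nR 9 d!)]; exact h3
    · rw [yR _ (nR 9 d!)]; exact hx.hR
    · exact hx.clean.std.same (fun q q1 q2 => h2 q q2 o!) hσ.hH
    · rw [yR _ (nv 9 d!)]; exact hx.prep.same hw ok.ha fun q hq => h2 q (lt_region_num o!) o!
    · have hrU : (r##w).toNat < 2 ^ (n + 40) := by
        rw [toNat_ofNat_of_lt (show n + 40 ≤ w by omega) (by have := hσ.hwU; omega)]
        have := hσ.hwU; omega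
      show y.2 (16 * (2 * j + 1) * 2 ^ (n + 40) + r)##w = 0; rw [ofNat_add]
      exact (hx.clean.mem (16 * (2 * j + 1)) o! o!).same
        (h2 _ (lt_region_num o!) o!) _ hrU
  · intro x hx
    have zr : ∀ s, s < 16 → x.1 (cf j s) = 0 := fun s hs =>
      hx.clean.reg _ (by rw [fr_val hB hs]; omega) (by rw [fr_val hB hs]; omega)
    have h1 := (perm_frameCopy (G := G) (hi 9 d!) hHi (nR 9 d!) hw
      (lev 1 d!) (lev 15 d!) ok.htn (lt_region_num o!) hx.clean.scr
      (zr 9 d!) (hx.clean.mem _ o! o!)).1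
    change ((connFrame j R d).perm G d σ x).1 = _ at h1
    have yR : ∀ r, r ≠ cf j 9 → ((connFrame j R d).perm G d σ x).1 r = x.1 r :=
      fun r hr => by rw [h1, setR_ne hr]
    refine exists_congr fun z => and_congr_right fun hz => ?_
    rw [setR_self, setR_ne (nv 0 d!), setR_ne (nR 0 d!),
      setR_ne (nX 0 d!), yR _ (nv 9 d!), yR _ (nR 9 d!),
      yR _ (nX 9 d!), toNat_ofNat_of_lt (by have := ok.hb'; omega) hz]

end ConnectionSearch

/-! # The recursive search -/

section Up

/-- The operand with the source. -/
def srcOp (dir : Bool) : COperand := if dir then .lit 0 else .creg 2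

def upTable (dir : Bool) (v : Reg) : RProg :=
  .seq (copyQ (fr 0 0) v) (.seq (copyC (fr 0 0) (srcOp dir))
    (readAt (fr 0 1) (.creg (if dir then 5 else 6)) (q (fr 0 0))))

def upFrame (j : ℕ) (dir : Bool) (v : Reg) (d : ℕ) : RProg :=
  .seq (copyQ (uf j 9) v) (.seq (copyC (uf j 9) (srcOp dir))
    (frameTab (!dir) (uf j 8) (lreg j 12) (lreg j 13) (lreg j 0) (lreg j 3)
      (uf j 9) v d))

def upCand (j : ℕ) (v : Reg) (d : ℕ) : RProg :=
  .seq (readList (uf j 4) (lreg j 1) (uf j 0) d)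
    (.seq (linTo (uf j 5) (lreg j 12) (lreg j 0) (uf j 4) d)
      (copyQ (uf j 5) v))

/-- Decide the existence of a path from the source to the vertex in `v`. -/
def up : ℕ → Bool → Reg → Reg → ℕ → RProg
  | 0, dir, v, out, _ => bracket (upTable dir v) (qx out .lt (c (.lit 0)) (q (fr 0 1)))
  | j + 1, dir, v, out, d => bracket (upFrame j dir v d) (search (uf j 0)
      (uf j 1) (uf j 2) (uf j 3) out (lreg j 4) (lreg j 5) (lreg j 6)
      (.creg 4) (lreg j 11) (fun e => bracket (upCand j v e) (bracket
        (.seq (up j dir (uf j 5) (uf j 6) e)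
          (conn j dir (uf j 4) (uf j 5) (uf j 7) e))
        (qx (uf j 3) .and (q (uf j 6)) (q (uf j 7))))) d)

def upBody (j : ℕ) (dir : Bool) (v : Reg) (e : ℕ) : RProg :=
  bracket (upCand j v e) (bracket
    (.seq (up j dir (uf j 5) (uf j 6) e)
      (conn j dir (uf j 4) (uf j 5) (uf j 7) e))
    (qx (uf j 3) .and (q (uf j 6)) (q (uf j 7))))

lemma avoids_upFrame {v r : Reg} (hr : Hi r) (hv : v ≠ r)
    (h : ∀ s < 16, uf j s ≠ r) : (upFrame j dir v d).All (·.Avoids r) :=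
  ⟨avoids_copyQ (h 9 d!) hv, ⟨h 9 d!, trivial, trivial⟩,
    avoids_frameTab hr (h 8 d!) (h 9 d!) hv _ _ _ _ _ _⟩

lemma avoids_upCand {v r : Reg} (hr : Hi r) (hv : v ≠ r)
    (h : ∀ s ∈ [0, 4, 5], uf j s ≠ r) : (upCand j v d).All (·.Avoids r) :=
  ⟨avoids_readList hr (h 4 (by simp)) (h 0 (by simp)) _ _,
    avoids_linTo hr (h 5 (by simp)) (h 4 (by simp)) _ _ _, avoids_copyQ (h 5 (by simp)) hv⟩

variable {lv : ℕ → LevelP} {v : Reg}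

/-- What `up` decides. -/
def UpSem (G : DGraph n) (a₀ : ℕ) (lv : ℕ → LevelP) (dir : Bool) : ℕ → BitVec w → Prop
  | 0, v => TabSem G dir (src w n dir) (twoPow w) n a₀ (v ^^^ src w n dir)
  | j + 1, v => ∃ z < 2 ^ (lv j).b,
      UpSem G a₀ lv dir j (v ^^^ lin (frameBit (v ^^^ src w n dir)) (lv j).a (LL w n (lv j).t z)) ∧
      ∃ z' < 2 ^ (lv j).b', ConnSem G (lv j) dir v (LL w n (lv j).t z)
        (v ^^^ lin (frameBit (v ^^^ src w n dir)) (lv j).a (LL w n (lv j).t z)) z'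

/-- The error of `up`. -/
def upErr (w : ℕ) (lv : ℕ → LevelP) : ℕ → ℝ
  | 0 => 0
  | j + 1 => 4 * w * 2 ^ (lv j).nm * (2 * (upErr w lv j + 2 * (1 / 2) ^ w)) + 2 * (1 / 2) ^ w

lemma srcOp_eval (hσ : Ctx n H σ) (dir : Bool) : (srcOp dir).eval σ = src w n dir := by
  cases dir
  · exact hσ.reg2
  · rfl

lemma src_lt (hw : 128 * (n + 1) ≤ w) (dir : Bool) : (src w n dir).toNat < 2 ^ n := by
  have h0 : 0 < 2 ^ n := by positivity
  cases dir
  · show (_##w).toNat < _; rw [toNat_ofNat_of_lt (b := n) o! o!]; omega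
  · simp [src]

lemma LL_lt (n h z : ℕ) : (LL w n h z).toNat < 2 ^ n := by
  unfold LL; split_ifs
  · exact listEntry_lt _ _ _
  · simp

lemma two_pow_lt_region (n : ℕ) : 2 ^ n ≤ 2 ^ (n + 40) :=
  two_pow_le o!

/-- The basis states on which `up` works. -/
def UpInput (G : DGraph n) (H a₀ j : ℕ) (v : Reg) : Set (QB w) :=
  {x | Clean G H a₀ (2 * j) x ∧ (x.1 v).toNat < 2 ^ n}

/-- `up` is approximately correct on level `j`. -/
def UpSpec (G : DGraph n) (H K a₀ : ℕ) (lv : ℕ → LevelP) (w j : ℕ) (ε : ℝ) : Prop :=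
  ∀ (σ : CStore w), LCtx n H K lv σ → ∀ (dir : Bool) (v out : Reg) (d : ℕ), 300 ≤ d →
    16 * (2 * j + 2) ≤ v.val → (out.val = 0 ∨ 16 * (2 * j + 2) ≤ out.val) → out ≠ v →
    Approx ((up j dir v out d).den G d σ)
      (permL (xorP out fun x => bw w (UpSem G a₀ lv dir j (x.1 v)))) (UpInput G H a₀ j v) ε

lemma upSpec_zero : UpSpec G H K a₀ lv w 0 0 := by
  intro σ hσ dir v out d hd hv hout hov; have hw := hσ.hw
  have hpure : (up 0 dir v out d).All Gate.Pure :=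
    All.bracket ⟨trivial, trivial, pure_readAt _ _⟩ trivial
  rw [den_eq_permL G hpure]; refine approx_permL fun x hx => ?_
  obtain ⟨hc, hxv⟩ := hx; rw [xorP_apply (fun y u => by rw [setR_ne hov.symm])]
  have hHi : Hi out := by rcases hout with h | h <;> [exact Or.inl h; exact Or.inr o!]
  have hv0 : v ≠ fr 0 0 := ne_fr o! d! o!; have n01 : fr 0 0 ≠ fr 0 1 := fr_ne_fr o! d! d! d!
  have no : ∀ s < 16, fr 0 s ≠ out := fun s hs => (ne_fr o! hs o!).symm
  have z : ∀ s < 16, x.1 (fr 0 s) = 0 := fun s hs =>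
    hc.reg _ (by rw [fr_val o! hs]; omega) (by rw [fr_val o! hs]; omega)
  have h0 : Hi (fr 0 0) := hi_fr o! d!; have h1 : Hi (fr 0 1) := hi_fr o! d!
  refine perm_bracket_xor G ⟨avoids_copyQ (no 0 d!) hov.symm, ⟨no 0 d!, trivial,
    trivial⟩, avoids_readAt hHi (no 1 d!) _ (no 0 d!)⟩ ?_
  rw [perm_cr (no 1 d!)]; congr 1
  have e1 : (copyC (fr 0 0) (srcOp dir)).perm G d σ ((copyQ (fr 0 0) v).perm G d σ x) =
      setR x (fr 0 0) (x.1 v ^^^ src w n dir) := by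
    rw [perm_copyQ hv0, perm_copyC, xorR_xorR, xorR_of_zero (z 0 d!), srcOp_eval hσ.toCtx]
  have vT : Val σ d (.creg (if dir then 5 else 6)) ((if dir then 1 else 2) * 2 ^ (n + 40)) := by
    cases dir
    · exact ⟨show 6 < d by omega, hσ.reg5 2 o! o!⟩
    · exact ⟨show 5 < d by omega, hσ.reg5 1 o! o!⟩
  rw [upTable, perm_seq, perm_seq, e1, perm_readAt_q ⟨h1.ne d!, h1.ne d!⟩ _
    ⟨h0.ne d!, h0.ne d!, n01⟩ _ _ (by
      rw [setR_ne (h0.ne d!).symm]; exact hc.scr 4 d!), vT.add_region,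
    setR_self, xorR_self, setR_ne n01.symm, z 1 d!, ofNat_eq_ofNat,
    bzero_xor, COperand.eval_lit, WordOp.eval_lt_zero]
  congr 1; refine propext (hc.std.tab dir _ ?_); rw [toNat_xor]
  exact (xor_lt_two_pow hxv (src_lt hw dir)).trans_le (two_pow_lt_region n)

/-- The basis states during the search of `up`. -/
structure UpState (G : DGraph n) (H a₀ : ℕ) (L : LevelP) (j : ℕ) (dir : Bool)
    (v : Reg) (x : QB w) : Prop where
  reg : ∀ r : Reg, 0 < r.val → r.val < 16 * (2 * j + 4) →
    (∀ s ∈ [0, 1, 2, 3, 8, 9], r ≠ uf j s) → x.1 r = 0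
  cand : (x.1 (uf j 0)).toNat < 2 ^ L.b
  mem : ∀ q, 16 ≤ q → q < 16 * (2 * j + 2) → ZeroAt n x.2 q
  hv : (x.1 v).toNat < 2 ^ n
  std : Std G H a₀ x.2
  prep : Prepared G L j dir (x.1 v) x.2

lemma UpState.scr {L : LevelP} (h : UpState G H a₀ L j dir v x)
    (hj : 2 * j + 2 ≤ 13) : Scr x := fun r hr => h.reg r hr.1 o! fun s hs e => by
  have h16 : s < 16 := by simp at hs; omega
  have := (congrArg Fin.val e).trans (fr_val hj h16); omega

lemma UpState.setR {L : LevelP} (h : UpState G H a₀ L j dir v x)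
    (hj : 2 * j + 2 ≤ 13) (hv : 16 * (2 * j + 4) ≤ v.val) {u : BitVec w} (ho : (o.val = 0 ∨ 16 * (2 * j + 4) ≤ o.val) ∧ o ≠ v ∨
      (∃ s ∈ [1, 2, 3], o = uf j s) ∨ o = uf j 0 ∧ u.toNat < 2 ^ L.b) :
    UpState G H a₀ L j dir v (setR x o u) := by
  have ov : v ≠ o := by
    rcases ho with ho | ⟨s, hs, rfl⟩ | ⟨rfl, -⟩
    · exact ho.2.symm
    · have : s < 16 := by simp at hs; omega
      exact ne_fr hj this (Or.inr o!)
    · exact ne_fr hj d! (Or.inr o!)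
  refine ⟨fun r h0 hr hs => ?_, ?_, h.mem, ?_, h.std, ?_⟩
  · rw [setR_ne]
    · exact h.reg r h0 hr hs
    · rintro rfl; rcases ho with ho | ⟨s, hs', e⟩ | ⟨e, -⟩
      · omega
      · exact hs s (by simp at hs' ⊢; omega) e
      · exact hs 0 (by simp) e
  · by_cases e : uf j 0 = o
    · rcases ho with ho | ⟨s, hs', rfl⟩ | ⟨rfl, hu⟩
      · have := (congrArg Fin.val e).symm.trans (fr_val hj (show 0 < 16 by decide)); omega
      · exact (fr_ne_fr hj d! (by simp at hs'; omega) (by simp at hs'; omega) e).elim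
      · rw [setR_self]; exact hu
    · rw [setR_ne e]; exact h.cand
  · rw [setR_ne ov]; exact h.hv
  · rw [setR_ne ov]; exact h.prep

/-- What the body of the search of `up` decides. -/
def CandSem (G : DGraph n) (a₀ : ℕ) (lv : ℕ → LevelP) (dir : Bool) (j : ℕ)
    (v : BitVec w) (z : ℕ) : Prop :=
  UpSem G a₀ lv dir j (v ^^^ lin (frameBit (v ^^^ src w n dir)) (lv j).a (LL w n (lv j).t z)) ∧
    ∃ z' < 2 ^ (lv j).b', ConnSem G (lv j) dir v (LL w n (lv j).t z)
      (v ^^^ lin (frameBit (v ^^^ src w n dir)) (lv j).a (LL w n (lv j).t z)) z'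

lemma upBody_approx (hσ : LCtx n H K lv σ) (hK : K ≤ 6) (hj : j < K) (hd : 300 ≤ d)
    (hv : 16 * (2 * j + 4) ≤ v.val) (ih : UpSpec G H K a₀ lv w j ε) :
    Approx ((upBody j dir v d).den G d σ) (permL (xorP (uf j 3) fun x =>
      bw w (CandSem G a₀ lv dir j (x.1 v) (x.1 (uf j 0)).toNat)))
      {x | UpState G H a₀ (lv j) j dir v x} (2 * (ε + 2 * (1 / 2) ^ w)) := by
  have hw := hσ.hw; have ok := hσ.ok j hj; have hA : 2 * j + 2 ≤ 13 := by omega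
  have lev := hσ.levAt hj hd; have ne := uf_ne (j := j) hA; have hi := fun s => hi_fr (s := s) hA
  have nv := ne_uf (R := v) hA o!
  have fv : ∀ s, s < 16 → (uf j s).val = 16 * (2 * j + 3) + s := fun s h => fr_val hA h
  set S : Set (QB w) := {x | ConnInput G H a₀ (lv j) j dir v (uf j 4) x ∧
    (x.1 (uf j 5)).toNat < 2 ^ n} with hS
  have sset : ∀ s, s < 16 ∧ s ≠ 4 ∧ s ≠ 5 → ∀ x ∈ S, ∀ u, setR x (uf j s) u ∈ S :=
    fun s hs x hx u => ⟨hx.1.setR ⟨Or.inr (by rw [fv s hs.1]; omega), (nv s hs.1).symm,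
      ne _ _ ⟨hs.1, by decide, hs.2.1⟩⟩ u, by
        rw [setR_ne (ne _ _ ⟨d!, hs.1, hs.2.2.symm⟩)]; exact hx.2⟩
  have a1 := (ih σ hσ dir (uf j 5) (uf j 6) d hd (by rw [fv 5 d!]; omega)
    (Or.inr (by rw [fv 6 d!]; omega)) (ne _ _ d!)).mono (S' := S)
    (fun x hx => ⟨hx.1.clean.mono o!, hx.2⟩) le_rfl
  have a2 := (conn_approx (G := G) (a₀ := a₀) (dir := dir) (v := v) (R := uf j 4)
    (X := uf j 5) (out := uf j 7) hσ hK hj hd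
    (by rw [fv 4 d!]; omega) (by rw [fv 5 d!]; omega) o!
    ⟨Or.inr (by rw [fv 7 d!]; omega), (nv 7 d!).symm, ne _ _ d!⟩
    (ne _ _ d!)).mono (S' := S) (fun x hx => hx.1) le_rfl
  have a3 := approx_bracket_and (o := uf j 3) a1 a2 (by
      simp only [nodup_cons, mem_cons, not_mem_nil, not_or, or_false, nodup_nil]
      exact ⟨⟨ne _ _ d!, ne _ _ d!⟩, ne _ _ d!, not_false, trivial⟩)
    (fun y u => by simp only [setR_ne (ne 5 6 d!)])
    (fun y u => by simp only [setR_ne (ne 5 7 d!)])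
    (fun y u => by simp only [setR_ne (ne 5 3 d!)])
    (fun y u => by simp only [setR_ne (ne 5 6 d!), setR_ne (ne 4 6 d!), setR_ne (nv 6 d!)])
    (fun y u => by simp only [setR_ne (ne 5 7 d!), setR_ne (ne 4 7 d!), setR_ne (nv 7 d!)])
    (fun y u => by simp only [setR_ne (ne 5 3 d!), setR_ne (ne 4 3 d!), setR_ne (nv 3 d!)])
    (sset 6 d!) (sset 7 d!) (sset 3 d!)
  have ecand : ∀ x, UpState G H a₀ (lv j) j dir v x → (upCand j v d).perm G d σ x =
      setR (setR x (uf j 4) (LL w n (lv j).t (x.1 (uf j 0)).toNat))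
        (uf j 5) (x.1 v ^^^ lin (frameBit (x.1 v ^^^ src w n dir)) (lv j).a
          (LL w n (lv j).t (x.1 (uf j 0)).toNat)) := by
    intro x hx; have hscr := hx.scr hA
    have z : ∀ s, s < 16 ∧ s ∉ [0, 1, 2, 3, 8, 9] → x.1 (uf j s) = 0 := fun s h =>
      hx.reg _ (by rw [fv s h.1]; omega) (by rw [fv s h.1]; omega) fun s' hs' =>
        ne _ _ ⟨h.1, by simp at hs'; omega, fun e => h.2 (e ▸ hs')⟩
    have e1 : (readList (uf j 4) (lreg j 1) (uf j 0) d).perm G d σ x =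
        setR x (uf j 4) (LL w n (lv j).t (x.1 (uf j 0)).toNat) := by
      rw [perm_readList hσ.toCtx (hi 4 d!) (hi 0 d!) (ne _ _ d!) o!
        (lev 1 d!) hscr, xorR_of_zero (z 4 d!)]
      congr 1; exact hx.std.list _ ok.ht _ (lt_of_lt_of_le hx.cand (two_pow_le
        (by have := ok.hb; omega)))
    set m := LL w n (lv j).t (x.1 (uf j 0)).toNat with hm
    have e2 : (linTo (uf j 5) (lreg j 12) (lreg j 0) (uf j 4) d).perm G d σ
        (setR x (uf j 4) m) = setR (setR x (uf j 4) m) (uf j 5)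
          (lin (frameBit (x.1 v ^^^ src w n dir)) (lv j).a m) := by
      rw [perm_linTo (hi 5 d!) (hi 4 d!) (ne _ _ d!) (lev 0 d!)
        (lev 12 d!) (by have := ok.ha; show (lv j).a ≤ w; omega)
        (hscr.setR (hi 4 d!) _), xorR_of_zero]
      · rw [setR_self, setR_mem]; congr 1; exact lin_congr hx.prep.frame _
      · rw [setR_ne (ne _ _ d!), z 5 d!]
    rw [upCand, perm_seq, perm_seq, e1, e2, perm_copyQ (nv 5 d!), xorR, setR_setR,
      setR_self, setR_ne (nv 5 d!), setR_ne (nv 4 d!), bxor_comm]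
  refine approx_bracket_xorP (A := upCand j v d) ⟨pure_readList _ _, pure_linTo _ _ _, trivial⟩
    (avoids_upCand (hi 3 d!) (nv 3 d!) fun s hs => ne _ _
      ⟨by simp at hs; omega, by decide, by simp at hs; omega⟩) a3 ?_ ?_ ?_
    (fun x hx u => UpState.setR hx hA hv (Or.inr (Or.inl ⟨3, by simp, rfl⟩))) ?_
  · intro y u; simp only [setR_ne (ne 5 3 d!), setR_ne (ne 4 3 d!), setR_ne (nv 3 d!)]
  · intro y u; simp only [setR_ne (ne 0 3 d!), setR_ne (nv 3 d!)]
  · intro x hx; rw [ecand x hx]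
    have z : ∀ s, s < 16 ∧ s ∉ [0, 1, 2, 3, 8, 9] → x.1 (uf j s) = 0 := fun s h =>
      hx.reg _ (by rw [fv s h.1]; omega) (by rw [fv s h.1]; omega) fun s' hs' =>
        ne _ _ ⟨h.1, by simp at hs'; omega, fun e => h.2 (e ▸ hs')⟩
    refine ⟨⟨⟨⟨fun r h0 hr => ?_, fun q h1 h2 => hx.mem q h1 o!, hx.std⟩, ?_, ?_⟩, ?_⟩, ?_, ?_⟩
    · have hr' : ∀ s < 16, r ≠ uf j s := fun s hs e => by
        rw [e, fv s hs] at hr; omega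
      rw [setR_ne (hr' 5 d!), setR_ne (hr' 4 d!)]
      exact hx.reg r h0 o! fun s hs => hr' s (by simp at hs; omega)
    · rw [setR_ne (ne _ _ d!), setR_self]; exact LL_lt _ _ _
    · rw [setR_ne (nv 5 d!), setR_ne (nv 4 d!)]; exact hx.prep
    · rw [setR_self, toNat_xor]; refine xor_lt_two_pow hx.hv (lin_lt (frameBit_lt ?_) _ _)
      rw [toNat_xor]; exact xor_lt_two_pow hx.hv (src_lt hw dir)
    · rw [setR_ne (ne _ _ d!), setR_ne (ne _ _ d!), z 6 d!]
    · rw [setR_ne (ne _ _ d!), setR_ne (ne _ _ d!), z 7 d!]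
  · intro x hx; rw [ecand x hx]
    simp only [setR_self, setR_ne (ne 4 5 d!), setR_ne (nv 5 d!), setR_ne (nv 4 d!)]; rfl

lemma perm_upFrame (hσ : LCtx n H K lv σ) (hK : K ≤ 6) (hj : j < K) (hd : 300 ≤ d)
    (hv : 16 * (2 * j + 4) ≤ v.val) (hx : Clean G H a₀ (2 * j + 2) x) :
    (∀ r, r ≠ uf j 8 → r ≠ uf j 9 → ((upFrame j dir v d).perm G d σ x).1 r = x.1 r) ∧
    (∀ q, q < 2 ^ (n + 20) → q ≠ 16 * (2 * j + 2) + 1 → q ≠ 16 * (2 * j + 2) + 2 →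
      SameAt n ((upFrame j dir v d).perm G d σ x).2 x.2 q) ∧
    Prepared G (lv j) j dir (x.1 v) ((upFrame j dir v d).perm G d σ x).2 := by
  have hw := hσ.hw; have ok := hσ.ok j hj; have hA : 2 * j + 2 ≤ 13 := by omega
  have lev := hσ.levAt hj hd; have ne := uf_ne (j := j) hA; have hi := fun s => hi_fr (s := s) hA
  have nv := ne_uf (R := v) hA o!
  have zr : ∀ s, s < 16 → x.1 (uf j s) = 0 := fun s hs =>
    hx.reg _ (by rw [fr_val hA hs]; omega) (by rw [fr_val hA hs]; omega)
  have e1 : (copyC (uf j 9) (srcOp dir)).perm G d σ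
      ((copyQ (uf j 9) v).perm G d σ x) =
      setR x (uf j 9) (x.1 v ^^^ src w n dir) := by
    rw [perm_copyQ (nv 9 d!), perm_copyC, xorR_xorR, xorR_of_zero (zr 9 d!), srcOp_eval hσ.toCtx]
  obtain ⟨h1, h2, h3, h4⟩ := perm_frameTab (G := G) (dir := !dir) (Y := uf j 8)
    (m := uf j 9) (s := v) (x := setR x (uf j 9) (x.1 v ^^^ src w n dir))
    hσ.toCtx (hi 8 d!) (hi 9 d!)
    (Or.inr o!) (ne _ _ d!) (nv 8 d!) o! (lev 0 d!)
    (lev 3 d!) (lev 12 d!) (lev 13 d!) ok.ha ok.hβ o!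
    (lt_region_num o!) (lt_region_num o!) (hx.scr.setR (hi 9 d!) _)
    (by rw [setR_ne (ne _ _ d!), zr 8 d!])
    (hx.mem _ o! o!) (hx.mem _ o! o!)
  have e : (upFrame j dir v d).perm G d σ x = (frameTab (!dir) (uf j 8) (lreg j 12)
      (lreg j 13) (lreg j 0) (lreg j 3) (uf j 9) v d).perm G d σ
        (setR x (uf j 9) (x.1 v ^^^ src w n dir)) := by
    rw [upFrame, perm_seq, perm_seq, e1]
  rw [e]; rw [setR_self] at h3 h4; rw [setR_ne (nv 9 d!)] at h4
  exact ⟨fun r h8 h9 => by rw [h1, setR_ne h8, setR_ne h9], h2, h3, h4⟩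

lemma upSpec_succ (hK : K ≤ 6) (hj : j < K) (ih : UpSpec G H K a₀ lv w j ε) :
    UpSpec G H K a₀ lv w (j + 1)
      (4 * w * 2 ^ (lv j).nm * (2 * (ε + 2 * (1 / 2) ^ w)) + 2 * (1 / 2) ^ w) := by
  intro σ hσ dir v out d hd hv hout hov
  replace hv : 16 * (2 * j + 4) ≤ v.val := by omega
  replace hout : out.val = 0 ∨ 16 * (2 * j + 4) ≤ out.val := by omega
  have hw := hσ.hw; have ok := hσ.ok j hj; have hA : 2 * j + 2 ≤ 13 := by omega
  have lev := hσ.levAt hj hd; have ne := uf_ne (j := j) hA; have hi := fun s => hi_fr (s := s) hA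
  have nv := ne_uf (R := v) hA o!; have nout := ne_uf (R := out) hA o!
  have nout' : ∀ s, s < 16 → uf j s ≠ out := fun s h => (nout s h).symm
  have hHi : Hi out := by rcases hout with h | h <;> [exact Or.inl h; exact Or.inr o!]
  have assm : SearchAssm G (uf j 0) (uf j 1) (uf j 2) (uf j 3) out
      (lreg j 4) (lreg j 5) (lreg j 6) (.creg 4) (lreg j 11) (lv j).b (lv j).nm w
      ((16 * (2 * j + 2)) * 2 ^ (n + 40)) (upBody j dir v) d σ
      (fun x => CandSem G a₀ lv dir j (x.1 v) (x.1 (uf j 0)).toNat)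
      {x | UpState G H a₀ (lv j) j dir v x} (2 * (ε + 2 * (1 / 2) ^ w)) := by
    have ind : ∀ s, s < 16 ∧ 0 < s → Indep (fun x : QB w =>
        CandSem G a₀ lv dir j (x.1 v) (x.1 (uf j 0)).toNat) (uf j s) :=
      fun s hs y u => by
        simp only [setR_ne (nv s hs.1), setR_ne (ne 0 s ⟨d!, hs.1, by omega⟩)]
    refine
      { spec := ?_
        hw := by omega
        hT := le_rfl
        vb := lev 4 d!
        vm := lev 5 d!
        vM := lev 6 d!
        vT := ⟨show 4 < d by omega, hσ.reg4⟩
        vst := lev 11 d!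
        hM := two_pow_lt (by have := ok.hnm; omega)
        hi := ?_
        scr := ?_
        body := ?_ }
    · refine
        { nodup := ?_
          hb := by have := ok.hb; omega
          hm := by have := ok.hnm; omega
          hbm := ok.hbm
          fC := ind 1 d!
          fo := ind 3 d!
          fout := fun y u => ?_
          sZ := fun x hx u hu => hx.setR hA hv (Or.inr (Or.inr ⟨rfl, hu⟩))
          sC := fun x hx u => hx.setR hA hv (Or.inr (Or.inl ⟨1, by simp, rfl⟩))
          sF := fun x hx u => hx.setR hA hv (Or.inr (Or.inl ⟨2, by simp, rfl⟩))
          so := fun x hx u => hx.setR hA hv (Or.inr (Or.inl ⟨3, by simp, rfl⟩))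
          sout := fun x hx u => hx.setR hA hv (Or.inl ⟨hout, hov⟩)
          sM := fun x hx r hr u => ?_ }
      · simp only [nodup_cons, mem_cons, not_mem_nil, not_or, or_false, nodup_nil]
        exact ⟨⟨ne _ _ d!, ne _ _ d!, ne _ _ d!, nout' 0 d!⟩, ⟨ne _ _ d!, ne _ _ d!, nout' 1 d!⟩,
          ⟨ne _ _ d!, nout' 2 d!⟩, nout' 3 d!, not_false, trivial⟩
      · simp only [setR_ne hov.symm, setR_ne (nout' 0 d!)]
      · have same : ∀ q, q < 2 ^ (n + 20) → q ≠ 16 * (2 * j + 2) →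
            SameAt n (setM x ((16 * (2 * j + 2)) * 2 ^ (n + 40) + r)##w u).2 x.2 q :=
          fun q hq hne => sameAt_setM hw x hq (lt_region_num o!) hne hr hσ.hwU u
        exact ⟨hx.reg, hx.cand, fun q h1 h2 => (hx.mem q h1 h2).same
          (same q (lt_region_num o!) o!), hx.hv,
          hx.std.same (fun q h1 h2 => same q h2 o!) hσ.hH,
          hx.prep.same hw ok.ha fun q hq => same q (lt_region_num o!) o!⟩
    · intro r hr; simp only [mem_cons, not_mem_nil, or_false] at hr
      rcases hr with rfl | rfl | rfl | rfl | rfl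
      exacts [hi 0 d!, hi 1 d!, hi 2 d!, hi 3 d!, hHi]
    · intro x hx; have := hx.scr hA; exact ⟨this 1 d!, this 2 d!, this 3 d!, this 4 d!⟩
    · intro r i; exact upBody_approx ((hσ.set hd _).set o! _) hK hj o! hv ih
  have key := assm.search_approx; have key' := approx_bracket_xorP (A := upFrame j dir v d)
    (g := fun x => UpSem G a₀ lv dir (j + 1) (x.1 v)) (S := UpInput G H a₀ (j + 1) v)
    ⟨trivial, trivial, pure_frameTab _ _ _ _ _ _⟩ (avoids_upFrame hHi hov.symm nout') key
    ?_ ?_ ?_ ?_ ?_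
  · exact key'
  · intro y u; simp only [setR_ne (nv 0 d!), setR_self, setR_ne hov.symm]
  · intro y u; simp only [setR_ne hov.symm]
  · intro x hx; obtain ⟨hx, hxv⟩ := hx; have hx : Clean G H a₀ (2 * j + 2) x := hx
    obtain ⟨h1, h2, h3⟩ := perm_upFrame (dir := dir) (v := v) hσ hK hj hd hv hx
    set y := (upFrame j dir v d).perm G d σ x with hy
    have zr : ∀ s, s < 16 → x.1 (uf j s) = 0 := fun s hs =>
      hx.reg _ (by rw [fr_val hA hs]; omega) (by rw [fr_val hA hs]; omega)
    have yz : ∀ s, s < 16 ∧ s ≠ 8 ∧ s ≠ 9 → y.1 (uf j s) = 0 := fun s hs => by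
      rw [h1 _ (ne _ _ ⟨hs.1, by decide, hs.2.1⟩) (ne _ _ ⟨hs.1, by decide, hs.2.2⟩), zr s hs.1]
    have yv : y.1 v = x.1 v := h1 v (nv 8 d!) (nv 9 d!)
    refine ⟨⟨fun r h0 hr hs => ?_, ?_, ?_, ?_, ?_, ?_⟩, yz 0 d!, yz 3 d!,
      yz 1 d!, yz 2 d!, fun r hr => ?_⟩
    · rw [h1 r (hs 8 (by simp)) (hs 9 (by simp))]; exact hx.reg r h0 o!
    · rw [yz 0 d!]; simp
    · exact fun q q1 q2 => (hx.mem q q1 o!).same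
        (h2 q (lt_region_num o!) o! o!)
    · rw [yv]; exact hxv
    · exact hx.std.same (fun q q1 q2 => h2 q q2 o! o!) hσ.hH
    · rw [yv]; exact h3
    · have hrU : (r##w).toNat < 2 ^ (n + 40) := by
        rw [toNat_ofNat_of_lt (show n + 40 ≤ w by omega) (by have := hσ.hwU; omega)]
        have := hσ.hwU; omega
      show y.2 (16 * (2 * j + 2) * 2 ^ (n + 40) + r)##w = 0; rw [ofNat_add]
      exact (hx.mem (16 * (2 * j + 2)) o! o!).same
        (h2 _ (lt_region_num o!) o! o!) _ hrU
  · intro x hx u; exact ⟨hx.1.setR o! u, by rw [setR_ne hov.symm]; exact hx.2⟩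
  · intro x hx
    have h1 := (perm_upFrame (dir := dir) (v := v) hσ hK hj hd hv hx.1).1 v (nv 8 d!) (nv 9 d!)
    refine exists_congr fun z => and_congr_right fun hz => ?_
    rw [setR_self, setR_ne (nv 0 d!), h1, toNat_ofNat_of_lt (by have := ok.hb; omega) hz]; rfl

lemma upSpec (hK : K ≤ 6) : ∀ j ≤ K, UpSpec G H K a₀ lv w j (upErr w lv j)
  | 0, _ => upSpec_zero
  | j + 1, hj => upSpec_succ hK hj (upSpec hK j o!)

end Up

/-! # The search for the middle vertex -/

section Top

def topBody (K : ℕ) (e : ℕ) : RProg :=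
  bracket (.seq (up K true (cf K 0) (cf K 4) e)
    (up K false (cf K 0) (cf K 5) e))
    (qx (cf K 3) .and (q (cf K 4)) (q (cf K 5)))

/-- Search for a vertex that is reachable from the bottom and from which the top is reachable. -/
def top (K : ℕ) (d : ℕ) : RProg :=
  search (cf K 0) (cf K 1) (cf K 2) (cf K 3) 0
    (.creg 0) (.creg 250) (.creg 251) (.creg 4) (.creg 252) (topBody K) d

variable {lv : ℕ → LevelP}

lemma topBody_approx (hσ : LCtx n H K lv σ) (hK : K ≤ 6) (hd : 300 ≤ d) :
    Approx ((topBody K d).den G d σ) (permL (xorP (cf K 3) fun x => bw w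
      (UpSem G a₀ lv true K (x.1 (cf K 0)) ∧ UpSem G a₀ lv false K (x.1 (cf K 0)))))
      {x | x ∈ UpInput G H a₀ K (cf K 0) ∧ x.1 (cf K 4) = 0 ∧
        x.1 (cf K 5) = 0} (2 * (upErr w lv K + upErr w lv K)) := by
  have hA : 2 * K + 1 ≤ 13 := by omega
  have ne := cf_ne (j := K) hA
  have fv : ∀ s, s < 16 → (cf K s).val = 16 * (2 * K + 2) + s := fun s h => fr_val hA h
  have sset : ∀ s, s < 16 ∧ s ≠ 0 → ∀ x ∈ UpInput (w := w) G H a₀ K (cf K 0), ∀ u,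
      setR x (cf K s) u ∈ UpInput G H a₀ K (cf K 0) := fun s hs x hx u =>
    ⟨hx.1.setR (Or.inr (by rw [fv s hs.1]; omega)) u, by
      rw [setR_ne (ne 0 s ⟨d!, hs.1, hs.2.symm⟩)]; exact hx.2⟩
  have a := fun dir s (hs : s < 16 ∧ s ≠ 0) => upSpec (G := G) (a₀ := a₀) hK K le_rfl σ hσ dir
    (cf K 0) (cf K s) d hd
    (by rw [fv 0 d!]; omega) (Or.inr (by rw [fv s hs.1]; omega))
    (ne _ _ ⟨hs.1, by decide, hs.2⟩)
  have ind : ∀ dir s, s < 16 ∧ s ≠ 0 → Indep (fun x : QB w =>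
      UpSem G a₀ lv dir K (x.1 (cf K 0))) (cf K s) := fun dir s hs y u => by
    simp only [setR_ne (ne 0 s ⟨d!, hs.1, hs.2.symm⟩)]
  exact approx_bracket_and (a true 4 d!) (a false 5 d!) (by
      simp only [nodup_cons, mem_cons, not_mem_nil, not_or, or_false, nodup_nil]
      exact ⟨⟨ne _ _ d!, ne _ _ d!⟩, ne _ _ d!, not_false, trivial⟩)
    (ind _ 4 d!) (ind _ 5 d!) (ind _ 3 d!) (ind _ 4 d!)
    (ind _ 5 d!) (ind _ 3 d!) (sset 4 d!) (sset 5 d!)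
    (sset 3 d!)

lemma top_approx (hσ : LCtx n H K lv σ) (hK : K ≤ 6) (hd : 300 ≤ d) {nm : ℕ} (hnm : nm ≤ n + 39)
    (hbm : 4 * 2 ^ n ≤ (2 ^ nm) ^ 2) (v0 : Val σ d (.creg 0) n) (v1 : Val σ d (.creg 250) nm)
    (v2 : Val σ d (.creg 251) (2 ^ nm))
    (v3 : Val σ d (.creg 252) ((16 * (2 * K + 1)) * 2 ^ (n + 40))) :
    Approx ((top K d).den G d σ) (permL (xorP 0 fun _ => bw w (∃ z < 2 ^ n,
      UpSem G a₀ lv true K z##w ∧ UpSem G a₀ lv false K z##w)))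
      {x | Clean G H a₀ (2 * K + 1) x}
      (4 * w * 2 ^ nm * (2 * (upErr w lv K + upErr w lv K)) + 2 * (1 / 2) ^ w) := by
  have hw := hσ.hw; have hA : 2 * K + 1 ≤ 13 := by omega
  have ne := cf_ne (j := K) hA; have hi := fun s => hi_fr (s := s) hA
  have fv : ∀ s, s < 16 → (cf K s).val = 16 * (2 * K + 2) + s := fun s h => fr_val hA h
  have nout : ∀ s, s < 16 → cf K s ≠ 0 := fun s h e => by
    have := congrArg Fin.val e; rw [fv s h] at this; simp at this
  have h0 : ((0 : Reg) : ℕ) = 0 := rfl; set S : Set (QB w) := {x | x ∈ UpInput G H a₀ K (cf K 0) ∧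
    x.1 (cf K 4) = 0 ∧ x.1 (cf K 5) = 0} with hS
  set f : QB w → Prop := fun x => UpSem G a₀ lv true K (x.1 (cf K 0)) ∧
    UpSem G a₀ lv false K (x.1 (cf K 0)) with hf
  have ind : ∀ r, cf K 0 ≠ r → Indep f r := fun r hr y u => by
    simp only [hf, setR_ne hr]
  have sset : ∀ r, (r.val = 0 ∨ 16 * (2 * K + 2) ≤ r.val) → (∀ s ∈ [0, 4, 5], cf K s ≠ r) →
      ∀ x ∈ S, ∀ u, setR x r u ∈ S := fun r hr hs x hx u =>
    ⟨⟨hx.1.1.setR hr u, by rw [setR_ne (hs 0 (by simp))]; exact hx.1.2⟩,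
      by rw [setR_ne (hs 4 (by simp))]; exact hx.2.1,
      by rw [setR_ne (hs 5 (by simp))]; exact hx.2.2⟩
  have sf : ∀ s, s < 16 ∧ s ∉ [0, 4, 5] → ∀ x ∈ S, ∀ u, setR x (cf K s) u ∈ S :=
    fun s hs => sset _ (Or.inr (by rw [fv s hs.1]; omega)) fun s' hs' =>
      ne _ _ ⟨by simp at hs'; omega, hs.1, fun e => hs.2 (e ▸ hs')⟩
  have assm : SearchAssm G (cf K 0) (cf K 1) (cf K 2) (cf K 3) 0
      (.creg 0) (.creg 250) (.creg 251) (.creg 4) (.creg 252) n nm w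
      ((16 * (2 * K + 1)) * 2 ^ (n + 40)) (topBody K) d σ f S
      (2 * (upErr w lv K + upErr w lv K)) := by
    refine
      { spec := ?_
        hw := by omega
        hT := le_rfl
        vb := v0
        vm := v1
        vM := v2
        vT := ⟨show 4 < d by omega, hσ.reg4⟩
        vst := v3
        hM := two_pow_lt o!
        hi := ?_
        scr := ?_
        body := fun r j => topBody_approx ((hσ.set hd _).set o! _) hK o! }
    · refine
        { nodup := ?_
          hb := by omega
          hm := by omega
          hbm := hbm
          fC := ind _ (ne _ _ d!)
          fo := ind _ (ne _ _ d!)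
          fout := ind _ (nout 0 d!)
          sZ := fun x hx u hu => ⟨⟨hx.1.1.setR (Or.inr (by rw [fv 0 d!]; omega)) u, by
              rw [setR_self]; exact hu⟩, by rw [setR_ne (ne _ _ d!)]; exact hx.2.1,
              by rw [setR_ne (ne _ _ d!)]; exact hx.2.2⟩
          sC := sf 1 d!
          sF := sf 2 d!
          so := sf 3 d!
          sout := sset 0 (Or.inl h0) fun s hs => nout s (by simp at hs; omega)
          sM := fun x hx r hr u => ?_ }
      · simp only [nodup_cons, mem_cons, not_mem_nil, not_or, or_false, nodup_nil]
        exact ⟨⟨ne _ _ d!, ne _ _ d!, ne _ _ d!, nout 0 d!⟩, ⟨ne _ _ d!, ne _ _ d!, nout 1 d!⟩,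
          ⟨ne _ _ d!, nout 2 d!⟩, nout 3 d!, not_false, trivial⟩
      · have same : ∀ q, q < 2 ^ (n + 20) → q ≠ 16 * (2 * K + 1) →
            SameAt n (setM x ((16 * (2 * K + 1)) * 2 ^ (n + 40) + r)##w u).2 x.2 q :=
          fun q hq hne => sameAt_setM hw x hq (lt_region_num o!) hne hr hσ.hwU u
        exact ⟨⟨⟨hx.1.1.reg, fun q h1 h2 => (hx.1.1.mem q h1 h2).same
          (same q (lt_region_num o!) o!),
          hx.1.1.std.same (fun q h1 h2 => same q h2 o!) hσ.hH⟩, hx.1.2⟩, hx.2⟩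
    · intro r hr; simp only [mem_cons, not_mem_nil, or_false] at hr
      rcases hr with rfl | rfl | rfl | rfl | rfl
      exacts [hi 0 d!, hi 1 d!, hi 2 d!, hi 3 d!, Or.inl rfl]
    · intro x hx; have := hx.1.1.scr; exact ⟨this 1 d!, this 2 d!, this 3 d!, this 4 d!⟩
  have key := assm.search_approx
  have zr : ∀ s, s < 16 → ∀ x : QB w, Clean G H a₀ (2 * K + 1) x →
      x.1 (cf K s) = 0 := fun s hs x hx =>
    hx.reg _ (by rw [fv s hs]; omega) (by rw [fv s hs]; omega)
  have hsub : {x | Clean G H a₀ (2 * K + 1) x} ⊆ SearchSpec.clean (cf K 0) (cf K 1)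
      (cf K 2) (cf K 3) w
      (fun r => ((16 * (2 * K + 1)) * 2 ^ (n + 40) + r)##w) S := by
    intro x hx; refine ⟨⟨⟨hx.mono o!, by rw [zr 0 d! x hx]; simp⟩, zr 4 d! x hx,
      zr 5 d! x hx⟩, zr 0 d! x hx, zr 3 d! x hx, zr 1 d! x hx,
      zr 2 d! x hx, fun r hr => ?_⟩
    have hrU : (r##w).toNat < 2 ^ (n + 40) := by
      rw [toNat_ofNat_of_lt (show n + 40 ≤ w by omega) (by have := hσ.hwU; omega)]
      have := hσ.hwU; omega
    show x.2 (16 * (2 * K + 1) * 2 ^ (n + 40) + r)##w = 0; rw [ofNat_add]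
    exact hx.mem (16 * (2 * K + 1)) o! o! _ hrU
  refine Approx.mono ?_ hsub le_rfl
  have e : (fun x : QB w => bw w (∃ m < 2 ^ n, f (setR x (cf K 0) m##w))) =
      fun _ => bw w (∃ z < 2 ^ n, UpSem G a₀ lv true K z##w ∧
        UpSem G a₀ lv false K z##w) := by
    funext x; simp only [hf, setR_self]
  rwa [e] at key

end Top

/-! # Initialization of the quantum memory -/

/-- Store the value of `op a b` at address `T + i`. -/
def storeAt (op : WordOp) (a b T i : COperand) : RProg :=
  .seq (qx 5 op (c a) (c b)) (swapAt 5 T (c i))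

lemma perm_storeAt (op : WordOp) (a b T i : COperand) (d : ℕ) (σ : CStore w) (h5 : x.1 5 = 0) (h4 : x.1 4 = 0) (h : x.2 (T.eval σ + i.eval σ) = 0) :
    (storeAt op a b T i).perm G d σ x =
      setM x (T.eval σ + i.eval σ) (op.eval (a.eval σ) (b.eval σ)) := by
  rw [storeAt, perm_seq, perm_cc, xorR_of_zero h5,
    perm_swapAt (i := c i) d! T trivial trivial d σ (by rw [setR_ne d!, h4])]
  show setM (setR (setR x 5 _) 5 (x.2 (T.eval σ + i.eval σ))) (T.eval σ + i.eval σ) _ = _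
  rw [h, setR_setR, setR_eq_self h5, setR_self]

lemma ordProd_store {S : ℕ → Equiv.Perm (QB w)} {A : BitVec w} {f : ℕ → BitVec w}
    {N : ℕ} (hN : N ≤ 2 ^ w) (h0 : ∀ i < N, x.2 (A + i##w) = 0)
    (hS : ∀ i < N, ∀ y : QB w, y.1 = x.1 → y.2 (A + i##w) = 0 → S i y = setM y (A + i##w) (f i)) :
    ordProd S N x = (x.1, writeMem x.2 A f N) := by
  induction N with
  | zero => rfl
  | succ N ih =>
    rw [ordProd, Equiv.Perm.mul_apply, ih o! (fun i hi => h0 i o!)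
      (fun i hi => hS i o!)]
    refine (hS N o! (x.1, writeMem x.2 A f N) rfl ?_).trans rfl; show writeMem x.2 A f N _ = 0
    rw [writeMem_of_ne, h0 N o!]; intro i hi e; exact absurd ((add_ofNat_inj o! o!).1 e) o!

/-- Store the standard frame at `T`. -/
def initFrame (T a : COperand) (d : ℕ) : RProg :=
  .loop false a (storeAt .shl (.lit 1) (.creg d) T (.creg d))

lemma perm_initFrame {a : COperand} {t : ℕ} (hw : 128 * (n + 1) ≤ w)
    (va : Val σ d a na) (vT : Val σ d T (t * 2 ^ (n + 40))) (hna : na ≤ n) (hx : Scr x) (h0 : ZeroAt n x.2 t) :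
    (initFrame T a d).perm G d σ x = (x.1, writeMem x.2 (T.eval σ) (twoPow w) na) := by
  have hnw : na < 2 ^ w := lt_two_pow_of_le o!
  show (ordProd _ (a.eval σ).toNat : Equiv.Perm (QB w)) x = _; rw [va.toNat hnw]
  refine ordProd_store hnw.le (fun i hi => by
    rw [vT.add_region]; exact h0 _ (small_lt_region hw o!)) fun i hi y hy hy0 => ?_
  have e1 : T.eval (σ.set d i##w) = T.eval σ := eval_set vT.1 le_rfl _ _
  have e2 : (COperand.creg d).eval (σ.set d i##w) = i##w := val_creg_eval _ _ _
  have := perm_storeAt (G := G) .shl (.lit 1) (.creg d) T (.creg d) (d + 2)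
    (σ.set d i##w) (x := y) (by rw [hy]; exact hx 5 d!)
    (by rw [hy]; exact hx 4 d!) (by rw [e1, e2]; exact hy0)
  rw [e1, e2] at this; refine this.trans ?_; congr 1; show 1#w <<< i##w = _
  rw [shiftLeft_eq', toNat_ofNat, mod_eq_of_lt o!]; exact (BitVec.twoPow_eq w i).symm

/-- Copy `N` words of classical memory from `L` to the quantum memory at `T`. -/
def copyList (L T N : COperand) (d : ℕ) : RProg :=
  .loop false N (.letop .add L (.creg d) (.letld (.creg (d + 2))
    (storeAt .or (.creg (d + 3)) (.creg (d + 3)) T (.creg d))))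

lemma perm_copyList {L N : COperand} {N' l t : ℕ} 
    (vN : Val σ d N N') (vL : Val σ d L (l * 2 ^ (n + 40))) (vT : Val σ d T (t * 2 ^ (n + 40)))
    (hN : N' < 2 ^ (n + 40)) (hnw : n + 40 ≤ w) (hx : Scr x) (h0 : ZeroAt n x.2 t) :
    (copyList L T N d).perm G d σ x =
      (x.1, writeMem x.2 (T.eval σ) (fun i => σ.mem (region n l i##w)) N') := by
  have hN2 : N' < 2 ^ w := hN.trans_le (two_pow_le hnw)
  show (ordProd _ (N.eval σ).toNat : Equiv.Perm (QB w)) x = _; rw [vN.toNat hN2]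
  refine ordProd_store hN2.le (fun i hi => by
    rw [vT.add_region]; exact h0 _ (by rw [toNat_ofNat_of_lt hnw o!]; omega))
    fun i hi y hy hy0 => ?_
  set σ1 := σ.set d i##w with hσ1
  set σ2 := σ1.set (d + 2) (WordOp.add.eval (L.eval σ1) ((COperand.creg d).eval σ1)) with hσ2
  set σ3 := σ2.set (d + 3) (σ2.mem ((COperand.creg (d + 2)).eval σ2)) with hσ3
  have low : ∀ o : COperand, o.Lt d → o.eval σ1 = o.eval σ ∧ o.eval σ3 = o.eval σ := by
    intro o ho; have q1 : o.eval σ1 = o.eval σ := eval_set ho le_rfl _ _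
    have q2 : o.eval σ2 = o.eval σ := (eval_set ho o! _ _).trans q1
    exact ⟨q1, (eval_set ho o! _ _).trans q2⟩
  have c0 : (COperand.creg d).eval σ1 = i##w := val_creg_eval _ _ _
  have c0' : (COperand.creg d).eval σ3 = i##w :=
    (set_reg_ne _ _ o!).trans ((set_reg_ne _ _ o!).trans c0)
  have c2 : (COperand.creg (d + 2)).eval σ2 = region n l i##w := by
    rw [hσ2, val_creg_eval, c0, (low L vL.1).1]; exact vL.add_region _
  have c3 : (COperand.creg (d + 3)).eval σ3 = σ.mem (region n l i##w) := by
    rw [hσ3, val_creg_eval, c2]; rfl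
  have e : ((RProg.letop .add L (.creg d) (.letld (.creg (d + 2))
    (storeAt .or (.creg (d + 3)) (.creg (d + 3)) T (.creg d)))).perm G (d + 2) σ1) y =
    (storeAt .or (.creg (d + 3)) (.creg (d + 3)) T (.creg d)).perm G (d + 2 + 1 + 1) σ3 y := rfl
  have := perm_storeAt (G := G) .or (.creg (d + 3)) (.creg (d + 3)) T (.creg d) (d + 2 + 1 + 1)
    σ3 (x := y) (by rw [hy]; exact hx 5 d!)
    (by rw [hy]; exact hx 4 d!) (by rw [c0', (low T vT.1).2]; exact hy0)
  rw [c0', (low T vT.1).2, c3, or_self_eval] at this; exact e.trans this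

/-- Load the list for `h`. -/
def loadList (h : COperand) : ℕ → RProg := withList (.creg 0) h fun L N e =>
  .letop .add h (.lit 257) (.letop .mul (.creg e) (.creg 1) (copyList L (.creg (e + 1)) N (e + 2)))

lemma perm_loadList (hσ : Ctx n H σ) {h : COperand} (hd : 8 ≤ d)
    (v0 : Val σ d (.creg 0) n) (vh : Val σ d h nh) (hnh : nh ≤ H) (hx : Scr x) (h0 : ZeroAt n x.2 (nh + 257)) :
    (loadList h d).perm G d σ x = (x.1, writeMem x.2 ((nh + 257) * 2 ^ (n + 40))##w
        (fun i => σ.mem (region n (nh + 1) i##w)) (listLen n (nh + 1))) := by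
  have hw := hσ.hw; have hH := hσ.hH
  obtain ⟨σ6, hm, up, vN, vL, hp, -⟩ := withList_env (G := G) hσ hd v0 vh le_rfl hnh
  set σ7 := σ6.set (d + 6) (WordOp.add.eval (h.eval σ6) ((COperand.lit 257).eval σ6)) with hσ7
  set σ8 := σ7.set (d + 7)
    (WordOp.mul.eval ((COperand.creg (d + 6)).eval σ7) ((COperand.creg 1).eval σ7)) with hσ8
  have up8 : ∀ {o u}, Val σ6 (d + 6) o u → Val σ8 (d + 8) o u := fun ho =>
    ((ho.set le_rfl _).set o! _).mono o!
  have v1 := (up (o := .creg 1) ⟨show 1 < d by omega, hσ.reg1⟩).set le_rfl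
    (WordOp.add.eval (h.eval σ6) ((COperand.lit 257).eval σ6))
  have c7 : (COperand.creg (d + 6)).eval σ7 = (nh + 257)##w := by
    rw [hσ7, val_creg_eval, (up vh).2, COperand.eval_lit, ofNat_add nh 257]
    generalize 257#w = c
    rfl
  have c8 : (COperand.creg (d + 7)).eval σ8 = ((nh + 257) * 2 ^ (n + 40))##w := by
    rw [hσ8, val_creg_eval, c7, v1.2, ofNat_mul (nh + 257)]
    generalize (nh + 257)##w = c
    rfl
  have hlen : listLen n (nh + 1) < 2 ^ (n + 40) :=
    (listLen_le_two_pow n (nh + 1)).trans_lt (two_pow_lt o!)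
  have vT : Val σ8 (d + 8) (.creg (d + 7)) ((nh + 257) * 2 ^ (n + 40)) :=
    ⟨show d + 7 < d + 8 by omega, c8⟩
  rw [loadList, hp]; have := perm_copyList (G := G) (up8 vN) (up8 vL) vT hlen o! hx h0
  rw [c8, show σ8.mem = σ.mem from hm] at this; exact this

def loadLists (N : COperand) (d : ℕ) : RProg := .loop false N (loadList (.creg d) (d + 2))

lemma perm_loadLists (hσ : Ctx n H σ) {N : COperand} {N' : ℕ} (hd : 8 ≤ d)
    (v0 : Val σ d (.creg 0) n) (vN : Val σ d N N') (hN : N' ≤ H + 1) (hx : Scr x)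
    (h0 : ∀ h ≤ H, ZeroAt n x.2 (h + 257)) :
    ((loadLists N d).perm G d σ x).1 = x.1 ∧
    (∀ q, q < 2 ^ (n + 20) → (∀ h < N', q ≠ h + 257) →
      SameAt n ((loadLists N d).perm G d σ x).2 x.2 q) ∧
    ∀ h < N', ∀ v : BitVec w, v.toNat < 2 ^ (n + 40) →
      ((loadLists N d).perm G d σ x).2 (region n (h + 257) v) = LL w n h v.toNat := by
  have hw := hσ.hw; have hH := hσ.hH
  have hlt : ∀ h ≤ H, h + 257 < 2 ^ (n + 20) := fun h hh => by
    have : 2 ^ (n + 20) = 2 ^ n * 2 ^ 20 := pow_add _ _ _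
    have h2 : n < 2 ^ n := Nat.lt_two_pow_self; omega
  show ((ordProd _ (N.eval σ).toNat : Equiv.Perm (QB w)) x).1 = _ ∧ (∀ q, _ → _ → SameAt n
    ((ordProd _ (N.eval σ).toNat : Equiv.Perm (QB w)) x).2 _ _) ∧ ∀ h, _ → ∀ v : BitVec w, _ →
    ((ordProd _ (N.eval σ).toNat : Equiv.Perm (QB w)) x).2 _ = _
  rw [vN.toNat (lt_two_pow_of_le o!)]; clear vN; induction N' with
  | zero => exact ⟨rfl, fun q _ _ v _ => rfl, fun h hh => absurd hh o!⟩
  | succ N' ih =>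
    obtain ⟨i1, i2, i3⟩ := ih o!; rw [ordProd, Equiv.Perm.mul_apply]
    set y := (ordProd (fun j => (loadList (.creg d) (d + 2)).perm G (d + 2)
      (σ.set d j##w)) N' : Equiv.Perm (QB w)) x with hy
    change y.1 = x.1 at i1
    change ∀ q, q < 2 ^ (n + 20) → (∀ h < N', q ≠ h + 257) → SameAt n y.2 x.2 q at i2
    change ∀ h < N', ∀ v : BitVec w, v.toNat < 2 ^ (n + 40) → y.2 (region n (h + 257) v) =
      LL w n h v.toNat at i3
    have e := perm_loadList (G := G) (h := .creg d) (d := d + 2) (nh := N') (x := y)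
      (hσ.set hd N'##w) o! ((v0.set le_rfl _).mono o!)
      ((Val.creg σ d N').mono o!) o!
      (fun r hr => by rw [i1]; exact hx r hr)
      ((h0 N' o!).same (i2 _ (hlt _ o!) (by intro h hh; omega)))
    show ((loadList (.creg d) (d + 2)).perm G (d + 2) (σ.set d N'##w) y).1 = x.1 ∧
      (∀ q, _ → _ → SameAt n ((loadList (.creg d) (d + 2)).perm G (d + 2)
        (σ.set d N'##w) y).2 x.2 q) ∧ ∀ h, _ → ∀ v : BitVec w, _ →
      ((loadList (.creg d) (d + 2)).perm G (d + 2) (σ.set d N'##w) y).2 _ = _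
    rw [e]; have hlen : listLen n (N' + 1) < 2 ^ (n + 40) :=
      (listLen_le_two_pow n (N' + 1)).trans_lt (two_pow_lt o!)
    have hi40 : ∀ i < listLen n (N' + 1), (i##w).toNat = i := fun i hi =>
      toNat_ofNat_of_lt (show n + 40 ≤ w by omega) o!
    have other : ∀ q, q < 2 ^ (n + 20) → q ≠ N' + 257 → SameAt n (writeMem y.2 (ofNat w
        ((N' + 257) * 2 ^ (n + 40))) (fun i => σ.mem (region n (N' + 1) i##w))
        (listLen n (N' + 1))) y.2 q := fun q hq hne v hv =>
      writeMem_of_ne fun i hi e => hne (region_inj hw hq (hlt _ o!) hv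
        (by rw [hi40 i hi]; omega) e).1
    refine ⟨i1, fun q hq hne v hv => ?_, fun h hh v hv => ?_⟩
    · exact (other q hq (hne N' o!) v hv).trans (i2 q hq (fun h hh => hne h o!) v hv)
    · by_cases hc : h = N'
      · subst hc; show writeMem _ _ _ _ _ = _; unfold LL; split_ifs with hv'
        · have ev : v = ofNat w v.toNat := by simp
          have : region n (h + 257) v = ((h + 257) * 2 ^ (n + 40))##w +
            ofNat w v.toNat := by rw [← ev]; rfl
          rw [this]; exact (writeMem_apply (hlen.trans_le (two_pow_le o!)).le hv').trans
            (hσ.list (h + 1) o! _ hv')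
        · rw [writeMem_of_ne, i2 _ (hlt _ o!) (by intro h hh; omega) v hv, h0 h o! v hv]
          intro i hi e
          have := (region_inj hw (hlt _ o!) (hlt _ o!) hv (by rw [hi40 i hi]; omega) e).2
          rw [this, hi40 i hi] at hv'; exact hv' hi
      · exact (other _ (hlt _ o!) o! v hv).trans (i3 h o! v hv)

def initTable (dir : Bool) (d : ℕ) : RProg :=
  .seq (copyC 13 (srcOp dir)) (.seq (dpList dir (.creg 7) (.creg (if dir then 5 else 6)) (.creg 0)
    (.creg 253) d) (copyC 13 (srcOp dir)))

/-- Fill the quantum memory with the permanent contents. -/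
def init (d : ℕ) : RProg :=
  .seq (initFrame (.creg 7) (.creg 0) d) (.seq (initTable true d) (.seq (initTable false d)
    (loadLists (.creg 254) d)))

lemma perm_initTable (hσ : Ctx n H σ) (hd : 300 ≤ d)
    (v0 : Val σ d (.creg 0) n) (va : Val σ d (.creg 253) a₀) (ha : a₀ ≤ H)
    (hx : Scr x) (h0 : ZeroAt n x.2 (if dir then 1 else 2)) (h3 : ∀ j < n, x.2 (region n 3 j##w) =
      twoPow w j) :
    ((initTable dir d).perm G d σ x).1 = x.1 ∧
    (∀ q, q < 2 ^ (n + 20) → q ≠ (if dir then 1 else 2) →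
      SameAt n ((initTable dir d).perm G d σ x).2 x.2 q) ∧
    TabAt G ((initTable dir d).perm G d σ x).2 (if dir then 1 else 2) dir (src w n dir)
      (twoPow w) n a₀ := by
  have h13 : x.1 13 = 0 := hx _ d!
  have hscr : DpScr (setR x 13 (src w n dir)) := fun r hr => by
    rw [setR_ne hr.2.2.2]; exact hx r ⟨hr.1, hr.2.1⟩
  have hlt : (if dir then 1 else 2) < 2 ^ (n + 20) := lt_region_num (by split_ifs <;> norm_num)
  have vP : Val σ d (.creg 7) (3 * 2 ^ (n + 40)) := ⟨show 7 < d by omega, hσ.reg5 3 o! o!⟩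
  have vT : Val σ d (.creg (if dir then 5 else 6)) ((if dir then 1 else 2) * 2 ^ (n + 40)) := by
    cases dir
    · exact ⟨show 6 < d by omega, hσ.reg5 2 o! o!⟩
    · exact ⟨show 5 < d by omega, hσ.reg5 1 o! o!⟩
  obtain ⟨h1, h2, h3'⟩ := perm_dpList (G := G) (dir := dir) (x := setR x 13 (src w n dir)) hσ o!
    v0 va vP vT le_rfl ha (by split_ifs <;> omega) (lt_region_num (by norm_num)) hlt hscr h0
  rw [initTable, perm_seq, perm_seq, perm_copyC, perm_copyC, srcOp_eval hσ, xorR_of_zero h13]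
  refine ⟨?_, fun q hq hne v hv => ?_, fun v hv => ?_⟩
  · rw [xorR]; show update _ 13 _ = _; rw [h1, setR_self, bxor_self]
    show update (update x.1 13 _) 13 _ = _; rw [Function.update_idem, Function.update_eq_self_iff]
    exact h13.symm
  · rw [xorR_mem]; exact h2 _ fun v' hv' e => hne (region_inj hσ.hw hq hlt hv hv' e).1
  · rw [xorR_mem, h3' v hv, setR_self]; exact TabSem.congr h3

lemma perm_init (hσ : Ctx n H σ) {f : ℕ} (hd : 300 ≤ d) (hf : f ≤ 13)
    (v0 : Val σ d (.creg 0) n) (va : Val σ d (.creg 253) a₀) (vH : Val σ d (.creg 254) (H + 1))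
    (ha : a₀ ≤ H) :
    Clean G H a₀ f ((init d).perm G d σ (fun _ => 0, fun _ => 0)) ∧
      ((init d).perm G d σ (fun _ => 0, fun _ => 0)).1 = fun _ => 0 := by
  have hw := hσ.hw; have hH := hσ.hH; set x : QB w := (fun _ => 0, fun _ => 0) with hx
  have xs : Scr x := fun r hr => rfl
  have xz : ∀ q, ZeroAt n x.2 q := fun q v hv => rfl
  have vP : Val σ d (.creg 7) (3 * 2 ^ (n + 40)) := ⟨show 7 < d by omega, hσ.reg5 3 o! o!⟩
  have e1 := perm_initFrame (G := G) hw v0 vP le_rfl xs (xz 3)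
  set y1 := (initFrame (.creg 7) (.creg 0) d).perm G d σ x with hy1
  have l3 : (3 : ℕ) < 2 ^ (n + 20) := lt_region_num (by norm_num)
  have l2 : (2 : ℕ) < 2 ^ (n + 20) := lt_region_num (by norm_num)
  have l1 : (1 : ℕ) < 2 ^ (n + 20) := lt_region_num (by norm_num)
  have s1 : ∀ q, q < 2 ^ (n + 20) → q ≠ 3 → SameAt n y1.2 x.2 q := fun q hq hne v hv => by
    rw [e1]
    exact writeMem_of_ne fun i hi e => hne (region_inj hw hq l3 hv (small_lt_region hw o!)
      (by rw [vP.add_region] at e; exact e)).1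
  have f1 : ∀ j < n, y1.2 (region n 3 j##w) = twoPow w j := fun j hj => by
    rw [e1, ← vP.add_region]; exact writeMem_apply (lt_two_pow_of_le o!).le hj
  have r1 : y1.1 = x.1 := by rw [e1]
  obtain ⟨t1, t2, t3⟩ := perm_initTable (G := G) (dir := true) (x := y1) hσ hd v0 va ha
    (fun r hr => by rw [r1]) ((xz _).same (s1 _ l1 d!)) f1
  set y2 := (initTable true d).perm G d σ y1 with hy2
  simp only [if_true] at t2 t3
  have f2 : ∀ j < n, y2.2 (region n 3 j##w) = twoPow w j := fun j hj => by
    rw [t2 3 l3 d! _ (small_lt_region hw hj), f1 j hj]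
  obtain ⟨u1, u2, u3⟩ := perm_initTable (G := G) (dir := false) (x := y2) hσ hd v0 va ha
    (fun r hr => by rw [t1, r1])
    (((xz _).same (s1 _ l2 d!)).same (t2 _ l2 d!)) f2
  set y3 := (initTable false d).perm G d σ y2 with hy3
  simp only [Bool.false_eq_true, if_false] at u2 u3
  have hlt : ∀ h ≤ H, h + 257 < 2 ^ (n + 20) := fun h hh => by
    have : 2 ^ (n + 20) = 2 ^ n * 2 ^ 20 := pow_add _ _ _
    have h2 : n < 2 ^ n := Nat.lt_two_pow_self; omega
  have z3 : ∀ q, 4 ≤ q → q < 2 ^ (n + 20) → ZeroAt n y3.2 q := fun q h4 hq =>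
    (((xz _).same (s1 q hq o!)).same (t2 q hq o!)).same (u2 q hq o!)
  obtain ⟨k1, k2, k3⟩ := perm_loadLists (G := G) (x := y3) hσ o! v0 vH le_rfl
    (fun r hr => by rw [u1, t1, r1]) (fun h hh => z3 _ o! (hlt h hh))
  have e : (init d).perm G d σ x = (loadLists (.creg 254) d).perm G d σ y3 := rfl; rw [e]
  have kreg : ((loadLists (.creg 254) d).perm G d σ y3).1 = fun _ => 0 := by
    rw [k1, u1, t1, r1]
  refine ⟨⟨fun r _ _ => by rw [kreg], fun q h1 h2 => (z3 q o! (lt_region_num o!)).same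
    (k2 q (lt_region_num o!) (by intro h hh; omega)), ⟨fun h hh => k3 h o!, fun dir => ?_⟩⟩, kreg⟩
  cases dir
  · exact u3.same (k2 2 l2 (by intro h hh; omega))
  · exact (t3.same (u2 1 l1 d!)).same (k2 1 l1 (by intro h hh; omega))

/-! # Masks in a frame -/

/-- The number of one-bits of `D` below `i`. -/
def rank (D : BitVec w) (i : ℕ) : ℕ := Nat.count (fun i => D.getLsbD i = true) i

lemma weight_eq_count (D : BitVec w) : weight D = rank D w := by
  rw [rank, Nat.count_eq_card_filter_range]; rfl

lemma rank_inj {i : ℕ} (hi : D.getLsbD i = true) (hj : D.getLsbD j = true)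
    (h : rank D i = rank D j) : i = j :=
  Nat.count_injective (p := fun i => D.getLsbD i = true) hi hj h

lemma rank_lt {i : ℕ} (hi : D.getLsbD i = true) : rank D i < weight D := by
  rw [weight_eq_count]
  exact Nat.count_strict_mono (p := fun i => D.getLsbD i = true) hi (lt_of_getLsbD hi)

lemma exists_rank (hj : j < weight D) :
    ∃ i, D.getLsbD i = true ∧ rank D i = j := by
  set s := (range w).filter fun i => D.getLsbD i = true with hs
  have h1 : s.image (rank D) ⊆ range (weight D) := by
    intro k hk; obtain ⟨i, hi, rfl⟩ := Finset.mem_image.1 hk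
    exact mem_range.2 (rank_lt (mem_filter.1 hi).2)
  have h2 : (s.image (rank D)).card = weight D := by
    rw [Finset.card_image_of_injOn]
    · rfl
    · intro a ha b hb hab; exact rank_inj (mem_filter.1 ha).2 (mem_filter.1 hb).2 hab
  have h3 := Finset.eq_of_subset_of_card_le h1 (by rw [h2, card_range])
  have : j ∈ s.image (rank D) := by rw [h3]; exact mem_range.2 hj
  obtain ⟨i, hi, e⟩ := Finset.mem_image.1 this; exact ⟨i, (mem_filter.1 hi).2, e⟩

lemma getLsbD_lowBit (D : BitVec w) (i : ℕ) : (lowBit D).getLsbD i = true ↔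
    D.getLsbD i = true ∧ ∀ j < i, D.getLsbD j = false := by
  rw [lowBit, show (0 : BitVec w) - D = -D from by simp, BitVec.getLsbD_and, BitVec.getLsbD_neg]
  by_cases h : D.getLsbD i = true
  · have hi := lt_of_getLsbD h; have h' : D[i] = true := by rwa [BitVec.getLsbD_eq_getElem hi] at h
    simp [h', hi]
  · simp [h]

lemma getLsbD_strip_iterate (D : BitVec w) (j i : ℕ) : (strip^[j] D).getLsbD i = true ↔
    D.getLsbD i = true ∧ j ≤ rank D i := by
  induction j generalizing i with
  | zero => simp
  | succ j ih =>
    rw [iterate_succ_apply', strip, getLsbD_xor]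
    have hl : (lowBit (strip^[j] D)).getLsbD i = true ↔ D.getLsbD i = true ∧ rank D i = j := by
      rw [getLsbD_lowBit, ih]; constructor
      · rintro ⟨⟨h1, h2⟩, h3⟩; refine ⟨h1, h2.antisymm' ?_⟩; by_contra hc
        obtain ⟨i', hi', e⟩ := exists_rank (show j < weight D from lt_of_lt_of_le o!
          (rank_lt h1).le)
        have hlt : i' < i := by
          by_contra hge; have := Nat.count_monotone (fun i => D.getLsbD i = true) (not_lt.1 hge)
          change rank D i ≤ rank D i' at this; omega
        have := h3 i' hlt; rw [Bool.eq_false_iff, Ne, ih] at this; exact this ⟨hi', e.ge⟩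
      · rintro ⟨h1, h2⟩; refine ⟨⟨h1, h2.ge⟩, fun i' hi' => ?_⟩; rw [Bool.eq_false_iff, Ne, ih]
        rintro ⟨h3, h4⟩
        have : rank D i' < rank D i := Nat.count_strict_mono (p := fun i => D.getLsbD i = true) h3 hi'
        omega
    have hs := ih i; by_cases h1 : D.getLsbD i = true
    · by_cases h2 : rank D i = j
      · rw [hl.2 ⟨h1, h2⟩, hs.2 ⟨h1, h2.ge⟩]
        simp; omega
      · have h3 : (lowBit (strip^[j] D)).getLsbD i = false := by
          rw [Bool.eq_false_iff, Ne, hl]; tauto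
        rw [h3, Bool.xor_false, hs]; exact and_congr_right fun _ => by omega
    · have h3 : (lowBit (strip^[j] D)).getLsbD i = false := by
        rw [Bool.eq_false_iff, Ne, hl]; tauto
      rw [h3, Bool.xor_false, hs]
      tauto

lemma getLsbD_frameBit (D : BitVec w) (j i : ℕ) : (frameBit D j).getLsbD i = true ↔
    D.getLsbD i = true ∧ rank D i = j := by
  have h1 := getLsbD_strip_iterate D (j + 1) i; have h0 := getLsbD_strip_iterate D j i
  have e : frameBit D j = strip^[j] D ^^^ strip^[j + 1] D := by
    rw [iterate_succ_apply', strip, ← xor_assoc, bxor_self, bzero_xor]; rfl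
  rw [e, getLsbD_xor]; by_cases hD : D.getLsbD i = true
  · rcases lt_trichotomy (rank D i) j with h | h | h
    · have a : (strip^[j] D).getLsbD i = false := by rw [Bool.eq_false_iff, Ne, h0]; omega
      have b : (strip^[j + 1] D).getLsbD i = false := by rw [Bool.eq_false_iff, Ne, h1]; omega
      rw [a, b]; simp; omega
    · have b : (strip^[j + 1] D).getLsbD i = false := by rw [Bool.eq_false_iff, Ne, h1]; omega
      rw [h0.2 ⟨hD, h.ge⟩, b]; simp [hD, h]
    · rw [h0.2 ⟨hD, by omega⟩, h1.2 ⟨hD, by omega⟩]; simp; omega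
  · have a : (strip^[j] D).getLsbD i = false := by rw [Bool.eq_false_iff, Ne, h0]; tauto
    have b : (strip^[j + 1] D).getLsbD i = false := by rw [Bool.eq_false_iff, Ne, h1]; tauto
    rw [a, b]; simp [hD]

lemma strip_eq_zero (h : weight D ≤ j) : strip^[j] D = 0 := by
  refine eq_of_getLsbD_eq fun i _ => ?_
  have : (strip^[j] D).getLsbD i = false := by
    rw [Bool.eq_false_iff, Ne, getLsbD_strip_iterate]; rintro ⟨h1, h2⟩; have := rank_lt h1; omega
  rw [this]; simp

lemma lin_frameBit_xor_strip (D : BitVec w) (g : ℕ) (m : BitVec w)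
    (hm : ∀ j < g, m.getLsbD j = true) : lin (frameBit D) g m ^^^ strip^[g] D = D := by
  induction g with
  | zero => simp [lin]
  | succ g ih =>
    rw [lin, hm g o!, if_pos rfl, iterate_succ_apply', strip, xor_assoc,
      show frameBit D g ^^^ (strip^[g] D ^^^ lowBit (strip^[g] D)) = strip^[g] D from ?_,
      ih fun j hj => hm j o!]
    show lowBit (strip^[g] D) ^^^ _ = _; rw [bxor_comm, xor_assoc, bxor_self, bxor_zero]

lemma getLsbD_lin_frameBit (D m : BitVec w) (a i : ℕ) : (lin (frameBit D) a m).getLsbD i = true ↔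
    D.getLsbD i = true ∧ rank D i < a ∧ m.getLsbD (rank D i) = true := by
  induction a with
  | zero => simp [lin]
  | succ a ih =>
    rw [lin, getLsbD_xor]; have hf := getLsbD_frameBit D a i; by_cases hD : D.getLsbD i = true
    · by_cases hr : rank D i = a
      · have h1 : (lin (frameBit D) a m).getLsbD i = false := by
          rw [Bool.eq_false_iff, Ne, ih]; omega
        rw [h1]; split_ifs with hm
        · rw [hf.2 ⟨hD, hr⟩]; simp [hD, hr, hm]
        · simp [hD, hr, hm]
      · have h1 : (frameBit D a).getLsbD i = false := by rw [Bool.eq_false_iff, Ne, hf]; tauto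
        have h2 : (if m.getLsbD a then frameBit D a else 0).getLsbD i = false := by
          split_ifs <;> simp [h1]
        rw [h2, Bool.xor_false, ih]; exact and_congr_right fun _ => and_congr_left fun _ => by omega
    · have h1 : (frameBit D a).getLsbD i = false := by rw [Bool.eq_false_iff, Ne, hf]; tauto
      have h2 : (if m.getLsbD a then frameBit D a else 0).getLsbD i = false := by
        split_ifs <;> simp [h1]
      rw [h2, Bool.xor_false, ih]
      tauto

/-- The mask of `S` in the frame of `D`. -/
def maskIn (D : BitVec w) (a : ℕ) (S : BitVec w) : BitVec w :=
  bitWord w (fun j => ∃ i, D.getLsbD i = true ∧ S.getLsbD i = true ∧ rank D i = j) a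

lemma getLsbD_maskIn (ha : a ≤ w) (D S : BitVec w) (j : ℕ) : (maskIn D a S).getLsbD j = true ↔
      j < a ∧ ∃ i, D.getLsbD i = true ∧ S.getLsbD i = true ∧ rank D i = j :=
  getLsbD_bitWord ha _ _

lemma getLsbD_maskIn_rank (ha : a ≤ w) (S : BitVec w) {i : ℕ}
    (hi : D.getLsbD i = true) (hr : rank D i < a) :
    (maskIn D a S).getLsbD (rank D i) = S.getLsbD i := by
  rw [Bool.eq_iff_iff, getLsbD_maskIn ha]
  exact ⟨fun ⟨_, i', h1, h2, h3⟩ => by rwa [← rank_inj h1 hi h3], fun h => ⟨hr, i, hi, h, rfl⟩⟩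

lemma maskIn_xor (ha : a ≤ w) (D S S' : BitVec w) :
    maskIn D a (S ^^^ S') = maskIn D a S ^^^ maskIn D a S' := by
  refine eq_of_getLsbD_eq fun j hj => ?_
  rw [getLsbD_xor]; by_cases h : j < a ∧ ∃ i, D.getLsbD i = true ∧ rank D i = j
  · obtain ⟨h1, i, hi, rfl⟩ := h
    rw [getLsbD_maskIn_rank ha _ hi h1, getLsbD_maskIn_rank ha _ hi h1,
      getLsbD_maskIn_rank ha _ hi h1, getLsbD_xor]
  · have z : ∀ S, (maskIn D a S).getLsbD j = false := fun S => by
      rw [Bool.eq_false_iff, Ne, getLsbD_maskIn ha]; rintro ⟨h1, i, h2, -, h3⟩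
      exact h ⟨h1, i, h2, h3⟩
    rw [z, z, z]; rfl

lemma maskIn_twoPow (ha : a ≤ w) {i : ℕ} (hi : D.getLsbD i = true)
    (hr : rank D i < a) : maskIn D a (twoPow w i) = twoPow w (rank D i) := by
  have hiw := lt_of_getLsbD hi; refine eq_of_getLsbD_eq fun j hj => ?_
  rw [Bool.eq_iff_iff, getLsbD_maskIn ha, getLsbD_twoPow]
  simp only [getLsbD_twoPow, hiw, decide_true, Bool.true_and, decide_eq_true_eq]; constructor
  · rintro ⟨h1, i', h2, rfl, h3⟩
    simp only [h3, decide_true, Bool.and_true, decide_eq_true_eq]; exact hj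
  · intro h; simp only [Bool.and_eq_true, decide_eq_true_eq] at h; exact ⟨o!, i, hi, rfl, h.2⟩

lemma maskIn_lt (ha : a ≤ w) (D S : BitVec w) : (maskIn D a S).toNat < 2 ^ a := by
  refine Nat.lt_pow_two_of_testBit _ fun i hi => ?_
  show (maskIn D a S).getLsbD i = false; rw [Bool.eq_false_iff, Ne, getLsbD_maskIn ha]; omega

/-- The bits of `S` are bits of `D`. -/
def SubBits (S D : BitVec w) : Prop := ∀ i, S.getLsbD i = true → D.getLsbD i = true

lemma lin_maskIn (ha : a ≤ w) {S : BitVec w} (h : SubBits S D) (hD : weight D ≤ a) :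
    lin (frameBit D) a (maskIn D a S) = S := by
  refine eq_of_getLsbD_eq fun i hi => ?_
  rw [Bool.eq_iff_iff, getLsbD_lin_frameBit]; constructor
  · rintro ⟨h1, h2, h3⟩
    rwa [getLsbD_maskIn_rank ha _ h1 h2] at h3
  · intro hS; have hr := (rank_lt (h i hS)).trans_le hD
    exact ⟨h i hS, hr, by rwa [getLsbD_maskIn_rank ha _ (h i hS) hr]⟩

lemma weight_maskIn (ha : a ≤ w) {S : BitVec w} (h : SubBits S D) (hD : weight D ≤ a) :
    weight (maskIn D a S) = weight S := by
  symm
  refine Finset.card_bij (fun i _ => rank D i) ?_ ?_ ?_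
  · intro i hi; have hS := (mem_filter.1 hi).2; have hr := (rank_lt (h i hS)).trans_le hD
    exact mem_filter.2 ⟨mem_range.2 o!, by
      rwa [getLsbD_maskIn_rank ha _ (h i hS) hr]⟩
  · intro i hi j hj e; exact rank_inj (h i (mem_filter.1 hi).2) (h j (mem_filter.1 hj).2) e
  · intro j hj; obtain ⟨-, i, h1, h2, h3⟩ := (getLsbD_maskIn ha D S j).1 (mem_filter.1 hj).2
    exact ⟨i, mem_filter.2 ⟨mem_range.2 (lt_of_getLsbD h2), h2⟩, h3⟩

lemma maskIn_self {g : ℕ} (hg : g ≤ w) {S : BitVec w} (h : weight S = g) :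
    maskIn S g S = (2 ^ g - 1)##w := by
  refine eq_of_getLsbD_eq fun j hj => ?_
  rw [Bool.eq_iff_iff, getLsbD_maskIn hg, getLsbD_ofNat, Nat.testBit_two_pow_sub_one]
  simp only [hj, decide_true, Bool.true_and, decide_eq_true_eq]
  refine ⟨fun h => h.1, fun hjg => ⟨hjg, ?_⟩⟩
  obtain ⟨i, h1, h2⟩ := exists_rank (D := S) (j := j) o!; exact ⟨i, h1, h1, h2⟩

lemma getLsbD_eq_false_of_lt {i : ℕ} (h : D.toNat < 2 ^ n) (hi : n ≤ i) : D.getLsbD i = false :=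
  Nat.testBit_lt_two_pow (h.trans_le (two_pow_le hi))

lemma lin_standard (hn : n ≤ w) {m : BitVec w} (hm : m.toNat < 2 ^ n) :
    lin (twoPow w) n m = m := by
  have key : ∀ a ≤ w, ∀ i, (lin (twoPow w) a m).getLsbD i = (decide (i < a) && m.getLsbD i) := by
    intro a; induction a with
    | zero => simp [lin]
    | succ a ih =>
      intro ha i; rw [lin, getLsbD_xor, ih o!]; rcases lt_trichotomy i a with h | rfl | h
      · have h2 : (if m.getLsbD a then twoPow w a else 0).getLsbD i = false := by
          split_ifs
          · rw [getLsbD_twoPow]; simp; omega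
          · simp
        rw [h2]; simp [h, show i < a + 1 by omega]
      · have h2 : (if m.getLsbD i then twoPow w i else 0).getLsbD i = m.getLsbD i := by
          split_ifs with hb
          · rw [getLsbD_twoPow, hb]; simp; omega
          · simp at hb; simp [hb]
        rw [h2]; simp
      · have h2 : (if m.getLsbD a then twoPow w a else 0).getLsbD i = false := by
          split_ifs
          · rw [getLsbD_twoPow]; simp; omega
          · simp
        rw [h2]; simp [show ¬ i < a by omega, show ¬ i < a + 1 by omega]
  refine eq_of_getLsbD_eq fun i hi => ?_
  rw [key n hn]; by_cases h : i < n
  · simp [h]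
  · rw [getLsbD_eq_false_of_lt hm o!]; simp

/-! # Paths -/

section Paths

variable {E : BitVec w → BitVec w → Prop}

lemma FReach.reflTransGen {s : BitVec w} {P : ℕ → BitVec w} {m : BitVec w}
    (h : FReach E s P a m) : Relation.ReflTransGen E s (s ^^^ lin P a m) := by
  induction h with
  | zero =>
    have : lin P a 0 = 0 := by simpa using lin_xor P a 0 0
    rw [this, ofNat_eq_ofNat, bxor_zero]
  | step _ _ _ _ he ih => exact ih.tail he

lemma wordEdge_not (dir : Bool) : WordEdge (w := w) G (!dir) = Function.swap (WordEdge G dir) := by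
  cases dir <;> rfl

lemma getLsbD_mask {g : ℕ} (hg : g ≤ w) (hj : j < g) :
    ((2 ^ g - 1)##w).getLsbD j = true := by
  rw [getLsbD_ofNat, Nat.testBit_two_pow_sub_one]; simp; omega

lemma UpSem.reflTransGen {lv : ℕ → LevelP} (hw : 128 * (n + 1) ≤ w) (j : ℕ)
    (hg : ∀ i < j, (lv i).g ≤ w) (hv : v.toNat < 2 ^ n)
    (h : UpSem G a₀ lv dir j v) : Relation.ReflTransGen (WordEdge G dir) (src w n dir) v := by
  have hD : (v ^^^ src w n dir).toNat < 2 ^ n := by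
    rw [toNat_xor]; exact xor_lt_two_pow hv (src_lt hw dir)
  induction j generalizing v with
  | zero =>
    have := h.2.reflTransGen
    rwa [lin_standard o! hD, bxor_comm, xor_assoc, bxor_self, bxor_zero] at this
  | succ j ih =>
    obtain ⟨z, -, h1, z', -, ⟨h2, h3⟩, h4⟩ := h; set R := LL w n (lv j).t z
    set D := v ^^^ src w n dir; set Q := lin (frameBit R) (lv j).t (LL w n (lv j).g z')
    have hX : (v ^^^ lin (frameBit D) (lv j).a R).toNat < 2 ^ n := by
      rw [toNat_xor]; exact xor_lt_two_pow hv (lin_lt (fun i => frameBit_lt hD i) _ _)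
    have e1 := ih (fun i hi => hg i o!) hX h1 (by
      rw [toNat_xor]; exact xor_lt_two_pow hX (src_lt hw dir))
    have e2 := h4.2.reflTransGen
    have e3 := lin_frameBit_xor_strip (lin (frameBit D) (lv j).a Q) (lv j).g _
      fun i hi => getLsbD_mask (hg j o!) hi
    rw [h3, ofNat_eq_ofNat, bxor_zero] at e3; have e4 := h2.2.reflTransGen
    rw [wordEdge_not, lin_xor, ← xor_assoc] at e4; rw [e3] at e2
    exact (e1.trans e2).trans (Relation.reflTransGen_swap.1 e4)

/-- A path that flips the bits `b 0, b 1, …`. -/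
structure Chain (E : BitVec w → BitVec w → Prop) (c : ℕ → BitVec w) (b : ℕ → ℕ) (m : ℕ) : Prop where
  flip : ∀ k < m, c (k + 1) = c k ^^^ twoPow w (b k)
  inj : ∀ k < m, ∀ l < m, b k = b l → k = l
  lt : ∀ k < m, b k < w
  edge : ∀ k < m, E (c k) (c (k + 1))

namespace Chain

variable {c : ℕ → BitVec w} {b : ℕ → ℕ} {m : ℕ}

lemma drop (h : Chain E c b m) (p : ℕ) {m' : ℕ} (hm : p + m' ≤ m) :
    Chain E (fun k => c (p + k)) (fun k => b (p + k)) m' where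
  flip := fun k hk => h.flip (p + k) o!
  inj := fun k hk l hl e => by have := h.inj (p + k) o! (p + l) o! e; omega
  lt := fun k hk => h.lt (p + k) o!
  edge := fun k hk => h.edge _ o!

lemma reverse (h : Chain E c b m) {m' : ℕ} (hm : m' ≤ m) :
    Chain (Function.swap E) (fun k => c (m - k)) (fun k => b (m - 1 - k)) m' where
  flip := fun k hk => by
    have := h.flip (m - 1 - k) o!; rw [show m - 1 - k + 1 = m - k by omega] at this
    show c (m - (k + 1)) = _; rw [this, xor_assoc, bxor_self, bxor_zero, Nat.sub_sub, Nat.add_comm]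
  inj := fun k hk l hl e => by have := h.inj _ o! _ o! e; omega
  lt := fun k hk => h.lt _ o!
  edge := fun k hk => by
    have := h.edge (m - 1 - k) o!; rw [show m - 1 - k + 1 = m - k by omega] at this
    rwa [show m - 1 - k = m - (k + 1) by omega] at this

lemma getLsbD (h : Chain E c b m) {k l : ℕ} (hkl : k ≤ l) (hl : l ≤ m) (i : ℕ) :
    (c k ^^^ c l).getLsbD i = true ↔ ∃ j, k ≤ j ∧ j < l ∧ b j = i := by
  induction l, hkl using Nat.le_induction with
  | base => simp; omega
  | succ l hkl ih =>
    rw [h.flip l o!, ← xor_assoc, getLsbD_xor, getLsbD_twoPow]; by_cases hb : b l = i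
    · have h1 : (c k ^^^ c l).getLsbD i = false := by
        rw [Bool.eq_false_iff, Ne, ih o!]; rintro ⟨j, h1, h2, h3⟩
        have := h.inj j o! l o! (h3.trans hb.symm); omega
      subst hb; simp only [h1, h.lt l o!, decide_true, Bool.and_true, Bool.false_xor, true_iff]
      exact ⟨l, hkl, by omega, rfl⟩
    · simp only [hb, decide_false, Bool.and_false, Bool.xor_false, ih (by omega : l ≤ m)]
      refine exists_congr fun j => and_congr_right fun _ => ⟨fun h => ⟨o!, h.2⟩, fun h => ⟨?_, h.2⟩⟩
      rcases eq_or_ne j l with rfl | hj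
      · exact absurd h.2 hb
      · omega

lemma weight (h : Chain E c b m) {k l : ℕ} (hkl : k ≤ l) (hl : l ≤ m) :
    weight (c k ^^^ c l) = l - k := by
  have : ((range w).filter fun i => (c k ^^^ c l).getLsbD i = true) =
      (Finset.Ico k l).image b := by
    ext i
    simp only [mem_filter, mem_range, h.getLsbD hkl hl, Finset.mem_image, Finset.mem_Ico, and_assoc]
    exact ⟨fun h => h.2, fun ⟨j, h1, h2, h3⟩ => ⟨h3 ▸ h.lt j o!, j, h1, h2, h3⟩⟩
  rw [_root_.weight, this, Finset.card_image_of_injOn, Nat.card_Ico]; intro i hi j hj e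
  simp only [Finset.coe_Ico, Set.mem_Ico] at hi hj; exact h.inj i o! j o! e

lemma subBits (h : Chain E c b m) {k l k' l' : ℕ} (h1 : k' ≤ k) (h2 : k ≤ l) (h3 : l ≤ l')
    (h4 : l' ≤ m) : SubBits (c k ^^^ c l) (c k' ^^^ c l') := fun i hi => by
  rw [h.getLsbD h2 o!] at hi; obtain ⟨j, ha, hb, hc⟩ := hi
  exact (h.getLsbD o! h4 i).2 ⟨j, by omega, by omega, hc⟩

lemma freach (h : Chain E c b m) {P : ℕ → BitVec w} (mask : ℕ → BitVec w)
    (h0 : mask 0 = 0) (hm : ∀ k < m, ∃ j < a, (mask (k + 1)).getLsbD j = true ∧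
      mask (k + 1) = mask k ^^^ twoPow w j)
    (hl : ∀ k ≤ m, lin P a (mask k) = c 0 ^^^ c k) (k : ℕ) (hk : k ≤ m) :
    FReach E (c 0) P a (mask k) := by
  have hx : ∀ k ≤ m, c 0 ^^^ lin P a (mask k) = c k := fun k hk => by
    rw [hl k hk, ← xor_assoc, bxor_self, bzero_xor]
  induction k with
  | zero => rw [h0]; exact .zero
  | succ k ih =>
    obtain ⟨j, hj, h1, h2⟩ := hm k o!; refine .step (ih o!) hj h1 ?_ ?_
    · rw [h2, xor_assoc, bxor_self, bxor_zero]
    · rw [hx k o!, hx _ hk]; exact h.edge k o!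

lemma inList {h : ℕ} (ha : a ≤ w) (hv : v.toNat < 2 ^ a) (hh : _root_.weight v ≤ h) :
    InList a h v := exists_listEntry ha hv o!

lemma tabSem (h : Chain (WordEdge G dir) c b m) (ha : a ≤ w)
    (hD : SubBits (c 0 ^^^ c m) D) (hDa : _root_.weight D ≤ a) (hH : m ≤ H) :
    TabSem G dir (c 0) (frameBit D) a H (maskIn D a (c 0 ^^^ c m)) := by
  have hs : ∀ k ≤ m, SubBits (c 0 ^^^ c k) D := fun k hk i hi =>
    hD i (h.subBits le_rfl (Nat.zero_le _) hk le_rfl i hi)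
  refine ⟨inList ha (maskIn_lt ha _ _) ?_, h.freach (fun k => maskIn D a (c 0 ^^^ c k)) ?_ ?_
    (fun k hk => lin_maskIn ha (hs k hk) hDa) m le_rfl⟩
  · rw [weight_maskIn ha hD hDa, h.weight (Nat.zero_le _) le_rfl]; omega
  · show maskIn D a (c 0 ^^^ c 0) = 0; rw [maskIn_xor ha, bxor_self]; rfl
  · intro k hk; have hb : (c 0 ^^^ c (k + 1)).getLsbD (b k) = true :=
      (h.getLsbD (Nat.zero_le _) hk _).2 ⟨k, Nat.zero_le _, by omega, rfl⟩
    have hi := hs _ hk _ hb; have hr := (rank_lt hi).trans_le hDa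
    refine ⟨rank D (b k), hr, by rw [getLsbD_maskIn_rank ha _ hi hr, hb], ?_⟩
    show maskIn D a (c 0 ^^^ c (k + 1)) = maskIn D a (c 0 ^^^ c k) ^^^ _
    rw [h.flip k hk, ← xor_assoc, maskIn_xor ha _ (c 0 ^^^ c k), maskIn_twoPow ha hi hr]

lemma toNat_lt (h : Chain E c b m) (hb : ∀ k < m, b k < n) {k l : ℕ} (hkl : k ≤ l)
    (hl : l ≤ m) : (c k ^^^ c l).toNat < 2 ^ n := by
  refine Nat.lt_pow_two_of_testBit _ fun i hi => ?_
  show (c k ^^^ c l).getLsbD i = false; rw [Bool.eq_false_iff, Ne, h.getLsbD hkl hl]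
  rintro ⟨j, h1, h2, rfl⟩; have := hb j o!; omega

/-- The length up to which paths are found by `up j`. -/
def upLen (a₀ : ℕ) (lv : ℕ → LevelP) : ℕ → ℕ
  | 0 => a₀
  | j + 1 => (lv j).a

/-- The length from which on paths are found by `up j`. -/
def lowLen (a₀ : ℕ) (lv : ℕ → LevelP) : ℕ → ℕ
  | 0 => 0
  | j + 1 => upLen a₀ lv j + (lv j).g

/-- The conditions under which `up` finds all paths. -/
structure Sched (n K a₀ : ℕ) (lv : ℕ → LevelP) : Prop where
  an : ∀ j < K, (lv j).a ≤ n
  ht : ∀ j < K, upLen a₀ lv j + (lv j).t = (lv j).a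
  hβ : ∀ j < K, (lv j).g + (lv j).β = (lv j).t
  hb : ∀ j < K, listLen (lv j).a ((lv j).t + 1) ≤ 2 ^ (lv j).b
  hb' : ∀ j < K, listLen (lv j).t ((lv j).g + 1) ≤ 2 ^ (lv j).b'

lemma exists_LL {h B : ℕ} (ha : a ≤ w) (han : a ≤ n) (hB : listLen a (h + 1) ≤ 2 ^ B) (hv : v.toNat < 2 ^ a) (hh : _root_.weight v ≤ h) :
    ∃ z < 2 ^ B, LL w n h z = v := by
  obtain ⟨i, hi, e⟩ := inList ha hv hh
  exact ⟨i, by omega, by rw [LL, if_pos (hi.trans_le (listLen_mono han _)), listEntry_prefix han hi, e]⟩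

lemma upSem {lv : ℕ → LevelP} (hS : Sched n K a₀ lv)
    (hw : 128 * (n + 1) ≤ w) (j : ℕ) (hj : j ≤ K) (m : ℕ) (h : Chain (WordEdge G dir) c b m)
    (hc : c 0 = src w n dir) (hb : ∀ k < m, b k < n) (h1 : lowLen a₀ lv j ≤ m)
    (h2 : m ≤ upLen a₀ lv j) : UpSem G a₀ lv dir j (c m) := by
  induction j generalizing m with
  | zero =>
    rw [UpSem, ← hc, bxor_comm]; have lt := fun k (hk : k ≤ m) => h.toNat_lt hb (Nat.zero_le k) hk
    refine ⟨inList o! (lt m le_rfl) ?_, h.freach (fun k => c 0 ^^^ c k) (bxor_self) ?_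
      (fun k hk => lin_standard o! (lt k hk)) m le_rfl⟩
    · rw [h.weight (Nat.zero_le _) le_rfl]; exact h2
    · exact fun k hk => ⟨b k, hb k hk, (h.getLsbD (Nat.zero_le _) hk _).2
        ⟨k, Nat.zero_le _, by omega, rfl⟩, by simp only [h.flip k hk, xor_assoc]⟩
  | succ j ih =>
    have ht := hS.ht j hj; have hβ := hS.hβ j hj; have an := hS.an j hj
    have aw : (lv j).a ≤ w := by omega
    set p := upLen a₀ lv j with hp
    change p + (lv j).g ≤ m at h1; change m ≤ (lv j).a at h2; set g := (lv j).g; set a := (lv j).a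
    set D := c m ^^^ src w n dir with hDdef
    have hD : D = c 0 ^^^ c m := by rw [hDdef, hc, bxor_comm]
    have hDa : _root_.weight D ≤ a := by rw [hD, h.weight (Nat.zero_le _) le_rfl]; omega
    have sub : ∀ {k l}, k ≤ l → l ≤ m → SubBits (c k ^^^ c l) D := fun hkl hl =>
      hD ▸ h.subBits (Nat.zero_le _) hkl hl le_rfl
    have wt : ∀ {k l}, k ≤ l → l ≤ m → _root_.weight (maskIn D a (c k ^^^ c l)) = l - k :=
      fun hkl hl => by rw [weight_maskIn aw (sub hkl hl) hDa, h.weight hkl hl]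
    obtain ⟨z, hz, ez⟩ := exists_LL (n := n) aw an (hS.hb j hj) (maskIn_lt aw D (c p ^^^ c m))
      (by rw [wt o! le_rfl]; omega)
    have eX : c m ^^^ lin (frameBit D) a (LL w n (lv j).t z) = c p := by
      rw [ez, lin_maskIn aw (sub o! le_rfl) hDa, bxor_comm, xor_assoc, bxor_self, bxor_zero]
    have low : lowLen a₀ lv j ≤ p := by
      cases j with
      | zero => exact Nat.zero_le _
      | succ i =>
        have h3 := hS.ht i o!; have h4 := hS.hβ i o!; rw [hp]; simp only [lowLen]; show _ ≤ (lv i).a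
        omega
    have hup := ih o! p (by
      have := h.drop 0 (m' := p) o!; simpa using this) (fun k hk => hb k o!) low le_rfl
    have sQR : SubBits (maskIn D a (c p ^^^ c (p + g))) (maskIn D a (c p ^^^ c m)) := fun i hi => by
      rw [getLsbD_maskIn aw] at hi ⊢; obtain ⟨q1, i', q2, q3, q4⟩ := hi
      exact ⟨q1, i', q2, h.subBits le_rfl o! o! le_rfl _ q3, q4⟩
    have wR : _root_.weight (maskIn D a (c p ^^^ c m)) ≤ (lv j).t := by
      rw [wt o! le_rfl]; omega
    obtain ⟨z', hz', ez'⟩ := exists_LL (n := n) (w := w) (by omega : (lv j).t ≤ w) o!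
      (hS.hb' j hj) (maskIn_lt o! (maskIn D a (c p ^^^ c m)) (maskIn D a (c p ^^^ c (p + g))))
      (by rw [weight_maskIn o! sQR wR, wt o! h1]; omega)
    refine ⟨z, hz, by rw [eX]; exact hup, z', hz', ?_⟩
    rw [eX, ez, ConnSem, ← hDdef, ez', lin_maskIn o! sQR wR]
    have eS := lin_maskIn aw (sub (k := p) (l := p + g) o! h1) hDa
    have wS : _root_.weight (c p ^^^ c (p + g)) = g := by rw [h.weight o! h1]; omega
    simp only [show (lv j).a = a from rfl, show (lv j).g = g from rfl, eS]
    refine ⟨⟨?_, strip_eq_zero wS.le⟩, ?_⟩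
    · have hr := h.reverse (m' := m - (p + g)) o!; rw [← wordEdge_not] at hr
      have em : m - (m - (p + g)) = p + g := by omega
      have := hr.tabSem (D := D) (a := a) (H := (lv j).β) aw (by
        simp only [em, Nat.sub_zero, bxor_comm (c m)]; exact sub h1 le_rfl) hDa o!
      simp only [em, Nat.sub_zero] at this; rw [← maskIn_xor aw]; convert this using 2
      rw [bxor_comm (c p), xor_assoc, ← xor_assoc (c p), bxor_self, bzero_xor]
    · have := (h.drop p h1).tabSem (D := c p ^^^ c (p + g)) (a := g) (H := g) o!
        (fun _ h => h) wS.le le_rfl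
      rwa [Nat.add_zero, maskIn_self o! wS] at this

lemma exists_of_path (hG : G ≤ directedHypercube n) (hw : n ≤ w) {y : Fin n → Bool}
    (h : Relation.ReflTransGen G.Adj (fun _ => false) y) : ∃ (c : ℕ → BitVec w) (b : ℕ → ℕ) (m : ℕ),
      Chain (WordEdge G true) c b m ∧ c 0 = 0 ∧ wordVertex n (c m) = y ∧ ∀ k < m, b k < n := by
  induction h with
  | refl => exact ⟨fun _ => 0, fun _ => 0, 0, ⟨o!, o!, o!, o!⟩, rfl,
      funext fun _ => by simp [wordVertex], by omega⟩
  | @tail y y' _ he ih =>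
    obtain ⟨c, b, m, h, h0, hy, hb⟩ := ih; obtain ⟨i, hi, rfl⟩ := hG he
    have hbi : ∀ k < m, b k ≠ i := fun k hk e => by
      have := (h.getLsbD (Nat.zero_le m) le_rfl (b k)).2 ⟨k, Nat.zero_le _, hk, rfl⟩
      rw [h0, ofNat_eq_ofNat, bzero_xor, e] at this; rw [← hy] at hi; simp [wordVertex, this] at hi
    have hy' : wordVertex n (c m ^^^ twoPow w i) = update y i true := by
      funext i'; rw [← hy]
      simp only [wordVertex, getLsbD_xor, getLsbD_twoPow, Function.update_apply]
      have hi' : (c m).getLsbD i = false := by rw [← hy] at hi; exact hi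
      split_ifs with e
      · subst e; rw [hi']; simp; omega
      · simp [show ¬ (i : ℕ) = i' from fun h => e (Fin.ext h.symm)]
    refine ⟨update c (m + 1) (c m ^^^ twoPow w i), update b m i, m + 1,
      ⟨fun k hk => ?_, fun k hk l hl e => ?_, fun k hk => ?_, fun k hk => ?_⟩, ?_, ?_, fun k hk => ?_⟩
    · rcases eq_or_ne k m with rfl | hne
      · simp
      · rw [update_of_ne o!, update_of_ne o!, update_of_ne hne, h.flip k o!]
    · simp only [Function.update_apply] at e; split_ifs at e with h1 h2 h2
      · omega
      · exact absurd e.symm (hbi l o!)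
      · exact absurd e (hbi k o!)
      · exact h.inj k o! l o! e
    · rw [Function.update_apply]; split_ifs
      · omega
      · exact h.lt k o!
    · rcases eq_or_ne k m with rfl | hne
      · rw [update_of_ne o!, update_self]; show G.Adj _ _; rw [hy, hy']; exact he
      · rw [update_of_ne o!, update_of_ne o!]; exact h.edge k o!
    · rw [update_of_ne o!, h0]
    · rw [update_self, hy']
    · rw [Function.update_apply]; split_ifs
      · omega
      · exact hb k o!

lemma exists_upSem_iff (hG : G ≤ directedHypercube n) (hw : 128 * (n + 1) ≤ w)
    {lv : ℕ → LevelP} (hS : Sched n K a₀ lv) (h1 : lowLen a₀ lv K ≤ n / 2)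
    (h2 : n - n / 2 ≤ upLen a₀ lv K) : (∃ z < 2 ^ n, UpSem G a₀ lv true K z##w ∧
      UpSem G a₀ lv false K z##w) ↔ HasHypercubePath G := by
  constructor
  · rintro ⟨z, hz, u, d⟩
    have hg : ∀ i < K, (lv i).g ≤ w := fun i hi => by
      have := hS.ht i hi; have := hS.hβ i hi; have := hS.an i hi; omega
    have hz' : (z##w).toNat < 2 ^ n := by rwa [toNat_ofNat_of_lt (b := n) o! hz]
    have r1 := u.reflTransGen hw K hg hz'; have r2 := d.reflTransGen hw K hg hz'
    rw [show false = !true from rfl, wordEdge_not, Relation.reflTransGen_swap] at r2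
    have := (r1.trans r2).lift (wordVertex n) (p := G.Adj) fun a b h => h
    change Relation.ReflTransGen G.Adj _ _ at this; unfold HasHypercubePath; convert this using 1
    · exact funext fun i => by simp [src, wordVertex]
    · exact funext fun i => (getLsbD_mask o! i.2).symm
  · intro h; obtain ⟨c, b, m, hc, h0, he, hb⟩ := exists_of_path (w := w) hG o! h
    have lt : ∀ k ≤ m, (c k).toNat < 2 ^ n := fun k hk => by
      have := hc.toNat_lt hb (Nat.zero_le k) hk
      rwa [h0, ofNat_eq_ofNat, bzero_xor] at this
    have e1 : c m = (2 ^ n - 1)##w := by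
      refine eq_of_getLsbD_eq fun i _ => ?_
      by_cases hi : i < n
      · rw [getLsbD_mask o! hi]; exact congrFun he ⟨i, hi⟩
      · rw [getLsbD_eq_false_of_lt (lt m le_rfl) o!, getLsbD_ofNat, Nat.testBit_two_pow_sub_one]
        simp [hi]
    have hm : m = n := by
      have h3 := hc.weight (Nat.zero_le m) le_rfl; rw [h0, ofNat_eq_ofNat, bzero_xor, e1] at h3
      refine (Nat.sub_zero m).symm.trans (h3.symm.trans ?_); rw [_root_.weight]
      conv_rhs => rw [← card_range n]
      congr 1; ext i; simp only [mem_filter, mem_range, getLsbD_ofNat,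
        Nat.testBit_two_pow_sub_one, Bool.and_eq_true, decide_eq_true_eq]
      omega
    subst hm; refine ⟨(c (m - m / 2)).toNat, lt _ o!, ?_⟩
    rw [BitVec.ofNat_toNat, BitVec.setWidth_eq]; constructor
    · have := hc.drop 0 (m' := m - m / 2) o!; simp only [Nat.zero_add] at this
      exact upSem hS hw K le_rfl _ this h0 (fun k hk => hb k o!) o! h2
    · have := hc.reverse (m' := m / 2) o!; rw [← wordEdge_not] at this
      exact upSem (c := fun k => c (m - k)) hS hw K le_rfl _ this e1 (fun k hk => hb _ o!) h1 o!

end Chain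

end Paths

/-! # Running times -/

namespace RProg

/-- The program is well-formed at depth `d`, and its running time is at most `c * (τ + 4)` if an
edge query takes time `τ`. -/
inductive Bd : RProg → ℕ → CStore w → ℕ → Prop
  | gate (g : Gate) (d : ℕ) (σ : CStore w) {c : ℕ} (h : 1 ≤ c) : Bd (.gate g) d σ c
  | seq {p q : RProg} {d : ℕ} {σ : CStore w} {c c' e : ℕ} (hp : Bd p d σ c) (hq : Bd q d σ c')
      (h : c + c' ≤ e) : Bd (.seq p q) d σ e
  | loop {r : Bool} {N : COperand} {p : RProg} {d : ℕ} {σ : CStore w} {m c e : ℕ}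
      (hN : Val σ d N m) (hp : ∀ j < max m 1, Bd p (d + 2) (σ.set d j##w) c)
      (h : m * (c + 1) + 1 ≤ e) : Bd (.loop r N p) d σ e
  | letop {op : WordOp} {a b : COperand} {p : RProg} {d : ℕ} {σ : CStore w} {c e : ℕ}
      (hp : Bd p (d + 1) (σ.set d (op.eval (a.eval σ) (b.eval σ))) c) (h : c + 1 ≤ e) :
      Bd (.letop op a b p) d σ e
  | letld {a : COperand} {p : RProg} {d : ℕ} {σ : CStore w} {c e : ℕ}
      (hp : Bd p (d + 1) (σ.set d (σ.mem (a.eval σ))) c) (h : c + 1 ≤ e) : Bd (.letld a p) d σ e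

namespace Bd

variable {p q A B : RProg} {c c' e : ℕ}

lemma inv (h : Bd p d σ c) : Bd p.inv d σ c := by
  induction h with
  | gate g d σ h => exact .gate g d σ h
  | seq _ _ h ihp ihq => exact .seq ihq ihp o!
  | loop hN _ h ih => exact .loop hN ih h
  | letop _ h ih => exact .letop ih h
  | letld _ h ih => exact .letld ih h

lemma bracket (hA : Bd A d σ c) (hB : Bd B d σ c') (h : 2 * c + c' ≤ e) :
    Bd (RProg.bracket A B) d σ e := .seq hA (.seq hB hA.inv le_rfl) o!

lemma mono (h : Bd p d σ c) (hc : c ≤ e) : Bd p d σ e := by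
  cases h with
  | gate g d σ h => exact .gate _ _ _ (h.trans hc)
  | seq hp hq h => exact .seq hp hq (h.trans hc)
  | loop hN hp h => exact .loop hN hp (h.trans hc)
  | letop hp h => exact .letop hp (h.trans hc)
  | letld hp h => exact .letld hp (h.trans hc)

lemma wf (h : Bd p d σ c) : p.WF d := by
  induction h with
  | gate => trivial
  | seq _ _ _ ihp ihq => exact ⟨ihp, ihq⟩
  | loop hN _ _ ih => exact ⟨hN.1, ih 0 o!⟩
  | letop _ _ ih => exact ih
  | letld _ _ ih => exact ih

lemma cost_le (τ : ℕ) (h : Bd p d σ c) : p.cost τ d σ ≤ c * (τ + 4) := by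
  induction h with
  | gate g d σ h =>
    refine le_trans ?_ (Nat.le_mul_of_pos_left _ h); cases g <;> simp [cost, Gate.cost]
  | seq _ _ h ihp ihq => rw [cost]; nlinarith
  | @loop r N p d σ m c e hN _ h ih =>
    have hm : (N.eval σ).toNat ≤ m := by rw [hN.2, toNat_ofNat]; exact Nat.mod_le _ _
    have key : ∑ j ∈ range (N.eval σ).toNat,
        (cost τ p (d + 2) (σ.set d j##w) + 4) ≤ m * ((c + 1) * (τ + 4)) := by
      refine (Finset.sum_le_card_nsmul _ _ ((c + 1) * (τ + 4)) fun j hj => ?_).trans ?_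
      · have := ih j (by have := mem_range.1 hj; omega); linarith
      · rw [card_range]; exact Nat.mul_le_mul_right _ hm
    have h2 : (m * (c + 1) + 1) * (τ + 4) ≤ e * (τ + 4) := Nat.mul_le_mul_right _ h; cases r
    · rw [cost, Finset.sum_congr rfl fun j _ => show _ = cost τ p (d + 2)
        (σ.set d j##w) + 4 by ring]
      linarith
    · rw [cost]
      have := sum_le_sum fun j (_ : j ∈ range (N.eval σ).toNat) => show
        1 + cost τ p (d + 2) (σ.set d j##w) + 1 ≤ cost τ p (d + 2)
        (σ.set d j##w) + 4 by omega
      linarith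
  | letop _ h ih => rw [cost]; nlinarith
  | letld _ h ih => rw [cost]; nlinarith

end Bd

/-- No loops. -/
def flat : RProg → Bool
  | gate _ => true
  | seq p q => p.flat && q.flat
  | loop _ _ _ => false
  | letop _ _ _ p => p.flat
  | letld _ p => p.flat

def size : RProg → ℕ
  | gate _ => 1
  | seq p q => p.size + q.size
  | loop _ _ p => p.size
  | letop _ _ _ p => p.size + 1
  | letld _ p => p.size + 1

lemma Bd.of_size {p : RProg} {c : ℕ} (h : p.flat = true) (hc : p.size ≤ c) (d : ℕ)
    (σ : CStore w) : Bd p d σ c := by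
  induction p generalizing c d σ with
  | gate g => exact .gate g d σ hc
  | seq p q ihp ihq =>
    simp only [flat, Bool.and_eq_true] at h; exact .seq (ihp h.1 le_rfl d σ) (ihq h.2 le_rfl d σ) hc
  | loop r N p => simp [flat] at h
  | letop op a b p ih => exact .letop (ih h le_rfl _ _) hc
  | letld a p ih => exact .letld (ih h le_rfl _ _) hc

lemma Bd.of_flat {p : RProg} {c : ℕ} (h : (p.flat && p.size.ble c) = true) : Bd p d σ c := by
  rw [Bool.and_eq_true] at h; exact .of_size h.1 (Nat.le_of_ble_eq_true h.2) d σ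

end RProg

section Bounds

variable {a b h : COperand} {nb : ℕ}

lemma bd_linProg (va : Val σ d a na) (hn : na ≤ w) : Bd (linProg P a d) d σ (50 * (w + 1)) :=
  .loop va (fun _ _ => .of_flat (c := 40) rfl) o!

lemma bd_linTo {m : Reg} (va : Val σ d a na) (hn : na ≤ w) :
    Bd (linTo Y P a m d) d σ (110 * (w + 1)) :=
  .bracket (.seq (.of_flat (c := 1) rfl) (bd_linProg va hn) le_rfl) (.of_flat (c := 1) rfl) o!

lemma bd_frameFrom (va : Val σ d a na) (hn : na ≤ w) : Bd (frameFrom Y P a d) d σ (50 * (w + 1)) :=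
  .seq (.loop va (fun _ _ => .of_flat (c := 30) rfl) le_rfl) (.of_flat (c := 2) rfl) o!

lemma bd_dpStep {m : COperand} (va : Val σ d a na) (hn : na ≤ w) :
    Bd (dpStep dir P a T m d) d σ (300 * (w + 1)) :=
  .seq (.seq (.of_flat (c := 1) rfl) (.seq (bd_linProg va hn) (.of_flat (c := 1) rfl) le_rfl) le_rfl)
    (.seq (.seq (.of_flat (c := 1) rfl) (.seq (.loop va (fun _ _ => .of_flat (c := 70) rfl) le_rfl)
      (.of_flat (c := 10) rfl) le_rfl) le_rfl) (.seq (.of_flat (c := 1) rfl) (.seq (bd_linProg va hn)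
        (.of_flat (c := 1) rfl) le_rfl) le_rfl) le_rfl) o!

/-- A unit of time that is polynomial in the word length. -/
def unit (w : ℕ) : ℕ := 1000 * (w + 1)

lemma Bd.withList {p : COperand → COperand → ℕ → RProg} {a : COperand} (hσ : Ctx n H σ)
    (hd : 8 ≤ d) (va : Val σ d a na) (hn : na ≤ n) (vh : Val σ d h nh) (hh : nh ≤ H) {c : ℕ}
    (hp : ∀ L N e (σ' : CStore w), (∀ {o u}, Val σ d o u → Val σ' e o u) →
      Val σ' e N (listLen na (nh + 1)) → Bd (p L N e) e σ' c) : Bd (withList a h p d) d σ (c + 6) := by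
  obtain ⟨σ', -, up, vN, vL, -, hb⟩ := withList_env (G := (⊤ : DGraph n)) hσ hd va vh hn hh
  exact hb Bd (fun _ _ _ _ _ _ _ h => .letop h le_rfl) (fun _ _ _ _ _ h => .letld h le_rfl) _ _
    (hp _ _ _ _ up vN)

lemma bd_dpList (hσ : Ctx n H σ) (hd : 8 ≤ d) (va : Val σ d a na) (hn : na ≤ n)
    (vh : Val σ d h nh) (hh : nh ≤ H) :
    Bd (dpList dir P T a h d) d σ (400 * (w + 1) * (listLen na (nh + 1) + 1)) := by
  have hw := hσ.hw
  refine (Bd.withList (c := listLen na (nh + 1) * (300 * (w + 1) + 3) + 1) hσ hd va hn vh hh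
    fun L N e σ' up vN => .loop vN (fun v _ => .letop (.letld (bd_dpStep (na := na)
      (((((up va).set le_rfl _).set o! _).set o! _).mono o!) o!)
        le_rfl) le_rfl) le_rfl).mono ?_
  nlinarith [Nat.zero_le (listLen na (nh + 1)), Nat.zero_le (w * listLen na (nh + 1))]

lemma bd_frameTab (hσ : Ctx n H σ) {m s : Reg} (hd : 8 ≤ d)
    (va : Val σ d a na) (hn : na ≤ n) (vh : Val σ d h nh) (hh : nh ≤ H) :
    Bd (frameTab dir Y P T a h m s d) d σ (unit w * (listLen na (nh + 1) + 1)) := by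
  have hw := hσ.hw
  refine .seq (.of_flat (c := 1) rfl) (.seq (bd_frameFrom va o!) (.seq (.of_flat (c := 1) rfl)
    (.seq (bd_dpList hσ hd va hn vh hh) (.of_flat (c := 1) rfl) le_rfl) le_rfl) le_rfl) ?_
  rw [unit]; nlinarith [Nat.zero_le (listLen na (nh + 1)), Nat.zero_le (w * listLen na (nh + 1))]

lemma bd_search {Z C F : Reg} {b m M st : COperand} {B : ℕ → RProg}
    {nm nM c : ℕ} (vb : Val σ d b nb) (vm : Val σ d m nm) (vM : Val σ d M nM) (vT : Val σ d T w)
    (hb : nb ≤ w) (hm : nm ≤ w) (hM : 1 ≤ nM)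
    (hB : ∀ u v, Bd (B (d + 4)) (d + 4) ((σ.set d u).set (d + 2) v) c) :
    Bd (search Z C F o out b m M T st B d) d σ (unit w * nM * (c + unit w)) := by
  refine .bracket (c := w * (nM * (2 * c + 4 * w + 40) + 4 * w + 40) + 3 * w + 10) (c' := 1) (.seq
    (.loop vb (fun _ _ => .of_flat (c := 1) rfl) le_rfl) (.loop vT (fun u _ => .seq (.seq (.loop (vm.set le_rfl _ |>.mono
      o!) (fun _ _ => .of_flat (c := 1) rfl) le_rfl) (.seq (.loop ((vM.set le_rfl _).mono o!)
        (fun v _ => .seq (.bracket (hB _ _) (.of_flat (c := 5) rfl) le_rfl) (.bracket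
          (.loop (((vb.set le_rfl _).set o! _).mono o!) (fun _ _ => .of_flat (c := 1) rfl) le_rfl)
          (.of_flat (c := 7) rfl) le_rfl) le_rfl) le_rfl) (.loop (vm.set le_rfl _ |>.mono
      o!) (fun _ _ => .of_flat (c := 1) rfl) le_rfl) le_rfl) le_rfl) (.of_flat (c := 10) rfl) le_rfl)
      le_rfl) ?_) (.of_flat rfl) ?_
  · have h1 : nM * (2 * c + 5 + (2 * (nb * (1 + 1) + 1) + 7) + 1) ≤ nM * (2 * c + 4 * w + 40) :=
      Nat.mul_le_mul_left _ o!
    have h2 := Nat.mul_le_mul_left w (show nm * (1 + 1) + 1 +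
      (nM * (2 * c + 5 + (2 * (nb * (1 + 1) + 1) + 7) + 1) + 1 + (nm * (1 + 1) + 1)) + 10 + 1 ≤
      nM * (2 * c + 4 * w + 40) + 4 * w + 40 by omega)
    omega
  · rw [unit]; obtain ⟨N, rfl⟩ := Nat.exists_eq_add_of_le hM
    ring_nf
    omega

lemma bd_readList {Z : Reg} : Bd (readList Y h Z d) d σ 20 := .of_flat rfl

section

variable {lv : ℕ → LevelP}

lemma bd_conn (hσ : LCtx n H K lv σ) (hd : 300 ≤ d) (hj : j < K)
    {R : Reg} : Bd (conn j dir R X out d) d σ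
      (12 * unit w ^ 2 * 2 ^ (lv j).nm' * 2 ^ (lv j).g) := by
  have hw := hσ.hw; have ok := hσ.ok j hj
  obtain ⟨ha, ht, htn, hg, hgn, -, hb, hb', hnm, hnm', -, -⟩ := ok
  have v : ∀ {σ' : CStore w}, LCtx n H K lv σ' → ∀ s < 18, Val σ' d (lreg j s) ((lv j).val n j s) :=
    fun h s hs => (h.lev j hj s hs).mono hd
  have hG := listLen_le_two_pow (lv j).g ((lv j).g + 1); have hu : 1000 * (w + 1) = unit w := rfl
  refine .bracket (.seq (.of_flat (c := 1) rfl) (bd_frameFrom (v hσ 1 o!) (show (lv j).t ≤ w by omega))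
    le_rfl) (bd_search (v hσ 7 o!) (v hσ 8 o!) (v hσ 9 o!)
      ⟨show 4 < d by omega, hσ.reg4⟩ (show (lv j).b' ≤ w by omega) (show (lv j).nm' ≤ w by omega)
      one_le_two_pow (c := 9 * unit w * 2 ^ (lv j).g) fun u u' => ?_) ?_
  · have hσ' := (hσ.set hd u).set (show 300 ≤ d + 2 by omega) u'
    have v' := fun s hs => (v hσ' s hs).mono (show d ≤ d + 4 by omega)
    refine .bracket (.seq (.seq bd_readList (.seq (bd_linTo (v' 1 o!) (show (lv j).t ≤ w by omega))
      (.seq (c := 1) (.of_flat rfl) (.seq (c := 1) (.of_flat rfl) (.seq (c := 20) (.of_flat rfl)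
        (bd_linTo (v' 0 o!) (show (lv j).a ≤ w by omega)) le_rfl) le_rfl) le_rfl) le_rfl) le_rfl)
      (.seq (bd_frameTab hσ'.toCtx o! (v' 2 o!) hgn (v' 2 o!) hg)
        (.of_flat (c := 40) rfl) le_rfl) le_rfl) (.of_flat (c := 1) rfl) ?_
    have := Nat.mul_le_mul_left (unit w) hG
    have := Nat.mul_le_mul_left (unit w) (one_le_two_pow (n := (lv j).g)); simp only [LevelP.val]
    rw [Nat.mul_add (unit w)]; linarith
  · simp only [LevelP.val]; have h1 : 1 ≤ 2 ^ (lv j).g := one_le_two_pow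
    have h2 : unit w * 2 ^ (lv j).nm' * (9 * unit w * 2 ^ (lv j).g + unit w) ≤
      unit w * 2 ^ (lv j).nm' * (10 * unit w * 2 ^ (lv j).g) := Nat.mul_le_mul_left _ (by nlinarith)
    have h3 : 2 * (1 + 50 * (w + 1)) ≤ unit w * unit w * (2 ^ (lv j).nm' * 2 ^ (lv j).g) := by
      refine le_trans ?_ (le_mul_of_pos_right _ (by positivity)); nlinarith
    nlinarith

/-- The exponential part of the running time of `up`. -/
def upTime (lv : ℕ → LevelP) : ℕ → ℕ
  | 0 => 1
  | j + 1 => listLen (lv j).a ((lv j).β + 1) +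
      2 ^ (lv j).nm * (upTime lv j + 2 ^ (lv j).nm' * 2 ^ (lv j).g)

lemma one_le_upTime (lv : ℕ → LevelP) (j : ℕ) : 1 ≤ upTime lv j := by
  cases j with
  | zero => exact le_rfl
  | succ j =>
    have := Nat.mul_le_mul (one_le_two_pow (n := (lv j).nm)) (show 1 ≤ upTime lv j +
      2 ^ (lv j).nm' * 2 ^ (lv j).g from Nat.le_add_left_of_le
        (Nat.mul_pos (by positivity) (by positivity)))
    rw [upTime]; omega

lemma bd_up {v : Reg} (j : ℕ) (hj : j ≤ K) :
    ∀ {d : ℕ} {σ : CStore w} {out : Reg}, 300 ≤ d → LCtx n H K lv σ →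
      Bd (up j dir v out d) d σ ((30 * unit w) ^ (3 * j + 1) * upTime lv j) := by
  induction j generalizing v with
  | zero =>
    intro d σ out hd hσ
    have h1 : Bd (up 0 dir v out d) d σ 30 := by cases dir <;> exact .of_flat rfl
    refine h1.mono ?_; rw [upTime, unit]; simp only [Nat.mul_zero, Nat.zero_add, pow_one]; omega
  | succ j ih =>
    intro d σ out hd hσ; have hw := hσ.hw; have ok := hσ.ok j hj
    obtain ⟨ha, ht, htn, hg, hgn, hβ, hb, hb', hnm, hnm', -, -⟩ := ok
    have vl : ∀ {σ' : CStore w}, LCtx n H K lv σ' → ∀ s < 18, Val σ' d (lreg j s) ((lv j).val n j s) :=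
      fun h s hs => (h.lev j hj s hs).mono hd
    have hu : 1000 * (w + 1) = unit w := rfl; set A := (30 * unit w) ^ (3 * j + 1) with hA
    refine .bracket (.seq (c := 1) (.of_flat rfl) (.seq (c := 1) (.of_flat rfl) (bd_frameTab hσ.toCtx
      o! (vl hσ 0 o!) ha (vl hσ 3 o!) hβ) le_rfl) le_rfl)
      (bd_search (vl hσ 4 o!) (vl hσ 5 o!) (vl hσ 6 o!)
      ⟨show 4 < d by omega, hσ.reg4⟩ (show (lv j).b ≤ w by omega) (show (lv j).nm ≤ w by omega)
      one_le_two_pow (c := unit w + 2 * (A * upTime lv j + 12 * unit w ^ 2 * 2 ^ (lv j).nm' *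
        2 ^ (lv j).g)) fun u u' => ?_) ?_
    · have hσ' := (hσ.set hd u).set (show 300 ≤ d + 2 by omega) u'
      have v' := fun s hs => (vl hσ' s hs).mono (show d ≤ d + 4 by omega)
      exact .bracket (.seq bd_readList (.seq (bd_linTo (v' 0 o!) (show (lv j).a ≤ w by omega))
        (.of_flat (c := 1) rfl) le_rfl) le_rfl) (.bracket (.seq (ih o! o! hσ')
          (bd_conn hσ' o! hj) le_rfl) (.of_flat (c := 1) rfl) le_rfl) o!
    · have e : (30 * unit w) ^ (3 * (j + 1) + 1) = (30 * unit w) ^ 3 * A := by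
        rw [hA, ← pow_add]; congr 1; ring
      have hA1 : 30 * unit w ≤ A := Nat.le_self_pow o! _; have hu1 : 1000 ≤ unit w := by omega
      have h1 := one_le_upTime lv j; rw [e, upTime]; simp only [LevelP.val]
      set N := listLen (lv j).a ((lv j).β + 1); set V := 2 ^ (lv j).nm' * 2 ^ (lv j).g with hV
      set M := 2 ^ (lv j).nm; have hM : 1 ≤ M := one_le_two_pow
      have hV1 : 1 ≤ V := Nat.mul_pos (by positivity) (by positivity); set Q := upTime lv j
      set U := unit w; have a1 : (30 * U) ^ 3 * A = 27000 * (U * U * U * A) := by ring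
      have pA : 0 < A := by omega
      have pU : 0 < U := by omega
      clear_value A U Q M V N
      have a3 : U * U * U ≤ U * U * U * A := le_mul_of_pos_right _ pA
      have a5 : U * U ≤ U * U * U * A := (le_mul_of_pos_right _ pU).trans a3
      have a2 : U ≤ U * U * U * A := (le_mul_of_pos_right _ pU).trans a5
      have a4 : U * A ≤ U * U * U * A := Nat.mul_le_mul_right _ ((le_mul_of_pos_right _ pU).trans
        (le_mul_of_pos_right _ pU))
      rw [a1]
      generalize U * U * U * A = E at *
      have b1 : U * N ≤ E * N := Nat.mul_le_mul_right _ a2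
      have b2 : U * A * (M * Q) ≤ E * (M * Q) := Nat.mul_le_mul_right _ a4
      have b3 : U * U * U * (M * V) ≤ E * (M * V) := Nat.mul_le_mul_right _ a3
      have b4 : U * U * M ≤ E * (M * Q) := Nat.mul_le_mul a5 (le_mul_of_pos_right _ h1)
      have b5 : E ≤ E * (M * Q) := le_mul_of_pos_right _ (Nat.mul_pos hM h1)
      have b6 : 12 * U ^ 2 * 2 ^ (lv j).nm' * 2 ^ (lv j).g = 12 * (U * U) * V := by rw [hV]; ring
      rw [b6]; have b7 := Nat.zero_le (E * N); have b8 := Nat.zero_le (E * (M * V))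
      linarith [show U * M * (U + 2 * (A * Q + 12 * (U * U) * V) + U) = 2 * (U * U * M) +
        2 * (U * A * (M * Q)) + 24 * (U * U * U * (M * V)) by ring,
        show 27000 * E * (N + M * (Q + V)) = 27000 * (E * N) + 27000 * (E * (M * Q)) +
        27000 * (E * (M * V)) by ring, show U * (N + 1) = U * N + U by ring]

lemma bd_top (hσ : LCtx n H K lv σ) (hd : 300 ≤ d) {nm : ℕ} (hnm : nm ≤ n + 39)
    (v0 : Val σ d (.creg 0) n) (v1 : Val σ d (.creg 250) nm) (v2 : Val σ d (.creg 251) (2 ^ nm)) :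
    Bd (top K d) d σ ((30 * unit w) ^ (3 * K + 3) * (2 ^ nm * upTime lv K)) := by
  have hw := hσ.hw
  refine (bd_search v0 v1 v2 (T := .creg 4) ⟨show 4 < d by omega, hσ.reg4⟩ o! o! one_le_two_pow
    (c := 4 * ((30 * unit w) ^ (3 * K + 1) * upTime lv K) + 1) fun u u' => ?_).mono ?_
  · have hσ' := (hσ.set hd u).set (show 300 ≤ d + 2 by omega) u'
    exact .bracket (.seq (bd_up K le_rfl o! hσ') (bd_up K le_rfl o! hσ') le_rfl)
      (.of_flat (c := 1) rfl) o!
  · set A := (30 * unit w) ^ (3 * K + 1) with hA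
    have hA1 : 30 * unit w ≤ A := Nat.le_self_pow o! _
    have hu1 : 1000 ≤ unit w := by rw [unit]; omega
    rw [show 3 * K + 3 = 2 + (3 * K + 1) by ring, pow_add, ← hA]; have h1 := one_le_upTime lv K
    have h2 : A ≤ A * upTime lv K := le_mul_of_pos_right _ h1
    have h3 : 4 * (A * upTime lv K) + 1 + unit w ≤ 6 * (A * upTime lv K) := by omega
    refine (Nat.mul_le_mul_left _ h3).trans ?_
    rw [show unit w * 2 ^ nm * (6 * (A * upTime lv K)) = 6 * unit w * A * (2 ^ nm * upTime lv K) by ring]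
    exact Nat.mul_le_mul_right _ (Nat.mul_le_mul_right _ (by nlinarith))

lemma bd_init (hσ : Ctx n H σ) (hd : 300 ≤ d) (v0 : Val σ d (.creg 0) n)
    (va : Val σ d (.creg 253) a₀) (vH : Val σ d (.creg 254) (H + 1)) (ha : a₀ ≤ H) :
    Bd (init d) d σ (5 * unit w ^ 2 * (listLen n (H + 1) + 1)) := by
  have hw := hσ.hw; have hH := hσ.hH
  have mono : ∀ {h}, h ≤ H → listLen n (h + 1) ≤ listLen n (H + 1) := fun hh =>
    monotone_nat_of_le_succ (listLen_mono_right n) o!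
  have hu : 1000 * (w + 1) = unit w := rfl
  have ht : ∀ dir, Bd (initTable dir d) d σ (unit w * (listLen n (H + 1) + 1)) := fun dir => by
    refine .seq (.of_flat (c := 1) rfl) (.seq (bd_dpList hσ o! v0 le_rfl va ha)
      (.of_flat (c := 1) rfl) le_rfl) ?_
    have := Nat.mul_le_mul_left (400 * (w + 1)) (Nat.add_le_add_right (mono ha) 1); nlinarith
  refine .seq (.loop v0 (fun _ _ => .of_flat (c := 10) rfl) le_rfl) (.seq (ht true) (.seq (ht false)
    (.loop (c := 30 * (listLen n (H + 1) + 1)) vH (fun j hj => ?_) le_rfl) le_rfl) le_rfl) ?_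
  · have := mono (h := j) o!; refine (Bd.withList (c := listLen n (j + 1) * 20 + 4) (hσ.set o! _) o!
      ((v0.set le_rfl _).mono o!) le_rfl (h := .creg d) (nh := j) ⟨show d < d + 2 by omega, val_creg_eval _ _ _⟩
      o! fun L N e σ' _ vN => .letop (.letop (.loop (((vN.set le_rfl _).set o! _).mono
        o!) (fun _ _ => .of_flat (c := 18) rfl) le_rfl) le_rfl) o!).mono o!
  · set N := listLen n (H + 1) + 1
    have h1 : (H + 1) * (30 * N + 1) ≤ unit w * (31 * N) := Nat.mul_le_mul o! o!
    have h2 : unit w * N ≤ unit w * (unit w * N) := Nat.mul_le_mul_left _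
      (Nat.le_mul_of_pos_left _ o!)
    have h3 : 40 * (unit w * N) ≤ unit w * (unit w * N) := by
      rw [mul_left_comm]; exact Nat.mul_le_mul_left _ (Nat.mul_le_mul_right _ o!)
    have h4 : unit w ≤ unit w * N := le_mul_of_pos_right _ o!
    rw [show 5 * unit w ^ 2 * N = 5 * (unit w * (unit w * N)) by ring]
    rw [show unit w * (31 * N) = 31 * (unit w * N) by ring] at h1; omega

end

end Bounds

/-! # The classical registers -/

/-- Arithmetic expressions in the dimension. -/
inductive CExp
  | lit (c : ℕ)
  | inp
  | op (o : WordOp) (e f : CExp)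

namespace CExp

/-- Compute the expression in register `r`, with the registers from `r + 1` on as workspace. -/
def compile : CExp → ℕ → QProg 255
  | lit c, r => .cset r .add (.lit c) (.lit 0)
  | inp, r => .cset r .add (.creg 0) (.lit 0)
  | op o e f, r => .seq (e.compile r) (.seq (f.compile (r + 1))
      (.seq (.cset r o (.creg r) (.creg (r + 1))) (QProg.czero (r + 1))))

/-- The word that is computed. -/
def bv (w n : ℕ) : CExp → BitVec w
  | lit c => c##w
  | inp => n##w
  | op o e f => o.eval (e.bv w n) (f.bv w n)

def cost : CExp → ℕ
  | op _ e f => e.cost + (f.cost + (1 + 1))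
  | _ => 1

/-- Registers `1, …, m` receive the values of the expressions in a table. -/
def assign (T : ℕ → CExp) : ℕ → QProg 255
  | 0 => QProg.czero 255
  | m + 1 => .seq (assign T m) (.seq ((T (m + 1)).compile 255)
      (.seq (.cset (m + 1) .add (.creg 255) (.lit 0)) (QProg.czero 255)))

def assignCost (T : ℕ → CExp) : ℕ → ℕ
  | 0 => 1
  | m + 1 => assignCost T m + ((T (m + 1)).cost + (1 + 1))

/-- The contents of the registers after `assign T m`. -/
def store (w n : ℕ) (T : ℕ → CExp) (m : ℕ) : CStore w :=
  ⟨fun i => if i ≤ m then (T i).bv w n else 0, fun _ => 0⟩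

section

variable {τ : ℕ}

lemma exec (e : CExp) : ∀ {r : ℕ} {σ : CStore w}, 0 < r → σ.reg 0 = n##w → (∀ i > r, σ.reg i = 0) →
    QExec G τ (e.compile r) (σ, ψ) e.cost (σ.set r (e.bv w n), ψ) := by
  induction e with
  | lit c => intro r σ _ _ _; exact .cset' _ _ _ _ _ _ _ (by simp [WordOp.eval, COperand.eval, bv])
  | inp => intro r σ _ h _; exact .cset' _ _ _ _ _ _ _ (by simp [WordOp.eval, COperand.eval, bv, h])
  | op o e f he hf =>
    intro r σ h0 h hz; have hne : r ≠ r + 1 := by omega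
    refine .seq (he h0 h hz) (.seq (hf o! ?_ fun i hi => ?_) (.seq (.cset' _ _ _ _ _ _ _ rfl) ?_))
    · rw [set_reg_ne _ _ o!, h]
    · rw [set_reg_ne _ _ o!, hz _ o!]
    · convert QExec.czero (r + 1) _ ψ using 2
      simp only [COperand.eval, set_reg_self, set_reg_ne _ _ hne]
      rw [set_comm _ hne.symm, set_set, set_set]
      exact (set_self (by rw [set_reg_ne _ _ hne.symm, hz _ o!])).symm

lemma exec_assign {T : ℕ → CExp} (h0 : T 0 = inp) {m : ℕ} (hm : m ≤ 254) :
    QExec G τ (assign T m) (startState 255 w n) (assignCost T m)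
      (store w n T m, Pi.single ((fun _ => 0, fun _ => 0) : QB w) 1) := by
  induction m with
  | zero =>
    have : store w n T 0 = (startState 255 w n).1.set 255 0 := by
      simp only [store, startState, CStore.set, CStore.mk.injEq, and_true]; funext i
      by_cases hi : i = 0
      · subst hi; simp [h0, bv]
      · by_cases h2 : i = 255 <;> simp [hi, h2]
    rw [this]; exact .czero _ _ _
  | succ m ih =>
    refine .seq (ih o!) (.seq (exec _ o! (by simp [store, h0, bv]) fun i hi => ?_)
      (.seq (.cset' _ _ _ _ _ _ _ rfl) ?_))
    · exact if_neg o!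
    · convert QExec.czero _ _ _ using 2
      simp only [store, CStore.set, WordOp.eval, COperand.eval, CStore.mk.injEq, and_true]; funext i
      by_cases h2 : i = 255
      · subst h2; simp; omega
      · by_cases h1 : i = m + 1
        · subst h1; simp [h2]
        · by_cases h3 : i ≤ m
          · simp [h1, h2, h3, Nat.le_succ_of_le h3]
          · simp [h1, h2, h3, show ¬i ≤ m + 1 by omega]

end

/-- The expression has a given value. -/
def Is (w n : ℕ) (e : CExp) (v : ℕ) : Prop := e.bv w n = v##w

/-- `⌊(A * n + R) / 100000⌋` -/
def lin (A R : ℕ) : CExp :=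
  op .div (op .add (op .mul (lit A) inp) (lit R)) (lit 100000)

def pow (e : CExp) : CExp := op .shl (lit 1) e

/-- A number of rounds of Grover search for a list of length at most `2 ^ e`. -/
def rounds (e : CExp) : CExp := op .add (op .div e (lit 2)) (lit 2)

def unit : CExp := pow (op .add inp (lit 40))

section

variable {e f : CExp} {u v : ℕ}

lemma is_lit (c : ℕ) : (lit c).Is w n c := rfl

lemma is_inp : inp.Is w n n := rfl

lemma Is.add (he : e.Is w n u) (hf : f.Is w n v) : (op .add e f).Is w n (u + v) := by
  simp only [Is, bv, WordOp.eval] at *; rw [he, hf, ofNat_add]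

lemma Is.mul (he : e.Is w n u) (hf : f.Is w n v) : (op .mul e f).Is w n (u * v) := by
  simp only [Is, bv, WordOp.eval] at *; rw [he, hf, ofNat_mul]

lemma Is.sub (he : e.Is w n u) (hf : f.Is w n v) (h : v ≤ u) : (op .sub e f).Is w n (u - v) := by
  simp only [Is, bv, WordOp.eval] at *; obtain ⟨k, rfl⟩ := Nat.exists_eq_add_of_le h
  rw [he, hf, ofNat_add, Nat.add_sub_cancel_left, BitVec.add_comm, BitVec.add_sub_cancel]

lemma Is.div (he : e.Is w n u) (hf : f.Is w n v) (hu : u < 2 ^ w) (hv : v < 2 ^ w) :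
    (op .div e f).Is w n (u / v) := by
  simp only [Is, bv, WordOp.eval] at *; rw [he, hf, ← toNat_inj, BitVec.toNat_udiv]
  simp only [toNat_ofNat, mod_eq_of_lt hu, mod_eq_of_lt hv,
    mod_eq_of_lt (lt_of_le_of_lt (Nat.div_le_self u v) hu)]

lemma Is.pow (he : e.Is w n u) (hu : u < 2 ^ w) : e.pow.Is w n (2 ^ u) := by
  simp only [Is, CExp.pow, bv, WordOp.eval] at *
  rw [he, ← toNat_inj, shiftLeft_eq', BitVec.toNat_shiftLeft]
  simp only [toNat_ofNat, mod_eq_of_lt hu, Nat.shiftLeft_eq, Nat.mod_mul_mod, one_mul]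

lemma add_thirty_lt (hw : 128 * (n + 1) ≤ w) {v : ℕ} (hv : v ≤ 2 ^ 20 * (n + 1)) : v < 2 ^ w :=
  calc v ≤ 2 ^ 20 * (n + 1) := hv
    _ < 2 ^ 20 * 2 ^ (n + 1) := Nat.mul_lt_mul_of_pos_left Nat.lt_two_pow_self (by norm_num)
    _ = 2 ^ (n + 21) := by rw [← pow_add]; congr 1; omega
    _ ≤ 2 ^ w := two_pow_le o!

lemma is_lin (hw : 128 * (n + 1) ≤ w) {A R : ℕ} (hA : A ≤ 2 ^ 19) (hR : R ≤ 2 ^ 20) :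
    (lin A R).Is w n ((A * n + R) / 100000) := by
  have : A * n ≤ 2 ^ 19 * n := Nat.mul_le_mul_right n hA
  exact (((is_lit A).mul is_inp).add (is_lit R)).div (is_lit _) (add_thirty_lt hw (by omega))
    (add_thirty_lt hw (by omega))

lemma Is.rounds (hw : 128 * (n + 1) ≤ w) (he : e.Is w n u) (hu : u ≤ n + 39) :
    e.rounds.Is w n (u / 2 + 2) :=
  (he.div (is_lit 2) (add_thirty_lt hw (by omega)) (add_thirty_lt hw (by omega))).add (is_lit 2)

lemma is_unit (hw : 128 * (n + 1) ≤ w) : unit.Is w n (2 ^ (n + 40)) :=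
  (is_inp.add (is_lit 40)).pow (add_thirty_lt hw (by omega))

end

end CExp

/-! # Classical programs with local variables -/

/-- In state `σ`, the program `p` only changes the classical memory, to contents satisfying `Φ`, in
time at most `c`; the registers from `d` on are workspace. -/
def Runs (G : DGraph n) (τ : ℕ) (ψ : QS w) (d : ℕ) (σ : CStore w)
    (p : QProg 255) (Φ : (BitVec w → BitVec w) → Prop) (c : ℕ) : Prop :=
  (∀ i ≥ d, σ.reg i = 0) → ∃ M t, Φ M ∧ t ≤ c ∧ QExec G τ p (σ, ψ) t (⟨σ.reg, M⟩, ψ)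

namespace QProg

def letOp (d : ℕ) (o : WordOp) (a b : COperand) (p : QProg 255) : QProg 255 :=
  .seq (.cset d o a b) (.seq p (czero d))

def letLoad (d : ℕ) (a : COperand) (p : QProg 255) : QProg 255 :=
  .seq (.cload d a) (.seq p (czero d))

def forLoop (d : ℕ) (N : COperand) (p : QProg 255) : QProg 255 :=
  .seq (upLoop d N p) (czero d)

end QProg

namespace Runs

variable {τ : ℕ} {c c' : ℕ} {p q : QProg 255} {Φ Ψ : (BitVec w → BitVec w) → Prop} {a b : COperand}

lemma mono (h : Runs G τ ψ d σ p Φ c) (hΦ : ∀ M, Φ M → Ψ M) (hc : c ≤ c') :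
    Runs G τ ψ d σ p Ψ c' := fun hz =>
  let ⟨M, t, h1, h2, h3⟩ := h hz; ⟨M, t, hΦ M h1, h2.trans hc, h3⟩

lemma store (h : Φ (update σ.mem (a.eval σ) (b.eval σ))) :
    Runs G τ ψ d σ (.cstore a b) Φ 1 := fun _ => ⟨_, 1, h, le_rfl, .cstore _ _ _ _⟩

lemma seq (h : Runs G τ ψ d σ p Φ c) (h' : ∀ M, Φ M → Runs G τ ψ d ⟨σ.reg, M⟩ q Ψ c') :
    Runs G τ ψ d σ (.seq p q) Ψ (c + c') := fun hz => by
  obtain ⟨M, t, h1, h2, h3⟩ := h hz; obtain ⟨M', t', h1', h2', h3'⟩ := h' M h1 hz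
  exact ⟨M', t + t', h1', by omega, .seq h3 h3'⟩

lemma set_zero (hz : ∀ i ≥ d, σ.reg i = 0) (v : BitVec w) (M : BitVec w → BitVec w) :
    (⟨σ.reg, M⟩ : CStore w) = (⟨(σ.set d v).reg, M⟩ : CStore w).set d 0 := by
  simp [CStore.set, hz]

lemma letOp {o : WordOp} (h : Runs G τ ψ (d + 1) (σ.set d (o.eval (a.eval σ) (b.eval σ))) p Φ c) :
    Runs G τ ψ d σ (QProg.letOp d o a b p) Φ (c + 2) := fun hz => by
  obtain ⟨M, t, h1, h2, h3⟩ := h fun i hi => by rw [set_reg_ne _ _ o!, hz i o!]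
  refine ⟨M, 1 + (t + 1), h1, by omega, .seq (.cset' _ _ _ _ _ _ _ rfl) (.seq h3 ?_)⟩
  rw [set_zero hz (o.eval (a.eval σ) (b.eval σ)) M]; exact .czero _ _ _

lemma letLoad (h : Runs G τ ψ (d + 1) (σ.set d (σ.mem (a.eval σ))) p Φ c) :
    Runs G τ ψ d σ (QProg.letLoad d a p) Φ (c + 2) := fun hz => by
  obtain ⟨M, t, h1, h2, h3⟩ := h fun i hi => by rw [set_reg_ne _ _ o!, hz i o!]
  refine ⟨M, 1 + (t + 1), h1, by omega, .seq (.cload _ _ _ _) (.seq h3 ?_)⟩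
  rw [set_zero hz (σ.mem (a.eval σ)) M]; exact .czero _ _ _

lemma forLoop {N : COperand} {V : ℕ} (hN : N.Lt d) (hV : (N.eval σ).toNat = V)
    (I : ℕ → (BitVec w → BitVec w) → Prop) (h0 : I 0 σ.mem)
    (h : ∀ j < V, ∀ M, I j M →
      Runs G τ ψ (d + 2) ((⟨σ.reg, M⟩ : CStore w).set d j##w) p (I (j + 1)) c) :
    Runs G τ ψ d σ (QProg.forLoop d N p) (I V) (V * (c + 4) + 3) := fun hz => by
  have h' : ∀ j M, ∃ M' t, j < V → I j M → I (j + 1) M' ∧ t ≤ c ∧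
      QExec G τ p ((⟨σ.reg, M⟩ : CStore w).set d j##w, ψ) t
        ((⟨σ.reg, M'⟩ : CStore w).set d j##w, ψ) := fun j M => by
    by_cases hj : j < V ∧ I j M
    · obtain ⟨M', t, h'⟩ := h j hj.1 M hj.2 fun i hi => by
        rw [set_reg_ne _ _ o!]; exact hz i o!
      exact ⟨M', t, fun _ _ => h'⟩
    · exact ⟨M, 0, fun h1 h2 => (hj ⟨h1, h2⟩).elim⟩
  choose F t hF using h'
  let s : ℕ → BitVec w → BitVec w := fun j => Nat.rec σ.mem F j
  have hs : ∀ j ≤ V, I j (s j) := fun j => by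
    induction j with
    | zero => exact fun _ => h0
    | succ j ih => exact fun hj => (hF j _ hj (ih o!)).1
  have hz' : ∀ M u, (((⟨σ.reg, M⟩ : CStore w).set d u).set (d + 1) 0) =
      (⟨σ.reg, M⟩ : CStore w).set d u := fun M u =>
    set_self (by rw [set_reg_ne _ _ o!]; exact hz _ o!)
  have key := QExec.upLoop (G := G) (τ := τ) (c := d) (N := N) (p := p) (V := N.eval σ)
    (fun j => (⟨σ.reg, s j⟩, ψ)) (fun j => t j (s j)) (hz d le_rfl)
    (fun j _ u v => by
      rw [eval_set hN o!, eval_set hN le_rfl]; cases N <;> rfl)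
    (fun j hj => by
      rw [hV] at hj; rw [hz', hz']; exact (hF j (s j) hj (hs j hj.le)).2.2)
  rw [hV, hz'] at key; refine ⟨s V, _ + 1, hs V le_rfl, ?_, .seq key ?_⟩
  · have : ∑ j ∈ range V, ((1 + t j (s j)) + (1 + 1) + 1) ≤ ∑ j ∈ range V, (c + 4) :=
      sum_le_sum fun j hj => by
        have hj := mem_range.1 hj; have := (hF j (s j) hj (hs j hj.le)).2.1; omega
    rw [Finset.sum_const, card_range, smul_eq_mul] at this; omega
  · convert QExec.czero d _ ψ using 2; exact set_zero hz _ _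

end Runs

/-! # The lists of masks in the classical memory -/

section

/-- The lengths for the pairs in `P` and the entries for the pairs in `Q` are in place. -/
structure MaskLists (n H : ℕ) (P Q : ℕ → ℕ → Prop) (M : BitVec w → BitVec w) : Prop where
  len : ∀ a ≤ n, ∀ h ≤ H + 1, P a h → M (a * (n + 8) + h)##w = (listLen a h)##w
  list : ∀ h ≤ H + 1, ∀ i < listLen n h, Q h i → M (region n h i##w) = listEntry w n h i

lemma address_lt {h : ℕ} (ha : a ≤ n) (hh : h < n + 8) : a * (n + 8) + h < 2 ^ (n + 40) := by
  have h1 : ∀ m, (m + 8) * (m + 8) ≤ 2 ^ (m + 7) := fun m => by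
    induction m with
    | zero => norm_num
    | succ m ih => rw [Nat.add_right_comm m, pow_succ]; nlinarith
  have h1 := h1 n; have h2 : 2 ^ (n + 7) < 2 ^ (n + 40) := two_pow_lt o!; nlinarith

variable {P Q P' Q' : ℕ → ℕ → Prop}

lemma MaskLists.mono (h : MaskLists n H P Q M) (hP : ∀ a ≤ n, ∀ r ≤ H + 1, P' a r → P a r)
    (hQ : ∀ r ≤ H + 1, ∀ i < listLen n r, Q' r i → Q r i) : MaskLists n H P' Q' M :=
  ⟨fun a ha r hr h' => h.len a ha r hr (hP a ha r hr h'),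
    fun r hr i hi h' => h.list r hr i hi (hQ r hr i hi h')⟩

lemma lt_region {r : ℕ} (hr : r ≤ n + 8) : r < 2 ^ (n + 20) := by
  have : n + 20 < 2 ^ (n + 20) := Nat.lt_two_pow_self; omega

lemma toNat_lt_region {h i : ℕ} (hw : 128 * (n + 1) ≤ w) (hi : i < listLen n h) :
    (i##w).toNat < 2 ^ (n + 40) := by
  have := lt_of_lt_of_le hi (listLen_le_two_pow n h); rw [toNat_ofNat_of_lt (b := n) o! this]
  exact this.trans (two_pow_lt o!)

lemma MaskLists.store_len (hM : MaskLists n H P Q M) (hw : 128 * (n + 1) ≤ w) (hH : H ≤ n + 4) {h : ℕ}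
    (ha : a ≤ n) (hh : h ≤ H + 1) (hP : ∀ a' h', P' a' h' → P a' h' ∨ a' = a ∧ h' = h) :
    MaskLists n H P' Q (update M (a * (n + 8) + h)##w
      (listLen a h)##w) := by
  refine ⟨fun a' ha' h' hh' hp => ?_, fun h' hh' i hi hq => ?_⟩
  · by_cases e : a' = a ∧ h' = h
    · rw [e.1, e.2, update_self]
    · rw [update_of_ne, hM.len a' ha' h' hh' ((hP _ _ hp).resolve_right e)]; intro e1
      have e2 := congrArg BitVec.toNat e1
      rw [toNat_ofNat_of_lt (b := n + 40) o! (address_lt ha' o!),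
        toNat_ofNat_of_lt (b := n + 40) o! (address_lt ha o!)] at e2
      rcases lt_trichotomy a a' with h1 | h1 | h1
      · have : (a + 1) * (n + 8) ≤ a' * (n + 8) := Nat.mul_le_mul_right _ h1
        rw [add_mul] at this; omega
      · exact e ⟨h1.symm, by rw [h1] at e2; omega⟩
      · have : (a' + 1) * (n + 8) ≤ a * (n + 8) := Nat.mul_le_mul_right _ h1
        rw [add_mul] at this; omega
  · rw [update_of_ne, hM.list h' hh' i hi hq]; intro e; have e' : region n h' i##w =
        region n 0 (a * (n + 8) + h)##w := by rw [e, region]; simp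
    have := (region_inj hw (lt_region o!) (lt_region o!) (toNat_lt_region hw hi) ?_ e').1
    · rw [this, listLen_zero] at hi; omega
    · rw [toNat_ofNat_of_lt (b := n + 40) o! (address_lt ha o!)]; exact address_lt ha o!

lemma MaskLists.store_entry (hM : MaskLists n H P Q M) (hw : 128 * (n + 1) ≤ w) (hH : H ≤ n + 4) {h i : ℕ}
    (hh : h ≤ H + 1) (hi : i < listLen n h) (hQ : ∀ h' i', Q' h' i' → Q h' i' ∨ h' = h ∧ i' = i) :
    MaskLists n H P Q' (update M (region n h i##w) (listEntry w n h i)) := by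
  refine ⟨fun a' ha' h' hh' hp => ?_, fun h' hh' i' hi' hq => ?_⟩
  · rw [update_of_ne, hM.len a' ha' h' hh' hp]; intro e; have e' : region n h i##w =
        region n 0 (a' * (n + 8) + h')##w := by rw [← e, region]; simp
    have := (region_inj hw (lt_region o!) (lt_region o!) (toNat_lt_region hw hi) ?_ e').1
    · rw [this, listLen_zero] at hi; omega
    · rw [toNat_ofNat_of_lt (b := n + 40) o! (address_lt ha' o!)]; exact address_lt ha' o!
  · by_cases e : h' = h ∧ i' = i
    · rw [e.1, e.2, update_self]
    · rw [update_of_ne, hM.list h' hh' i' hi' ((hQ _ _ hq).resolve_right e)]; intro e1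
      have e2 := region_inj hw (lt_region o!) (lt_region o!) (toNat_lt_region hw hi')
        (toNat_lt_region hw hi) e1
      refine e ⟨e2.1, ?_⟩; have e3 := congrArg BitVec.toNat e2.2
      rwa [toNat_ofNat_of_lt (b := n) o! (lt_of_lt_of_le hi' (listLen_le_two_pow _ _)),
        toNat_ofNat_of_lt (b := n) o! (lt_of_lt_of_le hi (listLen_le_two_pow _ _))] at e3

end

namespace QProg

/-- Compute entry number `h + 1` in the row `a + 1` of lengths and extend the list with number
`h + 1`, where register `255` contains `a` and register `257` contains `h`. -/
def extendList : QProg 255 :=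
  letOp 259 .mul (.creg 255) (.creg 3) (letOp 260 .add (.creg 259) (.creg 257)
    (letLoad 261 (.creg 260) (letOp 262 .add (.creg 260) (.lit 1) (letLoad 263 (.creg 262)
    (letOp 264 .add (.creg 262) (.creg 3) (letOp 265 .add (.creg 261) (.creg 263)
    (letOp 266 .shl (.lit 1) (.creg 255) (letOp 267 .mul (.creg 257) (.creg 1)
    (letOp 268 .add (.creg 267) (.creg 1) (letOp 269 .add (.creg 268) (.creg 263)
    (.seq (.cstore (.creg 264) (.creg 265))
      (forLoop 270 (.creg 261) (letOp 272 .add (.creg 267) (.creg 270) (letLoad 273 (.creg 272)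
      (letOp 274 .xor (.creg 273) (.creg 266) (letOp 275 .add (.creg 269) (.creg 270)
      (.cstore (.creg 275) (.creg 274))))))))))))))))))

/-- Write the lengths and the lists of masks into the classical memory. Register `0` contains `n`,
register `1` contains `2 ^ (n + 40)`, register `3` contains `n + 8`, and register `254` contains the
number of lists. -/
def fillLists : QProg 255 :=
  .seq (forLoop 255 (.creg 254) (letOp 257 .add (.creg 255) (.lit 1) (.cstore (.creg 257) (.lit 1))))
    (forLoop 255 (.creg 0) (forLoop 257 (.creg 254) extendList))

end QProg

/-- The pairs for which the length is in place once `h` lists have been extended to level `a + 1`. -/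
def LenDone (a h a' h' : ℕ) : Prop := a' ≤ a ∨ a' = a + 1 ∧ h' ≤ h ∨ h' = 0

/-- The entries that are in place once `h` lists and `i` entries of the next one have been added. -/
def EntryDone (a h i h' i' : ℕ) : Prop :=
  i' < listLen (if h' ≤ h then a + 1 else a) h' ∨ h' = h + 1 ∧ i' < listLen a h' + i

lemma listLen_mono_both {h a' h' : ℕ} (ha : a ≤ a') (hh : h ≤ h') :
    listLen a h ≤ listLen a' h' := by
  refine (listLen_mono ha h).trans ?_; induction hh with
  | refl => exact le_rfl
  | step _ ih => exact ih.trans (listLen_mono_right _ _)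

lemma EntryDone.store {h i h' i' : ℕ} (e : EntryDone a h (i + 1) h' i') :
    EntryDone a h i h' i' ∨ h' = h + 1 ∧ i' = listLen a (h + 1) + i := by
  rcases e with e | ⟨rfl, e⟩
  · exact .inl (.inl e)
  · by_cases h1 : i' = listLen a (h + 1) + i
    · exact .inr ⟨rfl, h1⟩
    · exact .inl (.inr ⟨rfl, by omega⟩)

lemma EntryDone.next {h h' i' : ℕ} (e : EntryDone a (h + 1) 0 h' i') :
    EntryDone a h (listLen a h) h' i' := by
  rcases e with e | ⟨rfl, e⟩
  · by_cases h1 : h' = h + 1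
    · subst h1; rw [if_pos le_rfl, listLen_succ] at e; exact .inr ⟨rfl, e⟩
    · refine .inl (e.trans_le (le_of_eq ?_)); congr 1; split_ifs <;> omega
  · exact .inl (by rw [if_neg o!]; exact e)

lemma entryDone_zero {h i : ℕ} : EntryDone a 0 0 h i ↔ i < listLen a h := by
  unfold EntryDone; by_cases h0 : h = 0
  · simp [h0, listLen_zero]
  · simp only [Nat.le_zero, h0, if_false, add_zero]; tauto

lemma run_extend {τ : ℕ}
    (hw : 128 * (n + 1) ≤ w) (hH : H ≤ n + 4)
    (r1 : σ.reg 1 = (2 ^ (n + 40))##w) (r3 : σ.reg 3 = (n + 8)##w)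
    {h : ℕ} (ha : a < n) (hh : h < H + 1) (ra : σ.reg 255 = a##w)
    (rh : σ.reg 257 = h##w) (hM : MaskLists n H (LenDone a h) (EntryDone a h 0) σ.mem) :
    Runs G τ ψ 259 σ .extendList (MaskLists n H (LenDone a (h + 1)) (EntryDone a (h + 1) 0))
      (13 * listLen n (H + 1) + 26) := by
  have e1 : a##w * (n + 8)##w + h##w =
    (a * (n + 8) + h)##w := by rw [ofNat_add _ h, ofNat_mul]
  have l0 := hM.len a ha.le h o! (Or.inl le_rfl)
  have l1 := hM.len a ha.le (h + 1) o! (Or.inl le_rfl); have e2 : (a * (n + 8) + h)##w + 1#w =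
    (a * (n + 8) + (h + 1))##w := by rw [← ofNat_add, add_assoc]
  have e3 : (a * (n + 8) + (h + 1))##w + (n + 8)##w =
    ((a + 1) * (n + 8) + (h + 1))##w := by rw [← ofNat_add]; congr 1; ring
  have e4 : (listLen a h)##w + (listLen a (h + 1))##w =
    (listLen (a + 1) (h + 1))##w := by
      rw [← ofNat_add, listLen_succ, Nat.add_sub_cancel, add_comm]
  have e5 : 1#w <<< a##w = twoPow w a := by
    rw [shiftLeft_eq', toNat_ofNat, mod_eq_of_lt
      (CExp.add_thirty_lt hw (by omega)), BitVec.twoPow_eq]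
  have hl : listLen a h ≤ listLen n (H + 1) := listLen_mono_both ha.le hh.le
  have e6 : ∀ i, h##w * (2 ^ (n + 40))##w + i##w =
    region n h i##w := fun i => by rw [region, ofNat_mul]
  have e7 : ∀ i, region n h (2 ^ (n + 40))##w + (listLen a (h + 1))##w + i##w =
    region n (h + 1) (listLen a (h + 1) + i)##w := fun i => by
      rw [region, region, add_mul, one_mul, ofNat_add _ i, ofNat_add _ (2 ^ (n + 40)),
        ofNat_mul, ← BitVec.add_assoc]
  refine Runs.mono (c := listLen a h * (9 + 4) + 4 + 22) ?_ (fun M hM => hM) o!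
  iterate 2 refine .letOp ?_
  refine .letLoad (.letOp (.letLoad ?_))
  iterate 6 refine .letOp ?_
  refine Runs.mono (c := 1 + (listLen a h * (9 + 4) + 3)) (.seq (.store (Φ := MaskLists n H
    (LenDone a (h + 1)) (EntryDone a h 0)) ?_) fun M hM => .forLoop (N := .creg 261) (d := 270) (show 261 < 270 by omega) ?_
    (fun i => MaskLists n H (LenDone a (h + 1)) (EntryDone a h i)) hM fun i hi M hM =>
      .letOp (.letLoad (.letOp (.letOp (.store ?_)))))
      (fun M hM => hM.mono (fun _ _ _ _ h => h) fun _ _ _ _ => EntryDone.next) o!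
  all_goals
    simp only [CStore.set, COperand.eval, WordOp.eval, update_self, ne_eq,
      Nat.reduceEqDiff, not_false_eq_true, update_of_ne, ra, rh, r1, r3, e1, l0, e2, l1,
      e3, e4, e5, e6, e7]
  · refine hM.store_len hw hH o! o! fun a' h' e => ?_
    simp only [LenDone] at e ⊢; omega
  · rw [toNat_ofNat_of_lt (b := n) o! (lt_of_le_of_lt (listLen_le_two_pow a h)
      (two_pow_lt ha))]
  · have h1 := listLen_mono_succ a h; have h2 := listLen_succ a (h + 1)
    have h3 := listLen_mono (show a + 1 ≤ n by omega) h
    have h4 := listLen_mono (show a + 1 ≤ n by omega) (h + 1); rw [Nat.add_sub_cancel] at h2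
    rw [hM.list h o! i o! (.inl (by rw [if_pos le_rfl]; omega)), listEntry_prefix ha.le hi]
    have h5 : listEntry w a h i ^^^ twoPow w a =
        listEntry w n (h + 1) (listLen a (h + 1) + i) := by
      rw [listEntry_prefix (show a + 1 ≤ n by omega) o!, listEntry, if_neg o!, Nat.add_sub_cancel,
        Nat.add_sub_cancel_left]
    rw [h5]; exact hM.store_entry hw hH o! o! fun _ _ => EntryDone.store

lemma run_fillLists {τ : ℕ}
    (hw : 128 * (n + 1) ≤ w) (hH : H ≤ n + 4) (r0 : σ.reg 0 = n##w)
    (r1 : σ.reg 1 = (2 ^ (n + 40))##w) (r3 : σ.reg 3 = (n + 8)##w)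
    (r : σ.reg 254 = (H + 1)##w) (hM : ∀ v, σ.mem v = 0) :
    Runs G τ ψ 255 σ .fillLists (MaskLists n H (fun _ _ => True) fun _ _ => True)
      ((n + 1) * ((H + 2) * (13 * listLen n (H + 1) + 40))) := by
  have eH : ((H + 1)##w).toNat = H + 1 := by
    rw [toNat_ofNat, mod_eq_of_lt (CExp.add_thirty_lt hw (by omega))]
  have en : (n##w).toNat = n := by
    rw [toNat_ofNat, mod_eq_of_lt (CExp.add_thirty_lt hw (by omega))]
  refine Runs.mono (c := (H + 1) * (3 + 4) + 3 + (n * ((H + 1) * (13 * listLen n (H + 1) + 26 + 4) +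
    3 + 4) + 3)) (.seq (.forLoop (N := .creg 254) (d := 255) (show 254 < 255 by omega)
    (by simp only [COperand.eval, r, eH])
    (fun m => MaskLists n H (fun a h => a = 0 ∧ h ≤ m ∨ h = 0) fun h i => i < listLen 0 h) ?_
    fun h hh M hM => .letOp (.store ?_)) fun M hM => .forLoop (N := .creg 0) (d := 255)
    (show 0 < 255 by omega) (by simp only [COperand.eval, r0, en])
    (fun a => MaskLists n H (LenDone a 0) (EntryDone a 0 0)) ?_ fun a ha M hM =>
      Runs.mono (.forLoop (N := .creg 254) (d := 257) (show 254 < 257 by omega)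
        (by simp only [CStore.set, COperand.eval, ne_eq, Nat.reduceEqDiff, not_false_eq_true,
          update_of_ne, r, eH])
        (fun h => MaskLists n H (LenDone a h) (EntryDone a h 0)) hM fun h hh M hM => ?_)
        ?_ le_rfl) ?_ ?_
  · refine ⟨fun a _ h _ e => ?_, fun h _ i _ hi => ?_⟩
    · rw [hM, show h = 0 by omega, listLen_zero]; rfl
    · rw [hM, listEntry_prefix (Nat.zero_le n) hi]; rfl
  · have := hM.store_len (P' := fun a h' => a = 0 ∧ h' ≤ h + 1 ∨ h' = 0) hw hH (Nat.zero_le n)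
      (show h + 1 ≤ H + 1 by omega) (fun a' h' e => by omega)
    rw [Nat.zero_mul, Nat.zero_add, ofNat_add] at this
    simpa only [CStore.set, COperand.eval, WordOp.eval, update_self, listLen] using this
  · exact hM.mono (fun a _ h _ e => by unfold LenDone at e; omega) fun _ _ _ _ => entryDone_zero.1
  · refine run_extend hw hH ?_ ?_ ha hh ?_ ?_ hM <;>
    simp only [CStore.set, ne_eq, Nat.reduceEqDiff, not_false_eq_true, update_self,
        update_of_ne, r1, r3]
  · exact fun M hM => hM.mono (fun a _ h _ e => by unfold LenDone at e ⊢; omega)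
      fun h hh _ _ e => .inl (by rw [if_pos hh]; exact entryDone_zero.1 e)
  · exact fun M hM => hM.mono (fun a ha _ _ _ => .inl ha) fun _ _ _ hi _ => entryDone_zero.2 hi
  · generalize listLen n (H + 1) = L
    ring_nf
    nlinarith [Nat.zero_le (n * H * L), Nat.zero_le (n * L), Nat.zero_le (H * L)]

/-! # The parameters -/

lemma listLen_mul_le {p q : ℕ} (hpq : p ≤ q) (a h : ℕ) :
    listLen a (h + 1) * p ^ h * q ^ a ≤ (p + q) ^ a * q ^ h := by
  induction a generalizing h with
  | zero => simpa [listLen] using Nat.pow_le_pow_left hpq h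
  | succ a ih =>
    cases h with
    | zero =>
      have h0 : listLen (a + 1) 1 = listLen a 1 := by simp [listLen, listLen_zero]
      rw [h0, pow_succ, pow_succ, ← mul_assoc]
      exact (Nat.mul_le_mul_right q (ih 0)).trans (by
        rw [mul_right_comm]; exact Nat.mul_le_mul_right _ (Nat.mul_le_mul_left _ o!))
    | succ h =>
      calc listLen (a + 1) (h + 1 + 1) * p ^ (h + 1) * q ^ (a + 1)
          = listLen a (h + 1 + 1) * p ^ (h + 1) * q ^ a * q +
            listLen a (h + 1) * p ^ h * q ^ a * (p * q) := by simp only [listLen]; ring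
        _ ≤ (p + q) ^ a * q ^ (h + 1) * q + (p + q) ^ a * q ^ h * (p * q) :=
          Nat.add_le_add (Nat.mul_le_mul_right _ (ih _)) (Nat.mul_le_mul_right _ (ih _))
        _ = (p + q) ^ (a + 1) * q ^ (h + 1) := by ring

/-- A bound for `listLen` by rational approximations of the binary logarithms of `(p + q) / q` and of
`q / p`. -/
lemma listLen_le_of_log {p q : ℕ} (M u v : ℕ) (hc : 0 < p ∧ p ≤ q ∧ 0 < M ∧
    (p + q) ^ M ≤ 2 ^ u * q ^ M ∧ q ^ M ≤ 2 ^ v * p ^ M) {h : ℕ} (hb : u * a + v * h ≤ M * b) :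
    listLen a (h + 1) ≤ 2 ^ b := by
  obtain ⟨hp, hpq, hM, hu, hv⟩ := hc; have hq : 0 < q := hp.trans_le hpq
  have h1 := Nat.pow_le_pow_left (listLen_mul_le hpq a h) M
  have h2 : ((p + q) ^ a * q ^ h) ^ M ≤ (2 ^ b) ^ M * ((p ^ h) ^ M * (q ^ a) ^ M) :=
    calc ((p + q) ^ a * q ^ h) ^ M = ((p + q) ^ M) ^ a * (q ^ M) ^ h := by
          rw [mul_pow, ← pow_mul, ← pow_mul, ← pow_mul, ← pow_mul, mul_comm a, mul_comm h]
      _ ≤ (2 ^ u * q ^ M) ^ a * (2 ^ v * p ^ M) ^ h :=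
        Nat.mul_le_mul (Nat.pow_le_pow_left hu a) (Nat.pow_le_pow_left hv h)
      _ = 2 ^ (u * a + v * h) * ((p ^ h) ^ M * (q ^ a) ^ M) := by
        rw [mul_pow, mul_pow, pow_add, pow_mul, pow_mul, ← pow_mul p, ← pow_mul p, mul_comm M h,
          ← pow_mul q, ← pow_mul q, mul_comm M a]; ring
      _ ≤ 2 ^ (M * b) * ((p ^ h) ^ M * (q ^ a) ^ M) := Nat.mul_le_mul_right _ (two_pow_le hb)
      _ = _ := by rw [mul_comm M b, pow_mul]
  have h3 : 0 < (p ^ h) ^ M * (q ^ a) ^ M := by positivity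
  rw [mul_pow, mul_pow, mul_assoc] at h1
  exact (Nat.pow_le_pow_iff_left hM.ne').1 (Nat.le_of_mul_le_mul_right (h1.trans h2) h3)

set_option exponentiation.threshold 4000

/-- `⌊(A * n + R) / 100000⌋` for the pair `(A, R)` -/
def quant (p : ℕ × ℕ) (n : ℕ) : ℕ := (p.1 * n + p.2) / 100000

/-- The layers at which the paths are cut. -/
def cutP : ℕ → ℕ × ℕ
  | 0 => (28430, 0)
  | 1 => (28595, 0)
  | 2 => (29567, 0)
  | 3 => (34046, 0)
  | _ => (50000, 50000)

def gapP : ℕ → ℕ × ℕ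
  | 0 => (92, 0)
  | 1 => (555, 0)
  | 2 => (2680, 0)
  | _ => (10013, 90000)

def listP : ℕ → ℕ × ℕ
  | 0 => (1466, 900000)
  | 1 => (6170, 900000)
  | 2 => (19127, 900000)
  | _ => (45180, 900000)

def listP' : ℕ → ℕ × ℕ
  | 0 => (164, 900000)
  | 1 => (958, 900000)
  | 2 => (4354, 900000)
  | _ => (15199, 900000)

/-- The parameters of the four levels. -/
def level (n j : ℕ) : LevelP where
  a := quant (cutP (j + 1)) n
  t := quant (cutP (j + 1)) n - quant (cutP j) n
  g := quant (cutP (j + 1)) n - quant (cutP j) n - quant (gapP j) n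
  β := quant (gapP j) n
  b := quant (listP j) n
  nm := quant (listP j) n / 2 + 2
  b' := quant (listP' j) n
  nm' := quant (listP' j) n / 2 + 2

/-- The size of the masks in the tables. -/
def tableH (n : ℕ) : ℕ := quant (cutP 0) n + 2

lemma four_mul_le (b : ℕ) : 4 * 2 ^ b ≤ (2 ^ (b / 2 + 2)) ^ 2 := by
  rw [← pow_mul, show 4 = 2 ^ 2 by norm_num, ← pow_add]; exact two_pow_le o!

lemma level_le (n : ℕ) (hj : j < 4) : quant (cutP (j + 1)) n ≤ n ∧
    quant (cutP j) n + quant (gapP j) n ≤ quant (cutP (j + 1)) n ∧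
    quant (cutP (j + 1)) n ≤ quant (cutP j) n + tableH n ∧
    quant (listP j) n ≤ n + 35 ∧ quant (listP' j) n ≤ n + 35 := by
  interval_cases j <;> simp only [quant, tableH, cutP, gapP, listP, listP', Nat.reduceAdd] <;> omega

lemma level_ok (n : ℕ) (hj : j < 4) : (level n j).OK n (tableH n) := by
  have h := level_le n hj; constructor <;> simp only [level] <;> first | exact four_mul_le _ | omega

lemma upLen_level (n j : ℕ) :
    Chain.upLen (quant (cutP 0) n) (level n) j = quant (cutP j) n := by cases j <;> rfl

lemma level_sched (n : ℕ) : Chain.Sched n 4 (quant (cutP 0) n) (level n) where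
  an j hj := (level_le n hj).1
  ht j hj := by have := level_le n hj; rw [upLen_level]; simp only [level]; omega
  hβ j hj := by have := level_le n hj; simp only [level]; omega
  hb j hj := by
    interval_cases j
    · exact listLen_le_of_log (p := 1) (q := 192) 400 3 3034 d!
        (by simp only [level, quant, cutP, gapP, listP]; omega)
    · exact listLen_le_of_log (p := 9) (q := 269) 400 19 1961 d!
        (by simp only [level, quant, cutP, gapP, listP]; omega)
    · exact listLen_le_of_log (p := 51) (q := 343) 400 80 1100 d!
        (by simp only [level, quant, cutP, gapP, listP]; omega)
    · exact listLen_le_of_log (p := 38) (q := 81) 400 222 437 d!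
        (by simp only [level, quant, cutP, gapP, listP]; omega)
  hb' j hj := by
    interval_cases j
    · exact listLen_le_of_log (p := 65) (q := 81) 400 340 127 d!
        (by simp only [level, quant, cutP, gapP, listP']; omega)
    · exact listLen_le_of_log (p := 229) (q := 298) 400 329 152 d!
        (by simp only [level, quant, cutP, gapP, listP']; omega)
    · exact listLen_le_of_log (p := 194) (q := 287) 400 298 226 d!
        (by simp only [level, quant, cutP, gapP, listP']; omega)
    · exact listLen_le_of_log (p := 89) (q := 152) 400 266 309 d!
        (by simp only [level, quant, cutP, gapP, listP']; omega)

lemma lowLen_level (n : ℕ) : Chain.lowLen (quant (cutP 0) n) (level n) 4 ≤ n / 2 := by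
  have := (level_le n (j := 3) d!).2.1
  have h1 : n = 0 ∨ 1 ≤ (10013 * n + 90000) / 100000 := by omega
  have h2 : (50000 * n + 50000) / 100000 ≤ n / 2 + 1 := by omega
  rw [Chain.lowLen, upLen_level]; simp only [level, quant, cutP, gapP] at this ⊢; omega

lemma le_upLen_level (n : ℕ) : n - n / 2 ≤ Chain.upLen (quant (cutP 0) n) (level n) 4 := by
  rw [upLen_level]; simp only [quant, cutP]; omega

/-- The binary logarithm of the running time. -/
def expo (n : ℕ) : ℕ := quant (86150, 5000000) n

lemma listLen_table_le (n : ℕ) : listLen n (tableH n + 1) ≤ 2 ^ expo n :=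
  listLen_le_of_log (p := 51) (q := 130) 400 191 540 d!
    (by simp only [tableH, expo, quant, cutP]; omega)

lemma upTime_step {lv : ℕ → LevelP} {e E m c : ℕ}
    (h : 2 ^ (m + (lv j).nm) * upTime lv j ≤ c * 2 ^ E)
    (hl : listLen (lv j).a ((lv j).β + 1) ≤ 2 ^ e) (he : m + e ≤ E)
    (hg : m + (lv j).nm + (lv j).nm' + (lv j).g ≤ E) :
    2 ^ m * upTime lv (j + 1) ≤ (c + 2) * 2 ^ E := by
  have h1 : 2 ^ m * listLen (lv j).a ((lv j).β + 1) ≤ 2 ^ E :=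
    (Nat.mul_le_mul_left _ hl).trans (by
      rw [← pow_add]; exact two_pow_le he)
  have h2 : 2 ^ (m + (lv j).nm + (lv j).nm' + (lv j).g) ≤ 2 ^ E := two_pow_le hg
  calc 2 ^ m * upTime lv (j + 1) = 2 ^ m * listLen (lv j).a ((lv j).β + 1) +
        (2 ^ (m + (lv j).nm) * upTime lv j + 2 ^ (m + (lv j).nm + (lv j).nm' + (lv j).g)) := by
        simp only [upTime, pow_add]; ring
    _ ≤ 2 ^ E + (c * 2 ^ E + 2 ^ E) := Nat.add_le_add h1 (Nat.add_le_add h h2)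
    _ = _ := by ring

lemma upTime_level_le (n : ℕ) : 2 ^ (n / 2 + 2) * upTime (level n) 4 ≤ 9 * 2 ^ expo n := by
  refine upTime_step (c := 7) (e := quant (36126, 900000) n) (upTime_step (c := 5)
    (e := quant (13540, 900000) n) (upTime_step (c := 3) (e := quant (3978, 900000) n)
    (upTime_step (c := 1) (e := quant (896, 900000) n) ?_ ?_ ?_ ?_) ?_ ?_ ?_) ?_ ?_ ?_) ?_ ?_ ?_
  · rw [upTime, mul_one, one_mul]; refine two_pow_le ?_
    simp only [level, quant, listP, expo]; omega
  · exact listLen_le_of_log (p := 1) (q := 289) 400 2 3270 d!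
      (by simp only [level, quant, cutP, gapP]; omega)
  · simp only [level, quant, listP, expo]; omega
  · simp only [level, quant, cutP, gapP, listP, listP', expo]; omega
  · exact listLen_le_of_log (p := 1) (q := 52) 400 11 2281 d!
      (by simp only [level, quant, cutP, gapP]; omega)
  · simp only [level, quant, listP, expo]; omega
  · simp only [level, quant, cutP, gapP, listP, listP', expo]; omega
  · exact listLen_le_of_log (p := 17) (q := 196) 400 48 1411 d!
      (by simp only [level, quant, cutP, gapP]; omega)
  · simp only [level, quant, listP, expo]; omega
  · simp only [level, quant, cutP, gapP, listP, listP', expo]; omega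
  · exact listLen_le_of_log (p := 66) (q := 259) 400 131 789 d!
      (by simp only [level, quant, cutP, gapP]; omega)
  · simp only [quant, expo]; omega
  · simp only [level, quant, cutP, gapP, listP, listP', expo]; omega

/-! # The algorithm -/

namespace CExp

def ofPair (p : ℕ × ℕ) : CExp := lin p.1 p.2

/-- The expressions for the values of a level. -/
def levelE (j : ℕ) : ℕ → CExp
  | 0 => ofPair (cutP (j + 1))
  | 1 => op .sub (ofPair (cutP (j + 1))) (ofPair (cutP j))
  | 2 => op .sub (op .sub (ofPair (cutP (j + 1))) (ofPair (cutP j))) (ofPair (gapP j))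
  | 3 => ofPair (gapP j)
  | 4 => ofPair (listP j)
  | 5 => rounds (ofPair (listP j))
  | 6 => pow (rounds (ofPair (listP j)))
  | 7 => ofPair (listP' j)
  | 8 => rounds (ofPair (listP' j))
  | 9 => pow (rounds (ofPair (listP' j)))
  | 10 => op .sub (pow (op .sub (op .sub (ofPair (cutP (j + 1))) (ofPair (cutP j))) (ofPair (gapP j))))
      (lit 1)
  | 11 => op .mul (lit (16 * (2 * j + 2))) unit
  | 12 => op .mul (lit (16 * (2 * j + 2) + 1)) unit
  | 13 => op .mul (lit (16 * (2 * j + 2) + 2)) unit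
  | s => op .mul (lit (16 * (2 * j + 1) + (s - 14))) unit

def baseE : ℕ → CExp
  | 0 => inp
  | 1 => unit
  | 2 => op .sub (pow inp) (lit 1)
  | 3 => op .add inp (lit 8)
  | 4 => op .mul (lit 512) (op .add inp (lit 1))
  | i => op .mul (lit (i - 4)) unit

def topE : ℕ → CExp
  | 0 => rounds inp
  | 1 => pow (rounds inp)
  | 2 => op .mul (lit (16 * (2 * 4 + 1))) unit
  | 3 => ofPair (cutP 0)
  | _ => op .add (ofPair (cutP 0)) (lit 3)

/-- The expression for the value of a classical register. -/
def regE (i : ℕ) : CExp :=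
  if i < 8 then baseE i else if i < 250 then levelE ((i - 8) / 32) ((i - 8) % 32) else topE (i - 250)

lemma is_ofPair (hw : 128 * (n + 1) ≤ w) {p : ℕ × ℕ} (hp : p.1 ≤ 2 ^ 19 ∧ p.2 ≤ 2 ^ 20) :
    (ofPair p).Is w n (quant p n) := is_lin hw hp.1 hp.2

lemma is_levelE (hw : 128 * (n + 1) ≤ w) {s : ℕ} (hj : j < 4) (hs : s < 18) :
    (levelE j s).Is w n ((level n j).val n j s) := by
  have h := level_le n hj
  have hc : ∀ j, (ofPair (cutP j)).Is w n (quant (cutP j) n) := fun j =>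
    is_ofPair hw (by unfold cutP; split <;> decide)
  have hβ : (ofPair (gapP j)).Is w n (quant (gapP j) n) :=
    is_ofPair hw (by unfold gapP; split <;> decide)
  have hl : (ofPair (listP j)).Is w n (quant (listP j) n) :=
    is_ofPair hw (by unfold listP; split <;> decide)
  have hl' : (ofPair (listP' j)).Is w n (quant (listP' j) n) :=
    is_ofPair hw (by unfold listP'; split <;> decide)
  have ht := (hc (j + 1)).sub (hc j) o!; have hg := ht.sub hβ o!; have hu := is_unit (n := n) hw
  have lt : ∀ v ≤ n + 100, v < 2 ^ w := fun v hv => add_thirty_lt hw (by omega)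
  interval_cases s
  · exact hc _
  · exact ht
  · exact hg
  · exact hβ
  · exact hl
  · exact hl.rounds hw o!
  · exact (hl.rounds hw o!).pow (lt _ o!)
  · exact hl'
  · exact hl'.rounds hw o!
  · exact (hl'.rounds hw o!).pow (lt _ o!)
  · exact (hg.pow (lt _ o!)).sub (is_lit 1) one_le_two_pow
  all_goals exact (is_lit _).mul hu

/-- The classical state with the registers set up. -/
def setup (w n : ℕ) (M : BitVec w → BitVec w) : CStore w := ⟨(store w n regE 254).reg, M⟩

lemma val_setup {i v : ℕ} (hi : i ≤ 254) (h : (regE i).Is w n v) :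
    Val (setup w n M) 300 (.creg i) v :=
  ⟨show i < 300 by omega, (if_pos hi).trans h⟩

lemma val_setup_top (hw : 128 * (n + 1) ≤ w) : Val (setup w n M) 300 (.creg 0) n ∧
    Val (setup w n M) 300 (.creg 250) (n / 2 + 2) ∧
    Val (setup w n M) 300 (.creg 251) (2 ^ (n / 2 + 2)) ∧
    Val (setup w n M) 300 (.creg 252) (16 * (2 * 4 + 1) * 2 ^ (n + 40)) ∧
    Val (setup w n M) 300 (.creg 253) (quant (cutP 0) n) ∧
    Val (setup w n M) 300 (.creg 254) (tableH n + 1) :=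
  have hr := is_inp.rounds (u := n) hw o!; have hq := is_ofPair (n := n) (p := cutP 0) hw d!
  ⟨val_setup d! is_inp, val_setup d! hr, val_setup d! (hr.pow (add_thirty_lt hw (by omega))),
    val_setup d! ((is_lit _).mul (is_unit hw)), val_setup d! hq,
    val_setup d! (hq.add (is_lit 3))⟩

lemma lctx_setup (hw : w = 512 * (n + 1))
    (hM : MaskLists n (tableH n) (fun _ _ => True) (fun _ _ => True) M) :
    LCtx n (tableH n) 4 (level n) (setup w n M) := by
  have hw' : 128 * (n + 1) ≤ w := by omega
  have hb : ∀ {i v : ℕ}, i ≤ 254 → (regE i).Is w n v → (setup w n M).reg i = v##w :=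
    fun hi h => (val_setup hi h).2
  refine ⟨⟨hw', ?_, hb d! (is_unit hw'), hb d! ((is_inp.pow ?_).sub (is_lit 1) ?_),
    hb d! (is_inp.add (is_lit 8)), (hb (i := 4) d! ((is_lit 512).mul (is_inp.add (is_lit 1)))).trans
      (by rw [hw]), fun r h1 h2 => ?_, fun a ha h hh => hM.len a ha h hh trivial,
    fun h hh i hi => hM.list h hh i hi trivial⟩, ?_, fun j hj s hs => ?_, fun j hj => level_ok n hj⟩
  · simp only [tableH, quant, cutP]; omega
  · exact add_thirty_lt hw' o!
  · exact one_le_two_pow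
  · have hu := is_unit (n := n) hw'
    interval_cases r <;> exact hb d! ((is_lit _).mul hu)
  · have : n + 1 < 2 ^ (n + 1) := Nat.lt_two_pow_self
    rw [hw, show n + 40 = 9 + (n + 1) + 30 by ring, pow_add, pow_add]; omega
  · refine val_setup o! ?_; have : regE (8 + 32 * j + s) = levelE j s := by
      rw [regE, if_neg o!, if_pos o!]; congr 1 <;> omega
    rw [this]; exact is_levelE hw' hj hs

end CExp

/-- The quantum algorithm for Hypercube Path. -/
def hypercubeProg : QProg 255 :=
  .seq (CExp.assign CExp.regE 254) (.seq .fillLists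
    (.seq ((init 300).compile 300) ((top 4 300).compile 300)))

section

set_option exponentiation.threshold 10000

variable {τ : ℕ}

lemma pure_init (d : ℕ) : (init d).All Gate.Pure := by
  have h : ∀ dir, (initTable dir d).All Gate.Pure := fun dir => by
    refine ⟨?_, pure_dpList _ _ _ _ _ _, ?_⟩ <;> cases dir <;> trivial
  refine ⟨?_, h true, h false, ?_⟩ <;>
    simp [RProg.All, bracket, inv, Gate.Pure, initFrame, storeAt, swapAt, loadLists, loadList,
      withList, copyList]

/-- The running time. -/
def hypercubeTime (n τ : ℕ) : ℕ :=
  CExp.assignCost CExp.regE 254 + ((n + 1) * ((tableH n + 2) * (13 * 2 ^ expo n + 40)) +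
    (5 * unit (512 * (n + 1)) ^ 2 * (2 ^ expo n + 1) +
      (30 * unit (512 * (n + 1))) ^ 15 * (9 * 2 ^ expo n)) * (τ + 4))

lemma upErr_level_le (hw : w = 512 * (n + 1)) :
    4 * w * 2 ^ (n / 2 + 2) * (2 * (upErr w (level n) 4 + upErr w (level n) 4)) + 2 * (1 / 2) ^ w ≤
      (1 / 10 : ℝ) := by
  have hn : ((n : ℝ) + 1) ≤ 2 ^ (n + 1) := by exact_mod_cast (Nat.lt_two_pow_self (n := n + 1)).le
  have hF : ∀ m ≤ n + 39, (4 * w * 2 ^ m * 2 : ℝ) ≤ 2 ^ (2 * n + 52) := fun m hm => by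
    have h1 : (2 : ℝ) ^ m ≤ 2 ^ (n + 39) := pow_le_pow_right₀ (by norm_num) hm
    have h2 : (w : ℝ) ≤ 2 ^ 9 * 2 ^ (n + 1) := by rw [hw]; push_cast; linarith
    calc (4 * w * 2 ^ m * 2 : ℝ) = 8 * (w * 2 ^ m) := by ring
      _ ≤ 8 * ((2 ^ 9 * 2 ^ (n + 1)) * 2 ^ (n + 39)) := by gcongr
      _ = 2 ^ (2 * n + 52) := by rw [two_mul]; ring
  set δ : ℝ := (1 / 2) ^ w with hδ
  have δ0 : 0 < δ := by positivity
  have e0 : ∀ j, 0 ≤ upErr w (level n) j := fun j => by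
    induction j with
    | zero => exact le_rfl
    | succ j ih => unfold upErr; positivity
  have h1 : (1 : ℝ) ≤ 2 ^ (2 * n + 52) := one_le_pow₀ (by norm_num)
  have step : ∀ j ≤ 4, upErr w (level n) j + 2 * δ ≤ 2 ^ ((2 * n + 54) * j) * (2 * δ) := fun j => by
    induction j with
    | zero => intro _; simp [upErr]
    | succ j ih =>
      intro hj; have h2 := (level_ok n (show j < 4 by omega)).hnm
      have h3 := mul_le_mul_of_nonneg_right (hF _ h2) (add_nonneg (e0 j) (by positivity : 0 ≤ 2 * δ))
      have h4 := mul_le_mul_of_nonneg_left (ih o!) (zero_le_one.trans h1)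
      have h5 : (1 : ℝ) ≤ 2 ^ ((2 * n + 54) * j) := one_le_pow₀ (by norm_num)
      have h6 := mul_le_mul_of_nonneg_right (one_le_mul_of_one_le_of_one_le h1 h5)
        (by positivity : 0 ≤ 2 * δ)
      rw [upErr, ← hδ, mul_add (2 * n + 54) j 1, pow_add, mul_one,
        show 2 * n + 54 = 2 * n + 52 + 2 by ring, pow_add _ _ 2]
      linarith
  have h2 := mul_le_mul_of_nonneg_right (hF (n / 2 + 2) o!) (e0 4)
  have h3 := mul_le_mul_of_nonneg_left (step 4 le_rfl) (zero_le_one.trans h1)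
  have h4 : 2 ^ (2 * n + 52) * (2 ^ ((2 * n + 54) * 4) * (2 * δ)) * 2 ≤ (1 / 10 : ℝ) := by
    have h5 : (2 : ℝ) ^ (10 * n + 274) * δ ≤ 1 := by
      rw [hδ, one_div, inv_pow, ← div_eq_mul_inv, div_le_one (by positivity)]
      exact pow_le_pow_right₀ (by norm_num) o!
    rw [show 10 * n + 274 = 2 * n + 52 + (2 * n + 54) * 4 + 6 by ring, pow_add, pow_add] at h5
    linarith
  have h5 := mul_le_mul_of_nonneg_right h1 δ0.le; linarith

lemma outputProb_ge {b : Bool}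
    (h : nrm (ψ - Pi.single x 1) ≤ ε) (hε : ε ≤ 1) (hb : (x.1 0).getLsbD 0 = b) :
    (1 - ε) ^ 2 ≤ outputProb ψ b := by
  have h1 : ‖ψ x - 1‖ ≤ ε := by
    refine (abs_le_of_sq_le_sq' ?_ (nrm_nonneg _)).2.trans h; rw [nrm_sq]
    refine le_trans (le_of_eq ?_) (Finset.single_le_sum
      (f := fun y => ‖(ψ - Pi.single x 1 : QS w) y‖ ^ 2)
      (fun y _ => sq_nonneg _) (mem_univ x))
    simp
  have h2 : 1 - ε ≤ ‖ψ x‖ := by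
    have := norm_sub_norm_le (1 : ℂ) (1 - ψ x); rw [norm_one, sub_sub_cancel, norm_sub_rev] at this
    linarith
  have h3 := Finset.single_le_sum (f := fun y : QB w => if (y.1 0).getLsbD 0 = b then ‖ψ y‖ ^ 2
    else 0) (fun y _ => by positivity) (mem_univ x)
  rw [if_pos hb] at h3; exact le_trans (pow_le_pow_left₀ (by linarith) h2 2) h3

lemma permL_single (e : Equiv.Perm (QB w)) (x : QB w) :
    permL e (Pi.single x 1) = Pi.single (e x) 1 := by
  funext y; simp only [permL_apply, Pi.single_apply, Equiv.symm_apply_eq]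

lemma nrm_single (x : QB w) : nrm (Pi.single x 1 : QS w) = 1 :=
  (PiLp.norm_single 2 (fun _ => ℂ) x 1).trans norm_one

open Classical in
lemma exec_hypercubeProg (hG : G ≤ directedHypercube n) (hw : w = 512 * (n + 1)) :
    ∃ t s, QExec G τ hypercubeProg (startState 255 w n) t s ∧ t ≤ hypercubeTime n τ ∧
      2 / 3 ≤ outputProb s.2 (decide (HasHypercubePath G)) := by
  have hw' : 128 * (n + 1) ≤ w := by omega
  have hH : tableH n ≤ n + 4 := by simp only [tableH, quant, cutP]; omega
  have hL := listLen_table_le n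
  have ze : ∀ i ≥ 255, (CExp.store w n CExp.regE 254).reg i = 0 := fun i hi => if_neg o!
  have hb : ∀ {i v : ℕ}, i ≤ 254 → (CExp.regE i).Is w n v → (CExp.setup w n 0).reg i =
    v##w := fun hi h => (CExp.val_setup hi h).2
  obtain ⟨M, t, hM, ht, hE⟩ := run_fillLists (G := G) (τ := τ) (H := tableH n)
    (ψ := Pi.single ((fun _ => 0, fun _ => 0) : QB w) 1)
    (σ := CExp.store w n CExp.regE 254) hw' hH (hb d! CExp.is_inp) (hb d! (CExp.is_unit hw'))
    (hb d! (CExp.is_inp.add (CExp.is_lit 8))) (CExp.val_setup_top (M := 0) hw').2.2.2.2.2.2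
    (fun _ => rfl) ze
  have hσ := CExp.lctx_setup hw hM
  obtain ⟨v0, v1, v2, v3, va, vH⟩ := CExp.val_setup_top (M := M) hw'
  have ha : quant (cutP 0) n ≤ tableH n := Nat.le_add_right _ _
  have b1 := bd_init hσ.toCtx le_rfl v0 va vH ha; have b2 := bd_top hσ le_rfl o! v0 v1 v2
  obtain ⟨hc, h0⟩ := perm_init (G := G) (f := 2 * 4 + 1) hσ.toCtx le_rfl o! v0 va vH ha
  have hA := top_approx (G := G) (a₀ := quant (cutP 0) n) hσ o! le_rfl o! (four_mul_le n) v0 v1 v2 v3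
  have z := fun i (hi : i ≥ 300) => ze i (le_trans d! hi)
  have E1 := RProg.compile_sound (G := G) (τ := τ) (init 300) 300 (CExp.setup w n M) z b1.wf
  have E2 := RProg.compile_sound (G := G) (τ := τ) (top 4 300) 300 (CExp.setup w n M) z b2.wf
  refine ⟨_, _, .seq (CExp.exec_assign rfl le_rfl) (.seq hE (.seq (E1 _) (E2 _))), ?_, ?_⟩
  · have c1 := b1.cost_le τ; have c2 := b2.cost_le τ; have hT := upTime_level_le n
    rw [hypercubeTime, ← hw]
    refine Nat.add_le_add_left (Nat.add_le_add (ht.trans (by gcongr)) ?_) _; rw [add_mul]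
    exact Nat.add_le_add (c1.trans (by gcongr)) (c2.trans (by gcongr))
  · have hp := Chain.exists_upSem_iff hG hw' (level_sched n) (lowLen_level n) (le_upLen_level n)
    rw [den_eq_permL G (pure_init 300), permL_single]
    set x := (init 300).perm G 300 (CExp.setup w n M) (fun _ => 0, fun _ => 0) with hx
    have h1 := hA (Pi.single x 1) fun y hy => Pi.single_eq_of_ne (fun e => hy (by rw [e]; exact hc)) 1
    rw [permL_single, nrm_single, mul_one, xorP_apply (fun _ _ => rfl)] at h1
    refine le_trans (by norm_num) (outputProb_ge (h1.trans (upErr_level_le hw)) (by norm_num) ?_)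
    have h2 := bw_bit (w := w) o! (HasHypercubePath G)
    simp only [xorR, setR, h0, hp, update_self, ofNat_eq_ofNat, bzero_xor]
    exact Bool.eq_iff_iff.2 (h2.trans decide_eq_true_iff.symm)

lemma hypercubeTime_le : ∃ C, ∀ n τ,
    hypercubeTime n τ ≤ C * ((n + 1) ^ 15 * 2 ^ expo n * (τ + 4)) := by
  refine ⟨CExp.assignCost CExp.regE 254 + (318 + (10 * 513000 ^ 2 + (30 * 513000) ^ 15 * 9)),
    fun n τ => ?_⟩
  have hu : unit (512 * (n + 1)) ≤ 513000 * (n + 1) := by rw [unit]; omega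
  have hH : tableH n + 2 ≤ 6 * (n + 1) := by simp only [tableH, quant, cutP]; omega
  have hX : 1 ≤ 2 ^ expo n := one_le_two_pow
  have hN : (n + 1) ^ 2 ≤ (n + 1) ^ 15 := Nat.pow_le_pow_right n.succ_pos o!; rw [hypercubeTime]
  generalize 2 ^ expo n = X at *
  generalize unit (512 * (n + 1)) = u at *
  generalize tableH n = H at *
  generalize hY : (n + 1) ^ 15 * X * (τ + 4) = Y
  have hY2 : (n + 1) ^ 2 * X * (τ + 4) ≤ Y := hY ▸ by gcongr
  have hX2 : (n + 1) ^ 2 * X ≤ Y := (le_mul_of_pos_right _ (by omega)).trans hY2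
  have hY1 : 1 ≤ Y := (Nat.mul_pos (by positivity) hX).trans_le hX2; rw [add_mul _ _ (τ + 4)]
  simp only [add_mul _ _ Y]
  refine Nat.add_le_add (le_mul_of_pos_right _ hY1) (Nat.add_le_add ?_ (Nat.add_le_add ?_ ?_))
  · calc (n + 1) * ((H + 2) * (13 * X + 40)) ≤ (n + 1) * (6 * (n + 1) * (13 * X + 40 * X)) := by
          gcongr; omega
      _ = 318 * ((n + 1) ^ 2 * X) := by ring
      _ ≤ _ := Nat.mul_le_mul_left _ hX2
  · calc 5 * u ^ 2 * (X + 1) * (τ + 4) ≤ 5 * (513000 * (n + 1)) ^ 2 * (X + X) * (τ + 4) := by gcongr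
      _ = 10 * 513000 ^ 2 * ((n + 1) ^ 2 * X * (τ + 4)) := by ring
      _ ≤ _ := Nat.mul_le_mul_left _ hY2
  · calc (30 * u) ^ 15 * (9 * X) * (τ + 4) ≤ (30 * (513000 * (n + 1))) ^ 15 * (9 * X) * (τ + 4) := by
          gcongr
      _ = (30 * 513000) ^ 15 * 9 * ((n + 1) ^ 15 * X * (τ + 4)) := by
          rw [← mul_assoc 30, mul_pow]; ac_rfl
      _ = _ := by rw [hY]

lemma two_pow_expo_le (n : ℕ) : (2 : ℝ) ^ expo n ≤ 2 ^ 50 * 1.817 ^ n := by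
  have h : expo n = 1723 * n / 2000 + 50 := by simp only [expo, quant]; omega
  rw [h, pow_add, mul_comm]; refine mul_le_mul_of_nonneg_left ?_ (by positivity)
  refine le_of_pow_le_pow_left₀ (n := 2000) (by norm_num) (by positivity) ?_
  calc ((2 : ℝ) ^ (1723 * n / 2000)) ^ 2000 = 2 ^ (1723 * n / 2000 * 2000) := by rw [pow_mul]
    _ ≤ 2 ^ (1723 * n) := pow_le_pow_right₀ (by norm_num) (Nat.div_mul_le_self _ _)
    _ = (2 ^ 1723) ^ n := by rw [pow_mul]
    _ ≤ (1.817 ^ 2000) ^ n := pow_le_pow_left₀ (by positivity) (by norm_num) n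
    _ = _ := by rw [← pow_mul, ← pow_mul, mul_comm]

lemma isOStar_hypercubeTime {τ : ℕ → ℕ} (hτ : IsPolyBounded fun n => (τ n : ℝ)) :
    IsOStar (fun n => (hypercubeTime n (τ n) : ℝ)) 1.817 := by
  obtain ⟨c, hc⟩ := hτ; obtain ⟨C, hC⟩ := hypercubeTime_le
  have one : ∀ c : ℕ, ∀ a : ℝ, (fun _ : ℕ => a) =O[atTop] fun n : ℕ => (n : ℝ) ^ c := fun c a =>
    .of_bound ‖a‖ ((eventually_ge_atTop 1).mono fun n hn => by
      have : (1 : ℝ) ≤ n := by exact_mod_cast hn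
      rw [norm_pow, Real.norm_of_nonneg (zero_le_one.trans this)]
      exact le_mul_of_one_le_right (norm_nonneg _) (one_le_pow₀ this))
  have h1 : (fun n : ℕ => (n : ℝ) + 1) =O[atTop] fun n : ℕ => (n : ℝ) :=
    (isBigO_refl _ _).add (by simpa using one 1 1)
  refine ⟨15 + c, .trans (.of_bound (C * 2 ^ 50) (.of_forall fun n => ?_))
    ((((h1.pow 15).mul (hc.add (one c 4))).mul (isBigO_refl (fun n : ℕ => (1.817 : ℝ) ^ n) _)).congr_right
      fun n => by rw [← pow_add])⟩
  rw [Real.norm_of_nonneg (by positivity), Real.norm_of_nonneg (by positivity)]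
  have h2 : (hypercubeTime n (τ n) : ℝ) ≤ C * ((n + 1) ^ 15 * 2 ^ expo n * (τ n + 4)) := by
    exact_mod_cast hC n (τ n)
  refine h2.trans ?_
  calc (C : ℝ) * ((n + 1) ^ 15 * 2 ^ expo n * (τ n + 4)) ≤
        C * ((n + 1) ^ 15 * (2 ^ 50 * 1.817 ^ n) * (τ n + 4)) := by gcongr; exact two_pow_expo_le n
    _ = _ := by ring
end

end

theorem mainTheorem1 :
    ∃ A : QAlgorithm, ∀ τ : ℕ → ℕ, IsPolyBounded (fun n => (τ n : ℝ)) →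
      ∃ T : ℕ → ℕ, IsOStar (fun n => (T n : ℝ)) 1.817 ∧ A.SolvesHypercubePath τ T :=
  ⟨⟨255, 512, hypercubeProg⟩, fun τ hτ => ⟨fun n => hypercubeTime n (τ n), isOStar_hypercubeTime hτ,
    fun _ _ hG =>
      let ⟨t, s, h⟩ := exec_hypercubeProg hG rfl; ⟨t, s, h⟩⟩⟩
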